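/- Let $\mu,\kappa,R,c_v>0$ be constants. Consider the one-dimensional compressible Navier–Stokes system for a viscous heat-conducting polytropic gas in Lagrangian mass coordinates, $$v_t=u_x,\qquad u_t+P_x=\mu\Big(\frac{u_x}{v}\Big)_x,\qquad \Big(e+\frac{u^2}{2}\Big)_t+(Pu)_x=\Big(\kappa\frac{\theta_x}{v}+\mu\frac{uu_x}{v}\Big)_x,\qquad P=\frac{R\theta}{v},\quad e=c_v\theta+\mathrm{const},$$ for $x\in\Omega$, $t>0$, with initial data $(v,u,\theta)(x,0)=(v_0,u_0,\theta_0)(x)$, $x\in\Omega$, and one of the following conditions for $t>0$: 1. $\Omega=\mathbb R$ and $\lim_{|x|\to\infty}(v,u,\theta)(x,t)=(1,0,1)$; 2. $\Omega=(0,\infty)$, $u(0,t)=0$, $\theta_x(0,t)=0$, $\lim_{x\to\infty}(v,u,\theta)(x,t)=(1,0,1)$; 3. $\Omega=(0,\infty)$, $u(0,t)=0$, $\theta(0,t)=1$, $\lim_{x\to\infty}(v,u,\theta)(x,t)=(1,0,1)$. Assume that $v_0-1,u_0,\theta_0-1\in H^1(\Omega)$, $\inf_\Omega v_0>0$, $\inf_\Omega\theta_0>0$,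 and that the data are compatible with the boundary conditions ($u_0(0)=0$ in cases 2 and 3, and $\theta_0(0)=1$ in case 3). Let $(v,u,\theta)$, with $v>0$ and $\theta>0$ on $\overline\Omega\times[0,\infty)$, be a generalized solution, i.e. a triple that satisfies, for every $T>0$, $$v-1,\,u,\,\theta-1\in L^\infty(0,T;H^1(\Omega)),\quad v_t\in L^\infty(0,T;L^2(\Omega)),\quad u_t,\theta_t,v_{xt},u_{xx},\theta_{xx}\in L^2(0,T;L^2(\Omega))$$ (with weak derivatives), solves the equations in the sense of distributions on $\Omega\times(0,\infty)$, and, for the representatives of $v,u,\theta$ continuous on $\overline\Omega\times[0,\infty)$, takes the initial, boundary and far-field values above (the condition $\theta_x(0,t)=0$ being understood in the sense of traces for almost every $t$). Then there is a constant $C_0>0$ depending only on $\mu,\kappa,R,c_v$, $\|(v_0-1,u_0,\theta_0-1)\|_{H^1(\Omega)}$, $\inf_\Omega v_0$ and $\inf_\Omega\theta_0$ such that $$C_0^{-1}\le\theta(x,t)\le C_0\quad\text{for all }(x,t)\in\overline\Omega\times[0,\infty),$$ $$\sup_{0\le t<\infty}\|(v-1,u,\theta-1)(t)\|_{H^1(\Omega)}+\int_0^\infty\Big(\|v_x\|_{L^2(\Omega)}^2+\|(u_x,\theta_x)\|_{H^1(\Omega)}^2\Big)\,dt\le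 C_0.$$ Moreover, for every $p\in(2,\infty]$, $$\lim_{t\to\infty}\Big(\|(v-1,u,\theta-1)(t)\|_{L^p(\Omega)}+\|(v_x,u_x,\theta_x)(t)\|_{L^2(\Omega)}\Big)=0.$$ -/

import Mathlib

open MeasureTheory Filter Set Topology
open scoped ENNReal NNReal Distributions

noncomputable section

namespace NavierStokes1D

/-! ### Weak derivatives and Sobolev norms -/

/-- `g` is the weak derivative of `f` in the direction `e` on the open set `U`. -/
def HasWeakDeriv {E : Type*} [NormedAddCommGroup E] [NormedSpace ℝ E] [MeasureSpace E]
    (U : TopologicalSpace.Opens E) (e : E) (f g : E → ℝ) : Prop :=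
  LocallyIntegrableOn f (U : Set E) ∧ LocallyIntegrableOn g (U : Set E) ∧
    ∀ φ : 𝓓(U, ℝ), ∫ z in (U : Set E), f z * fderiv ℝ φ z e = - ∫ z in (U : Set E), g z * φ z

/-- `f ∈ H¹(Ω)` for an open subset `Ω` of the line. -/
def MemH1 (Ω : TopologicalSpace.Opens ℝ) (f : ℝ → ℝ) : Prop :=
  MemLp f 2 (volume.restrict (Ω : Set ℝ)) ∧
    ∃ g : ℝ → ℝ, HasWeakDeriv Ω 1 f g ∧ MemLp g 2 (volume.restrict (Ω : Set ℝ))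

/-- `‖f‖_{L^p(Ω)}`. -/
def lpNorm (Ω : TopologicalSpace.Opens ℝ) (p : ℝ≥0∞) (f : ℝ → ℝ) : ℝ≥0∞ :=
  eLpNorm f p (volume.restrict (Ω : Set ℝ))

/-- `‖f_x‖_{L²(Ω)}`, which is `∞` if `f` has no weak derivative. The weak derivative is unique
almost everywhere, so that the infimum runs over one value at most. -/
def derivL2Norm (Ω : TopologicalSpace.Opens ℝ) (f : ℝ → ℝ) : ℝ≥0∞ :=
  ⨅ (g : ℝ → ℝ) (_ : HasWeakDeriv Ω 1 f g), lpNorm Ω 2 g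

/-- `‖f‖_{H¹(Ω)} = (‖f‖²_{L²(Ω)} + ‖f_x‖²_{L²(Ω)})^{1/2}`, which is `∞` outside `H¹(Ω)`. -/
def h1Norm (Ω : TopologicalSpace.Opens ℝ) (f : ℝ → ℝ) : ℝ≥0∞ :=
  (lpNorm Ω 2 f ^ 2 + derivL2Norm Ω f ^ 2) ^ (1 / 2 : ℝ)

/-- `‖f_x‖_{H¹(Ω)}`, which is `∞` if `f` has no weak derivative or the latter is not in `H¹(Ω)`. -/
def derivH1Norm (Ω : TopologicalSpace.Opens ℝ) (f : ℝ → ℝ) : ℝ≥0∞ :=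
  ⨅ (g : ℝ → ℝ) (_ : HasWeakDeriv Ω 1 f g), h1Norm Ω g

/-- `‖(f, g, h)‖_{H¹(Ω)}`. -/
def h1Norm3 (Ω : TopologicalSpace.Opens ℝ) (f g h : ℝ → ℝ) : ℝ≥0∞ :=
  (h1Norm Ω f ^ 2 + h1Norm Ω g ^ 2 + h1Norm Ω h ^ 2) ^ (1 / 2 : ℝ)

/-! ### Functions of time and space

Points of space-time are pairs `(t, x)`. -/

/-- The open space-time domain `(0, ∞) × Ω`. -/
def spaceTime (Ω : TopologicalSpace.Opens ℝ) : TopologicalSpace.Opens (ℝ × ℝ) :=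
  ⟨Ioi 0 ×ˢ (Ω : Set ℝ), isOpen_Ioi.prod Ω.isOpen⟩

/-- `g = f_t` weakly on `(0, ∞) × Ω`. -/
def HasWeakDerivT (Ω : TopologicalSpace.Opens ℝ) (f g : ℝ × ℝ → ℝ) : Prop :=
  HasWeakDeriv (spaceTime Ω) (1, 0) f g

/-- `g = f_x` weakly on `(0, ∞) × Ω`. -/
def HasWeakDerivX (Ω : TopologicalSpace.Opens ℝ) (f g : ℝ × ℝ → ℝ) : Prop :=
  HasWeakDeriv (spaceTime Ω) (0, 1) f g

/-- `f_t = g_x` in the sense of distributions on `(0, ∞) × Ω`. -/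
def ConservationLaw (Ω : TopologicalSpace.Opens ℝ) (f g : ℝ × ℝ → ℝ) : Prop :=
  ∀ φ : 𝓓(spaceTime Ω, ℝ),
    ∫ z in (spaceTime Ω : Set (ℝ × ℝ)), f z * fderiv ℝ φ z (1, 0) =
      ∫ z in (spaceTime Ω : Set (ℝ × ℝ)), g z * fderiv ℝ φ z (0, 1)

/-- `f ∈ L²(0, T; L²(Ω))`. -/
def MemL2L2 (Ω : TopologicalSpace.Opens ℝ) (T : ℝ) (f : ℝ × ℝ → ℝ) : Prop :=
  MemLp f 2 (volume.restrict (Ioo 0 T ×ˢ (Ω : Set ℝ)))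

/-- `f ∈ L^∞(0, T; L²(Ω))`. -/
def MemLinftyL2 (Ω : TopologicalSpace.Opens ℝ) (T : ℝ) (f : ℝ × ℝ → ℝ) : Prop :=
  AEStronglyMeasurable f (volume.restrict (Ioo 0 T ×ˢ (Ω : Set ℝ))) ∧
    ∃ C : ℝ≥0, ∀ᵐ t ∂(volume.restrict (Ioo 0 T)), lpNorm Ω 2 (fun x => f (t, x)) ≤ C

/-! ### The three problems -/

/-- The Cauchy problem, and the two initial boundary value problems on the half-line:
`u = 0, θ_x = 0` at `x = 0`, and `u = 0, θ = 1` at `x = 0`. -/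
inductive Problem
  | cauchy
  | insulated
  | isothermal

/-- The spatial domain `Ω`. -/
def Problem.dom : Problem → TopologicalSpace.Opens ℝ
  | .cauchy => ⊤
  | .insulated => ⟨Ioi 0, isOpen_Ioi⟩
  | .isothermal => ⟨Ioi 0, isOpen_Ioi⟩

/-- `|x| → ∞` on the line, `x → ∞` on the half-line. -/
def Problem.farField : Problem → Filter ℝ
  | .cauchy => cocompact ℝ
  | .insulated => atTop
  | .isothermal => atTop

/-- Compatibility of the initial data with the boundary conditions. -/
def Problem.Compatible : Problem → (u₀ θ₀ : ℝ → ℝ) → Prop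
  | .cauchy, _, _ => True
  | .insulated, u₀, _ => u₀ 0 = 0
  | .isothermal, u₀, θ₀ => u₀ 0 = 0 ∧ θ₀ 0 = 1

/-- The boundary conditions at `x = 0`. The condition `θ_x(0, t) = 0` is the vanishing of the trace
of `θ_x(·, t)`, which is in `H¹(Ω)` for almost every `t`. -/
def Problem.BoundaryCondition : Problem → (u θ : ℝ × ℝ → ℝ) → Prop
  | .cauchy, _, _ => True
  | .insulated, u, θ => (∀ t > 0, u (t, 0) = 0) ∧
      ∀ᵐ t ∂(volume.restrict (Ioi (0 : ℝ))), ∃ g : ℝ → ℝ,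
        HasWeakDeriv ⟨Ioi 0, isOpen_Ioi⟩ 1 (fun x => θ (t, x)) g ∧ Tendsto g (𝓝[>] 0) (𝓝 0)
  | .isothermal, u, θ => (∀ t > 0, u (t, 0) = 0) ∧ ∀ t > 0, θ (t, 0) = 1

/-- The conditions on the initial data; elements of `H¹(Ω)` are identified with their
representatives that are continuous on the closure of `Ω`. -/
structure AdmissibleData (P : Problem) (v₀ u₀ θ₀ : ℝ → ℝ) : Prop where
  cont_v : ContinuousOn v₀ (closure (P.dom : Set ℝ))
  cont_u : ContinuousOn u₀ (closure (P.dom : Set ℝ))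
  cont_θ : ContinuousOn θ₀ (closure (P.dom : Set ℝ))
  h1_v : MemH1 P.dom (fun x => v₀ x - 1)
  h1_u : MemH1 P.dom u₀
  h1_θ : MemH1 P.dom (fun x => θ₀ x - 1)
  inf_v : 0 < sInf (v₀ '' (P.dom : Set ℝ))
  inf_θ : 0 < sInf (θ₀ '' (P.dom : Set ℝ))
  compatible : P.Compatible u₀ θ₀

/-- Names for the derivatives of `(v, u, θ)` that occur in the definition of a solution. -/
structure Derivs where
  (vx vt vxt ux ut uxx θx θt θxx : ℝ × ℝ → ℝ)

/-- `(v, u, θ)` is a generalized solution, on all of `[0, ∞)`, of the Navier–Stokes system with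
`P = Rθ/v`, `e = c_v θ + e₀`, the given initial data, and the boundary and far-field conditions of
the problem, and `D` is the collection of its weak derivatives. -/
structure IsGeneralizedSolutionWith (P : Problem) (μ κ R cv e₀ : ℝ) (v₀ u₀ θ₀ : ℝ → ℝ)
    (v u θ : ℝ × ℝ → ℝ) (D : Derivs) : Prop where
  /- The continuous representatives, which exist by the regularity below. -/
  cont_v : ContinuousOn v (Ici 0 ×ˢ closure (P.dom : Set ℝ))
  cont_u : ContinuousOn u (Ici 0 ×ˢ closure (P.dom : Set ℝ))
  cont_θ : ContinuousOn θ (Ici 0 ×ˢ closure (P.dom : Set ℝ))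
  pos_v : ∀ t ≥ 0, ∀ x ∈ closure (P.dom : Set ℝ), 0 < v (t, x)
  pos_θ : ∀ t ≥ 0, ∀ x ∈ closure (P.dom : Set ℝ), 0 < θ (t, x)
  /- The derivatives. -/
  weak_vx : HasWeakDerivX P.dom v D.vx
  weak_vt : HasWeakDerivT P.dom v D.vt
  weak_vxt : HasWeakDerivT P.dom D.vx D.vxt
  weak_ux : HasWeakDerivX P.dom u D.ux
  weak_ut : HasWeakDerivT P.dom u D.ut
  weak_uxx : HasWeakDerivX P.dom D.ux D.uxx
  weak_θx : HasWeakDerivX P.dom θ D.θx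
  weak_θt : HasWeakDerivT P.dom θ D.θt
  weak_θxx : HasWeakDerivX P.dom D.θx D.θxx
  /- `v - 1, u, θ - 1 ∈ L^∞(0, T; H¹)`, `v_t ∈ L^∞(0, T; L²)`. -/
  reg_v : ∀ T > 0, MemLinftyL2 P.dom T (fun z => v z - 1)
  reg_vx : ∀ T > 0, MemLinftyL2 P.dom T D.vx
  reg_u : ∀ T > 0, MemLinftyL2 P.dom T u
  reg_ux : ∀ T > 0, MemLinftyL2 P.dom T D.ux
  reg_θ : ∀ T > 0, MemLinftyL2 P.dom T (fun z => θ z - 1)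
  reg_θx : ∀ T > 0, MemLinftyL2 P.dom T D.θx
  reg_vt : ∀ T > 0, MemLinftyL2 P.dom T D.vt
  /- `u_t, θ_t, v_xt, u_xx, θ_xx ∈ L²(0, T; L²)`. -/
  reg_ut : ∀ T > 0, MemL2L2 P.dom T D.ut
  reg_θt : ∀ T > 0, MemL2L2 P.dom T D.θt
  reg_vxt : ∀ T > 0, MemL2L2 P.dom T D.vxt
  reg_uxx : ∀ T > 0, MemL2L2 P.dom T D.uxx
  reg_θxx : ∀ T > 0, MemL2L2 P.dom T D.θxx
  /- `v_t = u_x`. -/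
  mass : ConservationLaw P.dom v u
  /- `u_t + P_x = μ (u_x / v)_x`. -/
  momentum : ConservationLaw P.dom u (fun z => μ * (D.ux z / v z) - R * θ z / v z)
  /- `(e + u²/2)_t + (P u)_x = (κ θ_x / v + μ u u_x / v)_x`. -/
  energy : ConservationLaw P.dom (fun z => (cv * θ z + e₀) + u z ^ 2 / 2)
    (fun z => κ * (D.θx z / v z) + μ * (u z * D.ux z / v z) - R * θ z / v z * u z)
  /- Initial, boundary and far-field conditions. -/
  init_v : ∀ x ∈ (P.dom : Set ℝ), v (0, x) = v₀ x
  init_u : ∀ x ∈ (P.dom : Set ℝ), u (0, x) = u₀ x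
  init_θ : ∀ x ∈ (P.dom : Set ℝ), θ (0, x) = θ₀ x
  boundary : P.BoundaryCondition u θ
  far_v : ∀ t > 0, Tendsto (fun x => v (t, x)) P.farField (𝓝 1)
  far_u : ∀ t > 0, Tendsto (fun x => u (t, x)) P.farField (𝓝 0)
  far_θ : ∀ t > 0, Tendsto (fun x => θ (t, x)) P.farField (𝓝 1)

/-- `(v, u, θ)` is a generalized solution. -/
def IsGeneralizedSolution (P : Problem) (μ κ R cv e₀ : ℝ) (v₀ u₀ θ₀ : ℝ → ℝ)
    (v u θ : ℝ × ℝ → ℝ) : Prop :=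
  ∃ D : Derivs, IsGeneralizedSolutionWith P μ κ R cv e₀ v₀ u₀ θ₀ v u θ D

end NavierStokes1D

end

noncomputable section

namespace NavierStokes1D

open TopologicalSpace (Opens)
open Real (exp log sqrt)
open intervalIntegral (integral_add_adjacent_intervals integral_interval_sub_left
  integral_mono_ae_restrict integral_mono_on integral_of_le)
open intervalIntegral renaming integral_add → interval_add, integral_congr → interval_congr, integral_const → interval_const,
  integral_const_mul → interval_const_mul, integral_nonneg → interval_nonneg, integral_sub → interval_sub

local notation "vol" => Measure.restrict volume
local notation "vol₊" => Measure.restrict volume (Ioi (0:ℝ))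
local notation:max A:max "ˢ" => SetLike.coe A

/-! ### Primitives -/

/-- On the interval `J`, `f` is a primitive of the locally integrable function `f'`. -/
def IsPrim (J : Set ℝ) (f f' : ℝ → ℝ) : Prop :=
  ∀ a ∈ J, ∀ b ∈ J, IntervalIntegrable f' volume a b ∧ f b - f a = ∫ x in a..b, f' x

theorem ae_mono_set {s t : Set ℝ} {P : ℝ → Prop} (h : s ⊆ t) (ht : ∀ᵐ x ∂vol t, P x) : ∀ᵐ x ∂vol s, P x :=
  ae_restrict_of_ae_restrict_of_subset h ht

theorem ae_mem_Ioc {a b : ℝ} : ∀ᵐ x ∂vol (Ioc a b), x ∈ Ioc a b := ae_restrict_mem measurableSet_Ioc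

theorem ae_mem_Ioi {a : ℝ} : ∀ᵐ x ∂vol (Ioi a), x ∈ Ioi a := ae_restrict_mem measurableSet_Ioi

theorem iiConst {a b c : ℝ} : IntervalIntegrable (fun _ => c) volume a b := intervalIntegrable_const

theorem intervalIntegrable_iff_Ioc {f : ℝ → ℝ} {a b : ℝ} (h : a ≤ b) :
    IntervalIntegrable f volume a b ↔ IntegrableOn f (Ioc a b) :=
  intervalIntegrable_iff_integrableOn_Ioc_of_le h

theorem mul_le_left {a b c : ℝ} (h : b ≤ c) (ha : 0 ≤ a) : a * b ≤ a * c := mul_le_mul_of_nonneg_left h ha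

theorem mul_le_right {a b c : ℝ} (h : b ≤ c) (ha : 0 ≤ a) : b * a ≤ c * a := mul_le_mul_of_nonneg_right h ha

theorem aesm {α : Type*} [MeasurableSpace α] {m : Measure α} {f : α → ℝ} (h : Measurable f := by fun_prop) :
    AEStronglyMeasurable f m := h.aestronglyMeasurable

theorem AbsolutelyContinuousOnInterval.congr' {f g : ℝ → ℝ} {a b : ℝ}
    (hf : AbsolutelyContinuousOnInterval f a b) (h : ∀ x ∈ uIcc a b, f x = g x) :
    AbsolutelyContinuousOnInterval g a b := by
  rw [absolutelyContinuousOnInterval_iff] at hf ⊢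
  intro ε hε
  obtain ⟨δ, hδ, H⟩ := hf ε hε
  refine ⟨δ, hδ, fun E hE hEδ => ?_⟩
  rw [Finset.sum_congr rfl fun i hi => ?_]
  · exact H E hE hEδ
  · rw [h _ (hE.1 i hi).1, h _ (hE.1 i hi).2]

theorem AbsolutelyContinuousOnInterval.lipschitz_comp {f φ : ℝ → ℝ} {a b : ℝ} {K : ℝ≥0} {s : Set ℝ}
    (hf : AbsolutelyContinuousOnInterval f a b) (hφ : LipschitzOnWith K φ s)
    (h : MapsTo f (uIcc a b) s) :
    AbsolutelyContinuousOnInterval (fun x => φ (f x)) a b := by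
  rw [absolutelyContinuousOnInterval_iff] at hf ⊢
  intro ε hε
  obtain ⟨δ, hδ, H⟩ := hf (ε / (K + 1)) (by positivity)
  refine ⟨δ, hδ, fun E hE hEδ => ?_⟩
  calc _ ≤ ∑ i ∈ Finset.range E.1, K * dist (f (E.2 i).1) (f (E.2 i).2) :=
        Finset.sum_le_sum fun i hi => hφ.dist_le_mul _ (h (hE.1 i hi).1) _ (h (hE.1 i hi).2)
    _ = K * ∑ i ∈ Finset.range E.1, dist (f (E.2 i).1) (f (E.2 i).2) := (Finset.mul_sum _ _ _).symm
    _ ≤ K * (ε / (K + 1)) := by gcongr; exact (H E hE hEδ).le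
    _ < (K + 1) * (ε / (K + 1)) := by gcongr; linarith
    _ = ε := by field

namespace IsPrim

variable {J : Set ℝ} {f f' g g' : ℝ → ℝ}

theorem intervalIntegrable (h : IsPrim J f f') {a b : ℝ} (ha : a ∈ J) (hb : b ∈ J) :
    IntervalIntegrable f' volume a b := (h a ha b hb).1

theorem sub_eq (h : IsPrim J f f') {a b : ℝ} (ha : a ∈ J) (hb : b ∈ J) :
    f b - f a = ∫ x in a..b, f' x := (h a ha b hb).2

theorem mono {J' : Set ℝ} (h : IsPrim J f f') (hJ : J' ⊆ J) : IsPrim J' f f' :=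
  fun a ha b hb => h a (hJ ha) b (hJ hb)

theorem add (hf : IsPrim J f f') (hg : IsPrim J g g') :
    IsPrim J (fun x => f x + g x) (fun x => f' x + g' x) := fun a ha b hb => by
  have h1 := hf a ha b hb
  have h2 := hg a ha b hb
  refine ⟨h1.1.add h2.1, ?_⟩
  rw [interval_add h1.1 h2.1, ← h1.2, ← h2.2]; ring

theorem const_mul (hf : IsPrim J f f') (c : ℝ) :
    IsPrim J (fun x => c * f x) (fun x => c * f' x) := fun a ha b hb => by
  have h1 := hf a ha b hb
  refine ⟨h1.1.const_mul c, ?_⟩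
  rw [interval_const_mul, ← h1.2]; ring

theorem neg (hf : IsPrim J f f') : IsPrim J (fun x => - f x) (fun x => - f' x) := by simpa using hf.const_mul (-1)

theorem sub (hf : IsPrim J f f') (hg : IsPrim J g g') : IsPrim J (fun x => f x - g x) (fun x => f' x - g' x) := by
  simpa only [sub_eq_add_neg] using hf.add hg.neg

theorem const (J : Set ℝ) (c : ℝ) : IsPrim J (fun _ => c) (fun _ => 0) := fun a _ b _ => ⟨by simp, by simp⟩

theorem sub_const (hf : IsPrim J f f') (c : ℝ) : IsPrim J (fun x => f x - c) f' := by
  simpa using hf.sub (const J c)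

theorem add_const (hf : IsPrim J f f') (c : ℝ) : IsPrim J (fun x => f x + c) f' := by
  simpa using hf.add (const J c)

theorem congr_left (hf : IsPrim J f f') (h : ∀ x ∈ J, f x = g x) : IsPrim J g f' :=
  fun a ha b hb => ⟨(hf a ha b hb).1, by rw [← h a ha, ← h b hb, (hf a ha b hb).2]⟩

theorem congr_right [hJ : J.OrdConnected] (hf : IsPrim J f f')
    (h : ∀ᵐ x ∂vol J, f' x = g' x) : IsPrim J f g' := fun a ha b hb => by
  have hsub : uIoc a b ⊆ J := uIoc_subset_uIcc.trans (hJ.uIcc_subset ha hb)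
  have hae : f' =ᵐ[vol (uIoc a b)] g' := ae_mono_set hsub h
  refine ⟨(hf a ha b hb).1.congr_ae hae, ?_⟩
  rw [(hf a ha b hb).2]
  exact intervalIntegral.integral_congr_ae_restrict hae

theorem absCont [hJ : J.OrdConnected] (hf : IsPrim J f f') {a b : ℝ} (ha : a ∈ J) (hb : b ∈ J) :
    AbsolutelyContinuousOnInterval f a b := by
  have h0 : AbsolutelyContinuousOnInterval (fun _ : ℝ => f a) a b :=
    (LipschitzWith.const (f a)).lipschitzOnWith.absolutelyContinuousOnInterval (K := 0)
  have h1 := h0.fun_add ((hf.intervalIntegrable ha hb).absolutelyContinuousOnInterval_intervalIntegral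
    (c := a) (by simp))
  refine AbsolutelyContinuousOnInterval.congr' h1 fun x hx => ?_
  rw [← hf.sub_eq ha (hJ.uIcc_subset ha hb hx)]; ring

theorem continuousOn [hJ : J.OrdConnected] (hf : IsPrim J f f') {a b : ℝ}
    (ha : a ∈ J) (hb : b ∈ J) : ContinuousOn f (uIcc a b) := (hf.absCont ha hb).continuousOn

theorem ae_hasDerivAt [hJ : J.OrdConnected] (hf : IsPrim J f f') {a b : ℝ}
    (ha : a ∈ J) (hb : b ∈ J) : ∀ᵐ x, x ∈ Ioo (min a b) (max a b) → HasDerivAt f (f' x) x := by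
  filter_upwards [(hf.intervalIntegrable ha hb).ae_hasDerivAt_integral] with x hx hxab
  have hxu : x ∈ uIcc a b := Ioo_subset_Icc_self hxab
  have h1 := (hx hxu a (by simp)).const_add (f a)
  refine h1.congr_of_eventuallyEq ?_
  filter_upwards [isOpen_Ioo.mem_nhds hxab] with y hy
  rw [← hf.sub_eq ha (hJ.uIcc_subset ha hb (Ioo_subset_Icc_self hy))]; ring

theorem of_absCont (h : ∀ a ∈ J, ∀ b ∈ J, AbsolutelyContinuousOnInterval f a b ∧
    ∀ᵐ x, x ∈ Ioo (min a b) (max a b) → HasDerivAt f (f' x) x) : IsPrim J f f' := by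
  intro a ha b hb
  obtain ⟨h1, h2⟩ := h a ha b hb
  have hne : ∀ᵐ x : ℝ, x ≠ max a b := by simp [ae_iff, measure_singleton]
  have hae : deriv f =ᵐ[vol (uIoc a b)] f' := by
    rw [EventuallyEq, ae_restrict_iff' measurableSet_uIoc]
    filter_upwards [h2, hne] with x hx hxne hxm
    exact (hx ⟨hxm.1, lt_of_le_of_ne hxm.2 hxne⟩).deriv
  refine ⟨h1.intervalIntegrable_deriv.congr_ae hae, ?_⟩
  rw [← h1.integral_deriv_eq_sub]
  exact intervalIntegral.integral_congr_ae_restrict hae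

theorem mul [J.OrdConnected] (hf : IsPrim J f f') (hg : IsPrim J g g') :
    IsPrim J (fun x => f x * g x) (fun x => f' x * g x + f x * g' x) := by
  refine of_absCont fun a ha b hb => ⟨(hf.absCont ha hb).fun_mul (hg.absCont ha hb), ?_⟩
  filter_upwards [hf.ae_hasDerivAt ha hb, hg.ae_hasDerivAt ha hb] with x h1 h2 hx
  exact (h1 hx).mul (h2 hx)

/-- The chain rule. -/
theorem comp [hJ : J.OrdConnected] (hf : IsPrim J f f') {K : Set ℝ}
    {φ φ' : ℝ → ℝ} (hφ : ∀ y ∈ K, HasDerivAt φ (φ' y) y) (hφ' : ContinuousOn φ' K)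
    (hm : ∀ x ∈ J, f x ∈ K) :
    IsPrim J (fun x => φ (f x)) (fun x => φ' (f x) * f' x) := by
  refine of_absCont fun a ha b hb => ⟨?_, ?_⟩
  · have hc := hf.continuousOn ha hb
    have hsub : f '' uIcc a b ⊆ K := by rintro _ ⟨x, hx, rfl⟩; exact hm x (hJ.uIcc_subset ha hb hx)
    have hcomp : IsCompact (f '' uIcc a b) := isCompact_uIcc.image_of_continuousOn hc
    have hconv : Convex ℝ (f '' uIcc a b) := (isPreconnected_uIcc.image f hc).ordConnected.convex
    obtain ⟨C, hC⟩ := hcomp.exists_bound_of_continuousOn (hφ'.mono hsub)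
    have hlip : LipschitzOnWith (Real.toNNReal C) φ (f '' uIcc a b) := by
      refine hconv.lipschitzOnWith_of_nnnorm_hasDerivWithin_le
        (fun x hx => (hφ x (hsub hx)).hasDerivWithinAt) fun x hx => ?_
      have := hC x hx
      rw [← NNReal.coe_le_coe, coe_nnnorm]
      exact this.trans (Real.le_coe_toNNReal C)
    exact AbsolutelyContinuousOnInterval.lipschitz_comp (hf.absCont ha hb) hlip (mapsTo_image f _)
  · filter_upwards [hf.ae_hasDerivAt ha hb] with x h1 hx
    exact (hφ _ (hm x (hJ.uIcc_subset ha hb (Ioo_subset_Icc_self hx)))).comp x (h1 hx)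

theorem inv [J.OrdConnected] (hf : IsPrim J f f') (hpos : ∀ x ∈ J, 0 < f x) :
    IsPrim J (fun x => (f x)⁻¹) (fun x => -(f' x) / f x ^ 2) := by
  have h := hf.comp (K := Ioi 0) (φ := fun y => y⁻¹) (φ' := fun y => -(y ^ 2)⁻¹)
    (fun y hy => hasDerivAt_inv (ne_of_gt hy))
    (by
      refine ContinuousOn.neg (ContinuousOn.inv₀ (by fun_prop) fun y hy => ?_)
      exact pow_ne_zero _ (ne_of_gt hy)) hpos
  refine h.congr_right (.of_forall fun x => ?_)
  ring

theorem div [hJ : J.OrdConnected] (hf : IsPrim J f f') (hg : IsPrim J g g')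
    (hpos : ∀ x ∈ J, 0 < g x) :
    IsPrim J (fun x => f x / g x) (fun x => f' x / g x - f x * g' x / g x ^ 2) := by
  have h := hf.mul (hg.inv hpos)
  have e1 : (fun x => f x / g x) = fun x => f x * (g x)⁻¹ := by ext x; rw [div_eq_mul_inv]
  rw [e1]
  refine h.congr_right (.of_forall fun x => ?_)
  ring

theorem log [hJ : J.OrdConnected] (hf : IsPrim J f f') (hpos : ∀ x ∈ J, 0 < f x) :
    IsPrim J (fun x => Real.log (f x)) (fun x => f' x / f x) := by
  have h := hf.comp (K := Ioi 0) (φ := Real.log) (φ' := fun y => y⁻¹)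
    (fun y hy => Real.hasDerivAt_log (ne_of_gt hy))
    (ContinuousOn.inv₀ continuousOn_id fun y hy => ne_of_gt hy) hpos
  refine h.congr_right (.of_forall fun x => ?_)
  ring

end IsPrim

/-! ### Integration on the line and on the half-line -/

/-- `S` is the line or the open half-line. -/
def IsLine (S : Set ℝ) : Prop := S = univ ∨ S = Ioi 0

namespace IsLine

variable {S : Set ℝ}

theorem isOpen (hS : IsLine S) : IsOpen S := by
  rcases hS with rfl | rfl
  exacts [isOpen_univ, isOpen_Ioi]

theorem measurableSet (hS : IsLine S) : MeasurableSet S := hS.isOpen.measurableSet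

theorem ordConnected (hS : IsLine S) : S.OrdConnected := by
  rcases hS with rfl | rfl
  exacts [ordConnected_univ, ordConnected_Ioi]

theorem closure_eq (hS : IsLine S) : S = univ ∧ closure S = univ ∨ S = Ioi 0 ∧ closure S = Ici 0 := by
  rcases hS with rfl | rfl
  · left; simp
  · right; simp

theorem ordConnected_closure (hS : IsLine S) : (closure S).OrdConnected := by
  rcases hS.closure_eq with ⟨_, h⟩ | ⟨_, h⟩ <;> rw [h]
  exacts [ordConnected_univ, ordConnected_Ici]

theorem restrict_closure (hS : IsLine S) : (volume : Measure ℝ).restrict (closure S) = vol S := by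
  rcases hS.closure_eq with ⟨h, h'⟩ | ⟨h, h'⟩ <;> rw [h', h]
  exact restrict_Ioi_eq_restrict_Ici.symm

theorem Ioi_subset (hS : IsLine S) {x : ℝ} (hx : x ∈ closure S) : Ioi x ⊆ S := by
  rcases hS.closure_eq with ⟨h, h'⟩ | ⟨h, h'⟩
  · rw [h]; exact subset_univ _
  · rw [h]; rw [h'] at hx; exact Ioi_subset_Ioi hx

theorem mem_of_le (hS : IsLine S) {x y : ℝ} (hx : x ∈ closure S) (h : x ≤ y) : y ∈ closure S := by
  rcases hS.closure_eq with ⟨_, h'⟩ | ⟨_, h'⟩ <;> rw [h'] at hx ⊢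
  · trivial
  · exact le_trans hx h

end IsLine

theorem IsPrim.tendsto_atTop_zero {a : ℝ} {H H' : ℝ → ℝ} (h : IsPrim (Ici a) H H')
    (hH : IntegrableOn H (Ioi a)) (hH' : IntegrableOn H' (Ioi a)) :
    Tendsto H atTop (𝓝 0) := by
  have h1 : Tendsto (fun b => ∫ x in a..b, H' x) atTop (𝓝 (∫ x in Ioi a, H' x)) :=
    intervalIntegral_tendsto_integral_Ioi a hH' tendsto_id
  have h2 : Tendsto H atTop (𝓝 (H a + ∫ x in Ioi a, H' x)) := by
    refine (h1.const_add (H a)).congr' ?_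
    filter_upwards [eventually_ge_atTop a] with b hb
    rw [← h.sub_eq (mem_Ici.2 le_rfl) hb]; ring
  have h3 : H a + ∫ x in Ioi a, H' x = 0 := by
    refine IntegrableAtFilter.eq_zero_of_tendsto (f := H) (l := atTop) (μ := volume)
      ⟨Ioi a, Ioi_mem_atTop a, hH⟩ ?_ h2
    intro s hs
    obtain ⟨b, hb⟩ := mem_atTop_sets.1 hs
    rw [← top_le_iff, ← Real.volume_Ici (a := b)]
    exact measure_mono hb
  rwa [h3] at h2

theorem IsPrim.integral_Ioi {a : ℝ} {H H' : ℝ → ℝ} (h : IsPrim (Ici a) H H')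
    (hH : IntegrableOn H (Ioi a)) (hH' : IntegrableOn H' (Ioi a)) :
    ∫ x in Ioi a, H' x = - H a := by
  have h0 := h.tendsto_atTop_zero hH hH'
  have h1 : Tendsto (fun b => ∫ x in a..b, H' x) atTop (𝓝 (∫ x in Ioi a, H' x)) :=
    intervalIntegral_tendsto_integral_Ioi a hH' tendsto_id
  refine tendsto_nhds_unique h1 ?_
  have : Tendsto (fun b => H b - H a) atTop (𝓝 (0 - H a)) := h0.sub_const _
  rw [zero_sub] at this
  refine this.congr' ?_
  filter_upwards [eventually_ge_atTop a] with b hb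
  rw [← h.sub_eq (mem_Ici.2 le_rfl) hb]

theorem IsPrim.reflect {H H' : ℝ → ℝ} (h : IsPrim univ H H') :
    IsPrim univ (fun x => H (-x)) (fun x => - H' (-x)) := by
  intro a _ b _
  have := h (-b) trivial (-a) trivial
  refine ⟨?_, ?_⟩
  · have h1 := (IntervalIntegrable.iff_comp_neg (f := H')).1 this.1
    have h2 : IntervalIntegrable (fun x => H' (-x)) volume a b := by simpa using h1.symm
    exact h2.neg
  · have e : ∫ x in a..b, H' (-x) = ∫ x in (-b)..(-a), H' x := intervalIntegral.integral_comp_neg H'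
    rw [intervalIntegral.integral_neg, e, ← this.2]; ring

theorem IsPrim.integral_eq_zero {S : Set ℝ} (hS : IsLine S) {H H' : ℝ → ℝ}
    (h : IsPrim (closure S) H H') (hH : IntegrableOn H S) (hH' : IntegrableOn H' S)
    (hb : S = univ ∨ H 0 = 0) : ∫ x in S, H' x = 0 := by
  rcases hS.closure_eq with ⟨h1, h2⟩ | ⟨h1, h2⟩
  · rw [h2] at h
    rw [h1] at hH hH' ⊢
    have e1 := (h.mono (subset_univ (Ici 0))).integral_Ioi (hH.mono_set (subset_univ _))
      (hH'.mono_set (subset_univ _))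
    have e2 := (h.reflect.mono (subset_univ (Ici 0))).integral_Ioi (by
        have := (integrableOn_univ.1 hH).comp_neg
        exact this.integrableOn)
      (by
        have := (integrableOn_univ.1 hH').comp_neg
        exact this.neg.integrableOn)
    have e3 : ∫ x in Ioi (0:ℝ), -H' (-x) = - ∫ x in Iic (0:ℝ), H' x := by
      rw [integral_neg, integral_comp_neg_Ioi (f := H')]; simp
    have e4 : ∫ x, H' x = (∫ x in Iic (0:ℝ), H' x) + ∫ x in Ioi (0:ℝ), H' x := by
      rw [← intervalIntegral.integral_Iic_add_Ioi (b := (0:ℝ))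
        (integrableOn_univ.1 hH').integrableOn (integrableOn_univ.1 hH').integrableOn]
    rw [setIntegral_univ, e4, e1]
    rw [e3] at e2
    simp only [neg_zero] at e2
    linarith
  · rw [h2] at h
    rw [h1] at hH hH' hb ⊢
    rw [h.integral_Ioi hH hH']
    rcases hb with hb | hb
    · exact absurd (hb ▸ mem_univ (0:ℝ)) (by simp)
    · simp [hb]

theorem IsPrim.abs_le_integral {S : Set ℝ} (hS : IsLine S) {H H' : ℝ → ℝ}
    (h : IsPrim (closure S) H H') (hH : IntegrableOn H S) (hH' : IntegrableOn H' S)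
    {x : ℝ} (hx : x ∈ closure S) : |H x| ≤ ∫ y in S, |H' y| := by
  have hsub := hS.Ioi_subset hx
  have e := (h.mono (fun y hy => hS.mem_of_le hx hy)).integral_Ioi (hH.mono_set hsub) (hH'.mono_set hsub)
  have : |H x| = |∫ y in Ioi x, H' y| := by rw [e, abs_neg]
  rw [this]
  refine (abs_integral_le_integral_abs).trans ?_
  exact setIntegral_mono_set hH'.abs (.of_forall fun y => abs_nonneg _) hsub.eventuallyLE

section L2

variable {α : Type*} [MeasurableSpace α] {m : Measure α} {F f g : α → ℝ}

theorem integrable_of_abs_le_sq (hF : AEStronglyMeasurable F m) (hf : MemLp f 2 m)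
    (hg : MemLp g 2 m) {C : ℝ} (h : ∀ᵐ z ∂m, |F z| ≤ C * (f z ^ 2 + g z ^ 2)) :
    Integrable F m := by
  refine ((hf.integrable_sq.add hg.integrable_sq).const_mul C).mono' hF ?_
  filter_upwards [h] with z hz
  simpa using hz

theorem integrable_of_abs_le_mul (hF : AEStronglyMeasurable F m) (hf : MemLp f 2 m)
    (hg : MemLp g 2 m) {C : ℝ} (hC : 0 ≤ C) (h : ∀ᵐ z ∂m, |F z| ≤ C * (|f z| * |g z|)) :
    Integrable F m := by
  refine integrable_of_abs_le_sq hF hf hg (C := C) ?_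
  filter_upwards [h] with z hz
  refine hz.trans (mul_le_left ?_ hC)
  nlinarith [sq_nonneg (|f z| - |g z|), sq_abs (f z), sq_abs (g z), sq_nonneg (f z), sq_nonneg (g z)]

theorem memLp_two_of_abs_le (hF : AEStronglyMeasurable F m) (hf : MemLp f 2 m) {C : ℝ}
    (h : ∀ᵐ z ∂m, |F z| ≤ C * |f z|) : MemLp F 2 m :=
  MemLp.of_le_mul hf hF (c := C) (by simpa using h)

end L2

section Sup

variable {S : Set ℝ}

/-- The embedding of `H¹` into the bounded functions. -/
theorem IsPrim.sq_le {f f' : ℝ → ℝ} (hS : IsLine S) (h : IsPrim (closure S) f f')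
    (hf : MemLp f 2 (vol S)) (hf' : MemLp f' 2 (vol S)) {l : ℝ}
    (hl : 0 < l) {x : ℝ} (hx : x ∈ closure S) :
    f x ^ 2 ≤ l * (∫ y in S, f y ^ 2) + l⁻¹ * ∫ y in S, f' y ^ 2 := by
  have := hS.ordConnected_closure
  have h2 := h.mul h
  have i1 : Integrable (fun y => f y * f y) (vol S) := hf.integrable_mul hf
  have i2 : Integrable (fun y => f' y * f y + f y * f' y) (vol S) :=
    (hf'.integrable_mul hf).add (hf.integrable_mul hf')
  have := h2.abs_le_integral hS i1 i2 hx
  have e : f x ^ 2 = |f x * f x| := by rw [abs_mul_self, sq]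
  rw [e]
  refine this.trans ?_
  rw [← integral_const_mul, ← integral_const_mul, ← integral_add]
  · refine integral_mono i2.abs ((hf.integrable_sq.const_mul l).add (hf'.integrable_sq.const_mul _)) fun y => ?_
    simp only
    have e2 : f' y * f y + f y * f' y = 2 * (f y * f' y) := by ring
    rw [e2, abs_le]
    have hl' : l * l⁻¹ = 1 := mul_inv_cancel₀ hl.ne'
    have a1 : 0 ≤ l * (f y - l⁻¹ * f' y) ^ 2 := by positivity
    have a2 : 0 ≤ l * (f y + l⁻¹ * f' y) ^ 2 := by positivity
    have b1 : l * (f y - l⁻¹ * f' y) ^ 2 = l * f y ^ 2 + l⁻¹ * f' y ^ 2 - 2 * (f y * f' y) := by field_simp; ring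
    have b2 : l * (f y + l⁻¹ * f' y) ^ 2 = l * f y ^ 2 + l⁻¹ * f' y ^ 2 + 2 * (f y * f' y) := by field_simp; ring
    constructor <;> linarith
  · exact hf.integrable_sq.const_mul l
  · exact hf'.integrable_sq.const_mul _

theorem IsPrim.integral_mul_eq {f f' g g' : ℝ → ℝ} (hS : IsLine S) (h : IsPrim (closure S) f f')
    (hg : IsPrim (closure S) g g')
    (hf2 : MemLp f 2 (vol S)) (hf'2 : MemLp f' 2 (vol S))
    (hg2 : MemLp g 2 (vol S)) (hg'2 : MemLp g' 2 (vol S))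
    (hb : S = univ ∨ f 0 * g 0 = 0) :
    ∫ y in S, f y * g' y = - ∫ y in S, f' y * g y := by
  have := hS.ordConnected_closure
  have h0 := (h.mul hg).integral_eq_zero hS (hf2.integrable_mul hg2)
    ((hf'2.integrable_mul hg2).add (hf2.integrable_mul hg'2)) hb
  have e : ∫ y in S, (f' y * g y + f y * g' y) = (∫ y in S, f' y * g y) + ∫ y in S, f y * g' y :=
    integral_add (hf'2.integrable_mul hg2) (hf2.integrable_mul hg'2)
  linarith

end Sup

section Slices

variable {α β : Type*} [MeasurableSpace α] [MeasurableSpace β] {ρ : Measure α} {ν : Measure β}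
  [SFinite ν]

theorem MemLp.ae_slice [SFinite ρ] {f : α × β → ℝ} (hf : MemLp f 2 (ρ.prod ν)) :
    ∀ᵐ t ∂ρ, MemLp (fun x => f (t, x)) 2 ν := by
  have h1 := hf.integrable_sq.prod_right_ae
  have h2 := hf.1.prodMk_left
  filter_upwards [h1, h2] with t a1 a2
  exact (memLp_two_iff_integrable_sq a2).2 a1

end Slices

/-- Differentiation under the integral sign in time, in integrated form. -/
theorem integral_time_eq {ν : Measure ℝ} [SFinite ν] {Φ Φt : ℝ × ℝ → ℝ}
    (h1 : ∀ᵐ x ∂ν, IsPrim (Ici 0) (fun t => Φ (t, x)) (fun t => Φt (t, x))) {T : ℝ} (hT : 0 ≤ T)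
    (h2 : Integrable Φt ((vol (Ioc 0 T)).prod ν))
    (h3 : Integrable (fun x => Φ (0, x)) ν) :
    Integrable (fun x => Φ (T, x)) ν ∧ ∫ x, Φ (T, x) ∂ν = (∫ x, Φ (0, x) ∂ν) + ∫ t in 0..T, ∫ x, Φt (t, x) ∂ν := by
  have hae : (fun x => Φ (T, x)) =ᵐ[ν] fun x => Φ (0, x) + ∫ t in Ioc 0 T, Φt (t, x) := by
    filter_upwards [h1] with x hx
    have := hx.sub_eq (mem_Ici.2 le_rfl) (mem_Ici.2 hT)
    rw [integral_of_le hT] at this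
    linarith
  have hi : Integrable (fun x => ∫ t in Ioc 0 T, Φt (t, x)) ν := h2.integral_prod_right
  refine ⟨(h3.add hi).congr hae.symm, ?_⟩
  rw [integral_congr_ae hae, integral_add h3 hi, integral_of_le hT,
    integral_integral_swap (f := fun t x => Φt (t, x)) h2]

/-! ### Solutions in terms of pointwise derivatives -/

/-- The physical constants and the bounds on the initial data. -/
structure Params where
  (μ κ R cv N a b : ℝ)
  hμ : 0 < μ
  hκ : 0 < κ
  hR : 0 < R
  hcv : 0 < cv
  ha : 0 < a
  hb : 0 < b

/-- The measure on `(0, T] × S`. -/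
abbrev stm (S : Set ℝ) (T : ℝ) : Measure (ℝ × ℝ) := (vol (Ioc 0 T)).prod (vol S)

theorem ae_stm {S : Set ℝ} (hS : IsLine S) (T : ℝ) : ∀ᵐ z ∂stm S T, z.1 ∈ Ioc 0 T ∧ z.2 ∈ closure S := by
  rw [stm, Measure.prod_restrict]
  filter_upwards [ae_restrict_mem (measurableSet_Ioc.prod hS.measurableSet)] with z hz
  exact ⟨hz.1, subset_closure hz.2⟩

/-- A solution whose derivatives are realized pointwise: functions of `t` for almost every `x` and
functions of `x` for almost every `t` are primitives of their derivatives. -/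
structure Sol (p : Params) where
  S : Set ℝ
  hS : IsLine S
  (v u θ vx ux uxx ut θx θxx θt : ℝ × ℝ → ℝ)
  (u0x θ0x : ℝ → ℝ)
  c_v : Continuous v
  c_u : Continuous u
  c_θ : Continuous θ
  m_vx : Measurable vx
  m_ux : Measurable ux
  m_uxx : Measurable uxx
  m_ut : Measurable ut
  m_θx : Measurable θx
  m_θxx : Measurable θxx
  m_θt : Measurable θt
  bound : ∀ T, ∃ c > 0, ∃ C, ∀ t ∈ Icc 0 T, ∀ x ∈ closure S, c ≤ v (t, x) ∧ v (t, x) ≤ C ∧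
    c ≤ θ (t, x) ∧ θ (t, x) ≤ C ∧ |u (t, x)| ≤ C
  sv : ∀ t ≥ 0, MemLp (fun x => v (t, x) - 1) 2 (vol S)
  su : ∀ t ≥ 0, MemLp (fun x => u (t, x)) 2 (vol S)
  sθ : ∀ t ≥ 0, MemLp (fun x => θ (t, x) - 1) 2 (vol S)
  svx : ∀ t ≥ 0, MemLp (fun x => vx (t, x)) 2 (vol S)
  lv : ∀ T, MemLp (fun z => v z - 1) 2 (stm S T)
  lu : ∀ T, MemLp u 2 (stm S T)
  lθ : ∀ T, MemLp (fun z => θ z - 1) 2 (stm S T)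
  lvx : ∀ T, MemLp vx 2 (stm S T)
  lux : ∀ T, MemLp ux 2 (stm S T)
  luxx : ∀ T, MemLp uxx 2 (stm S T)
  lut : ∀ T, MemLp ut 2 (stm S T)
  lθx : ∀ T, MemLp θx 2 (stm S T)
  lθxx : ∀ T, MemLp θxx 2 (stm S T)
  lθt : ∀ T, MemLp θt 2 (stm S T)
  xv : ∀ t ≥ 0, IsPrim (closure S) (fun x => v (t, x)) (fun x => vx (t, x))
  xu : ∀ᵐ t ∂vol₊, IsPrim (closure S) (fun x => u (t, x)) (fun x => ux (t, x))
  xux : ∀ᵐ t ∂vol₊, IsPrim (closure S) (fun x => ux (t, x)) (fun x => uxx (t, x))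
  xθ : ∀ᵐ t ∂vol₊, IsPrim (closure S) (fun x => θ (t, x)) (fun x => θx (t, x))
  xθx : ∀ᵐ t ∂vol₊, IsPrim (closure S) (fun x => θx (t, x)) (fun x => θxx (t, x))
  tv : ∀ᵐ x ∂vol S, IsPrim (Ici 0) (fun t => v (t, x)) (fun t => ux (t, x))
  tu : ∀ᵐ x ∂vol S, IsPrim (Ici 0) (fun t => u (t, x)) (fun t => ut (t, x))
  tθ : ∀ᵐ x ∂vol S, IsPrim (Ici 0) (fun t => θ (t, x)) (fun t => θt (t, x))
  tvx : ∀ᵐ x ∂vol S, IsPrim (Ici 0) (fun t => vx (t, x)) (fun t => uxx (t, x))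
  equ : ∀ᵐ t ∂vol₊, ∀ᵐ x ∂vol S,
    ut (t, x) = p.μ * (uxx (t, x) / v (t, x) - ux (t, x) * vx (t, x) / v (t, x) ^ 2)
      - p.R * (θx (t, x) / v (t, x) - θ (t, x) * vx (t, x) / v (t, x) ^ 2)
  eqθ : ∀ᵐ t ∂vol₊, ∀ᵐ x ∂vol S,
    p.cv * θt (t, x) = p.κ * (θxx (t, x) / v (t, x) - θx (t, x) * vx (t, x) / v (t, x) ^ 2)
      + p.μ * (ux (t, x) ^ 2 / v (t, x)) - p.R * (θ (t, x) * ux (t, x) / v (t, x))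
  bdry : S = univ ∨ (∀ t ≥ 0, u (t, 0) = 0) ∧ ((∀ t ≥ 0, θ (t, 0) = 1) ∨ ∀ᵐ t ∂vol₊, θx (t, 0) = 0)
  xu0 : IsPrim (closure S) (fun x => u (0, x)) u0x
  xθ0 : IsPrim (closure S) (fun x => θ (0, x)) θ0x
  lu0x : MemLp u0x 2 (vol S)
  lθ0x : MemLp θ0x 2 (vol S)
  data : (∫ x in S, (v (0, x) - 1) ^ 2) + (∫ x in S, vx (0, x) ^ 2) + (∫ x in S, u (0, x) ^ 2)
    + (∫ x in S, u0x x ^ 2) + (∫ x in S, (θ (0, x) - 1) ^ 2) + (∫ x in S, θ0x x ^ 2) ≤ p.N ^ 2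
  v0_ge : ∀ x ∈ closure S, p.a ≤ v (0, x)
  θ0_ge : ∀ x ∈ closure S, p.b ≤ θ (0, x)

namespace Sol

variable {p : Params} (s : Sol p)

theorem pos_v {t x : ℝ} (ht : 0 ≤ t) (hx : x ∈ closure s.S) : 0 < s.v (t, x) := by
  obtain ⟨c, hc, C, h⟩ := s.bound t
  exact hc.trans_le (h t ⟨ht, le_rfl⟩ x hx).1

theorem pos_θ {t x : ℝ} (ht : 0 ≤ t) (hx : x ∈ closure s.S) : 0 < s.θ (t, x) := by
  obtain ⟨c, hc, C, h⟩ := s.bound t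
  exact hc.trans_le (h t ⟨ht, le_rfl⟩ x hx).2.2.1

theorem m_v : Measurable s.v := s.c_v.measurable
theorem m_u : Measurable s.u := s.c_u.measurable
theorem m_θ : Measurable s.θ := s.c_θ.measurable

attribute [fun_prop] c_v c_u c_θ m_v m_u m_θ m_vx m_ux m_uxx m_ut m_θx m_θxx m_θt

theorem ae_Ioc {P : ℝ → Prop} (h : ∀ᵐ t ∂vol₊, P t) (T : ℝ) : ∀ᵐ t ∂vol (Ioc 0 T), P t :=
  ae_mono_set Ioc_subset_Ioi_self h

theorem ae_S {P : ℝ → Prop} (h : ∀ x ∈ closure s.S, P x) : ∀ᵐ x ∂vol s.S, P x := by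
  filter_upwards [ae_restrict_mem s.hS.measurableSet] with x hx using h x (subset_closure hx)

theorem continuous_slice {f : ℝ × ℝ → ℝ} (hf : Continuous f) (t : ℝ) : Continuous fun x => f (t, x) := by fun_prop

end Sol

theorem abs_le_of_hasDerivAt {g g' : ℝ → ℝ} {c C K : ℝ}
    (hg : ∀ y ∈ Icc c C, HasDerivAt g (g' y) y) (hK : ∀ y ∈ Icc c C, |g' y| ≤ K) {a y : ℝ}
    (ha : a ∈ Icc c C) (hy : y ∈ Icc c C) : |g y - g a| ≤ K * |y - a| := by
  have := (convex_Icc c C).norm_image_sub_le_of_norm_hasDerivWithin_le (f := g) (f' := g')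
    (fun x hx => (hg x hx).hasDerivWithinAt) hK ha hy
  simpa using this

/-- `G` is an entropy in the temperature, with first and second derivatives `g` and `g'`. -/
structure IsEntropy (G g g' : ℝ → ℝ) : Prop where
  hG : ∀ y > 0, HasDerivAt G (g y) y
  hg : ∀ y > 0, HasDerivAt g (g' y) y
  hg' : ContinuousOn g' (Ioi 0)
  hG1 : G 1 = 0
  hg1 : g 1 = 0
  mG : Measurable G
  mg : Measurable g
  mg' : Measurable g'

theorem IsEntropy.exists_bounds {G g g' : ℝ → ℝ} (he : IsEntropy G g g') {c : ℝ} (hc : 0 < c) (C : ℝ) :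
    ∃ K ≥ 0, ∀ y ∈ Icc c C, |g y| ≤ K * |y - 1| ∧ |g' y| ≤ K ∧ |g y| ≤ K ∧
      |G y| ≤ K * (y - 1) ^ 2 := by
  obtain ⟨hG, hg, hg', hG1, hg1, -, -, -⟩ := he
  set c' := min c 1
  set C' := max C 1
  have hc' : 0 < c' := lt_min hc one_pos
  have h1 : (1:ℝ) ∈ Icc c' C' := ⟨min_le_right _ _, le_max_right _ _⟩
  obtain ⟨K, hK⟩ := (isCompact_Icc (a := c') (b := C')).exists_bound_of_continuousOn
    (hg'.mono fun y hy => hc'.trans_le hy.1)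
  have hK0 : 0 ≤ K := (norm_nonneg _).trans (hK 1 h1)
  have hb : ∀ y ∈ Icc c' C', |g y| ≤ K * |y - 1| := fun y hy => by
    have := abs_le_of_hasDerivAt (fun y hy => hg y (hc'.trans_le hy.1)) hK h1 hy
    simpa [hg1] using this
  have hB : ∀ y ∈ Icc c' C', |G y| ≤ K * (y - 1) ^ 2 := fun y hy => by
    have hsub : Icc (min 1 y) (max 1 y) ⊆ Icc c' C' := Icc_subset_Icc (le_min h1.1 hy.1) (max_le h1.2 hy.2)
    have := abs_le_of_hasDerivAt (g := G) (g' := g) (c := min 1 y) (C := max 1 y)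
      (K := K * |y - 1|) (fun z hz => hG z (hc'.trans_le (hsub hz).1)) (fun z hz => by
        refine (hb z (hsub hz)).trans (mul_le_left ?_ hK0)
        rcases le_total 1 y with h | h
        · rw [min_eq_left h, max_eq_right h] at hz
          rw [abs_of_nonneg (by linarith [hz.1]), abs_of_nonneg (by linarith)]; linarith [hz.2]
        · rw [min_eq_right h, max_eq_left h] at hz
          rw [abs_of_nonpos (by linarith [hz.2]), abs_of_nonpos (by linarith)]; linarith [hz.1])
      (a := 1) (y := y) ⟨min_le_left _ _, le_max_left _ _⟩ ⟨min_le_right _ _, le_max_right _ _⟩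
    rw [hG1, sub_zero] at this
    refine this.trans (le_of_eq ?_)
    rw [mul_assoc, ← sq, sq_abs]
  refine ⟨K + K * (C' - c'), ?_, fun y hy => ?_⟩
  · have : 0 ≤ K * (C' - c') := mul_nonneg hK0 (by linarith [h1.1, h1.2])
    linarith
  have hy' : y ∈ Icc c' C' := ⟨(min_le_left _ _).trans hy.1, hy.2.trans (le_max_left _ _)⟩
  have hd : |y - 1| ≤ C' - c' := abs_le.2 ⟨by linarith [hy'.1, h1.2], by linarith [hy'.2, h1.1]⟩
  have hp : 0 ≤ K * (C' - c') := mul_nonneg hK0 (by linarith [h1.1, h1.2])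
  refine ⟨(hb y hy').trans ?_, (hK y hy').trans (by linarith), (hb y hy').trans ?_, (hB y hy').trans ?_⟩
  · exact mul_le_right (by linarith) (abs_nonneg _)
  · have := mul_le_left hd hK0
    linarith
  · exact mul_le_right (by linarith) (sq_nonneg _)

namespace Sol

variable {p : Params} (s : Sol p)

section Entropy

variable {G g g' : ℝ → ℝ}

theorem integrable_entropy (he : IsEntropy G g g') {t : ℝ} (ht : 0 ≤ t) :
    Integrable (fun x => G (s.θ (t, x))) (vol s.S) := by
  obtain ⟨c, hc, C, hb⟩ := s.bound t
  obtain ⟨K, hK, hKb⟩ := he.exists_bounds hc C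
  have := he.mG
  refine integrable_of_abs_le_sq (C := K) aesm (s.sθ t ht) (s.sθ t ht) ?_
  refine s.ae_S fun x hx => ?_
  have h1 := hb t ⟨ht, le_rfl⟩ x hx
  have h2 := (hKb (s.θ (t, x)) ⟨h1.2.2.1, h1.2.2.2.1⟩).2.2.2
  nlinarith [mul_nonneg hK (sq_nonneg (s.θ (t, x) - 1))]

theorem integrable_entropy_terms (he : IsEntropy G g g') (T : ℝ) :
    Integrable (fun z => g' (s.θ z) * s.θx z ^ 2 / s.v z) (stm s.S T) ∧
    Integrable (fun z => g (s.θ z) * s.ux z ^ 2 / s.v z) (stm s.S T) ∧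
    Integrable (fun z => g (s.θ z) * (s.θ z * s.ux z) / s.v z) (stm s.S T) ∧
    Integrable (fun z => g (s.θ z) * s.θt z) (stm s.S T) := by
  obtain ⟨c, hc, C, hb⟩ := s.bound T
  obtain ⟨K, hK, hKb⟩ := he.exists_bounds hc C
  have := he.mg
  have := he.mg'
  have key : ∀ᵐ z ∂stm s.S T, (c ≤ s.v z ∧ 0 < s.θ z ∧ s.θ z ≤ C) ∧
      (|g (s.θ z)| ≤ K * |s.θ z - 1| ∧ |g' (s.θ z)| ≤ K ∧ |g (s.θ z)| ≤ K) := by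
    filter_upwards [ae_stm s.hS T] with z hz
    have h1 := hb z.1 ⟨hz.1.1.le, hz.1.2⟩ z.2 hz.2
    have h2 := hKb (s.θ z) ⟨h1.2.2.1, h1.2.2.2.1⟩
    exact ⟨⟨h1.1, hc.trans_le h1.2.2.1, h1.2.2.2.1⟩, h2.1, h2.2.1, h2.2.2.1⟩
  have hdiv : ∀ {A B v : ℝ}, c ≤ v → |A| ≤ B → |A / v| ≤ c⁻¹ * B := by
    intro A B v hv hA
    rw [abs_div, abs_of_pos (hc.trans_le hv), div_eq_inv_mul]
    exact mul_le_mul (inv_anti₀ hc hv) hA (abs_nonneg _) (inv_nonneg.2 hc.le)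
  refine ⟨?_, ?_, ?_, ?_⟩
  · refine integrable_of_abs_le_mul (C := c⁻¹ * K) aesm (s.lθx T) (s.lθx T) (by positivity) ?_
    filter_upwards [key] with z hz
    rw [mul_assoc]
    refine hdiv hz.1.1 ?_
    rw [abs_mul, abs_pow, sq]
    exact mul_le_right hz.2.2.1 (by positivity)
  · refine integrable_of_abs_le_mul (C := c⁻¹ * K) aesm (s.lux T) (s.lux T) (by positivity) ?_
    filter_upwards [key] with z hz
    rw [mul_assoc]
    refine hdiv hz.1.1 ?_
    rw [abs_mul, abs_pow, sq]
    exact mul_le_right hz.2.2.2 (by positivity)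
  · refine integrable_of_abs_le_mul (C := c⁻¹ * (K * |C|)) aesm (s.lθ T) (s.lux T) (by positivity) ?_
    filter_upwards [key] with z hz
    rw [mul_assoc]
    refine hdiv hz.1.1 ?_
    rw [abs_mul, abs_mul, abs_of_pos hz.1.2.1]
    have h1 := hz.2.1
    have h4 := hz.1.2.1
    have h3 : s.θ z ≤ |C| := hz.1.2.2.trans (le_abs_self C)
    calc |g (s.θ z)| * (s.θ z * |s.ux z|) ≤ (K * |s.θ z - 1|) * (|C| * |s.ux z|) := by
          gcongr
      _ = K * |C| * (|s.θ z - 1| * |s.ux z|) := by ring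
  · refine integrable_of_abs_le_mul (C := K) aesm (s.lθ T) (s.lθt T) hK ?_
    filter_upwards [key] with z hz
    rw [abs_mul]
    calc |g (s.θ z)| * |s.θt z| ≤ (K * |s.θ z - 1|) * |s.θt z| := by gcongr; exact hz.2.1
      _ = _ := by ring

/-- The temperature equation multiplied by `g(θ)`. -/
theorem entropy_identity (he : IsEntropy G g g') {T : ℝ} (hT : 0 ≤ T) :
    p.cv * (∫ x in s.S, G (s.θ (T, x))) = p.cv * (∫ x in s.S, G (s.θ (0, x))) +
      ∫ z, (-(p.κ * (g' (s.θ z) * s.θx z ^ 2 / s.v z)) + (p.μ * (g (s.θ z) * s.ux z ^ 2 / s.v z)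
        - p.R * (g (s.θ z) * (s.θ z * s.ux z) / s.v z))) ∂stm s.S T := by
  have mg := he.mg
  have mg' := he.mg'
  have hg1 := he.hg1
  obtain ⟨i1, i2, i3, i4⟩ := s.integrable_entropy_terms he T
  have hJ := s.hS.ordConnected_closure
  have hF : Integrable (fun z => (-(p.κ * (g' (s.θ z) * s.θx z ^ 2 / s.v z)) +
      (p.μ * (g (s.θ z) * s.ux z ^ 2 / s.v z) - p.R * (g (s.θ z) * (s.θ z * s.ux z) / s.v z)))) (stm s.S T) :=
    (i1.const_mul p.κ).neg.add ((i2.const_mul p.μ).sub (i3.const_mul p.R))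
  have h1 : ∀ᵐ x ∂vol s.S, IsPrim (Ici 0) (fun t => p.cv * G (s.θ (t, x)))
      (fun t => p.cv * (g (s.θ (t, x)) * s.θt (t, x))) := by
    filter_upwards [s.tθ, ae_restrict_mem s.hS.measurableSet] with x hx hxS
    exact (hx.comp (K := Ioi 0) he.hG (fun y hy => (he.hg y hy).continuousAt.continuousWithinAt)
      fun t ht => s.pos_θ ht (subset_closure hxS)).const_mul p.cv
  have hΦ : Integrable (fun z => p.cv * (g (s.θ z) * s.θt z)) (stm s.S T) := i4.const_mul _
  have := (integral_time_eq (Φ := fun z => p.cv * G (s.θ z))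
    (Φt := fun z => p.cv * (g (s.θ z) * s.θt z)) h1 hT hΦ
    ((s.integrable_entropy he le_rfl).const_mul _)).2
  rw [integral_const_mul, integral_const_mul] at this
  rw [this]
  congr 1
  rw [integral_of_le hT, integral_prod _ hF]
  refine integral_congr_ae ?_
  filter_upwards [ae_Ioc s.xθ T, ae_Ioc s.xθx T, ae_Ioc s.eqθ T, hF.prod_right_ae,
    hΦ.prod_right_ae, ae_mem_Ioc, MemLp.ae_slice (s.lθx T),
    (by
      rcases s.bdry with h | ⟨-, h | h⟩
      · exact .of_forall fun t => Or.inl h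
      · filter_upwards [ae_mem_Ioc] with t ht using Or.inr (Or.inl (h t ht.1.le))
      · filter_upwards [ae_Ioc h T] with t ht using Or.inr (Or.inr ht) :
      ∀ᵐ t ∂vol (Ioc 0 T), s.S = univ ∨ s.θ (t, 0) = 1 ∨ s.θx (t, 0) = 0)]
    with t hθ hθx heq hFt hΦt ht hl hbd
  have hv := s.xv t ht.1.le
  have hgθ := hθ.comp (K := Ioi 0) he.hg he.hg' fun x hx => s.pos_θ ht.1.le hx
  have hH := ((hgθ.mul hθx).div hv fun x hx => s.pos_v ht.1.le hx).const_mul p.κ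
  obtain ⟨c, hc, C, hb⟩ := s.bound t
  obtain ⟨K, hK, hKb⟩ := he.exists_bounds hc C
  have hz := hH.integral_eq_zero s.hS ?_ ((hΦt.sub hFt).congr ?_) ?_
  · have e : (fun x => p.κ * ((g' (s.θ (t, x)) * s.θx (t, x) * s.θx (t, x) +
        g (s.θ (t, x)) * s.θxx (t, x)) / s.v (t, x) -
        g (s.θ (t, x)) * s.θx (t, x) * s.vx (t, x) / s.v (t, x) ^ 2)) =ᵐ[vol s.S]
        fun x => p.cv * (g (s.θ (t, x)) * s.θt (t, x)) -
          (-(p.κ * (g' (s.θ (t, x)) * s.θx (t, x) ^ 2 / s.v (t, x))) +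
      (p.μ * (g (s.θ (t, x)) * s.ux (t, x) ^ 2 / s.v (t, x))
        - p.R * (g (s.θ (t, x)) * (s.θ (t, x) * s.ux (t, x)) / s.v (t, x)))) := by
      filter_upwards [heq] with x hx
      linear_combination (- g (s.θ (t, x))) * hx
    rw [integral_congr_ae e, integral_sub hΦt hFt] at hz
    linarith
  · refine integrable_of_abs_le_mul (C := p.κ * (c⁻¹ * K))
      aesm (s.sθ t ht.1.le) hl
      (by have := p.hκ; positivity) (s.ae_S fun x hx => ?_)
    have h1 := hb t ⟨ht.1.le, le_rfl⟩ x hx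
    have h2 := hKb (s.θ (t, x)) ⟨h1.2.2.1, h1.2.2.2.1⟩
    rw [abs_mul, abs_div, abs_mul, abs_of_pos p.hκ, abs_of_pos (hc.trans_le h1.1), div_eq_inv_mul, mul_assoc]
    refine mul_le_left ?_ p.hκ.le
    calc (s.v (t, x))⁻¹ * (|g (s.θ (t, x))| * |s.θx (t, x)|)
        ≤ c⁻¹ * ((K * |s.θ (t, x) - 1|) * |s.θx (t, x)|) := by
          gcongr
          · exact h1.1
          · exact h2.1
      _ = _ := by ring
  · filter_upwards [heq] with x hx
    simp only [Pi.sub_apply]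
    linear_combination (g (s.θ (t, x))) * hx
  · rcases hbd with h | h | h
    · exact Or.inl h
    · right; simp [h, hg1]
    · right; simp [h]

end Entropy

end Sol

/-! ### The basic energy estimate -/

section L2

variable {α : Type*} [MeasurableSpace α] {m : Measure α} {f w : α → ℝ} {c : ℝ}

theorem memLp_div (hf : MemLp f 2 m) (hw : AEStronglyMeasurable w m) (hc : 0 < c)
    (h : ∀ᵐ z ∂m, c ≤ w z) : MemLp (fun z => f z / w z) 2 m := by
  refine memLp_two_of_abs_le (C := c⁻¹) (hf.1.div₀ hw) hf ?_
  filter_upwards [h] with z hz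
  rw [abs_div, abs_of_pos (hc.trans_le hz), div_eq_inv_mul]
  exact mul_le_right (inv_anti₀ hc hz) (abs_nonneg _)

theorem memLp_bdd_mul (hf : MemLp f 2 m) (hw : AEStronglyMeasurable w m)
    (h : ∀ᵐ z ∂m, |w z| ≤ c) : MemLp (fun z => w z * f z) 2 m := by
  refine memLp_two_of_abs_le (C := c) (hw.mul hf.1) hf ?_
  filter_upwards [h] with z hz
  rw [abs_mul]
  exact mul_le_right hz (abs_nonneg _)

theorem integrable_mul_div {g : α → ℝ} (hf : MemLp f 2 m) (hg : MemLp g 2 m)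
    (hw : AEStronglyMeasurable w m) (hc : 0 < c)
    (h : ∀ᵐ z ∂m, c ≤ w z) : Integrable (fun z => f z * g z / w z) m := by
  have h1 := hf.integrable_mul (memLp_div hg hw hc h)
  refine h1.congr (.of_forall fun z => ?_)
  simp only [Pi.mul_apply]; ring

end L2

theorem relEntropy_nonneg {y : ℝ} (hy : 0 < y) : 0 ≤ y - log y - 1 := by linarith [Real.log_le_sub_one_of_pos hy]

theorem relEntropy_le {y : ℝ} (hy : 0 < y) : y - log y - 1 ≤ (y - 1) ^ 2 / y := by
  have h1 := Real.one_sub_inv_le_log_of_pos hy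
  have h2 : (y - 1) ^ 2 / y = y - 2 + y⁻¹ := by field_simp; ring
  rw [h2]; linarith

theorem isEntropy_relEntropy :
    IsEntropy (fun y => y - log y - 1) (fun y => 1 - y⁻¹) (fun y => (y ^ 2)⁻¹) where
  hG y hy := by
    have := ((hasDerivAt_id y).sub (Real.hasDerivAt_log hy.ne')).sub_const 1
    simpa using this
  hg y hy := by
    have := (hasDerivAt_inv hy.ne').const_sub 1
    simpa using this
  hg' := ContinuousOn.inv₀ (by fun_prop) fun y hy => pow_ne_zero _ (ne_of_gt hy)
  hG1 := by simp
  hg1 := by simp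
  mG := by fun_prop
  mg := by fun_prop
  mg' := by fun_prop

/-- A bound for the initial energy. -/
def Params.E (p : Params) : ℝ := p.N ^ 2 * (1 + p.R / p.a + p.cv / p.b)

theorem Params.E_nonneg (p : Params) : 0 ≤ p.E := by
  have := p.hR; have := p.ha; have := p.hb; have := p.hcv
  unfold Params.E; positivity

namespace Sol

variable {p : Params} (s : Sol p)

/-- The density of the dissipation. -/
def diss (z : ℝ × ℝ) : ℝ := p.μ * (s.ux z ^ 2 / (s.v z * s.θ z)) + p.κ * (s.θx z ^ 2 / (s.v z * s.θ z ^ 2))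

theorem diss_nonneg {t x : ℝ} (ht : 0 ≤ t) (hx : x ∈ closure s.S) : 0 ≤ s.diss (t, x) := by
  have := s.pos_v ht hx; have := s.pos_θ ht hx; have := p.hμ; have := p.hκ
  unfold diss; positivity

theorem ae_bound (T : ℝ) : ∃ c > 0, ∃ C, ∀ᵐ z ∂stm s.S T, c ≤ s.v z ∧ s.v z ≤ C ∧
    c ≤ s.θ z ∧ s.θ z ≤ C ∧ |s.u z| ≤ C := by
  obtain ⟨c, hc, C, hb⟩ := s.bound T
  refine ⟨c, hc, C, ?_⟩
  filter_upwards [ae_stm s.hS T] with z hz using hb z.1 ⟨hz.1.1.le, hz.1.2⟩ z.2 hz.2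

theorem ae_bound_slice {t : ℝ} (ht : 0 ≤ t) : ∃ c > 0, ∃ C, ∀ᵐ x ∂vol s.S,
    c ≤ s.v (t, x) ∧ s.v (t, x) ≤ C ∧ c ≤ s.θ (t, x) ∧ s.θ (t, x) ≤ C ∧ |s.u (t, x)| ≤ C := by
  obtain ⟨c, hc, C, hb⟩ := s.bound t
  exact ⟨c, hc, C, s.ae_S fun x hx => hb t ⟨ht, le_rfl⟩ x hx⟩

theorem integrable_relEntropy_v {t : ℝ} (ht : 0 ≤ t) :
    Integrable (fun x => s.v (t, x) - log (s.v (t, x)) - 1) (vol s.S) := by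
  obtain ⟨c, hc, C, hb⟩ := s.bound t
  refine integrable_of_abs_le_sq (C := c⁻¹) aesm (s.sv t ht) (s.sv t ht) (s.ae_S fun x hx => ?_)
  have h1 := (hb t ⟨ht, le_rfl⟩ x hx).1
  have hv := s.pos_v ht hx
  rw [abs_of_nonneg (relEntropy_nonneg hv)]
  refine (relEntropy_le hv).trans ?_
  rw [div_eq_inv_mul]
  refine mul_le_mul (inv_anti₀ hc h1) ?_ (sq_nonneg _) (inv_nonneg.2 hc.le)
  nlinarith [sq_nonneg (s.v (t, x) - 1)]

theorem integrable_u_sq {t : ℝ} (ht : 0 ≤ t) :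
    Integrable (fun x => s.u (t, x) ^ 2) (vol s.S) := (s.su t ht).integrable_sq

/-- The momentum equation multiplied by `u`. -/
theorem momentum_identity {T : ℝ} (hT : 0 ≤ T) : Integrable (fun z => s.ux z ^ 2 / s.v z) (stm s.S T) ∧
    Integrable (fun z => (s.θ z - 1) * s.ux z / s.v z) (stm s.S T) ∧
    (∫ x in s.S, (1 / 2 * s.u (T, x) ^ 2 + p.R * (s.v (T, x) - log (s.v (T, x)) - 1))) =
    (∫ x in s.S, (1 / 2 * s.u (0, x) ^ 2 + p.R * (s.v (0, x) - log (s.v (0, x)) - 1))) +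
      ∫ z, (-(p.μ * (s.ux z ^ 2 / s.v z)) + p.R * ((s.θ z - 1) * s.ux z / s.v z)) ∂stm s.S T := by
  have hJ := s.hS.ordConnected_closure
  obtain ⟨c, hc, C, hb⟩ := s.ae_bound T
  have mv := s.m_v
  have i1 : Integrable (fun z => s.ux z ^ 2 / s.v z) (stm s.S T) := by
    have := integrable_mul_div (s.lux T) (s.lux T) mv.aestronglyMeasurable hc (hb.mono fun z hz => hz.1)
    simpa only [← sq] using this
  have i2 : Integrable (fun z => (s.θ z - 1) * s.ux z / s.v z) (stm s.S T) :=
    integrable_mul_div (s.lθ T) (s.lux T) mv.aestronglyMeasurable hc (hb.mono fun z hz => hz.1)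
  have i3 : Integrable (fun z => (s.v z - 1) * s.ux z / s.v z) (stm s.S T) :=
    integrable_mul_div (s.lv T) (s.lux T) mv.aestronglyMeasurable hc (hb.mono fun z hz => hz.1)
  have i4 : Integrable (fun z => s.u z * s.ut z) (stm s.S T) := (s.lu T).integrable_mul (s.lut T)
  have hF : Integrable (fun z => -(p.μ * (s.ux z ^ 2 / s.v z)) +
      p.R * ((s.θ z - 1) * s.ux z / s.v z)) (stm s.S T) :=
    (i1.const_mul p.μ).neg.add (i2.const_mul p.R)
  have hΦ : Integrable (fun z => s.u z * s.ut z + p.R * ((s.v z - 1) * s.ux z / s.v z))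
      (stm s.S T) := i4.add (i3.const_mul p.R)
  refine ⟨i1, i2, ?_⟩
  have h1 : ∀ᵐ x ∂vol s.S, IsPrim (Ici 0)
      (fun t => 1 / 2 * s.u (t, x) ^ 2 + p.R * (s.v (t, x) - log (s.v (t, x)) - 1))
      (fun t => s.u (t, x) * s.ut (t, x) + p.R * ((s.v (t, x) - 1) * s.ux (t, x) / s.v (t, x))) := by
    filter_upwards [s.tu, s.tv, ae_restrict_mem s.hS.measurableSet] with x hu hv hxS
    have hpos : ∀ t ∈ Ici (0:ℝ), 0 < s.v (t, x) := fun t ht => s.pos_v ht (subset_closure hxS)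
    have h := ((hu.mul hu).const_mul (1 / 2)).add (((hv.sub (hv.log hpos)).sub_const 1).const_mul p.R)
    refine (h.congr_left fun t _ => by ring).congr_right ?_
    filter_upwards [ae_restrict_mem measurableSet_Ici] with t ht
    have := hpos t ht
    field_simp
    ring
  have i0 : Integrable (fun x => 1 / 2 * s.u (0, x) ^ 2 + p.R * (s.v (0, x) - log (s.v (0, x)) - 1)) (vol s.S) :=
    ((s.integrable_u_sq le_rfl).const_mul _).add ((s.integrable_relEntropy_v le_rfl).const_mul _)
  rw [(integral_time_eq (Φ := fun z => 1 / 2 * s.u z ^ 2 + p.R * (s.v z - log (s.v z) - 1)) h1 hT hΦ i0).2]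
  congr 1
  rw [integral_of_le hT, integral_prod _ hF]
  refine integral_congr_ae ?_
  filter_upwards [ae_Ioc s.xu T, ae_Ioc s.xux T, ae_Ioc s.xθ T, ae_Ioc s.equ T, hF.prod_right_ae,
    hΦ.prod_right_ae, ae_mem_Ioc, MemLp.ae_slice (s.lux T)]
    with t hu hux hθ heq hFt hΦt ht hl
  have hv := s.xv t ht.1.le
  have hpos : ∀ x ∈ closure s.S, 0 < s.v (t, x) := fun x hx => s.pos_v ht.1.le hx
  have hH := (hu.mul (((hux.div hv hpos).const_mul p.μ).sub
    ((hθ.div hv hpos).const_mul p.R))).add (hu.const_mul p.R)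
  obtain ⟨c, hc, C, hb⟩ := s.ae_bound_slice ht.1.le
  have hlow : ∀ᵐ x ∂vol s.S, c ≤ s.v (t, x) := hb.mono fun z hz => hz.1
  have mvt : AEStronglyMeasurable (fun x => s.v (t, x)) (vol s.S) :=
    (continuous_slice s.c_v t).aestronglyMeasurable
  have hz := hH.integral_eq_zero s.hS ?_ ((hΦt.sub hFt).congr ?_) ?_
  · have e : (fun x => s.ux (t, x) * (p.μ * (s.ux (t, x) / s.v (t, x)) -
        p.R * (s.θ (t, x) / s.v (t, x))) + s.u (t, x) * (p.μ * (s.uxx (t, x) / s.v (t, x) -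
        s.ux (t, x) * s.vx (t, x) / s.v (t, x) ^ 2) - p.R * (s.θx (t, x) / s.v (t, x) -
        s.θ (t, x) * s.vx (t, x) / s.v (t, x) ^ 2)) + p.R * s.ux (t, x)) =ᵐ[vol s.S]
        fun x => (s.u (t, x) * s.ut (t, x) + p.R * ((s.v (t, x) - 1) * s.ux (t, x) / s.v (t, x)))
          - (-(p.μ * (s.ux (t, x) ^ 2 / s.v (t, x))) +
          p.R * ((s.θ (t, x) - 1) * s.ux (t, x) / s.v (t, x))) := by
      filter_upwards [heq, s.ae_S hpos] with x hx hp
      rw [hx]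
      field_simp
      ring
    rw [integral_congr_ae e, integral_sub hΦt hFt] at hz
    linarith
  · have j1 := (integrable_mul_div (s.su t ht.1.le) hl mvt hc hlow).const_mul p.μ
    have j2 := (integrable_mul_div (s.su t ht.1.le) (s.sv t ht.1.le) mvt hc hlow).const_mul p.R
    have j3 := (integrable_mul_div (s.su t ht.1.le) (s.sθ t ht.1.le) mvt hc hlow).const_mul p.R
    refine ((j1.add j2).sub j3).congr ?_
    filter_upwards [s.ae_S hpos] with x hp
    simp only [Pi.sub_apply, Pi.add_apply]
    field_simp
    ring
  · filter_upwards [heq, s.ae_S hpos] with x hx hp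
    simp only [Pi.sub_apply]
    rw [hx]
    field_simp
    ring
  · rcases s.bdry with h | h
    · exact Or.inl h
    · right; simp [h.1 t ht.1.le]

theorem integrable_diss (T : ℝ) : Integrable s.diss (stm s.S T) := by
  obtain ⟨c, hc, C, hb⟩ := s.ae_bound T
  have h1 := integrable_mul_div (s.lux T) (s.lux T) (w := fun z => s.v z * s.θ z)
    aesm (c := c * c) (by positivity)
    (by
      filter_upwards [hb] with z hz
      exact mul_le_mul hz.1 hz.2.2.1 hc.le (hc.le.trans hz.1))
  have h2 := integrable_mul_div (s.lθx T) (s.lθx T) (w := fun z => s.v z * s.θ z ^ 2)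
    aesm (c := c * c ^ 2) (by positivity)
    (by
      filter_upwards [hb] with z hz
      exact mul_le_mul hz.1 (pow_le_pow_left₀ hc.le hz.2.2.1 2) (by positivity) (hc.le.trans hz.1))
  simp only [← sq] at h1 h2
  exact (h1.const_mul p.μ).add (h2.const_mul p.κ)

theorem integrable_relEntropy_θ {t : ℝ} (ht : 0 ≤ t) :
    Integrable (fun x => s.θ (t, x) - log (s.θ (t, x)) - 1) (vol s.S) :=
  s.integrable_entropy isEntropy_relEntropy ht

theorem energy_identity {T : ℝ} (hT : 0 ≤ T) :
    (∫ x in s.S, (1 / 2 * s.u (T, x) ^ 2 + p.R * (s.v (T, x) - log (s.v (T, x)) - 1)))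
      + p.cv * (∫ x in s.S, (s.θ (T, x) - log (s.θ (T, x)) - 1)) + ∫ z, s.diss z ∂stm s.S T =
    (∫ x in s.S, (1 / 2 * s.u (0, x) ^ 2 + p.R * (s.v (0, x) - log (s.v (0, x)) - 1)))
      + p.cv * (∫ x in s.S, (s.θ (0, x) - log (s.θ (0, x)) - 1)) := by
  obtain ⟨i1, i2, hM⟩ := s.momentum_identity hT
  have hA := s.entropy_identity isEntropy_relEntropy hT
  obtain ⟨j1, j2, j3, -⟩ := s.integrable_entropy_terms isEntropy_relEntropy T
  rw [hM, hA]
  have e : ∫ z, s.diss z ∂stm s.S T = -((∫ z, (-(p.μ * (s.ux z ^ 2 / s.v z)) +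
      p.R * ((s.θ z - 1) * s.ux z / s.v z)) ∂stm s.S T) +
      ∫ z, (-(p.κ * ((s.θ z ^ 2)⁻¹ * s.θx z ^ 2 / s.v z)) + (p.μ * ((1 - (s.θ z)⁻¹) * s.ux z ^ 2 / s.v z)
        - p.R * ((1 - (s.θ z)⁻¹) * (s.θ z * s.ux z) / s.v z))) ∂stm s.S T) := by
    rw [← integral_add, ← integral_neg]
    · refine integral_congr_ae ?_
      filter_upwards [ae_stm s.hS T] with z hz
      have hv := s.pos_v hz.1.1.le hz.2
      have hθ := s.pos_θ hz.1.1.le hz.2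
      simp only [Prod.mk.eta] at hv hθ
      simp only [diss]
      field_simp
      ring
    · exact (i1.const_mul p.μ).neg.add (i2.const_mul p.R)
    · exact (j1.const_mul p.κ).neg.add ((j2.const_mul p.μ).sub (j3.const_mul p.R))
  rw [e]
  ring

theorem integral_nonneg_S {f : ℝ → ℝ} (h : ∀ x ∈ closure s.S, 0 ≤ f x) : 0 ≤ ∫ x in s.S, f x :=
  integral_nonneg_of_ae (s.ae_S h)

theorem integral_diss_nonneg (T : ℝ) : 0 ≤ ∫ z, s.diss z ∂stm s.S T := by
  refine integral_nonneg_of_ae ?_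
  filter_upwards [ae_stm s.hS T] with z hz using s.diss_nonneg hz.1.1.le hz.2

theorem data_le : (∫ x in s.S, (s.v (0, x) - 1) ^ 2) ≤ p.N ^ 2 ∧
    (∫ x in s.S, s.vx (0, x) ^ 2) ≤ p.N ^ 2 ∧ (∫ x in s.S, s.u (0, x) ^ 2) ≤ p.N ^ 2 ∧
    (∫ x in s.S, s.u0x x ^ 2) ≤ p.N ^ 2 ∧ (∫ x in s.S, (s.θ (0, x) - 1) ^ 2) ≤ p.N ^ 2 ∧
    (∫ x in s.S, s.θ0x x ^ 2) ≤ p.N ^ 2 := by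
  have h := s.data
  have n : ∀ f : ℝ → ℝ, 0 ≤ ∫ x in s.S, f x ^ 2 := fun f => integral_nonneg fun x => sq_nonneg _
  have h1 := n fun x => s.v (0, x) - 1
  have h2 := n fun x => s.vx (0, x)
  have h3 := n fun x => s.u (0, x)
  have h4 := n s.u0x
  have h5 := n fun x => s.θ (0, x) - 1
  have h6 := n s.θ0x
  refine ⟨?_, ?_, ?_, ?_, ?_, ?_⟩ <;> linarith

theorem energy_initial :
    (∫ x in s.S, (1 / 2 * s.u (0, x) ^ 2 + p.R * (s.v (0, x) - log (s.v (0, x)) - 1)))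
      + p.cv * (∫ x in s.S, (s.θ (0, x) - log (s.θ (0, x)) - 1)) ≤ p.E := by
  have := p.ha; have := p.hb; have hR := p.hR; have hcv := p.hcv
  obtain ⟨d1, -, d3, -, d5, -⟩ := s.data_le
  rw [integral_add ((s.integrable_u_sq le_rfl).const_mul _)
    ((s.integrable_relEntropy_v le_rfl).const_mul _), integral_const_mul, integral_const_mul]
  have e1 : ∫ x in s.S, (s.v (0, x) - log (s.v (0, x)) - 1) ≤ p.N ^ 2 / p.a := by
    have : ∫ x in s.S, (s.v (0, x) - log (s.v (0, x)) - 1) ≤ ∫ x in s.S, p.a⁻¹ * (s.v (0, x) - 1) ^ 2 := by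
      refine integral_mono_ae (s.integrable_relEntropy_v le_rfl)
        ((s.sv 0 le_rfl).integrable_sq.const_mul _) (s.ae_S fun x hx => ?_)
      refine (relEntropy_le (s.pos_v le_rfl hx)).trans ?_
      rw [div_eq_inv_mul]
      exact mul_le_right (inv_anti₀ p.ha (s.v0_ge x hx)) (sq_nonneg _)
    rw [integral_const_mul] at this
    rw [div_eq_inv_mul]
    exact this.trans (mul_le_left d1 (by positivity))
  have e2 : ∫ x in s.S, (s.θ (0, x) - log (s.θ (0, x)) - 1) ≤ p.N ^ 2 / p.b := by
    have : ∫ x in s.S, (s.θ (0, x) - log (s.θ (0, x)) - 1) ≤ ∫ x in s.S, p.b⁻¹ * (s.θ (0, x) - 1) ^ 2 := by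
      refine integral_mono_ae (s.integrable_relEntropy_θ le_rfl)
        ((s.sθ 0 le_rfl).integrable_sq.const_mul _) (s.ae_S fun x hx => ?_)
      refine (relEntropy_le (s.pos_θ le_rfl hx)).trans ?_
      rw [div_eq_inv_mul]
      exact mul_le_right (inv_anti₀ p.hb (s.θ0_ge x hx)) (sq_nonneg _)
    rw [integral_const_mul] at this
    rw [div_eq_inv_mul]
    exact this.trans (mul_le_left d5 (by positivity))
  have e3 := mul_le_left e1 hR.le
  have e4 := mul_le_left e2 hcv.le
  have e5 : p.E = p.N ^ 2 + p.R * (p.N ^ 2 / p.a) + p.cv * (p.N ^ 2 / p.b) := by unfold Params.E; ring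
  rw [e5]
  nlinarith [sq_nonneg p.N]

/-- The basic energy estimate. -/
theorem energy {t : ℝ} (ht : 0 ≤ t) : (∫ x in s.S, s.u (t, x) ^ 2) ≤ 2 * p.E ∧
    p.R * (∫ x in s.S, (s.v (t, x) - log (s.v (t, x)) - 1)) ≤ p.E ∧
    p.cv * (∫ x in s.S, (s.θ (t, x) - log (s.θ (t, x)) - 1)) ≤ p.E ∧
    ∫ z, s.diss z ∂stm s.S t ≤ p.E := by
  have h1 := s.energy_identity ht
  have h2 := s.energy_initial
  rw [integral_add ((s.integrable_u_sq ht).const_mul _)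
    ((s.integrable_relEntropy_v ht).const_mul _), integral_const_mul, integral_const_mul] at h1
  have n1 : 0 ≤ ∫ x in s.S, s.u (t, x) ^ 2 := integral_nonneg fun x => sq_nonneg _
  have n2 : 0 ≤ p.R * (∫ x in s.S, (s.v (t, x) - log (s.v (t, x)) - 1)) :=
    mul_nonneg p.hR.le (s.integral_nonneg_S fun x hx => relEntropy_nonneg (s.pos_v ht hx))
  have n3 : 0 ≤ p.cv * (∫ x in s.S, (s.θ (t, x) - log (s.θ (t, x)) - 1)) :=
    mul_nonneg p.hcv.le (s.integral_nonneg_S fun x hx => relEntropy_nonneg (s.pos_θ ht hx))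
  have n4 := s.integral_diss_nonneg t
  refine ⟨?_, ?_, ?_, ?_⟩ <;> linarith

end Sol

/-! ### Representation of the specific volume -/

theorem le_on_Icc_of_ae {f g : ℝ → ℝ} (hf : Continuous f) (hg : Continuous g) {a b : ℝ}
    (hab : a < b) (h : ∀ᵐ x ∂vol (Ioo a b), f x ≤ g x) :
    ∀ x ∈ Icc a b, f x ≤ g x := by
  have hopen : IsOpen ({x | g x < f x} ∩ Ioo a b) := (isOpen_lt hg hf).inter isOpen_Ioo
  have hnull : volume ({x | g x < f x} ∩ Ioo a b) = 0 := by
    rw [ae_restrict_iff' measurableSet_Ioo, ae_iff] at h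
    refine measure_mono_null ?_ h
    rintro x ⟨h1, h2⟩
    simp only [mem_ofPred_eq, not_forall, not_le]
    exact ⟨h2, h1⟩
  have hemp := (hopen.measure_eq_zero_iff volume).1 hnull
  have h1 : Ioo a b ⊆ {x | f x ≤ g x} := fun x hx => by
    by_contra hc
    have hlt : g x < f x := not_le.1 hc
    have : x ∈ ({x | g x < f x} ∩ Ioo a b) := ⟨hlt, hx⟩
    rw [hemp] at this; exact this
  have h2 : closure (Ioo a b) ⊆ {x | f x ≤ g x} := closure_minimal h1 (isClosed_le hf hg)
  rw [closure_Ioo hab.ne] at h2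
  exact fun x hx => h2 hx

theorem interval_le_S {S : Set ℝ} (hS : IsLine S) {f : ℝ → ℝ} {a b : ℝ} (ha : a ∈ closure S)
    (hab : a ≤ b) (hf : IntegrableOn f S) (h0 : ∀ x ∈ closure S, 0 ≤ f x) :
    ∫ x in a..b, f x ≤ ∫ x in S, f x := by
  rw [integral_of_le hab]
  refine setIntegral_mono_set hf ?_ (Ioc_subset_Ioi_self.trans (hS.Ioi_subset ha)).eventuallyLE
  filter_upwards [ae_restrict_mem hS.measurableSet] with x hx using h0 x (subset_closure hx)

theorem intervalIntegrable_of_S {S : Set ℝ} (hS : IsLine S) {f : ℝ → ℝ} {a b : ℝ}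
    (ha : a ∈ closure S) (hab : a ≤ b) (hf : IntegrableOn f S) :
    IntervalIntegrable f volume a b :=
  (intervalIntegrable_iff_Ioc hab).2 (hf.mono_set (Ioc_subset_Ioi_self.trans (hS.Ioi_subset ha)))

/-- The weight of the localized momentum balance. -/
def chi (x₀ x y : ℝ) : ℝ :=
  (Ioc x (x₀ + 1)).indicator 1 y + (Ioc (x₀ + 1) (x₀ + 2)).indicator (fun y => x₀ + 2 - y) y

theorem m_chi (x₀ x : ℝ) : Measurable (chi x₀ x) := by
  unfold chi
  exact (measurable_one.indicator measurableSet_Ioc).add (Measurable.indicator (by fun_prop) measurableSet_Ioc)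

theorem abs_chi_le {x₀ x : ℝ} (hx : x ∈ Icc x₀ (x₀ + 1)) (y : ℝ) :
    |chi x₀ x y| ≤ (Ioc x₀ (x₀ + 2)).indicator 1 y := by
  unfold chi
  by_cases h1 : y ∈ Ioc x (x₀ + 1)
  · have h2 : y ∉ Ioc (x₀ + 1) (x₀ + 2) := fun h => absurd h.1 (not_lt.2 h1.2)
    have h3 : y ∈ Ioc x₀ (x₀ + 2) := ⟨hx.1.trans_lt h1.1, by linarith [h1.2]⟩
    simp [h1, h2, h3]
  · by_cases h2 : y ∈ Ioc (x₀ + 1) (x₀ + 2)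
    · have h3 : y ∈ Ioc x₀ (x₀ + 2) := ⟨by linarith [h2.1], h2.2⟩
      simp only [h1, h2, h3, indicator_of_notMem, indicator_of_mem, not_false_eq_true, Pi.one_apply, zero_add]
      rw [abs_le]; constructor <;> linarith [h2.1, h2.2]
    · simp only [h1, h2, indicator_of_notMem, not_false_eq_true, add_zero, abs_zero]
      exact indicator_nonneg (fun _ _ => zero_le_one) _

theorem memLp_ind (S : Set ℝ) (a b : ℝ) : MemLp ((Ioc a b).indicator (1 : ℝ → ℝ)) 2 (vol S) := by
  have := memLp_indicator_const (μ := vol S) 2 (measurableSet_Ioc (a := a) (b := b))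
    (1 : ℝ) (Or.inr ((Measure.restrict_apply_le _ _).trans_lt (by simp)).ne)
  exact this

theorem memLp_chi (S : Set ℝ) {x₀ x : ℝ} (hx : x ∈ Icc x₀ (x₀ + 1)) : MemLp (chi x₀ x) 2 (vol S) := by
  refine memLp_two_of_abs_le (C := 1) (m_chi x₀ x).aestronglyMeasurable
    (memLp_ind S x₀ (x₀ + 2)) (.of_forall fun y => ?_)
  rw [one_mul]
  exact (abs_chi_le hx y).trans (le_abs_self _)

theorem memLp_snd {S : Set ℝ} {f : ℝ → ℝ} (hf : MemLp f 2 (vol S)) (T : ℝ) :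
    MemLp (fun z : ℝ × ℝ => f z.2) 2 (stm S T) := MemLp.comp_snd hf _

namespace Sol

variable {p : Params} (s : Sol p)

/-- The effective stress. -/
def stress (z : ℝ × ℝ) : ℝ := p.μ * (s.ux z / s.v z) - p.R * (s.θ z / s.v z)

/-- The mean stress over `[x₀ + 1, x₀ + 2]`. -/
def sig (x₀ τ : ℝ) : ℝ := if 0 < τ then ∫ y in (x₀ + 1)..(x₀ + 2), s.stress (τ, y) else 0

/-- The total dissipation at a given time. -/
def d (τ : ℝ) : ℝ := ∫ x in s.S, s.diss (τ, x)

theorem integrable_ind_stress (a b T : ℝ) :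
    Integrable (fun z => (Ioc a b).indicator 1 z.2 * s.stress z) (stm s.S T) := by
  obtain ⟨c, hc, C, hb⟩ := s.ae_bound T
  have mv := s.m_v
  have hlow : ∀ᵐ z ∂stm s.S T, c ≤ s.v z := hb.mono fun z hz => hz.1
  have hi := memLp_snd (memLp_ind s.S a b) T
  have i1 := integrable_mul_div hi (s.lux T) mv.aestronglyMeasurable hc hlow
  have i2 := integrable_mul_div hi (s.lθ T) mv.aestronglyMeasurable hc hlow
  have i3 := integrable_mul_div hi hi mv.aestronglyMeasurable hc hlow
  refine ((i1.const_mul p.μ).sub ((i2.add i3).const_mul p.R)).congr (.of_forall fun z => ?_)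
  simp only [Pi.sub_apply, Pi.add_apply, stress]
  by_cases h : z.2 ∈ Ioc a b
  · simp only [h, indicator_of_mem, Pi.one_apply]; ring
  · simp [h]

theorem integral_ind_stress {a b : ℝ} (ha : a ∈ closure s.S) (hab : a ≤ b) (τ : ℝ) :
    ∫ y in s.S, (Ioc a b).indicator 1 y * s.stress (τ, y) = ∫ y in a..b, s.stress (τ, y) := by
  have e : (fun y => (Ioc a b).indicator 1 y * s.stress (τ, y)) =
      (Ioc a b).indicator (fun y => s.stress (τ, y)) := by
    ext y
    by_cases h : y ∈ Ioc a b <;> simp [h]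
  rw [e, setIntegral_indicator measurableSet_Ioc, integral_of_le hab,
    inter_eq_self_of_subset_right (Ioc_subset_Ioi_self.trans (s.hS.Ioi_subset ha))]

theorem integrableOn_sig {x₀ : ℝ} (hx₀ : x₀ ∈ closure s.S) (T : ℝ) : IntegrableOn (s.sig x₀) (Ioc 0 T) := by
  have h := (s.integrable_ind_stress (x₀ + 1) (x₀ + 2) T).integral_prod_left
  refine h.congr ?_
  filter_upwards [ae_mem_Ioc] with τ hτ
  rw [s.integral_ind_stress (s.hS.mem_of_le hx₀ (by linarith)) (by linarith), sig, if_pos hτ.1]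

theorem intervalIntegrable_sig {x₀ : ℝ} (hx₀ : x₀ ∈ closure s.S) (a b : ℝ) :
    IntervalIntegrable (s.sig x₀) volume a b := by
  have key : ∀ T : ℝ, IntervalIntegrable (s.sig x₀) volume 0 T := by
    intro T
    rcases le_total 0 T with h | h
    · exact (intervalIntegrable_iff_Ioc h).2 (s.integrableOn_sig hx₀ T)
    · refine IntervalIntegrable.symm ?_
      rw [intervalIntegrable_iff_Ioc h]
      refine (integrableOn_zero (s := Ioc T 0)).congr_fun (fun τ hτ => ?_) measurableSet_Ioc
      simp [sig, not_lt.2 hτ.2]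
  exact (key a).symm.trans (key b)

/-- The logarithm of the common factor in the representation of the specific volume. -/
def A (x₀ t : ℝ) : ℝ := ∫ τ in 0..t, s.sig x₀ τ

theorem continuous_A {x₀ : ℝ} (hx₀ : x₀ ∈ closure s.S) : Continuous (s.A x₀) :=
  intervalIntegral.continuous_primitive (fun a b => s.intervalIntegrable_sig hx₀ a b) 0

theorem intervalIntegrable_d {T : ℝ} (hT : 0 ≤ T) : IntervalIntegrable s.d volume 0 T :=
  (intervalIntegrable_iff_Ioc hT).2 (s.integrable_diss T).integral_prod_left

theorem d_nonneg {τ : ℝ} (hτ : 0 ≤ τ) : 0 ≤ s.d τ := s.integral_nonneg_S fun _ hx => s.diss_nonneg hτ hx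

theorem integral_d_le {T : ℝ} (hT : 0 ≤ T) : ∫ τ in 0..T, s.d τ ≤ p.E := by
  have h := (s.energy hT).2.2.2
  rwa [integral_prod _ (s.integrable_diss T), ← integral_of_le hT] at h

theorem integral_d_le' {a b : ℝ} (ha : 0 ≤ a) (hab : a ≤ b) : ∫ τ in a..b, s.d τ ≤ p.E := by
  have h := s.integral_d_le (ha.trans hab)
  have e := integral_add_adjacent_intervals (s.intervalIntegrable_d ha)
    ((s.intervalIntegrable_d ha).symm.trans (s.intervalIntegrable_d (ha.trans hab)))
  have : 0 ≤ ∫ τ in 0..a, s.d τ := interval_nonneg ha fun τ hτ => s.d_nonneg hτ.1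
  linarith

theorem localized_momentum {x₀ x : ℝ} (hx₀ : x₀ ∈ closure s.S) (hx : x ∈ Icc x₀ (x₀ + 1)) {t : ℝ}
    (ht : 0 ≤ t) : IntervalIntegrable (fun τ => s.stress (τ, x)) volume 0 t ∧
    ∫ y in s.S, chi x₀ x y * s.u (t, y) =
      (∫ y in s.S, chi x₀ x y * s.u (0, y)) + s.A x₀ t - ∫ τ in 0..t, s.stress (τ, x) := by
  have hJ := s.hS.ordConnected_closure
  have hxJ : x ∈ closure s.S := s.hS.mem_of_le hx₀ hx.1
  have hx1 : x₀ + 1 ∈ closure s.S := s.hS.mem_of_le hx₀ (by linarith)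
  have hx2 : x₀ + 2 ∈ closure s.S := s.hS.mem_of_le hx₀ (by linarith)
  have hi : Integrable (fun z => chi x₀ x z.2 * s.ut z) (stm s.S t) :=
    (memLp_snd (memLp_chi s.S hx) t).integrable_mul (s.lut t)
  have h1 : ∀ᵐ y ∂vol s.S, IsPrim (Ici 0) (fun t => chi x₀ x y * s.u (t, y))
      (fun t => chi x₀ x y * s.ut (t, y)) := by
    filter_upwards [s.tu] with y hy using hy.const_mul _
  have key := (integral_time_eq (Φ := fun z => chi x₀ x z.2 * s.u z) h1 ht hi
    ((memLp_chi s.S hx).integrable_mul (s.su 0 le_rfl))).2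
  have hslice : ∀ᵐ τ ∂vol (Ioc 0 t), ∫ y in s.S, chi x₀ x y * s.ut (τ, y) = s.sig x₀ τ - s.stress (τ, x) := by
    filter_upwards [ae_Ioc s.xu t, ae_Ioc s.xux t, ae_Ioc s.xθ t, ae_Ioc s.equ t,
      ae_mem_Ioc, MemLp.ae_slice (s.lut t)] with τ hu hux hθ heq hτ hl
    have hv := s.xv τ hτ.1.le
    have hpos : ∀ x ∈ closure s.S, 0 < s.v (τ, x) := fun x hx => s.pos_v hτ.1.le hx
    have hσ : IsPrim (closure s.S) (fun y => s.stress (τ, y)) (fun y => s.ut (τ, y)) := by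
      have := ((hux.div hv hpos).const_mul p.μ).sub ((hθ.div hv hpos).const_mul p.R)
      refine IsPrim.congr_right this ?_
      rw [s.hS.restrict_closure]
      filter_upwards [heq] with y hy using hy.symm
    have hlin : IsPrim (closure s.S) (fun y => x₀ + 2 - y) (fun _ => -1) := fun a _ b _ => ⟨by simp, by simp⟩
    have e1 := hσ.sub_eq hxJ hx1
    have e2 := (hlin.mul hσ).sub_eq hx1 hx2
    have ii := hσ.intervalIntegrable hx1 hx2
    have is : IntervalIntegrable (fun y => s.stress (τ, y)) volume (x₀ + 1) (x₀ + 2) :=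
      (hσ.continuousOn hx1 hx2).intervalIntegrable
    rw [interval_add (is.const_mul (-1)) (ii.continuousOn_mul (by fun_prop)), interval_const_mul] at e2
    have e3 : ∫ y in s.S, chi x₀ x y * s.ut (τ, y) = (∫ y in x..(x₀ + 1), s.ut (τ, y)) +
        ∫ y in (x₀ + 1)..(x₀ + 2), (x₀ + 2 - y) * s.ut (τ, y) := by
      have e : (fun y => chi x₀ x y * s.ut (τ, y)) = fun y =>
          (Ioc x (x₀ + 1)).indicator (fun y => s.ut (τ, y)) y +
          (Ioc (x₀ + 1) (x₀ + 2)).indicator (fun y => (x₀ + 2 - y) * s.ut (τ, y)) y := by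
        ext y
        unfold chi
        by_cases h1 : y ∈ Ioc x (x₀ + 1) <;> by_cases h2 : y ∈ Ioc (x₀ + 1) (x₀ + 2) <;> (simp [h1, h2]; try ring)
      have a1 : IntegrableOn (fun y => s.ut (τ, y)) (Ioc x (x₀ + 1)) :=
        (intervalIntegrable_iff_Ioc hx.2).1 (hσ.intervalIntegrable hxJ hx1)
      have a2 : IntegrableOn (fun y => (x₀ + 2 - y) * s.ut (τ, y)) (Ioc (x₀ + 1) (x₀ + 2)) :=
        (intervalIntegrable_iff_Ioc (by linarith)).1 (ii.continuousOn_mul (by fun_prop))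
      rw [e, integral_add]
      · rw [setIntegral_indicator measurableSet_Ioc, setIntegral_indicator measurableSet_Ioc,
          integral_of_le hx.2, integral_of_le (by linarith),
          inter_eq_self_of_subset_right (Ioc_subset_Ioi_self.trans (s.hS.Ioi_subset hxJ)),
          inter_eq_self_of_subset_right (Ioc_subset_Ioi_self.trans (s.hS.Ioi_subset hx1))]
      · exact ((integrable_indicator_iff measurableSet_Ioc).2 a1).restrict
      · exact ((integrable_indicator_iff measurableSet_Ioc).2 a2).restrict
    rw [e3, ← e1, sig, if_pos hτ.1]
    linarith
  have hin : IntervalIntegrable (fun τ => s.stress (τ, x)) volume 0 t := by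
    rw [intervalIntegrable_iff_Ioc ht]
    refine ((s.integrableOn_sig hx₀ t).sub hi.integral_prod_left).congr ?_
    filter_upwards [hslice] with τ hτ
    simp only [Pi.sub_apply]
    rw [hτ]; ring
  refine ⟨hin, ?_⟩
  rw [key, A, add_sub_assoc, ← interval_sub (s.intervalIntegrable_sig hx₀ _ _) hin,
    integral_of_le ht, integral_of_le ht]
  congr 1
  exact integral_congr_ae hslice

theorem abs_chi_u_le {x₀ x : ℝ} (hx : x ∈ Icc x₀ (x₀ + 1)) {t : ℝ} (ht : 0 ≤ t) :
    |∫ y in s.S, chi x₀ x y * s.u (t, y)| ≤ 1 + p.E := by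
  have hi := (memLp_chi s.S hx).integrable_mul (s.su t ht)
  have hi' : Integrable (fun y => chi x₀ x y * s.u (t, y)) (vol s.S) := hi
  have hind := memLp_ind s.S x₀ (x₀ + 2)
  have h1 : ∫ y in s.S, |chi x₀ x y * s.u (t, y)| ≤
      ∫ y in s.S, (1 / 2 * (Ioc x₀ (x₀ + 2)).indicator (1 : ℝ → ℝ) y ^ 2 + 1 / 2 * s.u (t, y) ^ 2) := by
    refine integral_mono hi'.abs ((hind.integrable_sq.const_mul _).add
      ((s.integrable_u_sq ht).const_mul _)) fun y => ?_
    simp only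
    rw [abs_mul]
    have := abs_chi_le hx y
    have h0 := abs_nonneg (chi x₀ x y)
    have hs := sq_abs (s.u (t, y))
    nlinarith [sq_nonneg (|chi x₀ x y| - |s.u (t, y)|)]
  rw [integral_add (hind.integrable_sq.const_mul _) ((s.integrable_u_sq ht).const_mul _),
    integral_const_mul, integral_const_mul] at h1
  have h2 : ∫ y in s.S, (Ioc x₀ (x₀ + 2)).indicator (1 : ℝ → ℝ) y ^ 2 ≤ 2 := by
    have e : (fun y => (Ioc x₀ (x₀ + 2)).indicator (1 : ℝ → ℝ) y ^ 2) =
        (Ioc x₀ (x₀ + 2)).indicator (1 : ℝ → ℝ) := by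
      ext y; by_cases h : y ∈ Ioc x₀ (x₀ + 2) <;> simp [h]
    rw [e, integral_indicator_one measurableSet_Ioc]
    have : (vol s.S) (Ioc x₀ (x₀ + 2)) ≤ ENNReal.ofReal 2 := (Measure.restrict_apply_le _ _).trans (by simp)
    exact ENNReal.toReal_le_of_le_ofReal (by norm_num) this
  have h3 := (s.energy ht).1
  have h4 := abs_integral_le_integral_abs (f := fun y => chi x₀ x y * s.u (t, y)) (μ := vol s.S)
  linarith

end Sol

theorem isPrim_integral {J : Set ℝ} {f : ℝ → ℝ} {c : ℝ} (hc : c ∈ J)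
    (hf : ∀ a ∈ J, ∀ b ∈ J, IntervalIntegrable f volume a b) :
    IsPrim J (fun t => ∫ τ in c..t, f τ) f := fun a ha b hb => by
  refine ⟨hf a ha b hb, ?_⟩
  rw [integral_interval_sub_left (hf c hc b hb) (hf c hc a ha)]

theorem exp_neg_mul_le {k z : ℝ} (hz : 0 < z) : exp (-k) * (1 + k + log z) ≤ z := by
  have h1 := Real.add_one_le_exp (k + log z)
  have h2 : exp (-k) * exp (k + log z) = z := by rw [← Real.exp_add, neg_add_cancel_left, Real.exp_log hz]
  calc _ ≤ exp (-k) * exp (k + log z) := by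
        apply mul_le_left _ (Real.exp_pos _).le; linarith
    _ = z := h2

theorem log_le_half {y : ℝ} (hy : 0 < y) : log y ≤ y / 2 := by
  have h1 := Real.log_le_sub_one_of_pos (half_pos hy)
  rw [Real.log_div hy.ne' two_ne_zero] at h1
  have h2 := Real.log_two_lt_d9
  linarith

theorem le_relEntropy {y : ℝ} (hy : 0 < y) : y ≤ 2 * (y - log y - 1) + 2 := by linarith [log_le_half hy]

theorem neg_log_le_relEntropy {y : ℝ} (hy : 0 < y) : -log y ≤ (y - log y - 1) + 1 := by linarith

theorem log_le_relEntropy {y : ℝ} (hy : 0 < y) : log y ≤ (y - log y - 1) + 1 := by linarith [log_le_half hy]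

namespace Sol

variable {p : Params}

/-- The common factor in the representation of the specific volume. -/
def Y (s : Sol p) (x₀ t : ℝ) : ℝ := exp (s.A x₀ t / p.μ)

theorem Y_pos (s : Sol p) (x₀ t : ℝ) : 0 < s.Y x₀ t := Real.exp_pos _

theorem Y_zero (s : Sol p) (x₀ : ℝ) : s.Y x₀ 0 = 1 := by simp [Y, A]

theorem continuous_Y (s : Sol p) {x₀ : ℝ} (hx₀ : x₀ ∈ closure s.S) : Continuous (s.Y x₀) :=
  Real.continuous_exp.comp ((s.continuous_A hx₀).div_const _)

theorem v0_le (s : Sol p) {x : ℝ} (hx : x ∈ closure s.S) : s.v (0, x) ≤ 2 + 2 * p.N ^ 2 := by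
  have h := ((s.xv 0 le_rfl).sub_const 1).sq_le s.hS (s.sv 0 le_rfl) (s.svx 0 le_rfl) one_pos hx
  have h1 := s.data_le
  nlinarith [sq_nonneg (s.v (0, x) - 2)]

theorem continuous_integral_θ_div_Y (s : Sol p) {x₀ : ℝ} (hx₀ : x₀ ∈ closure s.S) (t : ℝ) :
    Continuous fun x => ∫ τ in 0..t, s.θ (τ, x) / s.Y x₀ τ := by
  refine intervalIntegral.continuous_parametric_intervalIntegral_of_continuous'
    (f := fun x τ => s.θ (τ, x) / s.Y x₀ τ) ?_ 0 t
  have h1 := s.c_θ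
  have h2 := s.continuous_Y hx₀
  have : Continuous fun q : ℝ × ℝ => s.θ (q.2, q.1) / s.Y x₀ q.2 :=
    Continuous.div (by fun_prop) (by fun_prop) fun q => (s.Y_pos x₀ q.2).ne'
  exact this

/-- The representation of the specific volume, up to constants. -/
theorem volume_rep (p : Params) : ∃ k₁ > 0, ∃ k₂ > 0, ∀ s : Sol p, ∀ x₀ ∈ closure s.S,
    ∀ x ∈ Icc x₀ (x₀ + 1), ∀ t ≥ 0, k₁ * (s.Y x₀ t * (1 + ∫ τ in 0..t, s.θ (τ, x) / s.Y x₀ τ)) ≤ s.v (t, x) ∧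
      s.v (t, x) ≤ k₂ * (s.Y x₀ t * (1 + ∫ τ in 0..t, s.θ (τ, x) / s.Y x₀ τ)) := by
  have hμ := p.hμ; have hR := p.hR; have hpa := p.ha
  set K := exp (2 * (1 + p.E) / p.μ) with hKdef
  have hK : 0 < K := Real.exp_pos _
  have hV : 0 < 2 + 2 * p.N ^ 2 := by positivity
  obtain ⟨k₁, hk₁, g1, g2⟩ : ∃ k > 0, k ≤ p.a / K ∧ k ≤ p.R / (p.μ * K ^ 2) :=
    ⟨min _ _, lt_min (by positivity) (by positivity), min_le_left _ _, min_le_right _ _⟩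
  obtain ⟨k₂, hk₂, g3, g4⟩ : ∃ k > 0, (2 + 2 * p.N ^ 2) * K ≤ k ∧ p.R * K ^ 2 / p.μ ≤ k :=
    ⟨max _ _, lt_max_of_lt_left (by positivity), le_max_left _ _, le_max_right _ _⟩
  refine ⟨k₁, hk₁, k₂, hk₂, fun s x₀ hx₀ x hx t ht => ?_⟩
  suffices hae : ∀ᵐ x ∂vol (Ioo x₀ (x₀ + 1)), k₁ *
        (s.Y x₀ t * (1 + ∫ τ in 0..t, s.θ (τ, x) / s.Y x₀ τ)) ≤ s.v (t, x) ∧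
      s.v (t, x) ≤ k₂ *
        (s.Y x₀ t * (1 + ∫ τ in 0..t, s.θ (τ, x) / s.Y x₀ τ)) by
    have c1 := s.continuous_integral_θ_div_Y hx₀ t
    have c2 := continuous_slice s.c_v t
    exact ⟨le_on_Icc_of_ae (by fun_prop) c2 (by linarith) (hae.mono fun x h => h.1) x hx,
      le_on_Icc_of_ae c2 (by fun_prop) (by linarith) (hae.mono fun x h => h.2) x hx⟩
  have hsub : Ioo x₀ (x₀ + 1) ⊆ s.S := fun y hy => s.hS.Ioi_subset hx₀ hy.1
  have htv := ae_mono_set hsub s.tv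
  filter_upwards [htv, ae_restrict_mem measurableSet_Ioo] with x hx hxI
  have hxJ : x ∈ closure s.S := s.hS.mem_of_le hx₀ hxI.1.le
  have hpos : ∀ t ∈ Ici (0:ℝ), 0 < s.v (t, x) := fun t ht => s.pos_v ht hxJ
  have hposθ : ∀ t ∈ Ici (0:ℝ), 0 < s.θ (t, x) := fun t ht => s.pos_θ ht hxJ
  have cv : Continuous fun τ => s.v (τ, x) := by fun_prop
  have cθ : Continuous fun τ => s.θ (τ, x) := by fun_prop
  have cq : ContinuousOn (fun τ => s.θ (τ, x) / s.v (τ, x)) (Ici 0) :=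
    cθ.continuousOn.div cv.continuousOn fun τ hτ => (hpos τ hτ).ne'
  have hP : IsPrim (Ici 0) (fun t => ∫ τ in 0..t, s.θ (τ, x) / s.v (τ, x))
      (fun τ => s.θ (τ, x) / s.v (τ, x)) := isPrim_integral self_mem_Ici fun a ha b hb =>
    (cq.mono (ordConnected_Ici.uIcc_subset ha hb)).intervalIntegrable
  set Pt := fun t => ∫ τ in 0..t, s.θ (τ, x) / s.v (τ, x) with hPt
  -- the exponential form
  have hform : ∀ t ≥ 0, s.v (0, x) / K * (s.Y x₀ t * exp (p.R * Pt t / p.μ)) ≤ s.v (t, x) ∧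
      s.v (t, x) ≤ s.v (0, x) * K * (s.Y x₀ t * exp (p.R * Pt t / p.μ)) := by
    intro t ht
    obtain ⟨hi, hQ⟩ := s.localized_momentum hx₀ ⟨hxI.1.le, hxI.2.le⟩ ht
    have hl := (hx.log hpos).sub_eq self_mem_Ici (mem_Ici.2 ht)
    have hq := hP.intervalIntegrable self_mem_Ici (mem_Ici.2 ht)
    have hs : ∫ τ in 0..t, s.stress (τ, x) = p.μ * (log (s.v (t, x)) - log (s.v (0, x))) - p.R * Pt t := by
      rw [hl, hPt, ← interval_const_mul, ← interval_const_mul, ← interval_sub]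
      · rfl
      · exact ((hx.log hpos).intervalIntegrable self_mem_Ici (mem_Ici.2 ht)).const_mul _
      · exact hq.const_mul _
    have q1 := abs_le.1 (s.abs_chi_u_le (x₀ := x₀) (x := x) ⟨hxI.1.le, hxI.2.le⟩ ht)
    have q2 := abs_le.1 (s.abs_chi_u_le (x₀ := x₀) (x := x) ⟨hxI.1.le, hxI.2.le⟩ le_rfl)
    rw [hs] at hQ
    set q := (∫ y in s.S, chi x₀ x y * s.u (t, y)) - ∫ y in s.S, chi x₀ x y * s.u (0, y)
    have hlog : log (s.v (t, x)) = log (s.v (0, x)) + (p.R * Pt t + s.A x₀ t - q) / p.μ := by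
      have : p.μ * log (s.v (t, x)) = p.μ * log (s.v (0, x)) + (p.R * Pt t + s.A x₀ t - q) := by linarith
      field_simp
      linarith
    have hv : s.v (t, x) = s.v (0, x) * (s.Y x₀ t * exp (p.R * Pt t / p.μ)) * exp (-q / p.μ) := by
      rw [← Real.exp_log (hpos t ht), hlog, Real.exp_add, Real.exp_log (hpos 0 self_mem_Ici), Y,
        mul_assoc, ← Real.exp_add, ← Real.exp_add]
      congr 2
      ring
    have hqK : exp (-q / p.μ) ≤ K := by
      rw [hKdef]; apply Real.exp_le_exp.2
      gcongr; linarith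
    have hqK' : K⁻¹ ≤ exp (-q / p.μ) := by
      rw [hKdef, ← Real.exp_neg]; apply Real.exp_le_exp.2
      rw [← neg_div]; gcongr; linarith
    have hb : 0 < s.v (0, x) * (s.Y x₀ t * exp (p.R * Pt t / p.μ)) :=
      mul_pos (hpos 0 self_mem_Ici) (mul_pos (s.Y_pos _ _) (Real.exp_pos _))
    constructor
    · rw [hv]
      calc _ = s.v (0, x) * (s.Y x₀ t * exp (p.R * Pt t / p.μ)) * K⁻¹ := by ring
        _ ≤ _ := mul_le_left hqK' hb.le
    · rw [hv]
      calc _ ≤ s.v (0, x) * (s.Y x₀ t * exp (p.R * Pt t / p.μ)) * K :=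
            mul_le_left hqK hb.le
        _ = _ := by ring
  -- the integral equation for the exponential
  have hW := (hP.const_mul (p.R / p.μ)).comp (K := univ) (φ := exp) (φ' := exp)
    (fun y _ => Real.hasDerivAt_exp y) Real.continuous_exp.continuousOn (fun _ _ => mem_univ _)
  have hWe := hW.sub_eq self_mem_Ici (mem_Ici.2 ht)
  have hP0 : Pt 0 = 0 := by simp [hPt]
  have hv0 := hpos 0 self_mem_Ici
  have cYθ : Continuous fun τ => s.θ (τ, x) / s.Y x₀ τ := cθ.div (s.continuous_Y hx₀) fun τ => (s.Y_pos x₀ τ).ne'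
  have hI0 : 0 ≤ ∫ τ in 0..t, s.θ (τ, x) / s.Y x₀ τ := interval_nonneg ht fun τ hτ =>
      div_nonneg (hposθ τ hτ.1).le (s.Y_pos _ _).le
  set I := ∫ τ in 0..t, s.θ (τ, x) / s.Y x₀ τ
  have hWi := hW.intervalIntegrable self_mem_Ici (mem_Ici.2 ht)
  have hP1 : exp (p.R / p.μ * Pt 0) = 1 := by rw [hP0]; simp
  have hlow : p.R / (p.μ * (s.v (0, x) * K)) * I ≤ exp (p.R / p.μ * Pt t) - 1 := by
    rw [← hP1]
    show _ ≤ exp (p.R / p.μ * ∫ τ in 0..t, s.θ (τ, x) / s.v (τ, x)) -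
      exp (p.R / p.μ * ∫ τ in 0..0, s.θ (τ, x) / s.v (τ, x))
    rw [hWe, ← interval_const_mul]
    refine integral_mono_on ht ((cYθ.intervalIntegrable _ _).const_mul _) hWi fun τ hτ => ?_
    have h1 := (hform τ hτ.1).2
    have h2 := hpos τ hτ.1
    have h3 := hposθ τ hτ.1
    have hY := s.Y_pos x₀ τ
    have e : p.R * Pt τ / p.μ = p.R / p.μ * Pt τ := by ring
    rw [e] at h1
    have h4 : s.v (τ, x) / (s.v (0, x) * K * s.Y x₀ τ) ≤ exp (p.R / p.μ * Pt τ) := by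
      rw [div_le_iff₀ (by positivity)]; linarith
    calc _ = (s.v (τ, x) / (s.v (0, x) * K * s.Y x₀ τ)) *
          (p.R / p.μ * (s.θ (τ, x) / s.v (τ, x))) := by field_simp
      _ ≤ _ := mul_le_right h4 (by positivity)
  have hup : exp (p.R / p.μ * Pt t) - 1 ≤ p.R * K / (p.μ * s.v (0, x)) * I := by
    rw [← hP1]
    show exp (p.R / p.μ * ∫ τ in 0..t, s.θ (τ, x) / s.v (τ, x)) -
      exp (p.R / p.μ * ∫ τ in 0..0, s.θ (τ, x) / s.v (τ, x)) ≤ _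
    rw [hWe, ← interval_const_mul]
    refine integral_mono_on ht hWi ((cYθ.intervalIntegrable _ _).const_mul _) fun τ hτ => ?_
    have h1 := (hform τ hτ.1).1
    have h2 := hpos τ hτ.1
    have h3 := hposθ τ hτ.1
    have hY := s.Y_pos x₀ τ
    have e : p.R * Pt τ / p.μ = p.R / p.μ * Pt τ := by ring
    rw [e] at h1
    have h4 : exp (p.R / p.μ * Pt τ) ≤ s.v (τ, x) * K / (s.v (0, x) * s.Y x₀ τ) := by
      rw [le_div_iff₀ (by positivity)]
      calc _ = s.v (0, x) / K * (s.Y x₀ τ * exp (p.R / p.μ * Pt τ)) * K := by field_simp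
        _ ≤ _ := mul_le_right h1 hK.le
    calc _ ≤ s.v (τ, x) * K / (s.v (0, x) * s.Y x₀ τ) *
          (p.R / p.μ * (s.θ (τ, x) / s.v (τ, x))) := mul_le_right h4 (by positivity)
      _ = _ := by field_simp
  obtain ⟨f1, f2⟩ := hform t ht
  have e : p.R * Pt t / p.μ = p.R / p.μ * Pt t := by ring
  rw [e] at f1 f2
  have hY := s.Y_pos x₀ t
  constructor
  · refine le_trans ?_ f1
    replace g1 : k₁ ≤ s.v (0, x) / K := g1.trans (by have := s.v0_ge x hxJ; gcongr)
    calc _ = s.Y x₀ t * (k₁ + k₁ * I) := by ring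
      _ ≤ s.Y x₀ t * (s.v (0, x) / K + p.R / (p.μ * K ^ 2) * I) := by gcongr
      _ = s.v (0, x) / K * (s.Y x₀ t * (1 + p.R / (p.μ * (s.v (0, x) * K)) * I)) := by field_simp
      _ ≤ _ := by gcongr; linarith
  · refine f2.trans ?_
    replace g3 : s.v (0, x) * K ≤ k₂ := le_trans (by have := s.v0_le hxJ; gcongr) g3
    calc _ ≤ s.v (0, x) * K * (s.Y x₀ t * (1 + p.R * K / (p.μ * s.v (0, x)) * I)) := by
          gcongr; linarith
      _ = s.Y x₀ t * (s.v (0, x) * K + p.R * K ^ 2 / p.μ * I) := by field_simp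
      _ ≤ s.Y x₀ t * (k₂ + k₂ * I) := by gcongr
      _ = _ := by ring

theorem local_relEntropy (s : Sol p) {x₀ t : ℝ} (hx₀ : x₀ ∈ closure s.S) (ht : 0 ≤ t) :
    (∫ x in x₀..(x₀ + 1), (s.v (t, x) - log (s.v (t, x)) - 1)) ≤ p.E / p.R ∧
    (∫ x in x₀..(x₀ + 1), (s.θ (t, x) - log (s.θ (t, x)) - 1)) ≤ p.E / p.cv := by
  obtain ⟨-, h1, h2, -⟩ := s.energy ht
  constructor
  · refine (interval_le_S s.hS hx₀ (by linarith) (s.integrable_relEntropy_v ht)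
      fun x hx => relEntropy_nonneg (s.pos_v ht hx)).trans ?_
    rw [le_div_iff₀ p.hR]; linarith
  · refine (interval_le_S s.hS hx₀ (by linarith) (s.integrable_relEntropy_θ ht)
      fun x hx => relEntropy_nonneg (s.pos_θ ht hx)).trans ?_
    rw [le_div_iff₀ p.hcv]; linarith

theorem intervalIntegrable_relEntropy (s : Sol p) {x₀ t : ℝ} (hx₀ : x₀ ∈ closure s.S) (ht : 0 ≤ t) :
    IntervalIntegrable (fun x => s.v (t, x) - log (s.v (t, x)) - 1) volume x₀ (x₀ + 1) ∧
    IntervalIntegrable (fun x => s.θ (t, x) - log (s.θ (t, x)) - 1) volume x₀ (x₀ + 1) :=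
  ⟨intervalIntegrable_of_S s.hS hx₀ (by linarith) (s.integrable_relEntropy_v ht),
    intervalIntegrable_of_S s.hS hx₀ (by linarith) (s.integrable_relEntropy_θ ht)⟩

/-- Exponential decay of the common factor. -/
theorem A_sub_le (p : Params) : ∃ c > 0, ∀ s : Sol p, ∀ x₀ ∈ closure s.S, ∀ r ≥ 0, ∀ t ≥ r,
    s.A x₀ t - s.A x₀ r ≤ p.μ / (2 * p.R) * p.E - c * (t - r) := by
  have hμ := p.hμ; have hR := p.hR; have hcv := p.hcv
  set k := 2 + p.E / p.cv + p.E / p.R with hk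
  refine ⟨p.R / 2 * exp (-k), by positivity, fun s x₀ hx₀ r hr t hrt => ?_⟩
  have hJ := s.hS.ordConnected_closure
  have hx1 : x₀ + 1 ∈ closure s.S := s.hS.mem_of_le hx₀ (by linarith)
  have hx2 : x₀ + 2 ∈ closure s.S := s.hS.mem_of_le hx₀ (by linarith)
  have hsig : ∀ᵐ τ ∂vol (Ioc 0 t), s.sig x₀ τ ≤ p.μ / (2 * p.R) * s.d τ - p.R / 2 * exp (-k) := by
    filter_upwards [ae_Ioc s.xux t, ae_mem_Ioc, (s.integrable_diss t).prod_right_ae] with τ hux hτ hdi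
    rw [sig, if_pos hτ.1]
    have cv := (continuous_slice s.c_v τ).continuousOn (s := uIcc (x₀ + 1) (x₀ + 2))
    have cθ := (continuous_slice s.c_θ τ).continuousOn (s := uIcc (x₀ + 1) (x₀ + 2))
    have hne : ∀ x ∈ uIcc (x₀ + 1) (x₀ + 2), s.v (τ, x) ≠ 0 := fun x hx =>
      (s.pos_v hτ.1.le (hJ.uIcc_subset hx1 hx2 hx)).ne'
    have istress : IntervalIntegrable (fun y => s.stress (τ, y)) volume (x₀ + 1) (x₀ + 2) :=
      ContinuousOn.intervalIntegrable
        ((((hux.continuousOn hx1 hx2).div cv hne).const_mul p.μ).sub ((cθ.div cv hne).const_mul p.R))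
    have e12 : x₀ + 1 + 1 = x₀ + 2 := by ring
    have hr := s.local_relEntropy hx1 hτ.1.le
    have hri := s.intervalIntegrable_relEntropy hx1 hτ.1.le
    rw [e12] at hr hri
    have hd : ∫ y in (x₀ + 1)..(x₀ + 2), s.diss (τ, y) ≤ s.d τ :=
      interval_le_S s.hS hx1 (by linarith) hdi fun x hx => s.diss_nonneg hτ.1.le hx
    have hdi' := intervalIntegrable_of_S s.hS hx1 (show x₀ + 1 ≤ x₀ + 2 by linarith) hdi
    have hmono : ∫ y in (x₀ + 1)..(x₀ + 2), s.stress (τ, y) ≤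
        ∫ y in (x₀ + 1)..(x₀ + 2), (p.μ / (2 * p.R) * s.diss (τ, y) -
          p.R / 2 * exp (-k) * (k - 1 - (s.θ (τ, y) - log (s.θ (τ, y)) - 1)
            - (s.v (τ, y) - log (s.v (τ, y)) - 1))) := by
      refine integral_mono_on (by linarith) istress
        ((hdi'.const_mul _).sub (((iiConst.sub hri.2).sub hri.1).const_mul _))
        fun y hy => ?_
      have hyJ : y ∈ closure s.S := s.hS.mem_of_le hx1 hy.1
      have hv := s.pos_v hτ.1.le hyJ
      have hθ := s.pos_θ hτ.1.le hyJ
      have h1 := exp_neg_mul_le (k := k) (div_pos hθ hv)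
      rw [Real.log_div hθ.ne' hv.ne'] at h1
      have h2 := neg_log_le_relEntropy hθ
      have h3 := log_le_relEntropy hv
      have h4 : exp (-k) * (k - 1 - (s.θ (τ, y) - log (s.θ (τ, y)) - 1)
            - (s.v (τ, y) - log (s.v (τ, y)) - 1)) ≤ s.θ (τ, y) / s.v (τ, y) := by
        refine le_trans (mul_le_left ?_ (Real.exp_pos _).le) h1
        linarith
      have h5 : p.μ * (s.ux (τ, y) / s.v (τ, y)) ≤ p.R / 2 * (s.θ (τ, y) / s.v (τ, y)) +
          p.μ / (2 * p.R) * s.diss (τ, y) := by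
        have e : p.R / 2 * (s.θ (τ, y) / s.v (τ, y)) + p.μ / (2 * p.R) * s.diss (τ, y) -
            p.μ * (s.ux (τ, y) / s.v (τ, y)) =
            (p.R * s.θ (τ, y) - p.μ * s.ux (τ, y)) ^ 2 / (2 * p.R * s.v (τ, y) * s.θ (τ, y)) +
            p.μ / (2 * p.R) * (p.κ * (s.θx (τ, y) ^ 2 / (s.v (τ, y) * s.θ (τ, y) ^ 2))) := by
          simp only [diss]; field_simp; ring
        have hκ := p.hκ
        have : 0 ≤ (p.R * s.θ (τ, y) - p.μ * s.ux (τ, y)) ^ 2 / (2 * p.R * s.v (τ, y) * s.θ (τ, y)) +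
            p.μ / (2 * p.R) * (p.κ * (s.θx (τ, y) ^ 2 / (s.v (τ, y) * s.θ (τ, y) ^ 2))) := by
          positivity
        linarith
      have h6 := mul_le_left h4 (half_pos hR).le
      simp only [stress]
      linarith
    refine hmono.trans ?_
    rw [interval_sub (hdi'.const_mul _) (((iiConst.sub hri.2).sub hri.1).const_mul _),
      interval_const_mul, interval_const_mul,
      interval_sub (iiConst.sub hri.2) hri.1,
      interval_sub iiConst hri.2,
      interval_const]
    have hlen : x₀ + 2 - (x₀ + 1) = 1 := by ring
    rw [hlen, one_smul]
    have h7 : 1 ≤ k - 1 - (∫ x in (x₀ + 1)..(x₀ + 2), (s.θ (τ, x) - log (s.θ (τ, x)) - 1)) -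
        ∫ x in (x₀ + 1)..(x₀ + 2), (s.v (τ, x) - log (s.v (τ, x)) - 1) := by
      rw [hk]; linarith [hr.1, hr.2]
    have h8 := mul_le_left h7 (show 0 ≤ p.R / 2 * exp (-k) by positivity)
    have h9 := mul_le_left hd (show 0 ≤ p.μ / (2 * p.R) by positivity)
    linarith
  have hAe : s.A x₀ t - s.A x₀ r = ∫ τ in r..t, s.sig x₀ τ := by
    rw [A, A, integral_interval_sub_left (s.intervalIntegrable_sig hx₀ _ _) (s.intervalIntegrable_sig hx₀ _ _)]
  have hdint : IntervalIntegrable s.d volume r t :=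
    (s.intervalIntegrable_d hr).symm.trans (s.intervalIntegrable_d (hr.trans hrt))
  rw [hAe]
  have : ∫ τ in r..t, s.sig x₀ τ ≤ ∫ τ in r..t, (p.μ / (2 * p.R) * s.d τ - p.R / 2 * exp (-k)) := by
    refine integral_mono_ae_restrict hrt (s.intervalIntegrable_sig hx₀ _ _) ((hdint.const_mul _).sub iiConst) ?_
    rw [← restrict_Ioc_eq_restrict_Icc]
    exact ae_mono_set (Ioc_subset_Ioc_left hr) hsig
  refine this.trans ?_
  rw [interval_sub (hdint.const_mul _) iiConst, interval_const_mul, interval_const, smul_eq_mul]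
  have h := mul_le_left (s.integral_d_le' hr hrt) (show 0 ≤ p.μ / (2 * p.R) by positivity)
  linarith

end Sol

/-! ### Bounds for the specific volume -/

/-- Grönwall's inequality with an integrable kernel. -/
theorem gronwall_integral {m d : ℝ → ℝ} {C T : ℝ} (hm : Continuous m)
    (hd : ∀ t ∈ Icc 0 T, IntervalIntegrable d volume 0 t) (hd0 : ∀ t ∈ Icc 0 T, 0 ≤ d t)
    (hC : 0 ≤ C) (h : ∀ t ∈ Icc 0 T, m t ≤ C + C * ∫ τ in 0..t, m τ * d τ) (hT : 0 ≤ T) :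
    m T ≤ C * exp (C * ∫ τ in 0..T, d τ) := by
  have h0 : (0:ℝ) ∈ Icc 0 T := ⟨le_rfl, hT⟩
  have hTm : T ∈ Icc 0 T := ⟨hT, le_rfl⟩
  have hdi : ∀ a ∈ Icc 0 T, ∀ b ∈ Icc 0 T, IntervalIntegrable d volume a b := fun a ha b hb =>
    (hd a ha).symm.trans (hd b hb)
  have hD := isPrim_integral h0 hdi
  have hM := isPrim_integral (f := fun τ => m τ * d τ) h0 fun a ha b hb =>
    (hdi a ha b hb).continuousOn_mul hm.continuousOn
  have hZ := (hM.const_mul C).add_const C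
  have hE := (hD.const_mul (-C)).comp (K := univ) (φ := exp) (φ' := exp)
    (fun y _ => Real.hasDerivAt_exp y) Real.continuous_exp.continuousOn (fun _ _ => mem_univ _)
  have hp := (hZ.mul hE).sub_eq h0 hTm
  have hneg : ∫ t in 0..T, (C * (m t * d t) * exp (-C * ∫ τ in 0..t, d τ) +
      (C * (∫ τ in 0..t, m τ * d τ) + C) * (exp (-C * ∫ τ in 0..t, d τ) * (-C * d t))) ≤ 0 := by
    have : ∫ t in 0..T, (C * (m t * d t) * exp (-C * ∫ τ in 0..t, d τ) +
      (C * (∫ τ in 0..t, m τ * d τ) + C) * (exp (-C * ∫ τ in 0..t, d τ) * (-C * d t))) ≤ ∫ t in 0..T, (0:ℝ) := by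
      refine integral_mono_on hT ((hZ.mul hE).intervalIntegrable h0 hTm) (by simp) fun t ht => ?_
      have h1 := h t ht
      have h2 := mul_nonneg (mul_nonneg hC (hd0 t ht)) (Real.exp_pos (-C * ∫ τ in 0..t, d τ)).le
      have h3 := mul_nonneg h2 (sub_nonneg.2 h1)
      nlinarith
    simpa using this
  rw [← hp] at hneg
  simp only [intervalIntegral.integral_same, mul_zero, Real.exp_zero, zero_add, mul_one] at hneg
  have h1 := h T hTm
  have hpos := Real.exp_pos (-C * ∫ τ in 0..T, d τ)
  have h2 : m T * exp (-C * ∫ τ in 0..T, d τ) ≤ C := by nlinarith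
  have h3 := mul_le_right h2 (Real.exp_pos (C * ∫ τ in 0..T, d τ)).le
  rw [mul_assoc, ← Real.exp_add] at h3
  simpa using h3

theorem integral_exp_neg_le {c t : ℝ} (hc : 0 < c) : ∫ τ in 0..t, exp (-c * (t - τ)) ≤ 1 / c := by
  have hderiv : ∀ τ ∈ uIcc 0 t, HasDerivAt (fun τ => exp (-c * (t - τ)) / c) (exp (-c * (t - τ))) τ := by
    intro τ _
    have h1 : HasDerivAt (fun τ => -c * (t - τ)) (-c * (-1)) τ := ((hasDerivAt_id τ).const_sub t).const_mul (-c)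
    have := h1.exp.div_const c
    have e : exp (-c * (t - τ)) * (-c * -1) / c = exp (-c * (t - τ)) := by field_simp
    rwa [e] at this
  rw [intervalIntegral.integral_eq_sub_of_hasDerivAt hderiv (Continuous.intervalIntegrable (by fun_prop) _ _)]
  simp only [sub_self, mul_zero, Real.exp_zero]
  have : 0 ≤ exp (-c * (t - 0)) / c := by positivity
  linarith

theorem IsPrim.abs_sub_le {J : Set ℝ} {f f' : ℝ → ℝ} (h : IsPrim J f f') {x₀ x₁ a b : ℝ}
    (h0 : x₀ ∈ J) (h1 : x₁ ∈ J) (ha : a ∈ Icc x₀ x₁) (hb : b ∈ Icc x₀ x₁) [hJ : J.OrdConnected] :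
    |f b - f a| ≤ ∫ y in x₀..x₁, |f' y| := by
  have hle : x₀ ≤ x₁ := ha.1.trans ha.2
  rw [h.sub_eq (hJ.out h0 h1 ha) (hJ.out h0 h1 hb), integral_of_le hle]
  refine (intervalIntegral.norm_integral_le_integral_norm_uIoc (f := f') (a := a) (b := b) (μ := volume)).trans ?_
  have hi := (intervalIntegrable_iff_Ioc hle).1 (h.intervalIntegrable h0 h1)
  refine setIntegral_mono_set hi.norm (.of_forall fun y => norm_nonneg _) (LE.le.eventuallyLE ?_)
  intro y hy
  exact ⟨(le_min ha.1 hb.1).trans_lt hy.1, hy.2.trans (max_le ha.2 hb.2)⟩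

namespace Sol

variable {p : Params}

theorem ae_Ioi_of_Ioc {P : ℝ → Prop} (h : ∀ T : ℝ, ∀ᵐ t ∂vol (Ioc 0 T), P t) : ∀ᵐ t ∂vol₊, P t := by
  have : ∀ n : ℕ, ∀ᵐ τ ∂volume, τ ∈ Ioc (0:ℝ) n → P τ := fun n => (ae_restrict_iff' measurableSet_Ioc).1 (h n)
  rw [ae_restrict_iff' measurableSet_Ioi]
  filter_upwards [ae_all_iff.2 this] with τ hτ hτ0
  obtain ⟨n, hn⟩ := exists_nat_ge τ
  exact hτ n ⟨hτ0, hn⟩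

theorem ae_integrable_diss (s : Sol p) : ∀ᵐ τ ∂vol₊, Integrable (fun x => s.diss (τ, x)) (vol s.S) :=
  ae_Ioi_of_Ioc fun T => (s.integrable_diss T).prod_right_ae

theorem Y_ratio (p : Params) : ∃ C ≥ 1, ∃ c > 0, ∀ s : Sol p, ∀ x₀ ∈ closure s.S, ∀ r ≥ 0,
    ∀ t ≥ r, s.Y x₀ t ≤ C * exp (-c * (t - r)) * s.Y x₀ r := by
  obtain ⟨c, hc, h⟩ := A_sub_le p
  have hμ := p.hμ; have hR := p.hR
  have hE := p.E_nonneg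
  refine ⟨exp (p.E / (2 * p.R)), Real.one_le_exp (by positivity), c / p.μ, by positivity,
    fun s x₀ hx₀ r hr t hrt => ?_⟩
  rw [Y, Y, ← Real.exp_add, ← Real.exp_add]
  apply Real.exp_le_exp.2
  have h1 := h s x₀ hx₀ r hr t hrt
  rw [div_le_iff₀ hμ]
  have : (p.E / (2 * p.R) + -(c / p.μ) * (t - r) + s.A x₀ r / p.μ) * p.μ =
      p.μ / (2 * p.R) * p.E - c * (t - r) + s.A x₀ r := by field_simp; ring
  rw [this]; linarith

theorem local_mass (p : Params) : ∃ k > 0, ∃ K ≥ 1, ∀ s : Sol p, ∀ x₀ ∈ closure s.S, ∀ t ≥ 0,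
    k ≤ (∫ x in x₀..(x₀ + 1), s.v (t, x)) ∧ (∫ x in x₀..(x₀ + 1), s.v (t, x)) ≤ K ∧
    (∫ x in x₀..(x₀ + 1), s.θ (t, x)) ≤ K := by
  have hμ := p.hμ; have hR := p.hR; have hcv := p.hcv
  have hE := p.E_nonneg
  refine ⟨exp (-(1 + p.E / p.R)), Real.exp_pos _, 2 * (p.E / p.R) + 2 * (p.E / p.cv) + 2,
    by have : 0 ≤ p.E / p.R := by positivity
       have : 0 ≤ p.E / p.cv := by positivity
       linarith, fun s x₀ hx₀ t ht => ?_⟩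
  have a1 : 0 ≤ p.E / p.R := by positivity
  have a2 : 0 ≤ p.E / p.cv := by positivity
  obtain ⟨r1, r2⟩ := s.local_relEntropy hx₀ ht
  obtain ⟨i1, i2⟩ := s.intervalIntegrable_relEntropy hx₀ ht
  have iv : IntervalIntegrable (fun x => s.v (t, x)) volume x₀ (x₀ + 1) :=
    (continuous_slice s.c_v t).intervalIntegrable _ _
  have iθ : IntervalIntegrable (fun x => s.θ (t, x)) volume x₀ (x₀ + 1) :=
    (continuous_slice s.c_θ t).intervalIntegrable _ _
  refine ⟨?_, ?_, ?_⟩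
  · have : ∫ x in x₀..(x₀ + 1), exp (-(1 + p.E / p.R)) * (1 + p.E / p.R -
        (s.v (t, x) - log (s.v (t, x)) - 1)) ≤ ∫ x in x₀..(x₀ + 1), s.v (t, x) := by
      refine integral_mono_on (by linarith) ((iiConst.sub i1).const_mul _) iv fun x hx => ?_
      have hv := s.pos_v ht (s.hS.mem_of_le hx₀ hx.1)
      refine le_trans (mul_le_left ?_ (Real.exp_pos _).le) (exp_neg_mul_le (k := 1 + p.E / p.R) hv)
      linarith [neg_log_le_relEntropy hv]
    rw [interval_const_mul, interval_sub iiConst i1, interval_const, add_sub_cancel_left, one_smul] at this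
    refine le_trans ?_ this
    have h1 : 1 ≤ 1 + p.E / p.R - ∫ x in x₀..(x₀ + 1), (s.v (t, x) - log (s.v (t, x)) - 1) := by linarith
    have := mul_le_left h1 (Real.exp_pos (-(1 + p.E / p.R))).le
    linarith
  · have : ∫ x in x₀..(x₀ + 1), s.v (t, x) ≤ ∫ x in x₀..(x₀ + 1),
        (2 * (s.v (t, x) - log (s.v (t, x)) - 1) + 2) := by
      refine integral_mono_on (by linarith) iv
        ((i1.const_mul _).add iiConst) fun x hx =>
        le_relEntropy (s.pos_v ht (s.hS.mem_of_le hx₀ hx.1))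
    rw [interval_add (i1.const_mul _) iiConst, interval_const_mul, interval_const, add_sub_cancel_left,
      one_smul] at this
    linarith
  · have : ∫ x in x₀..(x₀ + 1), s.θ (t, x) ≤ ∫ x in x₀..(x₀ + 1),
        (2 * (s.θ (t, x) - log (s.θ (t, x)) - 1) + 2) := by
      refine integral_mono_on (by linarith) iθ
        ((i2.const_mul _).add iiConst) fun x hx =>
        le_relEntropy (s.pos_θ ht (s.hS.mem_of_le hx₀ hx.1))
    rw [interval_add (i2.const_mul _) iiConst, interval_const_mul, interval_const, add_sub_cancel_left,
      one_smul] at this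
    linarith

theorem exists_point (s : Sol p) {x₀ t : ℝ} (hx₀ : x₀ ∈ closure s.S) (ht : 0 ≤ t) :
    ∃ b ∈ Icc x₀ (x₀ + 1), s.θ (t, b) - log (s.θ (t, b)) - 1 ≤ p.E / p.cv := by
  have hpos : ∀ x ∈ Icc x₀ (x₀ + 1), s.θ (t, x) ≠ 0 := fun x hx => (s.pos_θ ht (s.hS.mem_of_le hx₀ hx.1)).ne'
  have hc : ContinuousOn (fun x => s.θ (t, x) - log (s.θ (t, x)) - 1) (Icc x₀ (x₀ + 1)) := by
    have := (continuous_slice s.c_θ t).continuousOn (s := Icc x₀ (x₀ + 1))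
    exact (this.sub (this.log hpos)).sub continuousOn_const
  obtain ⟨b, hb, hmin⟩ := isCompact_Icc.exists_isMinOn (nonempty_Icc.2 (by linarith)) hc
  refine ⟨b, hb, le_trans ?_ (s.local_relEntropy hx₀ ht).2⟩
  have := integral_mono_on (show x₀ ≤ x₀ + 1 by linarith)
    (iiConst (c := s.θ (t, b) - log (s.θ (t, b)) - 1))
    (s.intervalIntegrable_relEntropy hx₀ ht).2 fun x hx => hmin hx
  rwa [interval_const, add_sub_cancel_left, one_smul] at this

theorem θ_local_upper (p : Params) : ∃ C > 0, ∀ s : Sol p, ∀ x₀ ∈ closure s.S,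
    ∀ᵐ τ ∂vol₊, ∀ m > 0, (∀ y ∈ Icc x₀ (x₀ + 1), s.v (τ, y) ≤ m) →
      ∀ x ∈ Icc x₀ (x₀ + 1), s.θ (τ, x) ≤ C + C * (m * s.d τ) := by
  obtain ⟨k, -, K, hK, hmass⟩ := local_mass p
  have hE := p.E_nonneg; have hκ := p.hκ; have hcv := p.hcv
  have hK0 : 0 < K := by linarith
  refine ⟨4 * (p.E / p.cv) + 4 + K / p.κ, by positivity, fun s x₀ hx₀ => ?_⟩
  have hJ := s.hS.ordConnected_closure
  have hdi := s.ae_integrable_diss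
  filter_upwards [s.xθ, hdi, ae_mem_Ioi] with τ hθ hdiτ hτ m hm hvm x hx
  have hτ0 : (0:ℝ) ≤ τ := le_of_lt hτ
  have hx1 : x₀ + 1 ∈ closure s.S := s.hS.mem_of_le hx₀ (by linarith)
  obtain ⟨xm, hxm, hmax⟩ := isCompact_Icc.exists_isMaxOn
    (nonempty_Icc.2 (show x₀ ≤ x₀ + 1 by linarith))
    (continuous_slice s.c_θ τ).continuousOn
  obtain ⟨b, hb, hbE⟩ := s.exists_point hx₀ hτ0
  set X := s.θ (τ, xm)
  have hposθ : ∀ y ∈ Icc x₀ (x₀ + 1), 0 < s.θ (τ, y) := fun y hy => s.pos_θ hτ0 (s.hS.mem_of_le hx₀ hy.1)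
  have hposv : ∀ y ∈ Icc x₀ (x₀ + 1), 0 < s.v (τ, y) := fun y hy => s.pos_v hτ0 (s.hS.mem_of_le hx₀ hy.1)
  have hX : 0 < X := hposθ xm hxm
  have hθb : s.θ (τ, b) ≤ 2 * (p.E / p.cv) + 2 := by linarith [le_relEntropy (hposθ b hb)]
  have h1 := hθ.abs_sub_le hx₀ hx1 hb hxm
  have hdi' := intervalIntegrable_of_S s.hS hx₀ (show x₀ ≤ x₀ + 1 by linarith) hdiτ
  have hd : ∫ y in x₀..(x₀ + 1), s.diss (τ, y) ≤ s.d τ :=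
    interval_le_S s.hS hx₀ (by linarith) hdiτ fun x hx => s.diss_nonneg hτ0 hx
  have iθ : IntervalIntegrable (fun x => s.θ (τ, x)) volume x₀ (x₀ + 1) :=
    (continuous_slice s.c_θ τ).intervalIntegrable _ _
  have h2 : ∫ y in x₀..(x₀ + 1), |s.θx (τ, y)| ≤ ∫ y in x₀..(x₀ + 1),
      (m * K / (2 * p.κ) * s.diss (τ, y) + X / (2 * K) * s.θ (τ, y)) := by
    refine integral_mono_on (by linarith)
      (hθ.intervalIntegrable hx₀ hx1).abs ((hdi'.const_mul _).add (iθ.const_mul _)) fun y hy => ?_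
    have hv := hposv y hy
    have ht := hposθ y hy
    have hμ := p.hμ
    have e1 : p.κ * (s.θx (τ, y) ^ 2 / (s.v (τ, y) * s.θ (τ, y) ^ 2)) ≤ s.diss (τ, y) := by
      have : 0 ≤ p.μ * (s.ux (τ, y) ^ 2 / (s.v (τ, y) * s.θ (τ, y))) := by positivity
      simp only [diss]; linarith
    have e2 : |s.θx (τ, y)| ≤ m * K / 2 * (s.θx (τ, y) ^ 2 / (s.v (τ, y) * s.θ (τ, y) ^ 2)) +
        s.v (τ, y) * s.θ (τ, y) ^ 2 / (2 * (m * K)) := by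
      have e : m * K / 2 * (s.θx (τ, y) ^ 2 / (s.v (τ, y) * s.θ (τ, y) ^ 2)) +
        s.v (τ, y) * s.θ (τ, y) ^ 2 / (2 * (m * K)) - |s.θx (τ, y)| =
        (m * K * |s.θx (τ, y)| - s.v (τ, y) * s.θ (τ, y) ^ 2) ^ 2 /
          (2 * (m * K) * (s.v (τ, y) * s.θ (τ, y) ^ 2)) := by
        rw [← sq_abs (s.θx (τ, y))]; field_simp; ring
      have : 0 ≤ (m * K * |s.θx (τ, y)| - s.v (τ, y) * s.θ (τ, y) ^ 2) ^ 2 /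
          (2 * (m * K) * (s.v (τ, y) * s.θ (τ, y) ^ 2)) := by positivity
      linarith
    have e3 : m * K / 2 * (s.θx (τ, y) ^ 2 / (s.v (τ, y) * s.θ (τ, y) ^ 2)) ≤
        m * K / (2 * p.κ) * s.diss (τ, y) := by
      have := mul_le_left e1 (show 0 ≤ m * K / (2 * p.κ) by positivity)
      refine le_trans (le_of_eq ?_) this
      field_simp
    have e4 : s.v (τ, y) * s.θ (τ, y) ^ 2 / (2 * (m * K)) ≤ X / (2 * K) * s.θ (τ, y) := by
      have : s.v (τ, y) * s.θ (τ, y) ^ 2 ≤ m * (X * s.θ (τ, y)) := by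
        have a1 := hvm y hy
        have a2 : s.θ (τ, y) ≤ X := hmax hy
        have a3 : s.θ (τ, y) ^ 2 ≤ X * s.θ (τ, y) := by nlinarith
        exact mul_le_mul a1 a3 (by positivity) hm.le
      rw [div_le_iff₀ (by positivity)]
      refine this.trans (le_of_eq ?_)
      field_simp
    linarith
  rw [interval_add (hdi'.const_mul _) (iθ.const_mul _), interval_const_mul, interval_const_mul] at h2
  have h3 : m * K / (2 * p.κ) * (∫ y in x₀..(x₀ + 1), s.diss (τ, y)) ≤
      m * K / (2 * p.κ) * s.d τ := mul_le_left hd (by positivity)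
  have h4 : X / (2 * K) * (∫ y in x₀..(x₀ + 1), s.θ (τ, y)) ≤ X / 2 := by
    have := mul_le_left (hmass s x₀ hx₀ τ hτ0).2.2 (show 0 ≤ X / (2 * K) by positivity)
    refine this.trans (le_of_eq ?_)
    field_simp
  have h5 : X - s.θ (τ, b) ≤ m * K / (2 * p.κ) * s.d τ + X / 2 := (le_abs_self _).trans (h1.trans (by linarith))
  have h6 : s.θ (τ, x) ≤ X := hmax hx
  have h7 : 0 ≤ m * s.d τ := mul_nonneg hm.le (s.d_nonneg hτ0)
  have h8 : m * K / (2 * p.κ) * s.d τ = K / p.κ * (m * s.d τ) / 2 := by field_simp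
  rw [h8] at h5
  have h9 : 0 ≤ p.E / p.cv := by positivity
  have h10 : 0 ≤ K / p.κ := by positivity
  nlinarith [mul_nonneg h9 h7]

theorem θ_local_lower (p : Params) : ∃ c > 0, ∀ s : Sol p, ∀ x₀ ∈ closure s.S,
    ∀ᵐ τ ∂vol₊, ∀ x ∈ Icc x₀ (x₀ + 1), c * (1 - s.d τ) ≤ s.θ (τ, x) := by
  obtain ⟨k, -, K, hK, hmass⟩ := local_mass p
  have hE := p.E_nonneg; have hκ := p.hκ; have hcv := p.hcv
  refine ⟨exp (-(p.E / p.cv + 1) - 1 / 2 * (1 / p.κ + K)), Real.exp_pos _, fun s x₀ hx₀ => ?_⟩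
  have hJ := s.hS.ordConnected_closure
  have hdi := s.ae_integrable_diss
  filter_upwards [s.xθ, hdi, ae_mem_Ioi] with τ hθ hdiτ hτ x hx
  have hτ0 : (0:ℝ) ≤ τ := le_of_lt hτ
  have hx1 : x₀ + 1 ∈ closure s.S := s.hS.mem_of_le hx₀ (by linarith)
  have hposθ : ∀ y ∈ closure s.S, 0 < s.θ (τ, y) := fun y hy => s.pos_θ hτ0 hy
  have hd0 := s.d_nonneg hτ0
  have hxJ := s.hS.mem_of_le hx₀ hx.1
  rcases le_or_gt 1 (s.d τ) with h1d | h1d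
  · exact (mul_nonpos_of_nonneg_of_nonpos (Real.exp_pos _).le (by linarith)).trans (hposθ x hxJ).le
  obtain ⟨b, hb, hbE⟩ := s.exists_point hx₀ hτ0
  have hbJ := s.hS.mem_of_le hx₀ hb.1
  have hl := hθ.log hposθ
  have h1 := hl.abs_sub_le hx₀ hx1 hb hx
  have hdi' := intervalIntegrable_of_S s.hS hx₀ (show x₀ ≤ x₀ + 1 by linarith) hdiτ
  have hd : ∫ y in x₀..(x₀ + 1), s.diss (τ, y) ≤ s.d τ :=
    interval_le_S s.hS hx₀ (by linarith) hdiτ fun x hx => s.diss_nonneg hτ0 hx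
  have iv : IntervalIntegrable (fun x => s.v (τ, x)) volume x₀ (x₀ + 1) :=
    (continuous_slice s.c_v τ).intervalIntegrable _ _
  have h2 : ∫ y in x₀..(x₀ + 1), |s.θx (τ, y) / s.θ (τ, y)| ≤ ∫ y in x₀..(x₀ + 1),
      (1 / (2 * p.κ) * s.diss (τ, y) + 1 / 2 * s.v (τ, y)) := by
    refine integral_mono_on (by linarith)
      (hl.intervalIntegrable hx₀ hx1).abs ((hdi'.const_mul _).add (iv.const_mul _)) fun y hy => ?_
    have hyJ := s.hS.mem_of_le hx₀ hy.1
    have hv := s.pos_v hτ0 hyJ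
    have ht := hposθ y hyJ
    have hμ := p.hμ
    have e1 : p.κ * (s.θx (τ, y) ^ 2 / (s.v (τ, y) * s.θ (τ, y) ^ 2)) ≤ s.diss (τ, y) := by
      have : 0 ≤ p.μ * (s.ux (τ, y) ^ 2 / (s.v (τ, y) * s.θ (τ, y))) := by positivity
      simp only [diss]; linarith
    have e3 := mul_le_left e1 (show 0 ≤ 1 / (2 * p.κ) by positivity)
    have e : 1 / (2 * p.κ) * (p.κ * (s.θx (τ, y) ^ 2 / (s.v (τ, y) * s.θ (τ, y) ^ 2))) +
        1 / 2 * s.v (τ, y) - |s.θx (τ, y) / s.θ (τ, y)| =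
        (|s.θx (τ, y)| - s.v (τ, y) * s.θ (τ, y)) ^ 2 / (2 * (s.v (τ, y) * s.θ (τ, y) ^ 2)) := by
      rw [← sq_abs (s.θx (τ, y)), abs_div, abs_of_pos ht]; field_simp; ring
    have : 0 ≤ (|s.θx (τ, y)| - s.v (τ, y) * s.θ (τ, y)) ^ 2 / (2 * (s.v (τ, y) * s.θ (τ, y) ^ 2)) := by positivity
    linarith
  rw [interval_add (hdi'.const_mul _) (iv.const_mul _), interval_const_mul, interval_const_mul] at h2
  have h3 := mul_le_left (hd.trans h1d.le) (show 0 ≤ 1 / (2 * p.κ) by positivity)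
  have h4 := (hmass s x₀ hx₀ τ hτ0).2.1
  have h5 : -(p.E / p.cv + 1) ≤ log (s.θ (τ, b)) := by linarith [neg_log_le_relEntropy (hposθ b hbJ)]
  have h6 := (abs_le.1 h1).1
  have h7 : -(p.E / p.cv + 1) - 1 / 2 * (1 / p.κ + K) ≤ log (s.θ (τ, x)) := by
    have : 1 / (2 * p.κ) * 1 = 1 / 2 * (1 / p.κ) := by field_simp
    linarith
  have h8 : exp (-(p.E / p.cv + 1) - 1 / 2 * (1 / p.κ + K)) ≤ s.θ (τ, x) := by
    rw [← Real.exp_log (hposθ x hxJ)]; exact Real.exp_le_exp.2 h7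
  have := Real.exp_pos (-(p.E / p.cv + 1) - 1 / 2 * (1 / p.κ + K))
  nlinarith

theorem continuous_inv_Y (s : Sol p) {x₀ : ℝ} (hx₀ : x₀ ∈ closure s.S) : Continuous fun τ => (s.Y x₀ τ)⁻¹ :=
  (s.continuous_Y hx₀).inv₀ fun τ => (s.Y_pos x₀ τ).ne'

theorem Y_mul_lower (p : Params) : ∃ k > 0, ∀ s : Sol p, ∀ x₀ ∈ closure s.S, ∀ t ≥ 0,
    k ≤ s.Y x₀ t * (1 + ∫ τ in 0..t, (s.Y x₀ τ)⁻¹) := by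
  obtain ⟨k₁, hk₁, k₂, hk₂, hrep⟩ := volume_rep p
  obtain ⟨k, hk, K, hK, hmass⟩ := local_mass p
  refine ⟨k / (k₂ * K), by positivity, fun s x₀ hx₀ t ht => ?_⟩
  have hY := s.Y_pos x₀ t
  have c1 := s.continuous_integral_θ_div_Y hx₀ t
  have h1 : ∫ x in x₀..(x₀ + 1), s.v (t, x) ≤ ∫ x in x₀..(x₀ + 1),
      k₂ * (s.Y x₀ t * (1 + ∫ τ in 0..t, s.θ (τ, x) / s.Y x₀ τ)) :=
    integral_mono_on (by linarith)
      ((continuous_slice s.c_v t).intervalIntegrable _ _)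
      (Continuous.intervalIntegrable (by fun_prop) _ _)
      fun x hx => (hrep s x₀ hx₀ x hx t ht).2
  rw [interval_const_mul, interval_const_mul,
    interval_add (by simp) (c1.intervalIntegrable _ _),
    interval_const, add_sub_cancel_left, one_smul] at h1
  have cY := s.continuous_Y hx₀
  have cθ := s.c_θ
  have hcont : Continuous fun q : ℝ × ℝ => s.θ (q.2, q.1) / s.Y x₀ q.2 :=
    Continuous.div (by fun_prop) (by fun_prop) fun q => (s.Y_pos x₀ q.2).ne'
  have hswap : ∫ x in x₀..(x₀ + 1), ∫ τ in 0..t, s.θ (τ, x) / s.Y x₀ τ =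
      ∫ τ in 0..t, ∫ x in x₀..(x₀ + 1), s.θ (τ, x) / s.Y x₀ τ := by
    simp only [integral_of_le ht, integral_of_le (show x₀ ≤ x₀ + 1 by linarith)]
    refine integral_integral_swap (f := fun x τ => s.θ (τ, x) / s.Y x₀ τ) ?_
    rw [Measure.prod_restrict]
    exact (hcont.continuousOn.integrableOn_compact
      (isCompact_Icc.prod isCompact_Icc)).mono_set (prod_mono Ioc_subset_Icc_self Ioc_subset_Icc_self)
  have h2 : ∫ τ in 0..t, ∫ x in x₀..(x₀ + 1), s.θ (τ, x) / s.Y x₀ τ ≤ ∫ τ in 0..t, K * (s.Y x₀ τ)⁻¹ := by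
    have hci : Continuous fun τ => ∫ x in x₀..(x₀ + 1), s.θ (τ, x) / s.Y x₀ τ := by
      refine intervalIntegral.continuous_parametric_intervalIntegral_of_continuous'
        (f := fun τ x => s.θ (τ, x) / s.Y x₀ τ) ?_ _ _
      have : Continuous fun q : ℝ × ℝ => s.θ (q.1, q.2) / s.Y x₀ q.1 :=
        Continuous.div (by fun_prop) (by fun_prop) fun q => (s.Y_pos x₀ q.1).ne'
      exact this
    refine integral_mono_on ht (hci.intervalIntegrable _ _)
      (((s.continuous_inv_Y hx₀).const_mul K).intervalIntegrable _ _) fun τ hτ => ?_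
    rw [intervalIntegral.integral_div, div_eq_mul_inv]
    exact mul_le_right (hmass s x₀ hx₀ τ hτ.1).2.2 (inv_pos.2 (s.Y_pos _ _)).le
  rw [interval_const_mul] at h2
  have h3 := (hmass s x₀ hx₀ t ht).1
  rw [hswap] at h1
  have hZ : 0 ≤ ∫ τ in 0..t, (s.Y x₀ τ)⁻¹ := interval_nonneg ht fun τ _ => (inv_pos.2 (s.Y_pos _ _)).le
  rw [div_le_iff₀ (by positivity)]
  set Z := ∫ τ in 0..t, (s.Y x₀ τ)⁻¹
  calc k ≤ k₂ * (s.Y x₀ t * (1 + K * Z)) :=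
        h3.trans (h1.trans (by gcongr))
    _ ≤ k₂ * (s.Y x₀ t * (K + K * Z)) := by gcongr
    _ = _ := by ring

theorem v_upper (p : Params) : ∃ C > 0, ∀ s : Sol p, ∀ t ≥ 0, ∀ x ∈ closure s.S, s.v (t, x) ≤ C := by
  obtain ⟨k₁, hk₁, k₂, hk₂, hrep⟩ := volume_rep p
  obtain ⟨C, hC, c, hc, hY⟩ := Y_ratio p
  obtain ⟨B, hB, hθ⟩ := θ_local_upper p
  have hC0 : 0 < C := by linarith
  have hE := p.E_nonneg
  set L := k₂ * (C + C * B / c + C * B) with hL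
  have hL0 : 0 < L := by positivity
  refine ⟨L * exp (L * p.E), by positivity, fun s T hT x hx => ?_⟩
  set m : ℝ → ℝ := fun t => sSup ((fun y => s.v (t, y)) '' Icc x (x + 1)) with hm
  have hmc : Continuous m := isCompact_Icc.continuous_sSup (f := fun t y => s.v (t, y)) s.c_v
  have hle : ∀ t, ∀ y ∈ Icc x (x + 1), s.v (t, y) ≤ m t := fun t y hy =>
    le_csSup (isCompact_Icc.image (continuous_slice s.c_v t)).bddAbove (mem_image_of_mem _ hy)
  have hxI : x ∈ Icc x (x + 1) := ⟨le_rfl, by linarith⟩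
  have hmpos : ∀ t ≥ 0, 0 < m t := fun t ht => (s.pos_v ht hx).trans_le (hle t x hxI)
  have hbound : ∀ t ∈ Icc 0 T, m t ≤ L + L * ∫ τ in 0..t, m τ * s.d τ := by
    intro t ht
    refine csSup_le ((nonempty_Icc.2 (by linarith)).image _) ?_
    rintro _ ⟨y, hy, rfl⟩
    refine (hrep s x hx y hy t ht.1).2.trans ?_
    have hYt := s.Y_pos x t
    have hY1 : s.Y x t ≤ C := by
      have := hY s x hx 0 le_rfl t ht.1
      rw [s.Y_zero, mul_one] at this
      refine this.trans ?_
      have h1 : exp (-c * (t - 0)) ≤ 1 := Real.exp_le_one_iff.2 (by nlinarith [ht.1])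
      nlinarith
    have cθ : Continuous fun τ => s.θ (τ, y) := by fun_prop
    have hdi := (s.intervalIntegrable_d ht.1).continuousOn_mul hmc.continuousOn
    have hin : s.Y x t * (∫ τ in 0..t, s.θ (τ, y) / s.Y x τ) ≤ C * B / c + C * B * ∫ τ in 0..t, m τ * s.d τ := by
      rw [← interval_const_mul]
      have : ∫ τ in 0..t, s.Y x t * (s.θ (τ, y) / s.Y x τ) ≤
          ∫ τ in 0..t, (C * B * exp (-c * (t - τ)) + C * B * (m τ * s.d τ)) := by
        refine integral_mono_ae_restrict ht.1 ?_ ?_ ?_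
        · exact Continuous.intervalIntegrable
            ((cθ.div (s.continuous_Y hx) fun τ => (s.Y_pos x τ).ne').const_mul _) _ _
        · exact (Continuous.intervalIntegrable (by fun_prop) _ _).add (hdi.const_mul _)
        · rw [← restrict_Ioc_eq_restrict_Icc]
          filter_upwards [ae_Ioc (hθ s x hx) t, ae_mem_Ioc] with τ h1 hτ
          have h2 := h1 (m τ) (hmpos τ hτ.1.le) (hle τ) y hy
          have h3 := hY s x hx τ hτ.1.le t hτ.2
          have hYτ := s.Y_pos x τ
          have h4 : s.Y x t / s.Y x τ ≤ C * exp (-c * (t - τ)) := by rw [div_le_iff₀ hYτ]; exact h3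
          have h5 : exp (-c * (t - τ)) ≤ 1 := Real.exp_le_one_iff.2 (by nlinarith [hτ.2])
          have h6 : 0 ≤ m τ * s.d τ := mul_nonneg (hmpos τ hτ.1.le).le (s.d_nonneg hτ.1.le)
          have hexp := Real.exp_pos (-c * (t - τ))
          calc s.Y x t * (s.θ (τ, y) / s.Y x τ) = s.Y x t / s.Y x τ * s.θ (τ, y) := by ring
            _ ≤ C * exp (-c * (t - τ)) * (B + B * (m τ * s.d τ)) :=
                mul_le_mul h4 h2 (s.pos_θ hτ.1.le (s.hS.mem_of_le hx hy.1)).le (by positivity)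
            _ = C * B * exp (-c * (t - τ)) + exp (-c * (t - τ)) * (C * B * (m τ * s.d τ)) := by ring
            _ ≤ C * B * exp (-c * (t - τ)) + 1 * (C * B * (m τ * s.d τ)) := by gcongr
            _ = _ := by ring
      refine this.trans ?_
      rw [interval_add (Continuous.intervalIntegrable (by fun_prop) _ _)
        (hdi.const_mul _), interval_const_mul,
        interval_const_mul]
      have h7 := mul_le_left (integral_exp_neg_le (t := t) hc) (show 0 ≤ C * B by positivity)
      have : C * B * (1 / c) = C * B / c := by ring
      linarith
    have hI : 0 ≤ ∫ τ in 0..t, m τ * s.d τ := interval_nonneg ht.1 fun τ hτ =>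
      mul_nonneg (hmpos τ hτ.1).le (s.d_nonneg hτ.1)
    set I := ∫ τ in 0..t, m τ * s.d τ
    calc k₂ * (s.Y x t * (1 + ∫ τ in 0..t, s.θ (τ, y) / s.Y x τ)) =
        k₂ * (s.Y x t + s.Y x t * ∫ τ in 0..t, s.θ (τ, y) / s.Y x τ) := by ring
      _ ≤ k₂ * (C + (C * B / c + C * B * I)) := by gcongr
      _ ≤ L + L * I := by
          rw [hL]
          have : 0 ≤ k₂ * (C * B) := by positivity
          have : 0 ≤ k₂ * (C + C * B / c) * I := by positivity
          nlinarith
  have hg := gronwall_integral hmc (fun t ht => s.intervalIntegrable_d ht.1)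
    (fun t ht => s.d_nonneg ht.1) hL0.le hbound hT
  refine (hle T x hxI).trans (hg.trans ?_)
  have := s.integral_d_le hT
  gcongr

theorem v_lower (p : Params) : ∃ c > 0, ∀ s : Sol p, ∀ t ≥ 0, ∀ x ∈ closure s.S, c ≤ s.v (t, x) := by
  obtain ⟨k₁, hk₁, k₂, hk₂, hrep⟩ := volume_rep p
  obtain ⟨C, hC, c, hc, hY⟩ := Y_ratio p
  obtain ⟨b, hb, hθ⟩ := θ_local_lower p
  obtain ⟨k, hk, hYk⟩ := Y_mul_lower p
  have hC0 : 0 < C := by linarith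
  have hE := p.E_nonneg
  set L := p.E + 1 with hL
  set q := k * exp (-(L / k)) / (C + C / c) with hq
  have hq0 : 0 < q := by positivity
  refine ⟨min (k₁ * (k * exp (-(L / k)))) (k₁ * (q * b)), by positivity, fun s t ht x hx => ?_⟩
  have hxI : x ∈ Icc x (x + 1) := ⟨le_rfl, by linarith⟩
  refine le_trans ?_ (hrep s x hx x hxI t ht).1
  set Z : ℝ → ℝ := fun t => 1 + ∫ τ in 0..t, (s.Y x τ)⁻¹ with hZ
  have cinv := s.continuous_inv_Y hx
  have hZd : ∀ t, HasDerivAt Z (s.Y x t)⁻¹ t := fun t =>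
    (intervalIntegral.integral_hasDerivAt_right (cinv.intervalIntegrable _ _)
      (cinv.stronglyMeasurableAtFilter _ _) cinv.continuousAt).const_add 1
  have hZ0 : Z 0 = 1 := by simp [hZ]
  have hkZ : ∀ t ≥ 0, k ≤ s.Y x t * Z t := fun t ht => hYk s x hx t ht
  have hanti : AntitoneOn (fun t => Z t * exp (-(t / k))) (Ici 0) := by
    have hder : ∀ t, HasDerivAt (fun t => Z t * exp (-(t / k)))
        ((s.Y x t)⁻¹ * exp (-(t / k)) + Z t * (exp (-(t / k)) * (-(1 / k)))) t :=
      fun t => (hZd t).mul (((hasDerivAt_id t).div_const k).neg.exp)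
    refine antitoneOn_of_deriv_nonpos (convex_Ici 0)
      (fun t _ => (hder t).continuousAt.continuousWithinAt)
      (fun t _ => (hder t).differentiableAt.differentiableWithinAt) fun t ht => ?_
    rw [interior_Ici] at ht
    rw [(hder t).deriv]
    have h1 := hkZ t (le_of_lt ht)
    have hYt := s.Y_pos x t
    have h2 : (s.Y x t)⁻¹ ≤ Z t * (1 / k) := by
      rw [inv_le_iff_one_le_mul₀ hYt, mul_one_div, div_mul_eq_mul_div, le_div_iff₀ hk]
      linarith
    have h3 := Real.exp_pos (-(t / k))
    nlinarith
  have hZpos : ∀ t ≥ 0, 1 ≤ Z t := fun t ht => by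
    have : 0 ≤ ∫ τ in 0..t, (s.Y x τ)⁻¹ := interval_nonneg ht fun τ _ => (inv_pos.2 (s.Y_pos _ _)).le
    simp only [hZ]; linarith
  have hgrow : ∀ r ≥ 0, ∀ t ≥ r, t - r ≤ L → Z t * exp (-(L / k)) ≤ Z r := by
    intro r hr t hrt hL'
    have h1 : Z t * exp (-(t / k)) ≤ Z r * exp (-(r / k)) := hanti (mem_Ici.2 hr) (mem_Ici.2 (hr.trans hrt)) hrt
    have h2 := mul_le_right h1 (Real.exp_pos (r / k)).le
    rw [mul_assoc, mul_assoc, ← Real.exp_add, ← Real.exp_add, neg_add_cancel, Real.exp_zero, mul_one] at h2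
    refine le_trans (mul_le_left ?_ (by linarith [hZpos t (hr.trans hrt)])) h2
    apply Real.exp_le_exp.2
    have : (t - r) / k ≤ L / k := by gcongr
    rw [sub_div] at this
    linarith
  have hYt := s.Y_pos x t
  have cθ : Continuous fun τ => s.θ (τ, x) := by fun_prop
  have cYθ : Continuous fun τ => s.θ (τ, x) / s.Y x τ := cθ.div (s.continuous_Y hx) fun τ => (s.Y_pos x τ).ne'
  have hnn : ∀ τ ≥ 0, 0 ≤ s.θ (τ, x) / s.Y x τ := fun τ hτ => div_nonneg (s.pos_θ hτ hx).le (s.Y_pos _ _).le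
  rcases le_total t L with htL | htL
  · refine (min_le_left _ _).trans (mul_le_left ?_ hk₁.le)
    have h1 := hgrow 0 le_rfl t ht (by linarith)
    rw [hZ0] at h1
    have h2 := hkZ t ht
    have hI : 0 ≤ ∫ τ in 0..t, s.θ (τ, x) / s.Y x τ := interval_nonneg ht fun τ hτ => hnn τ hτ.1
    have h3 := mul_le_right h2 (Real.exp_pos (-(L / k))).le
    calc k * exp (-(L / k)) ≤ s.Y x t * (Z t * exp (-(L / k))) := by linarith
      _ ≤ s.Y x t * 1 := by gcongr
      _ ≤ _ := by gcongr; linarith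
  · refine (min_le_right _ _).trans (mul_le_left ?_ hk₁.le)
    have hr0 : 0 ≤ t - L := by linarith
    have hrt : t - L ≤ t := by linarith
    have hsplit := integral_add_adjacent_intervals
      (cYθ.intervalIntegrable (μ := volume) 0 (t - L)) (cYθ.intervalIntegrable (t - L) t)
    have hI : 0 ≤ ∫ τ in 0..(t - L), s.θ (τ, x) / s.Y x τ := interval_nonneg hr0 fun τ hτ => hnn τ hτ.1
    have hratio : ∀ r ∈ Icc (t - L) t, q ≤ s.Y x t / s.Y x r := by
      intro r hr
      have hr0' : 0 ≤ r := hr0.trans hr.1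
      have hYr := s.Y_pos x r
      have h1 : Z r ≤ (C + C / c) / s.Y x r := by
        have i1 : 1 ≤ C / s.Y x r := by
          rw [le_div_iff₀ hYr, one_mul]
          have := hY s x hx 0 le_rfl r hr0'
          rw [s.Y_zero, mul_one] at this
          refine this.trans ?_
          have h1 : exp (-c * (r - 0)) ≤ 1 := Real.exp_le_one_iff.2 (by nlinarith)
          nlinarith
        have i2 : ∫ τ in 0..r, (s.Y x τ)⁻¹ ≤ ∫ τ in 0..r, C / s.Y x r * exp (-c * (r - τ)) := by
          refine integral_mono_on hr0' (cinv.intervalIntegrable _ _)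
            (Continuous.intervalIntegrable (by fun_prop) _ _) fun τ hτ => ?_
          have := hY s x hx τ hτ.1 r hτ.2
          have hYτ := s.Y_pos x τ
          rw [inv_le_iff_one_le_mul₀ hYτ, div_mul_eq_mul_div, div_mul_eq_mul_div, le_div_iff₀ hYr]
          linarith
        rw [interval_const_mul] at i2
        have i3 := mul_le_left (integral_exp_neg_le (t := r) hc) (show 0 ≤ C / s.Y x r by positivity)
        have i4 : (C + C / c) / s.Y x r = C / s.Y x r + C / s.Y x r * (1 / c) := by field_simp
        rw [i4]; simp only [hZ]; linarith
      have h2 := hgrow r hr0' t hr.2 (by linarith [hr.1])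
      have h3 := hkZ t ht
      rw [hq, div_le_div_iff₀ (by positivity) hYr]
      have h4 : Z r * s.Y x r ≤ C + C / c := by rwa [le_div_iff₀ hYr] at h1
      have hexp := Real.exp_pos (-(L / k))
      calc k * exp (-(L / k)) * s.Y x r ≤ s.Y x t * Z t * exp (-(L / k)) * s.Y x r := by
            gcongr
        _ = s.Y x t * (Z t * exp (-(L / k))) * s.Y x r := by ring
        _ ≤ s.Y x t * Z r * s.Y x r := by gcongr
        _ = s.Y x t * (Z r * s.Y x r) := by ring
        _ ≤ _ := by gcongr
    have hdint : IntervalIntegrable s.d volume (t - L) t :=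
      (s.intervalIntegrable_d hr0).symm.trans (s.intervalIntegrable_d ht)
    have hmain : ∫ τ in (t - L)..t, q * (b * (1 - s.d τ)) ≤
        ∫ τ in (t - L)..t, s.Y x t * (s.θ (τ, x) / s.Y x τ) := by
      refine integral_mono_ae_restrict hrt
        (((iiConst.sub hdint).const_mul _).const_mul _)
        ((cYθ.const_mul _).intervalIntegrable _ _) ?_
      rw [← restrict_Ioc_eq_restrict_Icc]
      have h1 := ae_mono_set (show Ioc (t - L) t ⊆ Ioi 0 from fun τ hτ => hr0.trans_lt hτ.1) (hθ s x hx)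
      filter_upwards [h1, ae_mem_Ioc] with τ h2 hτ
      have h3 := h2 x hxI
      have h4 := hratio τ ⟨hτ.1.le, hτ.2⟩
      have hθτ := s.pos_θ (hr0.trans hτ.1.le) hx
      calc q * (b * (1 - s.d τ)) ≤ q * s.θ (τ, x) := by gcongr
        _ ≤ s.Y x t / s.Y x τ * s.θ (τ, x) := by gcongr
        _ = _ := by ring
    rw [interval_const_mul, interval_const_mul, interval_const_mul, interval_sub iiConst hdint,
      interval_const, sub_sub_cancel, smul_eq_mul, mul_one] at hmain
    have h5 := s.integral_d_le' hr0 hrt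
    have h6 : (1:ℝ) ≤ L - ∫ τ in (t - L)..t, s.d τ := by linarith
    have h7 : q * b ≤ q * (b * (L - ∫ τ in (t - L)..t, s.d τ)) := by
      have := mul_le_left h6 (show 0 ≤ q * b by positivity)
      linarith
    have h8 := mul_nonneg hYt.le hI
    rw [← hsplit]
    nlinarith

end Sol

/-! ### Large temperatures and the dissipation of the velocity -/

theorem hasDerivAt_pospart_pow (a : ℝ) (n : ℕ) (y : ℝ) :
    HasDerivAt (fun y => max (y - a) 0 ^ (n + 2)) ((n + 2 : ℕ) * max (y - a) 0 ^ (n + 1)) y := by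
  rcases lt_trichotomy y a with h | h | h
  · have e : (fun y => max (y - a) 0 ^ (n + 2)) =ᶠ[𝓝 y] fun _ => 0 := by
      filter_upwards [gt_mem_nhds h] with z hz
      rw [max_eq_right (by linarith)]; simp
    rw [max_eq_right (by linarith)]
    simpa using (hasDerivAt_const y (0:ℝ)).congr_of_eventuallyEq e
  · subst h
    rw [sub_self, max_self, zero_pow (by omega), mul_zero, hasDerivAt_iff_isLittleO]
    simp only [sub_self, max_self, smul_zero, sub_zero]
    rw [zero_pow (by omega)]
    simp only [sub_zero]
    refine Asymptotics.IsBigO.trans_isLittleO (g := fun z => (z - y) ^ 2) ?_ ?_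
    · refine Asymptotics.IsBigO.of_bound 1 ?_
      filter_upwards [Metric.ball_mem_nhds y one_pos] with z hz
      rw [Metric.mem_ball, Real.dist_eq] at hz
      rw [Real.norm_eq_abs, Real.norm_eq_abs, abs_pow, abs_pow, one_mul]
      have h1 : |max (z - y) 0| ≤ |z - y| := by
        rw [abs_of_nonneg (le_max_right _ _)]; exact max_le (le_abs_self _) (abs_nonneg _)
      exact (pow_le_pow_left₀ (abs_nonneg _) h1 _).trans (pow_le_pow_of_le_one (abs_nonneg _) hz.le (by omega))
    · rw [Asymptotics.isLittleO_iff]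
      intro c hc
      filter_upwards [Metric.ball_mem_nhds y hc] with z hz
      rw [Metric.mem_ball, Real.dist_eq] at hz
      rw [Real.norm_eq_abs, Real.norm_eq_abs, abs_pow, sq]
      exact mul_le_right hz.le (abs_nonneg _)
  · have e : (fun y => max (y - a) 0 ^ (n + 2)) =ᶠ[𝓝 y] fun y => (y - a) ^ (n + 2) := by
      filter_upwards [lt_mem_nhds h] with z hz
      rw [max_eq_left (by linarith)]
    rw [max_eq_left (by linarith)]
    have := ((hasDerivAt_id y).sub_const a).pow (n + 2)
    simp only [id, mul_one] at this
    exact this.congr_of_eventuallyEq e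

theorem pospart_mul_self (a y : ℝ) : max (y - a) 0 * (max (y - a) 0 - (y - a)) = 0 := by
  rcases le_total (y - a) 0 with h | h
  · rw [max_eq_right h]; ring
  · rw [max_eq_left h]; ring

theorem pospart_le_relEntropy {y : ℝ} (hy : 0 < y) : max (y - 3 / 2) 0 ≤ 3 * (y - log y - 1) := by
  refine max_le ?_ (by linarith [relEntropy_nonneg hy])
  have h1 := Real.log_le_sub_one_of_pos (show 0 < y / (3 / 2) by positivity)
  rw [Real.log_div hy.ne' (by norm_num)] at h1
  have h2 : log (3 / 2) ≤ 1 / 2 := by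
    have := Real.log_le_sub_one_of_pos (show (0:ℝ) < 3 / 2 by norm_num)
    linarith
  linarith

theorem isEntropy_sublinear :
    IsEntropy (fun y => max (y - 2) 0 ^ 3 / y ^ 2) (fun y => max (y - 2) 0 ^ 2 * (y + 4) / y ^ 3)
      (fun y => 24 * max (y - 2) 0 / y ^ 4) where
  hG y hy := by
    have h := (hasDerivAt_pospart_pow 2 1 y).div (hasDerivAt_pow 2 y) (pow_ne_zero 2 hy.ne')
    refine h.congr_deriv ?_
    have e := pospart_mul_self 2 y
    push_cast
    field_simp
    linear_combination (-2 * max (y - 2) 0 ) * e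
  hg y hy := by
    have h := ((hasDerivAt_pospart_pow 2 0 y).mul ((hasDerivAt_id y).add_const 4)).div
      (hasDerivAt_pow 3 y) (pow_ne_zero 3 hy.ne')
    refine (h.congr_deriv ?_)
    have e := pospart_mul_self 2 y
    simp only [id, Pi.mul_apply]
    push_cast
    field_simp
    linear_combination (-2 * (y + 6)) * e
  hg' := ContinuousOn.div (by fun_prop) (by fun_prop) fun y hy => pow_ne_zero _ (ne_of_gt hy)
  hG1 := by norm_num
  hg1 := by norm_num
  mG := by fun_prop
  mg := by fun_prop
  mg' := by fun_prop

namespace Sol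

variable {p : Params}

/-- The excess of the temperature over `2` is controlled by the dissipation. -/
theorem integral_excess_le (p : Params) : ∃ C > 0, ∀ s : Sol p, ∀ᵐ τ ∂vol₊,
      ∫ x in s.S, max (s.θ (τ, x) - 2) 0 ^ 2 ≤ C * s.d τ := by
  obtain ⟨V, hV, hv⟩ := v_upper p
  have hE := p.E_nonneg; have hκ := p.hκ; have hcv := p.hcv; have hμ := p.hμ
  set A := 3 * (p.E / p.cv) + 1 with hA
  have hA0 : 0 < A := by positivity
  refine ⟨A * (64 * A * (V / p.κ)), by positivity, fun s => ?_⟩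
  have hJ := s.hS.ordConnected_closure
  filter_upwards [s.xθ, s.ae_integrable_diss, ae_mem_Ioi,
    ae_Ioi_of_Ioc fun T => MemLp.ae_slice (s.lθx T)] with τ hθ hd hτ hl
  have hτ0 : 0 ≤ τ := le_of_lt hτ
  have hpos : ∀ x ∈ closure s.S, 0 < s.θ (τ, x) := fun x hx => s.pos_θ hτ0 hx
  obtain ⟨c, hc, C, hb⟩ := s.bound τ
  have hb' := hb τ ⟨hτ0, le_rfl⟩
  have mθ := s.m_θ
  have mθx := s.m_θx
  set q : ℝ → ℝ := fun x => max (s.θ (τ, x) - 3 / 2) 0 with hq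
  have q0 : ∀ x, 0 ≤ q x := fun x => le_max_right _ _
  have hq1 : ∀ x ∈ closure s.S, q x ≤ 3 * (s.θ (τ, x) - log (s.θ (τ, x)) - 1) := fun x hx =>
    pospart_le_relEntropy (hpos x hx)
  have mq : Measurable q := by fun_prop
  have iq : Integrable q (vol s.S) := by
    refine ((s.integrable_relEntropy_θ hτ0).const_mul 3).mono' mq.aestronglyMeasurable (s.ae_S fun x hx => ?_)
    rw [Real.norm_eq_abs, abs_of_nonneg (q0 x)]
    exact hq1 x hx
  have hqA : ∫ x in s.S, q x ≤ A := by
    have h1 := integral_mono_ae iq ((s.integrable_relEntropy_θ hτ0).const_mul 3) (s.ae_S hq1)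
    rw [integral_const_mul] at h1
    have h2 := (s.energy hτ0).2.2.1
    have h3 : ∫ x in s.S, (s.θ (τ, x) - log (s.θ (τ, x)) - 1) ≤ p.E / p.cv := by rw [le_div_iff₀ hcv]; linarith
    rw [hA]; linarith
  have lq : MemLp q 2 (vol s.S) := by
    refine memLp_two_of_abs_le (C := 1) mq.aestronglyMeasurable (s.sθ τ hτ0) (.of_forall fun x => ?_)
    rw [abs_of_nonneg (q0 x), one_mul]
    exact max_le (by linarith [le_abs_self (s.θ (τ, x) - 1)]) (abs_nonneg _)
  have hd0 := s.d_nonneg hτ0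
  set D := ∫ x in s.S, (s.θx (τ, x) / s.θ (τ, x)) ^ 2 with hD
  have lD : MemLp (fun x => s.θx (τ, x) / s.θ (τ, x)) 2 (vol s.S) :=
    memLp_div hl (continuous_slice s.c_θ τ).aestronglyMeasurable hc (s.ae_S fun x hx => (hb' x hx).2.2.1)
  have hDd : D ≤ V / p.κ * s.d τ := by
    rw [hD, d, ← integral_const_mul]
    refine integral_mono_ae lD.integrable_sq (hd.const_mul _) (s.ae_S fun x hx => ?_)
    have h1 := s.pos_v hτ0 hx
    have h2 := hpos x hx
    have h3 := hv s τ hτ0 x hx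
    simp only [diss]
    have h4 : s.θx (τ, x) ^ 2 / s.θ (τ, x) ^ 2 / V ≤ s.θx (τ, x) ^ 2 / (s.v (τ, x) * s.θ (τ, x) ^ 2) := by
      rw [div_div, mul_comm]
      gcongr
    have h5 : 0 ≤ p.μ * (s.ux (τ, x) ^ 2 / (s.v (τ, x) * s.θ (τ, x))) := by positivity
    calc (s.θx (τ, x) / s.θ (τ, x)) ^ 2
        = V / p.κ * (0 + p.κ * (s.θx (τ, x) ^ 2 / s.θ (τ, x) ^ 2 / V)) := by field_simp; ring
      _ ≤ _ := by gcongr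
  have hw : ∀ x, max (s.θ (τ, x) - 2) 0 ≤ q x := fun x => max_le_max (by linarith) le_rfl
  by_cases hbig : ∃ x ∈ closure s.S, 1 / 2 < q x
  swap
  · push Not at hbig
    have : ∫ x in s.S, max (s.θ (τ, x) - 2) 0 ^ 2 = ∫ x in s.S, (0:ℝ) := by
      refine integral_congr_ae (s.ae_S fun x hx => ?_)
      have h1 : s.θ (τ, x) - 3 / 2 ≤ 1 / 2 := (le_max_left _ _).trans (hbig x hx)
      simp only
      rw [max_eq_right (by linarith)]; simp
    rw [this, integral_zero]
    positivity
  obtain ⟨x₁, hx₁, hbig⟩ := hbig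
  set X := sSup (q '' closure s.S) with hX
  have hbdd : BddAbove (q '' closure s.S) := by
    refine ⟨max (C - 3 / 2) 0, ?_⟩
    rintro _ ⟨x, hx, rfl⟩
    exact max_le_max (by linarith [(hb' x hx).2.2.2.1]) le_rfl
  have hXle : ∀ x ∈ closure s.S, q x ≤ X := fun x hx => le_csSup hbdd ⟨x, hx, rfl⟩
  have hX0 : 1 / 2 < X := hbig.trans_le (hXle x₁ hx₁)
  have hq2 : ∫ x in s.S, q x ^ 2 ≤ X * A := by
    have h1 : ∫ x in s.S, q x ^ 2 ≤ ∫ x in s.S, X * q x := by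
      refine integral_mono_ae lq.integrable_sq (iq.const_mul X) (s.ae_S fun x hx => ?_)
      simp only
      rw [sq]
      exact mul_le_right (hXle x hx) (q0 x)
    rw [integral_const_mul] at h1
    exact h1.trans (mul_le_left hqA (by linarith))
  have hH := hθ.comp (K := Ioi 0) (φ := fun y => max (y - 3 / 2) 0 ^ 2 / y)
    (φ' := fun y => (2 * max (y - 3 / 2) 0 * y - max (y - 3 / 2) 0 ^ 2) / y ^ 2)
    (fun y hy => by
      have h := (hasDerivAt_pospart_pow (3 / 2) 0 y).div (hasDerivAt_id y) (ne_of_gt hy)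
      exact h.congr_deriv (by simp))
    (ContinuousOn.div (by fun_prop) (by fun_prop) fun y hy => pow_ne_zero _ (ne_of_gt hy)) hpos
  have hbound : ∀ x ∈ closure s.S, |(2 * q x * s.θ (τ, x) - q x ^ 2) / s.θ (τ, x) ^ 2 *
      s.θx (τ, x)| ≤ (8 * A)⁻¹ * q x ^ 2 + 8 * A * (s.θx (τ, x) / s.θ (τ, x)) ^ 2 := by
    intro x hx
    have h1 := hpos x hx
    have h2 : q x ≤ s.θ (τ, x) := max_le (by linarith) h1.le
    have h3 : |(2 * q x * s.θ (τ, x) - q x ^ 2) / s.θ (τ, x) ^ 2 * s.θx (τ, x)| ≤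
        2 * (q x * |s.θx (τ, x) / s.θ (τ, x)|) := by
      rw [abs_mul, abs_div, abs_div, abs_of_nonneg (by nlinarith [q0 x] : 0 ≤ 2 * q x * s.θ (τ, x) - q x ^ 2),
        abs_of_pos (by positivity : 0 < s.θ (τ, x) ^ 2), abs_of_pos h1]
      calc _ ≤ (2 * q x * s.θ (τ, x)) / s.θ (τ, x) ^ 2 * |s.θx (τ, x)| := by
            gcongr; nlinarith [sq_nonneg (q x)]
        _ = _ := by field_simp
    refine h3.trans ?_
    rw [← sq_abs (s.θx (τ, x) / s.θ (τ, x))]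
    set r := |s.θx (τ, x) / s.θ (τ, x)|
    have h4 : 0 ≤ (8 * A)⁻¹ * (q x - 8 * A * r) ^ 2 := by positivity
    have h5 : (8 * A)⁻¹ * (q x - 8 * A * r) ^ 2 =
      (8 * A)⁻¹ * q x ^ 2 + 8 * A * r ^ 2 - 2 * (q x * r) := by field_simp; ring
    linarith
  have iR : Integrable (fun x => (8 * A)⁻¹ * q x ^ 2 + 8 * A * (s.θx (τ, x) / s.θ (τ, x)) ^ 2)
      (vol s.S) := (lq.integrable_sq.const_mul _).add (lD.integrable_sq.const_mul _)
  have iH' : Integrable (fun x => (2 * q x * s.θ (τ, x) - q x ^ 2) / s.θ (τ, x) ^ 2 * s.θx (τ, x)) (vol s.S) :=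
    iR.mono' aesm (s.ae_S hbound)
  have iH : Integrable (fun x => q x ^ 2 / s.θ (τ, x)) (vol s.S) := by
    have := integrable_mul_div lq lq (continuous_slice s.c_θ τ).aestronglyMeasurable hc
      (s.ae_S fun x hx => (hb' x hx).2.2.1)
    simpa only [← sq] using this
  have hpt : ∀ x ∈ closure s.S, q x ^ 2 / s.θ (τ, x) ≤ X / 8 + 8 * A * D := by
    intro x hx
    refine (le_abs_self _).trans ((hH.abs_le_integral s.hS iH iH' hx).trans ?_)
    refine (integral_mono_ae iH'.abs iR (s.ae_S hbound)).trans ?_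
    rw [integral_add (lq.integrable_sq.const_mul _) (lD.integrable_sq.const_mul _),
      integral_const_mul, integral_const_mul]
    have : (8 * A)⁻¹ * ∫ x in s.S, q x ^ 2 ≤ (8 * A)⁻¹ * (X * A) := by gcongr
    have e : (8 * A)⁻¹ * (X * A) = X / 8 := by field_simp
    linarith
  have hfin : X ≤ 64 * A * D := by
    have hX2 : X ≤ max (1 / 2) (4 * (X / 8 + 8 * A * D)) := by
      refine csSup_le ⟨_, x₁, hx₁, rfl⟩ ?_
      rintro _ ⟨x, hx, rfl⟩
      by_cases h : q x ≤ 1 / 2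
      · exact le_max_of_le_left h
      · push Not at h
        refine le_max_of_le_right ?_
        have h1 := hpt x hx
        have h2 : s.θ (τ, x) ≤ 4 * q x := by
          have : q x = s.θ (τ, x) - 3 / 2 := max_eq_left (by
            by_contra h3
            push Not at h3
            have : q x = 0 := max_eq_right h3.le
            linarith)
          linarith
        have h3 := hpos x hx
        have h4 : q x / 4 ≤ q x ^ 2 / s.θ (τ, x) := by rw [div_le_div_iff₀ (by norm_num) h3]; nlinarith [q0 x]
        linarith
    rcases le_max_iff.1 hX2 with h | h <;> linarith
  calc ∫ x in s.S, max (s.θ (τ, x) - 2) 0 ^ 2 ≤ ∫ x in s.S, q x ^ 2 := by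
        refine integral_mono_of_nonneg (.of_forall fun x => by positivity)
          lq.integrable_sq (.of_forall fun x => ?_)
        exact pow_le_pow_left₀ (le_max_right _ _) (hw x) 2
    _ ≤ X * A := hq2
    _ ≤ (64 * A * (V / p.κ * s.d τ)) * A := by
        gcongr
        exact hfin.trans (by gcongr)
    _ = _ := by ring

theorem memLp_excess (s : Sol p) (T : ℝ) : MemLp (fun z => max (s.θ z - 2) 0) 2 (stm s.S T) := by
  refine memLp_two_of_abs_le (C := 1) aesm (s.lθ T) (.of_forall fun x => ?_)
  rw [abs_of_nonneg (le_max_right _ _), one_mul]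
  exact max_le (by linarith [le_abs_self (s.θ x - 1)]) (abs_nonneg _)

theorem integral_excess_stm_le (p : Params) : ∃ C > 0, ∀ s : Sol p, ∀ T ≥ 0,
    ∫ z, max (s.θ z - 2) 0 ^ 2 ∂stm s.S T ≤ C := by
  obtain ⟨C, hC, h⟩ := integral_excess_le p
  have hE := p.E_nonneg
  refine ⟨C * p.E + 1, by positivity, fun s T hT => ?_⟩
  have hi := (s.memLp_excess T).integrable_sq
  rw [integral_prod _ hi]
  have h1 : ∫ t in Ioc 0 T, ∫ x in s.S, max (s.θ (t, x) - 2) 0 ^ 2 ≤ ∫ t in Ioc 0 T, C * s.d t :=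
    integral_mono_ae hi.integral_prod_left (((s.integrable_diss T).integral_prod_left).const_mul C)
      (ae_Ioc (h s) T)
  rw [integral_const_mul, ← integral_of_le hT] at h1
  have h2 := mul_le_left (s.integral_d_le hT) hC.le
  rw [integral_of_le hT] at h1 h2
  linarith

theorem integral_pospart_le (s : Sol p) {t : ℝ} (ht : 0 ≤ t) :
    Integrable (fun x => max (s.θ (t, x) - 2) 0) (vol s.S) ∧
    ∫ x in s.S, max (s.θ (t, x) - 2) 0 ≤ 3 * (p.E / p.cv) := by
  have h0 : ∀ x ∈ closure s.S, max (s.θ (t, x) - 2) 0 ≤ 3 * (s.θ (t, x) - log (s.θ (t, x)) - 1) := fun x hx =>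
    (max_le_max (by linarith) le_rfl).trans (pospart_le_relEntropy (s.pos_θ ht hx))
  have hi : Integrable (fun x => max (s.θ (t, x) - 2) 0) (vol s.S) := by
    refine ((s.integrable_relEntropy_θ ht).const_mul 3).mono' aesm (s.ae_S fun x hx => ?_)
    rw [Real.norm_eq_abs, abs_of_nonneg (le_max_right _ _)]
    exact h0 x hx
  refine ⟨hi, ?_⟩
  have h1 := integral_mono_ae hi ((s.integrable_relEntropy_θ ht).const_mul 3) (s.ae_S h0)
  rw [integral_const_mul] at h1
  have h2 := (s.energy ht).2.2.1
  have h3 : ∫ x in s.S, (s.θ (t, x) - log (s.θ (t, x)) - 1) ≤ p.E / p.cv := by rw [le_div_iff₀ p.hcv]; linarith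
  linarith

end Sol

section Comb

variable {α : Type*} [MeasurableSpace α] {m : Measure α} {f g h : α → ℝ}

theorem integrable_comb (hf : Integrable f m) (hg : Integrable g m) (hh : Integrable h m)
    (a b c : ℝ) : Integrable (fun z => a * f z + b * g z + c * h z) m :=
  ((hf.const_mul a).add (hg.const_mul b)).add (hh.const_mul c)

theorem integral_comb (hf : Integrable f m) (hg : Integrable g m) (hh : Integrable h m)
    (a b c : ℝ) : ∫ z, (a * f z + b * g z + c * h z) ∂m =
      a * (∫ z, f z ∂m) + b * (∫ z, g z ∂m) + c * ∫ z, h z ∂m := by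
  have h1 : Integrable (fun z => a * f z + b * g z) m := (hf.const_mul a).add (hg.const_mul b)
  rw [integral_add h1 (hh.const_mul c), integral_add (hf.const_mul a) (hg.const_mul b),
    integral_const_mul, integral_const_mul, integral_const_mul]

end Comb

theorem isEntropy_quadratic :
    IsEntropy (fun y => max (y - 2) 0 ^ 3 / y) (fun y => max (y - 2) 0 ^ 2 * (2 * y + 2) / y ^ 2)
      (fun y => 2 * max (y - 2) 0 * (y ^ 2 + 2 * y + 4) / y ^ 3) where
  hG y hy := by
    have h := (hasDerivAt_pospart_pow 2 1 y).div (hasDerivAt_id y) hy.ne'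
    refine h.congr_deriv ?_
    have e := pospart_mul_self 2 y
    simp only [id]
    push_cast
    field_simp
    linear_combination (- max (y - 2) 0 ) * e
  hg y hy := by
    have h := ((hasDerivAt_pospart_pow 2 0 y).mul (((hasDerivAt_id y).const_mul 2).add_const 2)).div
      (hasDerivAt_pow 2 y) (pow_ne_zero 2 hy.ne')
    refine (h.congr_deriv ?_)
    have e := pospart_mul_self 2 y
    simp only [id, Pi.mul_apply]
    push_cast
    field_simp
    linear_combination (-(y + 2)) * e
  hg' := ContinuousOn.div (by fun_prop) (by fun_prop) fun y hy => pow_ne_zero _ (ne_of_gt hy)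
  hG1 := by norm_num
  hg1 := by norm_num
  mG := by fun_prop
  mg := by fun_prop
  mg' := by fun_prop

namespace Sol

variable {p : Params}

theorem ae_pos (s : Sol p) (T : ℝ) : ∀ᵐ z ∂stm s.S T, 0 < s.v z ∧ 0 < s.θ z := by
  filter_upwards [ae_stm s.hS T] with z hz
  exact ⟨s.pos_v hz.1.1.le hz.2, s.pos_θ hz.1.1.le hz.2⟩

/-- The two parts of the dissipation. -/
theorem integral_diss_parts (p : Params) : ∃ C > 0, ∀ s : Sol p, ∀ T ≥ 0,
    Integrable (fun z => s.ux z ^ 2 / s.θ z) (stm s.S T) ∧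
    ∫ z, s.ux z ^ 2 / s.θ z ∂stm s.S T ≤ C ∧
    Integrable (fun z => s.θx z ^ 2 / s.θ z ^ 2) (stm s.S T) ∧
    ∫ z, s.θx z ^ 2 / s.θ z ^ 2 ∂stm s.S T ≤ C := by
  obtain ⟨V, hV, hv⟩ := v_upper p
  have hE := p.E_nonneg; have hκ := p.hκ; have hμ := p.hμ
  refine ⟨V / p.μ * p.E + V / p.κ * p.E + 1, by positivity, fun s T hT => ?_⟩
  have hd := s.integrable_diss T
  have key : ∀ᵐ z ∂stm s.S T, s.ux z ^ 2 / s.θ z ≤ V / p.μ * s.diss z ∧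
      s.θx z ^ 2 / s.θ z ^ 2 ≤ V / p.κ * s.diss z ∧ 0 < s.θ z := by
    filter_upwards [ae_stm s.hS T, s.ae_pos T] with z hz h1
    have h3 : s.v z ≤ V := hv s z.1 hz.1.1.le z.2 hz.2
    obtain ⟨h1, h2⟩ := h1
    have n1 : 0 ≤ p.μ * (s.ux z ^ 2 / (s.v z * s.θ z)) := by positivity
    have n2 : 0 ≤ p.κ * (s.θx z ^ 2 / (s.v z * s.θ z ^ 2)) := by positivity
    refine ⟨?_, ?_, h2⟩
    · calc s.ux z ^ 2 / s.θ z = V / p.μ * (p.μ * (s.ux z ^ 2 / (V * s.θ z)) + 0) := by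
            field_simp; ring
        _ ≤ _ := by unfold diss; gcongr
    · calc s.θx z ^ 2 / s.θ z ^ 2 = V / p.κ * (0 + p.κ * (s.θx z ^ 2 / (V * s.θ z ^ 2))) := by
            field_simp; ring
        _ ≤ _ := by unfold diss; gcongr
  have hle := (s.energy hT).2.2.2
  have i1 : Integrable (fun z => s.ux z ^ 2 / s.θ z) (stm s.S T) := by
    refine (hd.const_mul (V / p.μ)).mono' aesm ?_
    filter_upwards [key] with z hz
    have := hz.2.2
    rw [Real.norm_eq_abs, abs_of_nonneg (by positivity)]; exact hz.1
  have i2 : Integrable (fun z => s.θx z ^ 2 / s.θ z ^ 2) (stm s.S T) := by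
    refine (hd.const_mul (V / p.κ)).mono' aesm ?_
    filter_upwards [key] with z hz
    rw [Real.norm_eq_abs, abs_of_nonneg (by positivity)]; exact hz.2.1
  have b1 := integral_mono_ae i1 (hd.const_mul (V / p.μ)) (key.mono fun z hz => hz.1)
  have b2 := integral_mono_ae i2 (hd.const_mul (V / p.κ)) (key.mono fun z hz => hz.2.1)
  rw [integral_const_mul] at b1 b2
  have c1 : V / p.μ * ∫ z, s.diss z ∂stm s.S T ≤ V / p.μ * p.E := by gcongr
  have c2 : V / p.κ * ∫ z, s.diss z ∂stm s.S T ≤ V / p.κ * p.E := by gcongr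
  have n1 : 0 ≤ V / p.μ * p.E := by positivity
  have n2 : 0 ≤ V / p.κ * p.E := by positivity
  exact ⟨i1, by linarith, i2, by linarith⟩

set_option maxHeartbeats 1000000 in
theorem integral_ux_sq_le (p : Params) : ∃ K > 0, ∀ s : Sol p, ∀ T ≥ 0, ∫ z, s.ux z ^ 2 ∂stm s.S T ≤ K := by
  obtain ⟨V, hV, hv⟩ := v_upper p
  obtain ⟨c, hc, hv'⟩ := v_lower p
  obtain ⟨C, hC, hd⟩ := integral_diss_parts p
  obtain ⟨C', hC', hw⟩ := integral_excess_stm_le p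
  have hE := p.E_nonneg; have hκ := p.hκ; have hμ := p.hμ; have hR := p.hR; have hcv := p.hcv
  set B := 2 / p.μ * (3 * p.E + 24 * p.κ / c * C + 3 * p.R ^ 2 / (2 * p.μ * c) * C') with hB
  have hB0 : 0 < B := by positivity
  refine ⟨4 * C + 4 * V * B, by positivity, fun s T hT => ?_⟩
  obtain ⟨d1, d2, d3, d4⟩ := hd s T hT
  obtain ⟨i1, i2, i3, -⟩ := s.integrable_entropy_terms isEntropy_sublinear T
  have hid := s.entropy_identity isEntropy_sublinear hT
  have iw := (s.memLp_excess T).integrable_sq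
  have key : ∀ᵐ z ∂stm s.S T, 0 < s.θ z ∧ c ≤ s.v z ∧ s.v z ≤ V := by
    filter_upwards [ae_stm s.hS T] with z hz
    exact ⟨s.pos_θ hz.1.1.le hz.2, hv' s z.1 hz.1.1.le z.2 hz.2, hv s z.1 hz.1.1.le z.2 hz.2⟩
  have hK : ∫ z, max (s.θ z - 2) 0 ^ 2 * (s.θ z + 4) / s.θ z ^ 3 * s.ux z ^ 2 / s.v z ∂stm s.S T ≤ B := by
    have hlow : ∫ z, (p.μ / 2 * (max (s.θ z - 2) 0 ^ 2 * (s.θ z + 4) / s.θ z ^ 3 * s.ux z ^ 2 / s.v z)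
        + (-(24 * p.κ / c)) * (s.θx z ^ 2 / s.θ z ^ 2) + (-(3 * p.R ^ 2 / (2 * p.μ * c))) *
          max (s.θ z - 2) 0 ^ 2) ∂stm s.S T ≤
        ∫ z, (-(p.κ * (24 * max (s.θ z - 2) 0 / s.θ z ^ 4 * s.θx z ^ 2 / s.v z)) +
      (p.μ * (max (s.θ z - 2) 0 ^ 2 * (s.θ z + 4) / s.θ z ^ 3 * s.ux z ^ 2 / s.v z) -
        p.R * (max (s.θ z - 2) 0 ^ 2 * (s.θ z + 4) / s.θ z ^ 3 * (s.θ z * s.ux z) / s.v z)))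
        ∂stm s.S T := by
      refine integral_mono_ae (integrable_comb i2 d3 iw _ _ _)
        ((i1.const_mul p.κ).neg.add ((i2.const_mul p.μ).sub (i3.const_mul p.R))) ?_
      filter_upwards [key] with z hz
      obtain ⟨hθ, hvl, hvu⟩ := hz
      have hvp : 0 < s.v z := hc.trans_le hvl
      have w0 : 0 ≤ max (s.θ z - 2) 0 := le_max_right _ _
      have w1 : max (s.θ z - 2) 0 ≤ s.θ z := max_le (by linarith) hθ.le
      have w2 := pospart_mul_self 2 (s.θ z)
      set w := max (s.θ z - 2) 0
      have a1 : p.κ * (24 * w / s.θ z ^ 4 * s.θx z ^ 2 / s.v z) ≤ 24 * p.κ / c * (s.θx z ^ 2 / s.θ z ^ 2) := by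
        have : w ≤ s.θ z ^ 2 := by nlinarith
        calc p.κ * (24 * w / s.θ z ^ 4 * s.θx z ^ 2 / s.v z)
            ≤ p.κ * (24 * s.θ z ^ 2 / s.θ z ^ 4 * s.θx z ^ 2 / c) := by gcongr
          _ = _ := by field_simp
      set k := w ^ 2 * (s.θ z + 4) / s.θ z ^ 3 with hk
      have hk0 : 0 ≤ k := by positivity
      have a2 : k * s.θ z ^ 2 ≤ 3 * w ^ 2 := by
        have : k * s.θ z ^ 2 = w ^ 2 * (s.θ z + 4) / s.θ z := by rw [hk]; field_simp
        rw [this, div_le_iff₀ hθ]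
        have : w ^ 2 * 4 ≤ w ^ 2 * (2 * s.θ z) := by nlinarith
        nlinarith
      have a3 : p.R * (k * (s.θ z * s.ux z) / s.v z) ≤ p.μ / 2 * (k * s.ux z ^ 2 / s.v z) +
          3 * p.R ^ 2 / (2 * p.μ * c) * w ^ 2 := by
        have h1 : 0 ≤ k / (2 * p.μ * s.v z) * (p.μ * s.ux z - p.R * s.θ z) ^ 2 := by positivity
        have h2 : k / (2 * p.μ * s.v z) * (p.μ * s.ux z - p.R * s.θ z) ^ 2 =
          p.μ / 2 * (k * s.ux z ^ 2 / s.v z) + p.R ^ 2 / (2 * p.μ * s.v z) * (k * s.θ z ^ 2) -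
            p.R * (k * (s.θ z * s.ux z) / s.v z) := by field_simp; ring
        have h3 : p.R ^ 2 / (2 * p.μ * s.v z) * (k * s.θ z ^ 2) ≤
          p.R ^ 2 / (2 * p.μ * c) * (3 * w ^ 2) := by gcongr
        have h4 : p.R ^ 2 / (2 * p.μ * c) * (3 * w ^ 2) = 3 * p.R ^ 2 / (2 * p.μ * c) * w ^ 2 := by ring
        linarith
      linarith
    rw [integral_comb i2 d3 iw] at hlow
    have hG0 : 0 ≤ p.cv * ∫ x in s.S, max (s.θ (0, x) - 2) 0 ^ 3 / s.θ (0, x) ^ 2 := by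
      refine mul_nonneg hcv.le (s.integral_nonneg_S fun x hx => ?_)
      have := s.pos_θ le_rfl hx
      have : 0 ≤ max (s.θ (0, x) - 2) 0 := le_max_right _ _
      positivity
    have hGT : p.cv * ∫ x in s.S, max (s.θ (T, x) - 2) 0 ^ 3 / s.θ (T, x) ^ 2 ≤ 3 * p.E := by
      obtain ⟨j1, j2⟩ := s.integral_pospart_le hT
      have h1 : ∫ x in s.S, max (s.θ (T, x) - 2) 0 ^ 3 / s.θ (T, x) ^ 2 ≤ ∫ x in s.S, max (s.θ (T, x) - 2) 0 := by
        refine integral_mono_ae (s.integrable_entropy isEntropy_sublinear hT) j1 (s.ae_S fun x hx => ?_)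
        have h0 := s.pos_θ hT hx
        have h1 : 0 ≤ max (s.θ (T, x) - 2) 0 := le_max_right _ _
        have h2 : max (s.θ (T, x) - 2) 0 ≤ s.θ (T, x) := max_le (by linarith) h0.le
        rw [div_le_iff₀ (by positivity), pow_succ, mul_comm]
        gcongr
      calc _ ≤ p.cv * (3 * (p.E / p.cv)) := by gcongr; exact h1.trans j2
        _ = 3 * p.E := by field_simp
    have e4 : 24 * p.κ / c * ∫ z, s.θx z ^ 2 / s.θ z ^ 2 ∂stm s.S T ≤ 24 * p.κ / c * C := by gcongr
    have e5 : 3 * p.R ^ 2 / (2 * p.μ * c) * ∫ z, max (s.θ z - 2) 0 ^ 2 ∂stm s.S T ≤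
      3 * p.R ^ 2 / (2 * p.μ * c) * C' := by gcongr; exact hw s T hT
    have e6 : p.μ / 2 * ∫ z, max (s.θ z - 2) 0 ^ 2 * (s.θ z + 4) / s.θ z ^ 3 * s.ux z ^ 2 / s.v z
        ∂stm s.S T ≤ p.μ / 2 * B := by
      have : p.μ / 2 * B = 3 * p.E + 24 * p.κ / c * C + 3 * p.R ^ 2 / (2 * p.μ * c) * C' := by rw [hB]; field_simp
      rw [this]; linarith
    exact le_of_mul_le_mul_left e6 (by positivity)
  have hpt : ∀ᵐ z ∂stm s.S T, s.ux z ^ 2 ≤ 4 * (s.ux z ^ 2 / s.θ z) + 4 * V *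
      (max (s.θ z - 2) 0 ^ 2 * (s.θ z + 4) / s.θ z ^ 3 * s.ux z ^ 2 / s.v z) := by
    filter_upwards [key] with z hz
    obtain ⟨hθ, hvl, hvu⟩ := hz
    have hvp : 0 < s.v z := hc.trans_le hvl
    by_cases h4 : s.θ z ≤ 4
    · have h1 : s.ux z ^ 2 ≤ 4 * (s.ux z ^ 2 / s.θ z) := by
        rw [mul_div_assoc', le_div_iff₀ hθ]
        nlinarith [sq_nonneg (s.ux z)]
      have h2 : 0 ≤ max (s.θ z - 2) 0 ^ 2 * (s.θ z + 4) / s.θ z ^ 3 * s.ux z ^ 2 / s.v z := by positivity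
      nlinarith
    · push Not at h4
      have hw : max (s.θ z - 2) 0 = s.θ z - 2 := max_eq_left (by linarith)
      rw [hw]
      have hk : 1 / 4 ≤ (s.θ z - 2) ^ 2 * (s.θ z + 4) / s.θ z ^ 3 := by
        rw [div_le_div_iff₀ (by norm_num) (by positivity)]
        nlinarith [sq_nonneg (s.θ z), mul_pos hθ hθ]
      have h1 : 1 / 4 * s.ux z ^ 2 / V ≤ (s.θ z - 2) ^ 2 * (s.θ z + 4) / s.θ z ^ 3 * s.ux z ^ 2 / s.v z := by
        gcongr
      have h2 : 0 ≤ s.ux z ^ 2 / s.θ z := by positivity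
      calc s.ux z ^ 2 = 4 * 0 + 4 * V * (1 / 4 * s.ux z ^ 2 / V) := by field_simp; ring
        _ ≤ _ := by gcongr
  have hfin := integral_mono_ae (s.lux T).integrable_sq ((d1.const_mul 4).add (i2.const_mul (4 * V))) hpt
  simp only [Pi.add_apply] at hfin
  rw [integral_add (d1.const_mul 4) (i2.const_mul (4 * V)), integral_const_mul, integral_const_mul] at hfin
  refine hfin.trans ?_
  gcongr

/-- `M` bounds the temperature up to the time `T`. -/
def TempLe (s : Sol p) (T M : ℝ) : Prop := 1 ≤ M ∧ ∀ t ∈ Icc 0 T, ∀ x ∈ closure s.S, s.θ (t, x) ≤ M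

theorem TempLe.mono {s : Sol p} {T M t : ℝ} (h : s.TempLe T M) (ht : t ≤ T) : s.TempLe t M :=
  ⟨h.1, fun r hr x hx => h.2 r ⟨hr.1, hr.2.trans ht⟩ x hx⟩

theorem TempLe.ae {s : Sol p} {T M : ℝ} (h : s.TempLe T M) : ∀ᵐ z ∂stm s.S T, s.θ z ≤ M := by
  filter_upwards [ae_stm s.hS T] with z hz using h.2 z.1 ⟨hz.1.1.le, hz.1.2⟩ z.2 hz.2

local notation "δ[" s "]" z:max => 2 * max (Sol.θ s z - 2) 0 * (Sol.θ s z ^ 2 + 2 * Sol.θ s z + 4) / Sol.θ s z ^ 3 * Sol.θx s z ^ 2 / Sol.v s z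

set_option maxHeartbeats 1000000 in
theorem integral_θx_sq_le (p : Params) : ∃ K > 0, ∀ s : Sol p, ∀ T ≥ 0, ∀ M, s.TempLe T M →
    ∫ x in s.S, max (s.θ (T, x) - 2) 0 ^ 3 / s.θ (T, x) ≤ K * M ∧
    ∫ z, s.θx z ^ 2 ∂stm s.S T ≤ K * M := by
  obtain ⟨V, hV, hv⟩ := v_upper p
  obtain ⟨c, hc, hv'⟩ := v_lower p
  obtain ⟨C, hC, hd⟩ := integral_diss_parts p
  obtain ⟨C', hC', hw⟩ := integral_excess_stm_le p
  obtain ⟨C₂, hC₂, hux⟩ := integral_ux_sq_le p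
  have hE := p.E_nonneg; have hκ := p.hκ; have hμ := p.hμ; have hR := p.hR; have hcv := p.hcv
  set B := p.cv * p.N ^ 2 + 3 * p.μ / c * C₂ + 2 * p.R / c * (C' + C₂) with hB
  have hB0 : 0 < B := by positivity
  refine ⟨B / p.cv + 16 * C + V * B / p.κ, by positivity, fun s T hT M hM => ?_⟩
  obtain ⟨-, -, d3, d4⟩ := hd s T hT
  obtain ⟨i1, i2, i3, -⟩ := s.integrable_entropy_terms isEntropy_quadratic T
  have hid := s.entropy_identity isEntropy_quadratic hT
  have iw := (s.memLp_excess T).integrable_sq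
  have iu := (s.lux T).integrable_sq
  have hM0 : 0 < M := by linarith [hM.1]
  have key : ∀ᵐ z ∂stm s.S T, 0 < s.θ z ∧ c ≤ s.v z ∧ s.v z ≤ V ∧ s.θ z ≤ M := by
    filter_upwards [ae_stm s.hS T, hM.ae] with z hz hz'
    exact ⟨s.pos_θ hz.1.1.le hz.2, hv' s z.1 hz.1.1.le z.2 hz.2, hv s z.1 hz.1.1.le z.2 hz.2, hz'⟩
  have hup : ∫ z, (-(p.κ * (δ[s] z)) + (p.μ * (max (s.θ z - 2) 0 ^ 2 * (2 * s.θ z + 2) / s.θ z ^ 2 *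
      s.ux z ^ 2 / s.v z) - p.R * (max (s.θ z - 2) 0 ^ 2 * (2 * s.θ z + 2) / s.θ z ^ 2 *
      (s.θ z * s.ux z) / s.v z))) ∂stm s.S T ≤
      ∫ z, ((-p.κ) * (δ[s] z) + (3 * p.μ / c * M + 2 * p.R / c * M) * s.ux z ^ 2 +
      2 * p.R / c * M * max (s.θ z - 2) 0 ^ 2) ∂stm s.S T := by
    refine integral_mono_ae ((i1.const_mul p.κ).neg.add ((i2.const_mul p.μ).sub (i3.const_mul p.R)))
      (integrable_comb i1 iu iw _ _ _) ?_
    filter_upwards [key] with z hz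
    obtain ⟨hθ, hvl, hvu, hθM⟩ := hz
    have hvp : 0 < s.v z := hc.trans_le hvl
    have w0 : 0 ≤ max (s.θ z - 2) 0 := le_max_right _ _
    have w1 : max (s.θ z - 2) 0 ≤ s.θ z := max_le (by linarith) hθ.le
    have w2 := pospart_mul_self 2 (s.θ z)
    set w := max (s.θ z - 2) 0
    have hk : w ^ 2 * (2 * s.θ z + 2) / s.θ z ^ 2 * s.θ z ≤ 3 * w ^ 2 := by
      have : w ^ 2 * (2 * s.θ z + 2) / s.θ z ^ 2 * s.θ z = w ^ 2 * (2 * s.θ z + 2) / s.θ z := by field_simp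
      rw [this, div_le_iff₀ hθ]
      have : w ^ 2 * 2 ≤ w ^ 2 * (s.θ z) := by nlinarith
      nlinarith
    have hk1 : w ^ 2 * (2 * s.θ z + 2) / s.θ z ^ 2 ≤ 3 * M := by
      refine le_of_mul_le_mul_right (hk.trans ?_) hθ
      nlinarith
    set k := w ^ 2 * (2 * s.θ z + 2) / s.θ z ^ 2 with hkdef
    have hk0 : 0 ≤ k := by positivity
    have a1 : p.μ * (k * s.ux z ^ 2 / s.v z) ≤ 3 * p.μ / c * M * s.ux z ^ 2 := by
      calc _ ≤ p.μ * (3 * M * s.ux z ^ 2 / c) := by gcongr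
        _ = _ := by ring
    have a2 : -(p.R * (k * (s.θ z * s.ux z) / s.v z)) ≤ 2 * p.R / c * M * (w ^ 2 + s.ux z ^ 2) := by
      have h1 : -(k * (s.θ z * s.ux z)) ≤ 3 * w ^ 2 * |s.ux z| := by
        calc -(k * (s.θ z * s.ux z)) = (k * s.θ z) * (-s.ux z) := by ring
          _ ≤ (k * s.θ z) * |s.ux z| := by gcongr; exact neg_le_abs _
          _ ≤ _ := by gcongr
      have h2 : 3 * w ^ 2 * |s.ux z| ≤ 2 * M * (w ^ 2 + s.ux z ^ 2) := by
        have h3 : w * |s.ux z| ≤ (w ^ 2 + s.ux z ^ 2) / 2 := by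
          nlinarith [sq_nonneg (w - |s.ux z|), sq_abs (s.ux z)]
        have h4 : 3 * w ^ 2 * |s.ux z| ≤ 3 * M * (w * |s.ux z|) := by
          have : w * (w * |s.ux z|) ≤ M * (w * |s.ux z|) := by gcongr; linarith
          nlinarith
        nlinarith [sq_nonneg w, sq_nonneg (s.ux z)]
      have h5 : -(p.R * (k * (s.θ z * s.ux z) / s.v z)) = p.R * (-(k * (s.θ z * s.ux z)) / s.v z) := by ring
      rw [h5]
      calc _ ≤ p.R * (2 * M * (w ^ 2 + s.ux z ^ 2) / s.v z) := by gcongr; exact h1.trans h2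
        _ ≤ p.R * (2 * M * (w ^ 2 + s.ux z ^ 2) / c) := by gcongr
        _ = _ := by ring
    linarith
  rw [integral_comb i1 iu iw] at hup
  have hG0 : p.cv * ∫ x in s.S, max (s.θ (0, x) - 2) 0 ^ 3 / s.θ (0, x) ≤ p.cv * p.N ^ 2 := by
    refine mul_le_left ?_ hcv.le
    refine le_trans ?_ s.data_le.2.2.2.2.1
    refine integral_mono_ae (s.integrable_entropy isEntropy_quadratic le_rfl)
      (s.sθ 0 le_rfl).integrable_sq (s.ae_S fun x hx => ?_)
    have h0 := s.pos_θ le_rfl hx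
    have h1 : 0 ≤ max (s.θ (0, x) - 2) 0 := le_max_right _ _
    have h2 : max (s.θ (0, x) - 2) 0 ≤ s.θ (0, x) := max_le (by linarith) h0.le
    have h3 : max (s.θ (0, x) - 2) 0 ≤ |s.θ (0, x) - 1| :=
      max_le (by linarith [le_abs_self (s.θ (0, x) - 1)]) (abs_nonneg _)
    simp only
    rw [div_le_iff₀ h0, ← sq_abs (s.θ (0, x) - 1), pow_succ]
    gcongr
  have hGT : 0 ≤ ∫ x in s.S, max (s.θ (T, x) - 2) 0 ^ 3 / s.θ (T, x) := by
    refine (s.integral_nonneg_S fun x hx => ?_)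
    have := s.pos_θ hT hx
    have : 0 ≤ max (s.θ (T, x) - 2) 0 := le_max_right _ _
    positivity
  have hGg : 0 ≤ ∫ z, δ[s] z ∂stm s.S T := by
    refine integral_nonneg_of_ae ?_
    filter_upwards [key] with z hz
    have h1 := hz.1
    have h2 := hc.trans_le hz.2.1
    have : 0 ≤ max (s.θ z - 2) 0 := le_max_right _ _
    simp only [Pi.zero_apply]
    positivity
  have e1 : 3 * p.μ / c * M * ∫ z, s.ux z ^ 2 ∂stm s.S T ≤ 3 * p.μ / c * M * C₂ := by gcongr; exact hux s T hT
  have e2 : 2 * p.R / c * M * ((∫ z, max (s.θ z - 2) 0 ^ 2 ∂stm s.S T) + ∫ z, s.ux z ^ 2 ∂stm s.S T)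
      ≤ 2 * p.R / c * M * (C' + C₂) := by
    gcongr
    · exact hw s T hT
    · exact hux s T hT
  have e3 : p.cv * p.N ^ 2 ≤ p.cv * p.N ^ 2 * M := le_mul_of_one_le_right (by positivity) hM.1
  have e4 : B * M = p.cv * p.N ^ 2 * M + 3 * p.μ / c * M * C₂ + 2 * p.R / c * M * (C' + C₂) := by rw [hB]; ring
  have f1 : p.cv * ∫ x in s.S, max (s.θ (T, x) - 2) 0 ^ 3 / s.θ (T, x) ≤ B * M := by
    have := mul_nonneg hκ.le hGg
    linarith
  have f2 : p.κ * ∫ z, δ[s] z ∂stm s.S T ≤ B * M := by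
    have := mul_nonneg hcv.le hGT
    linarith
  constructor
  · have h1 : ∫ x in s.S, max (s.θ (T, x) - 2) 0 ^ 3 / s.θ (T, x) ≤ B / p.cv * M := by
      rw [div_mul_eq_mul_div, le_div_iff₀ hcv]; linarith
    refine h1.trans ?_
    have : 0 ≤ 16 * C + V * B / p.κ := by positivity
    nlinarith
  have hpt : ∀ᵐ z ∂stm s.S T, s.θx z ^ 2 ≤ 16 * (s.θx z ^ 2 / s.θ z ^ 2) + V *
      (δ[s] z) := by
    filter_upwards [key] with z hz
    obtain ⟨hθ, hvl, hvu, -⟩ := hz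
    have hvp : 0 < s.v z := hc.trans_le hvl
    by_cases h4 : s.θ z ≤ 4
    · have h1 : s.θx z ^ 2 ≤ 16 * (s.θx z ^ 2 / s.θ z ^ 2) := by
        rw [mul_div_assoc', le_div_iff₀ (by positivity), mul_comm]
        gcongr
        nlinarith
      have h2 : 0 ≤ V * (δ[s] z) := by positivity
      linarith
    · push Not at h4
      have hw : max (s.θ z - 2) 0 = s.θ z - 2 := max_eq_left (by linarith)
      rw [hw]
      have hk : 1 ≤ 2 * (s.θ z - 2) * (s.θ z ^ 2 + 2 * s.θ z + 4) / s.θ z ^ 3 := by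
        rw [le_div_iff₀ (by positivity)]
        nlinarith [pow_le_pow_left₀ (by norm_num) h4.le 3]
      have h1 : 1 * s.θx z ^ 2 / V ≤ 2 * (s.θ z - 2) * (s.θ z ^ 2 + 2 * s.θ z + 4) / s.θ z ^ 3 *
        s.θx z ^ 2 / s.v z := by gcongr
      have h2 : 0 ≤ s.θx z ^ 2 / s.θ z ^ 2 := by positivity
      calc s.θx z ^ 2 = 16 * 0 + V * (1 * s.θx z ^ 2 / V) := by field_simp; ring
        _ ≤ _ := by gcongr
  have hfin := integral_mono_ae (s.lθx T).integrable_sq ((d3.const_mul 16).add (i1.const_mul V)) hpt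
  simp only [Pi.add_apply] at hfin
  rw [integral_add (d3.const_mul 16) (i1.const_mul V), integral_const_mul, integral_const_mul] at hfin
  refine hfin.trans ?_
  have g1 : ∫ z, δ[s] z ∂stm s.S T ≤ B * M / p.κ := by
    rw [le_div_iff₀ hκ]; linarith
  have g2 := mul_le_left g1 hV.le
  have g3 : C ≤ C * M := le_mul_of_one_le_right hC.le hM.1
  have g4 : 0 ≤ B / p.cv * M := by positivity
  have g5 : V * (B * M / p.κ) = V * B / p.κ * M := by ring
  linarith

end Sol

/-! ### The energy inequality for first derivatives -/

theorem measurePreserving_shift (r : ℝ) : MeasurePreserving (fun z : ℝ × ℝ => (z.1 - r, z.2)) volume volume :=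
  (measurePreserving_sub_right volume r).prod (MeasurePreserving.id volume)

/-- Continuity of translations in time, in weak form. -/
theorem continuous_integral_shift {F G : ℝ × ℝ → ℝ} (hF : MemLp F 2 volume)
    (hG : MemLp G 2 volume) : Continuous fun r : ℝ => ∫ z : ℝ × ℝ, F (z.1 - r, z.2) * G z := by
  have h2 : Fact ((1:ℝ≥0∞) ≤ 2) := ⟨by norm_num⟩
  set g : C(ℝ, C(ℝ × ℝ, ℝ × ℝ)) :=
    (ContinuousMap.mk (fun q : ℝ × (ℝ × ℝ) => (q.2.1 - q.1, q.2.2)) (by fun_prop)).curry with hg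
  have hgm : ∀ r, MeasurePreserving (g r) (volume : Measure (ℝ × ℝ)) volume := measurePreserving_shift
  have h := (continuous_const (y := hF.toLp F)).compMeasurePreservingLp g.continuous hgm ENNReal.ofNat_ne_top
  have h3 := h.inner (continuous_const (y := hG.toLp G)) (𝕜 := ℝ)
  refine h3.congr fun r => ?_
  rw [L2.inner_def]
  refine integral_congr_ae ?_
  have e1 := Lp.coeFn_compMeasurePreserving (hF.toLp F) (hgm r)
  have e2 := (hgm r).quasiMeasurePreserving.ae_eq_comp hF.coeFn_toLp
  filter_upwards [e1, e2, hG.coeFn_toLp] with z h1 h2 h3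
  rw [h1, h3]
  simp only [Function.comp_apply] at h2 ⊢
  rw [h2]
  simp only [RCLike.inner_apply, conj_trivial]
  rw [mul_comm]
  rfl

theorem integral_shift_swap {F G : ℝ × ℝ → ℝ} (hF : MemLp F 2 volume) (hG : MemLp G 2 volume)
    (mF : Measurable F) (mG : Measurable G) (h : ℝ) :
    Integrable (fun z : ℝ × ℝ => (∫ r in Ioc 0 h, F (z.1 - r, z.2)) * G z) ∧
    ∫ z : ℝ × ℝ, (∫ r in Ioc 0 h, F (z.1 - r, z.2)) * G z =
      ∫ r in Ioc 0 h, ∫ z : ℝ × ℝ, F (z.1 - r, z.2) * G z := by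
  have hm : Measurable fun q : ℝ × (ℝ × ℝ) => F (q.2.1 - q.1, q.2.2) * G q.2 := by fun_prop
  have hsh : ∀ r : ℝ, MemLp (fun z : ℝ × ℝ => F (z.1 - r, z.2)) 2 volume := fun r =>
    hF.comp_measurePreserving (measurePreserving_shift r)
  have hin : Integrable (fun q : ℝ × (ℝ × ℝ) => F (q.2.1 - q.1, q.2.2) * G q.2)
      ((vol (Ioc 0 h)).prod volume) := by
    rw [integrable_prod_iff hm.aestronglyMeasurable]
    refine ⟨.of_forall fun r => (hsh r).integrable_mul hG, ?_⟩
    refine Integrable.mono' (g := fun _ => (∫ z, F z ^ 2) + ∫ z, G z ^ 2) (integrable_const _) ?_ ?_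
    · exact hm.norm.stronglyMeasurable.integral_prod_right.aestronglyMeasurable
    · refine .of_forall fun r => ?_
      rw [Real.norm_eq_abs, abs_of_nonneg (integral_nonneg fun z => norm_nonneg _)]
      have e : ∫ z : ℝ × ℝ, F (z.1 - r, z.2) ^ 2 = ∫ z, F z ^ 2 :=
        (measurePreserving_shift r).integral_comp (by
            have : MeasurableEmbedding fun z : ℝ × ℝ => (z.1 - r, z.2) :=
              ((MeasurableEquiv.subRight r).prodCongr (MeasurableEquiv.refl ℝ)).measurableEmbedding
            exact this) (fun z => F z ^ 2)
      rw [← e, ← integral_add (hsh r).integrable_sq hG.integrable_sq]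
      refine integral_mono ((hsh r).integrable_mul hG).norm
        ((hsh r).integrable_sq.add hG.integrable_sq) fun z => ?_
      simp only [Real.norm_eq_abs, abs_mul]
      nlinarith [sq_nonneg (|F (z.1 - r, z.2)| - |G z|), sq_abs (F (z.1 - r, z.2)), sq_abs (G z),
        sq_nonneg (F (z.1 - r, z.2)), sq_nonneg (G z)]
  have e : (fun z : ℝ × ℝ => (∫ r in Ioc 0 h, F (z.1 - r, z.2)) * G z) = fun z =>
      ∫ r in Ioc 0 h, F (z.1 - r, z.2) * G z := by
    ext z; rw [integral_mul_const]
  rw [e]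
  refine ⟨hin.integral_prod_right, ?_⟩
  exact (integral_integral_swap (f := fun r (z : ℝ × ℝ) => F (z.1 - r, z.2) * G z) hin).symm

/-- A function of time and space with square integrable derivatives `f_t`, `f_x`, `f_xx`, and with
Dirichlet or Neumann conditions on the boundary. -/
structure Evol (S : Set ℝ) (c : ℝ) (f fx fxx ft : ℝ × ℝ → ℝ) : Prop where
  hS : IsLine S
  mf : Measurable f
  mfx : Measurable fx
  mfxx : Measurable fxx
  mft : Measurable ft
  sf : ∀ t ≥ 0, MemLp (fun x => f (t, x) - c) 2 (vol S)
  lfx : ∀ T, MemLp fx 2 (stm S T)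
  lfxx : ∀ T, MemLp fxx 2 (stm S T)
  lft : ∀ T, MemLp ft 2 (stm S T)
  xf : ∀ᵐ t ∂vol₊, IsPrim (closure S) (fun x => f (t, x)) (fun x => fx (t, x))
  xfx : ∀ᵐ t ∂vol₊, IsPrim (closure S) (fun x => fx (t, x)) (fun x => fxx (t, x))
  tf : ∀ᵐ x ∂vol S, IsPrim (Ici 0) (fun t => f (t, x)) (fun t => ft (t, x))
  bd : S = univ ∨ (∀ t ≥ 0, f (t, 0) = c) ∨ ∀ᵐ t ∂vol₊, fx (t, 0) = 0

theorem Sol.evol_u {p : Params} (s : Sol p) : Evol s.S 0 s.u s.ux s.uxx s.ut where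
  hS := s.hS
  mf := s.m_u
  mfx := s.m_ux
  mfxx := s.m_uxx
  mft := s.m_ut
  sf := by simpa using s.su
  lfx := s.lux
  lfxx := s.luxx
  lft := s.lut
  xf := s.xu
  xfx := s.xux
  tf := s.tu
  bd := s.bdry.imp_right fun h => Or.inl h.1

theorem Sol.evol_θ {p : Params} (s : Sol p) : Evol s.S 1 s.θ s.θx s.θxx s.θt where
  hS := s.hS
  mf := s.m_θ
  mfx := s.m_θx
  mfxx := s.m_θxx
  mft := s.m_θt
  sf := s.sθ
  lfx := s.lθx
  lfxx := s.lθxx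
  lft := s.lθt
  xf := s.xθ
  xfx := s.xθx
  tf := s.tθ
  bd := s.bdry.imp_right fun h => h.2

namespace Evol

variable {S : Set ℝ} {c : ℝ} {f fx fxx ft : ℝ × ℝ → ℝ}

theorem integrable_mul (h : Evol S c f fx fxx ft) (T : ℝ) :
    Integrable (fun z => ft z * fxx z) (stm S T) := (h.lft T).integrable_mul (h.lfxx T)

theorem memLp_indicator (h : Evol S c f fx fxx ft) {g : ℝ × ℝ → ℝ} {T : ℝ} (hg : MemLp g 2 (stm S T))
    {a b : ℝ} (ha : 0 ≤ a) (hb : b ≤ T) : MemLp ((Ioc a b ×ˢ S).indicator g) 2 volume := by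
  rw [memLp_indicator_iff_restrict (measurableSet_Ioc.prod h.hS.measurableSet)]
  rw [stm, Measure.prod_restrict] at hg
  exact hg.mono_measure (Measure.restrict_mono (prod_mono (Ioc_subset_Ioc ha hb) le_rfl) le_rfl)

/-- The energy inequality for `f_x` between a time `a` at which `f` has the derivative `g₀`
and almost every later time. -/
theorem integral_sq_le (h : Evol S c f fx fxx ft) {a : ℝ} (ha : 0 ≤ a) {g₀ : ℝ → ℝ}
    (hg : IsPrim (closure S) (fun x => f (a, x)) g₀) (lg : MemLp g₀ 2 (vol S)) :
    ∀ᵐ t ∂vol (Ioi a), ∫ x in S, fx (t, x) ^ 2 ≤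
      (∫ x in S, g₀ x ^ 2) - 2 * ∫ τ in a..t, ∫ x in S, ft (τ, x) * fxx (τ, x) := by
  have hJ := h.hS.ordConnected_closure
  set E₀ := ∫ x in S, g₀ x ^ 2 with hE₀
  set E : ℝ → ℝ := fun t => if t ≤ a then E₀ else ∫ x in S, fx (t, x) ^ 2 with hE
  have sub0 : Ioi a ⊆ Ioi (0:ℝ) := Ioi_subset_Ioi ha
  have hEa : ∀ b, IntervalIntegrable E volume a b := by
    intro b
    rcases le_total a b with hab | hab
    · rw [intervalIntegrable_iff_Ioc hab]
      have h1 : IntegrableOn (fun t => ∫ x in S, fx (t, x) ^ 2) (Ioc a b) :=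
        IntegrableOn.mono_set (h.lfx b).integrable_sq.integral_prod_left (Ioc_subset_Ioc_left ha)
      refine h1.congr_fun (fun t ht => ?_) measurableSet_Ioc
      simp only [hE]
      rw [if_neg (not_le.2 ht.1)]
    · refine IntervalIntegrable.symm ?_
      rw [intervalIntegrable_iff_Ioc hab]
      have h1 : IntegrableOn (fun _ : ℝ => E₀) (Ioc b a) := by simp
      refine h1.congr_fun (fun t ht => ?_) measurableSet_Ioc
      simp only [hE]
      rw [if_pos ht.2]
  have hEi : ∀ b b', IntervalIntegrable E volume b b' := fun b b' => (hEa b).symm.trans (hEa b')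
  have hfxs : ∀ᵐ t ∂vol₊, MemLp (fun x => fx (t, x)) 2 (vol S) :=
    Sol.ae_Ioi_of_Ioc fun T => MemLp.ae_slice (h.lfx T)
  have hfxxs : ∀ᵐ t ∂vol₊, MemLp (fun x => fxx (t, x)) 2 (vol S) :=
    Sol.ae_Ioi_of_Ioc fun T => MemLp.ae_slice (h.lfxx T)
  have hprev : ∀ᵐ t, IsPrim (closure S) (fun x => f (max t a, x)) (fun x => if t ≤ a then g₀ x else fx (t, x)) ∧
      MemLp (fun x => if t ≤ a then g₀ x else fx (t, x)) 2 (vol S) := by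
    filter_upwards [(ae_restrict_iff' measurableSet_Ioi).1 h.xf,
      (ae_restrict_iff' measurableSet_Ioi).1 hfxs] with t h1 h2
    by_cases hta : t ≤ a
    · simp only [if_pos hta, max_eq_right hta]; exact ⟨hg, lg⟩
    · simp only [if_neg hta, max_eq_left (not_le.1 hta).le]
      have h0 : t ∈ Ioi (0:ℝ) := lt_of_le_of_lt ha (not_le.1 hta)
      exact ⟨h1 h0, h2 h0⟩
  have main : ∀ b > a, ∀ e > 0, (∫ t in (b - e)..b, E t) - e * E₀ ≤ -2 * ∫ r in 0..e,
      ∫ z : ℝ × ℝ, (Ioc a b ×ˢ S).indicator ft (z.1 - r, z.2) * (Ioc a b ×ˢ S).indicator fxx z := by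
    intro b hb e he
    have hms : MeasurableSet (Ioc a b ×ˢ S) := measurableSet_Ioc.prod h.hS.measurableSet
    have lF := h.memLp_indicator (h.lft b) ha (le_refl b)
    have lG := h.memLp_indicator (h.lfxx b) ha (le_refl b)
    obtain ⟨i1, i2⟩ := integral_shift_swap lF lG (h.mft.indicator hms) (h.mfxx.indicator hms) e
    rw [integral_of_le he.le, ← i2]
    have e1 : (fun z : ℝ × ℝ => (∫ r in Ioc 0 e, (Ioc a b ×ˢ S).indicator ft (z.1 - r, z.2)) *
        (Ioc a b ×ˢ S).indicator fxx z) = (Ioc a b ×ˢ S).indicator fun z =>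
        (∫ r in Ioc 0 e, (Ioc a b ×ˢ S).indicator ft (z.1 - r, z.2)) * fxx z := by
      ext z
      by_cases hz : z ∈ Ioc a b ×ˢ S <;> simp [hz]
    rw [e1, integrable_indicator_iff hms] at i1
    rw [e1, integral_indicator hms]
    rw [IntegrableOn, Measure.volume_eq_prod, ← Measure.prod_restrict] at i1
    rw [Measure.volume_eq_prod, ← Measure.prod_restrict, integral_prod _ i1]
    have hsh : IntervalIntegrable (fun t => E (t - e)) volume a b := by
      simpa only [sub_add_cancel] using (hEi (a - e) (b - e)).comp_sub_right e
    have e2 : (∫ t in (b - e)..b, E t) - e * E₀ = ∫ t in Ioc a b, (E t - E (t - e)) := by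
      rw [← integral_of_le hb.le, interval_sub (hEi _ _) hsh, intervalIntegral.integral_comp_sub_right]
      have e3 : ∫ t in (a - e)..a, E t = e * E₀ := by
        have : ∫ t in (a - e)..a, E t = ∫ t in (a - e)..a, E₀ := by
          refine interval_congr fun t ht => ?_
          rw [uIcc_of_le (by linarith)] at ht
          simp only [hE]
          rw [if_pos ht.2]
        rw [this, interval_const]; simp
      have e4 := integral_add_adjacent_intervals (hEi (a - e) a) (hEi a b)
      have e5 := integral_add_adjacent_intervals (hEi (a - e) (b - e)) (hEi (b - e) b)
      linarith
    rw [e2, ← integral_const_mul]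
    refine integral_mono_ae ?_ (i1.integral_prod_left.const_mul _) ?_
    · exact (intervalIntegrable_iff_Ioc hb.le).1 ((hEi a b).sub hsh)
    have hprev' : ∀ᵐ t, _ := (measurePreserving_sub_right volume e).quasiMeasurePreserving.ae hprev
    have sub1 : Ioc a b ⊆ Ioi (0:ℝ) := fun t ht => lt_of_le_of_lt ha ht.1
    have hbd : ∀ᵐ t ∂vol₊, S = univ ∨ (∀ t ≥ 0, f (t, 0) = c) ∨ fx (t, 0) = 0 := by
      rcases h.bd with h | h | h
      · exact .of_forall fun _ => Or.inl h
      · exact .of_forall fun _ => Or.inr (Or.inl h)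
      · filter_upwards [h] with t ht using Or.inr (Or.inr ht)
    filter_upwards [ae_restrict_of_ae hprev', ae_mem_Ioc, ae_mono_set sub1 h.xf, ae_mono_set sub1 h.xfx,
      ae_mono_set sub1 hfxs, ae_mono_set sub1 hfxxs,
      ae_mono_set sub1 hbd]
      with t hp ht hx hxx l1 l2 hb0
    obtain ⟨p1, p2⟩ := hp
    have ht0 : 0 ≤ t := ha.trans ht.1.le
    set g : ℝ → ℝ := fun x => if t - e ≤ a then g₀ x else fx (t - e, x) with hgdef
    have hE1 : E (t - e) = ∫ x in S, g x ^ 2 := by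
      simp only [hE, hgdef]
      split_ifs with h1
      · rfl
      · rfl
    have hE2 : E t = ∫ x in S, fx (t, x) ^ 2 := by simp only [hE]; rw [if_neg (not_le.2 ht.1)]
    have hD : MemLp (fun x => f (t, x) - f (max (t - e) a, x)) 2 (vol S) := by
      have := (h.sf t ht0).sub (h.sf (max (t - e) a) (ha.trans (le_max_right _ _)))
      refine this.congr_norm ?_ ?_ |> fun h => h
      · have := h.mf
        exact aesm
      · refine .of_forall fun x => ?_
        simp
    have hip := hxx.integral_mul_eq h.hS (hx.sub p1) l1 l2 hD (l1.sub p2) (by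
      rcases hb0 with h0 | h0 | h0
      · exact Or.inl h0
      · right
        simp [h0 t ht0, h0 (max (t - e) a) (ha.trans (le_max_right _ _))]
      · right; simp [h0])
    have hfe : ∫ x in S, fxx (t, x) * (f (t, x) - f (max (t - e) a, x)) =
        ∫ x in S, (∫ r in Ioc 0 e, (Ioc a b ×ˢ S).indicator ft (t - r, x)) * fxx (t, x) := by
      refine integral_congr_ae ?_
      filter_upwards [h.tf, ae_restrict_mem h.hS.measurableSet] with x htx hxS
      rw [mul_comm]
      congr 1
      have hm0 : a ≤ max (t - e) a := le_max_right _ _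
      have hmt : max (t - e) a ≤ t := max_le (by linarith) ht.1.le
      rw [htx.sub_eq (mem_Ici.2 (ha.trans hm0)) (mem_Ici.2 ht0), integral_of_le hmt, ← integral_of_le he.le,
        intervalIntegral.integral_comp_sub_left (fun r => (Ioc a b ×ˢ S).indicator ft (r, x)) t, sub_zero,
        integral_of_le (by linarith)]
      have e6 : (fun r => (Ioc a b ×ˢ S).indicator ft (r, x)) = (Ioc a b).indicator fun r => ft (r, x) := by
        ext r
        by_cases hr : r ∈ Ioc a b
        · rw [indicator_of_mem hr, indicator_of_mem (mk_mem_prod hr hxS)]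
        · rw [indicator_of_notMem hr, indicator_of_notMem (fun h => hr h.1)]
      rw [e6, setIntegral_indicator measurableSet_Ioc, Ioc_inter_Ioc, min_eq_left ht.2]
    have hsq : E t - E (t - e) ≤ 2 * ∫ x in S, fx (t, x) * (fx (t, x) - g x) := by
      rw [hE1, hE2, ← integral_sub l1.integrable_sq p2.integrable_sq, ← integral_const_mul]
      refine integral_mono (l1.integrable_sq.sub p2.integrable_sq)
        ((l1.integrable_mul (l1.sub p2)).const_mul 2) fun x => ?_
      beta_reduce
      nlinarith [sq_nonneg (fx (t, x) - g x)]
    rw [hip, hfe] at hsq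
    linarith
  have hleb : ∀ᵐ t ∂vol (Ioi a), HasDerivAt (fun y => ∫ τ in a..y, E τ) (E t) t := by
    have : ∀ n : ℕ, ∀ᵐ t, t ∈ uIcc a n → ∀ d ∈ uIcc a (n:ℝ),
        HasDerivAt (fun y => ∫ τ in d..y, E τ) (E t) t := fun n =>
      (hEi a n).ae_hasDerivAt_integral
    filter_upwards [ae_restrict_of_ae (ae_all_iff.2 this), ae_mem_Ioi] with t ht hta
    obtain ⟨n, hn⟩ := exists_nat_ge t
    have hta' : a < t := hta
    exact ht n ⟨inf_le_left.trans hta'.le, hn.trans le_sup_right⟩ a (by simp)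
  filter_upwards [hleb, ae_mem_Ioi] with b hbd hb
  have hba : a < b := hb
  have hms : MeasurableSet (Ioc a b ×ˢ S) := measurableSet_Ioc.prod h.hS.measurableSet
  have hC := continuous_integral_shift (h.memLp_indicator (h.lft b) ha (le_refl b))
    (h.memLp_indicator (h.lfxx b) ha (le_refl b))
  set C := fun r : ℝ => ∫ z : ℝ × ℝ, (Ioc a b ×ˢ S).indicator ft (z.1 - r, z.2) *
    (Ioc a b ×ˢ S).indicator fxx z with hCdef
  have hC0 : C 0 = ∫ τ in a..b, ∫ x in S, ft (τ, x) * fxx (τ, x) := by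
    have e1 : C 0 = ∫ z : ℝ × ℝ, (Ioc a b ×ˢ S).indicator (fun z => ft z * fxx z) z := by
      simp only [hCdef, sub_zero]
      refine integral_congr_ae (.of_forall fun z => ?_)
      by_cases hz : z ∈ Ioc a b ×ˢ S <;> simp [hz]
    rw [e1, integral_indicator hms, integral_of_le hba.le, Measure.volume_eq_prod,
      ← Measure.prod_restrict, integral_prod]
    · have := h.integrable_mul b
      exact this.mono_measure (Measure.prod_mono (Measure.restrict_mono (Ioc_subset_Ioc_left ha) le_rfl) le_rfl)
  have hd1 : HasDerivAt (fun e => ∫ t in (b - e)..b, E t) (E b) 0 := by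
    have h1 : HasDerivAt (fun e => ∫ τ in a..(b - e), E τ) (E b * (-1)) 0 := by
      have h2 : HasDerivAt (fun e : ℝ => b - e) (-1) 0 := by simpa using (hasDerivAt_id (0:ℝ)).const_sub b
      have h3 : HasDerivAt (fun y => ∫ τ in a..y, E τ) (E b) (b - 0) := by simpa using hbd
      exact h3.comp (0:ℝ) h2
    have h2 := h1.const_sub (∫ τ in a..b, E τ)
    refine (h2.congr_deriv (by ring)).congr_of_eventuallyEq (.of_forall fun e => ?_)
    simp only
    rw [integral_interval_sub_left (hEi _ _) (hEi _ _)]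
  have hd2 : HasDerivAt (fun e => ∫ r in 0..e, C r) (C 0) 0 :=
    intervalIntegral.integral_hasDerivAt_right (hC.intervalIntegrable 0 0)
      hC.aestronglyMeasurable.stronglyMeasurableAtFilter hC.continuousAt
  have hd3 := ((hd1.sub ((hasDerivAt_id (0:ℝ)).mul_const E₀)).add (hd2.const_mul 2))
  have hlim := hd3.tendsto_slope_zero_right
  have hle : E b - 1 * E₀ + 2 * C 0 ≤ 0 := by
    refine le_of_tendsto hlim ?_
    filter_upwards [self_mem_nhdsWithin] with e he
    have he' : 0 < e := he
    have := main b hba e he'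
    simp only [Pi.add_apply, Pi.sub_apply, id, zero_add, sub_zero, intervalIntegral.integral_same,
      zero_mul, mul_zero, add_zero, smul_eq_mul]
    exact mul_nonpos_of_nonneg_of_nonpos (inv_nonneg.2 he'.le) (by linarith)
  have hEb : E b = ∫ x in S, fx (b, x) ^ 2 := by simp only [hE]; rw [if_neg (not_le.2 hba)]
  rw [← hC0, ← hEb]
  linarith

end Evol

/-! ### The derivative of the specific volume -/

theorem ae_stm_of_ae_ae {S : Set ℝ} {P : ℝ × ℝ → Prop} (hm : MeasurableSet {z | P z})
    (h : ∀ᵐ t ∂vol₊, ∀ᵐ x ∂vol S, P (t, x)) (T : ℝ) :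
    ∀ᵐ z ∂stm S T, P z := (Measure.ae_prod_iff_ae_ae hm).2 (Sol.ae_Ioc h T)

theorem integrable_fun_mul {α : Type*} [MeasurableSpace α] {m : Measure α} {f g : α → ℝ}
    (hf : MemLp f 2 m) (hg : MemLp g 2 m) : Integrable (fun z => f z * g z) m := hf.integrable_mul hg

namespace Sol

variable {p : Params}

theorem equ_stm (s : Sol p) (T : ℝ) : ∀ᵐ z ∂stm s.S T,
    s.ut z = p.μ * (s.uxx z / s.v z - s.ux z * s.vx z / s.v z ^ 2)
      - p.R * (s.θx z / s.v z - s.θ z * s.vx z / s.v z ^ 2) := by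
  exact ae_stm_of_ae_ae (measurableSet_eq_fun (by fun_prop) (by fun_prop)) s.equ T

theorem eqθ_stm (s : Sol p) (T : ℝ) : ∀ᵐ z ∂stm s.S T,
    p.cv * s.θt z = p.κ * (s.θxx z / s.v z - s.θx z * s.vx z / s.v z ^ 2)
      + p.μ * (s.ux z ^ 2 / s.v z) - p.R * (s.θ z * s.ux z / s.v z) := by
  exact ae_stm_of_ae_ae (measurableSet_eq_fun (by fun_prop) (by fun_prop)) s.eqθ T

theorem memLp_strain (s : Sol p) (T : ℝ) :
    MemLp (fun z => s.uxx z / s.v z - s.ux z * s.vx z / s.v z ^ 2) 2 (stm s.S T) := by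
  obtain ⟨c, hc, C, hb⟩ := s.ae_bound T
  have hlow : ∀ᵐ z ∂stm s.S T, c ≤ s.v z := hb.mono fun z hz => hz.1
  have h1 := memLp_div (s.lθx T) s.m_v.aestronglyMeasurable hc hlow
  have h2 : MemLp (fun z => s.θ z / s.v z ^ 2 * s.vx z) 2 (stm s.S T) := by
    refine memLp_bdd_mul (c := C / c ^ 2) (s.lvx T) aesm ?_
    filter_upwards [hb] with z hz
    have hv : 0 < s.v z := hc.trans_le hz.1
    have hθ : 0 < s.θ z := hc.trans_le hz.2.2.1
    rw [abs_of_pos (by positivity)]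
    exact div_le_div₀ (hθ.le.trans hz.2.2.2.1) hz.2.2.2.1 (by positivity) (pow_le_pow_left₀ hc.le hz.1 2)
  refine (((s.lut T).add ((h1.sub h2).const_mul p.R)).const_mul p.μ⁻¹).congr_norm (by exact aesm) ?_
  filter_upwards [s.equ_stm T] with z hz
  simp only [Pi.add_apply, Pi.sub_apply]
  congr 1
  rw [hz]
  have := p.hμ
  field_simp
  ring

/-- The equation of the effective velocity, multiplied by `v_x / v`. -/
theorem effective_identity (s : Sol p) {T : ℝ} (hT : 0 ≤ T) :
    Integrable (fun z => s.ux z ^ 2 / s.v z) (stm s.S T) ∧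
    Integrable (fun z => s.θx z * s.vx z / s.v z ^ 2) (stm s.S T) ∧
    Integrable (fun z => s.θ z * s.vx z ^ 2 / s.v z ^ 3) (stm s.S T) ∧
    (∫ x in s.S, (p.μ / 2 * (s.vx (T, x) / s.v (T, x)) ^ 2 - s.u (T, x) * (s.vx (T, x) / s.v (T, x)))) =
    (∫ x in s.S, (p.μ / 2 * (s.vx (0, x) / s.v (0, x)) ^ 2 - s.u (0, x) * (s.vx (0, x) / s.v (0, x)))) +
      ∫ z, (1 * (s.ux z ^ 2 / s.v z) + p.R * (s.θx z * s.vx z / s.v z ^ 2)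
        + (-p.R) * (s.θ z * s.vx z ^ 2 / s.v z ^ 3)) ∂stm s.S T := by
  have hJ := s.hS.ordConnected_closure
  obtain ⟨c, hc, C, hb⟩ := s.ae_bound T
  have mv := s.m_v
  have hlow : ∀ᵐ z ∂stm s.S T, c ≤ s.v z := hb.mono fun z hz => hz.1
  have lb := memLp_div (s.lvx T) s.m_v.aestronglyMeasurable hc hlow
  have lW := s.memLp_strain T
  have i1 : Integrable (fun z => s.ux z ^ 2 / s.v z) (stm s.S T) := by
    have := integrable_mul_div (s.lux T) (s.lux T) mv.aestronglyMeasurable hc hlow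
    simpa only [← sq] using this
  have i2 : Integrable (fun z => s.θx z * s.vx z / s.v z ^ 2) (stm s.S T) :=
    integrable_mul_div (s.lθx T) (s.lvx T) aesm
      (c := c ^ 2) (by positivity) (hlow.mono fun z hz => pow_le_pow_left₀ hc.le hz 2)
  have i3 : Integrable (fun z => s.θ z * s.vx z ^ 2 / s.v z ^ 3) (stm s.S T) := by
    have l1 : MemLp (fun z => s.θ z * s.vx z) 2 (stm s.S T) :=
      memLp_bdd_mul (c := C) (s.lvx T) s.m_θ.aestronglyMeasurable (hb.mono fun z hz => by
        rw [abs_of_pos (hc.trans_le hz.2.2.1)]; exact hz.2.2.2.1)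
    have := integrable_mul_div l1 (s.lvx T) (w := fun z => s.v z ^ 3)
      aesm
      (c := c ^ 3) (by positivity) (hlow.mono fun z hz => pow_le_pow_left₀ hc.le hz 3)
    refine this.congr (.of_forall fun z => ?_)
    simp only; ring
  have hF : Integrable (fun z => 1 * (s.ux z ^ 2 / s.v z) + p.R * (s.θx z * s.vx z / s.v z ^ 2)
        + (-p.R) * (s.θ z * s.vx z ^ 2 / s.v z ^ 3)) (stm s.S T) := integrable_comb i1 i2 i3 _ _ _
  refine ⟨i1, i2, i3, ?_⟩
  have hΦ : Integrable (fun z => p.μ * (s.vx z / s.v z *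
      (s.uxx z / s.v z - s.ux z * s.vx z / s.v z ^ 2)) + (-1) * (s.ut z * (s.vx z / s.v z)) +
      (-1) * (s.u z * (s.uxx z / s.v z - s.ux z * s.vx z / s.v z ^ 2))) (stm s.S T) :=
    integrable_comb (lb.integrable_mul lW) ((s.lut T).integrable_mul lb) ((s.lu T).integrable_mul lW) _ _ _
  have h1 : ∀ᵐ x ∂vol s.S, IsPrim (Ici 0)
      (fun t => p.μ / 2 * (s.vx (t, x) / s.v (t, x)) ^ 2 - s.u (t, x) * (s.vx (t, x) / s.v (t, x)))
      (fun t => p.μ * (s.vx (t, x) / s.v (t, x) *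
      (s.uxx (t, x) / s.v (t, x) - s.ux (t, x) * s.vx (t, x) / s.v (t, x) ^ 2)) +
      (-1) * (s.ut (t, x) * (s.vx (t, x) / s.v (t, x))) +
      (-1) * (s.u (t, x) * (s.uxx (t, x) / s.v (t, x) - s.ux (t, x) * s.vx (t, x) / s.v (t, x) ^ 2))) := by
    filter_upwards [s.tu, s.tv, s.tvx, ae_restrict_mem s.hS.measurableSet] with x hu hv hvx hxS
    have hb := hvx.div hv fun t ht => s.pos_v ht (subset_closure hxS)
    have h := ((hb.mul hb).const_mul (p.μ / 2)).sub (hu.mul hb)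
    refine (h.congr_left fun t _ => by ring).congr_right (.of_forall fun t => ?_)
    ring
  obtain ⟨c0, hc0, C0, hb0⟩ := s.ae_bound_slice (le_refl (0:ℝ))
  have lb0 := memLp_div (s.svx 0 le_rfl) (continuous_slice s.c_v 0).aestronglyMeasurable hc0
    (hb0.mono fun z hz => hz.1)
  have i0 : Integrable (fun x => p.μ / 2 * (s.vx (0, x) / s.v (0, x)) ^ 2 -
      s.u (0, x) * (s.vx (0, x) / s.v (0, x))) (vol s.S) :=
    (lb0.integrable_sq.const_mul _).sub ((s.su 0 le_rfl).integrable_mul lb0)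
  rw [(integral_time_eq (Φ := fun z => p.μ / 2 * (s.vx z / s.v z) ^ 2 - s.u z * (s.vx z / s.v z)) h1 hT hΦ i0).2]
  congr 1
  rw [integral_of_le hT, integral_prod _ hF]
  refine integral_congr_ae ?_
  filter_upwards [ae_Ioc s.xu T, ae_Ioc s.xux T, ae_Ioc s.equ T, hF.prod_right_ae,
    hΦ.prod_right_ae, ae_mem_Ioc, MemLp.ae_slice (s.lux T), MemLp.ae_slice lW]
    with t hu hux heq hFt hΦt ht hl hlW
  have hv := s.xv t ht.1.le
  have hpos : ∀ x ∈ closure s.S, 0 < s.v (t, x) := fun x hx => s.pos_v ht.1.le hx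
  obtain ⟨c, hc, C, hb⟩ := s.ae_bound_slice ht.1.le
  have lux : MemLp (fun x => s.ux (t, x) / s.v (t, x)) 2 (vol s.S) :=
    memLp_div hl (continuous_slice s.c_v t).aestronglyMeasurable hc (hb.mono fun z hz => hz.1)
  have hip := hu.integral_mul_eq s.hS (hux.div hv hpos) (s.su t ht.1.le) hl lux hlW (by
    rcases s.bdry with h | h
    · exact Or.inl h
    · right; simp [h.1 t ht.1.le])
  have hz : ∫ x in s.S, ((s.u (t, x) * (s.uxx (t, x) / s.v (t, x) - s.ux (t, x) * s.vx (t, x) /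
      s.v (t, x) ^ 2)) + s.ux (t, x) * (s.ux (t, x) / s.v (t, x))) = 0 := by
    rw [integral_add (integrable_fun_mul (s.su t ht.1.le) hlW) (integrable_fun_mul hl lux), hip]
    ring
  rw [← sub_eq_zero, ← integral_sub hΦt hFt, ← neg_eq_zero, ← integral_neg, ← hz]
  refine integral_congr_ae ?_
  filter_upwards [heq, s.ae_S hpos] with x hx hp
  rw [hx]
  field_simp
  ring

theorem integral_θx_sq_div_le (p : Params) : ∃ K > 0, ∀ s : Sol p, ∀ T ≥ 0, ∀ m ≥ 1,
    s.TempLe T (m ^ 4) → Integrable (fun z => s.θx z ^ 2 / s.θ z) (stm s.S T) ∧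
      ∫ z, s.θx z ^ 2 / s.θ z ∂stm s.S T ≤ K * m ^ 2 := by
  obtain ⟨C, hC, hd⟩ := integral_diss_parts p
  obtain ⟨K, hK, h⟩ := integral_θx_sq_le p
  refine ⟨C + K, by positivity, fun s T hT m hm hM => ?_⟩
  obtain ⟨-, -, d3, d4⟩ := hd s T hT
  have h1 := (h s T hT _ hM).2
  have i1 := (s.lθx T).integrable_sq
  have hm0 : 0 < m := by linarith
  have hpt : ∀ᵐ z ∂stm s.S T, 0 ≤ s.θx z ^ 2 / s.θ z ∧ s.θx z ^ 2 / s.θ z ≤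
      m ^ 2 * (s.θx z ^ 2 / s.θ z ^ 2) + (m ^ 2)⁻¹ * s.θx z ^ 2 + 0 * s.θx z ^ 2 := by
    filter_upwards [s.ae_pos T] with z hz
    have hθ := hz.2
    refine ⟨by positivity, ?_⟩
    have e : m ^ 2 * (s.θx z ^ 2 / s.θ z ^ 2) + (m ^ 2)⁻¹ * s.θx z ^ 2 + 0 * s.θx z ^ 2 -
      s.θx z ^ 2 / s.θ z = s.θx z ^ 2 * ((m / s.θ z - m⁻¹ / 2) ^ 2 + 3 / 4 * (m⁻¹) ^ 2) := by
      field_simp; ring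
    have : 0 ≤ s.θx z ^ 2 * ((m / s.θ z - m⁻¹ / 2) ^ 2 + 3 / 4 * (m⁻¹) ^ 2) := by positivity
    linarith
  have iR := integrable_comb d3 i1 i1 (m ^ 2) (m ^ 2)⁻¹ 0
  have iL : Integrable (fun z => s.θx z ^ 2 / s.θ z) (stm s.S T) := by
    refine iR.mono' aesm ?_
    filter_upwards [hpt] with z hz
    rw [Real.norm_eq_abs, abs_of_nonneg hz.1]; exact hz.2
  refine ⟨iL, ?_⟩
  have hfin := integral_mono_ae iL iR (hpt.mono fun z hz => hz.2)
  rw [integral_comb d3 i1 i1] at hfin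
  have e1 : m ^ 2 * ∫ z, s.θx z ^ 2 / s.θ z ^ 2 ∂stm s.S T ≤ m ^ 2 * C := by gcongr
  have e2 : (m ^ 2)⁻¹ * ∫ z, s.θx z ^ 2 ∂stm s.S T ≤ (m ^ 2)⁻¹ * (K * m ^ 4) := by gcongr
  have e3 : (m ^ 2)⁻¹ * (K * m ^ 4) = K * m ^ 2 := by field_simp
  linarith

set_option maxHeartbeats 400000 in
theorem integral_vx_sq_le (p : Params) : ∃ K > 0, ∀ s : Sol p, ∀ T ≥ 0, ∀ m ≥ 1,
    s.TempLe T (m ^ 4) → ∫ x in s.S, s.vx (T, x) ^ 2 ≤ K * m ^ 2 ∧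
      Integrable (fun z => s.θ z * s.vx z ^ 2) (stm s.S T) ∧
      ∫ z, s.θ z * s.vx z ^ 2 ∂stm s.S T ≤ K * m ^ 2 := by
  obtain ⟨V, hV, hv⟩ := v_upper p
  obtain ⟨c, hc, hv'⟩ := v_lower p
  obtain ⟨C₂, hC₂, hux⟩ := integral_ux_sq_le p
  obtain ⟨K, hK, hθx⟩ := integral_θx_sq_div_le p
  have hE := p.E_nonneg; have hμ := p.hμ; have hR := p.hR; have hpa := p.ha
  set B := p.μ / p.a ^ 2 * p.N ^ 2 + p.N ^ 2 / p.μ + 2 * p.E / p.μ + C₂ / c + p.R / (2 * c) * K with hB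
  have hB0 : 0 < B := by positivity
  refine ⟨4 * V ^ 2 / p.μ * B + 2 * V ^ 3 / p.R * B, by positivity, fun s T hT m hm hM => ?_⟩
  obtain ⟨i1, i2, i3, hid⟩ := s.effective_identity hT
  obtain ⟨j1, j2⟩ := hθx s T hT m hm hM
  have iu := (s.lux T).integrable_sq
  have key : ∀ᵐ z ∂stm s.S T, 0 < s.θ z ∧ c ≤ s.v z ∧ s.v z ≤ V := by
    filter_upwards [ae_stm s.hS T] with z hz
    exact ⟨s.pos_θ hz.1.1.le hz.2, hv' s z.1 hz.1.1.le z.2 hz.2, hv s z.1 hz.1.1.le z.2 hz.2⟩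
  have hup : ∫ z, (1 * (s.ux z ^ 2 / s.v z) + p.R * (s.θx z * s.vx z / s.v z ^ 2)
        + (-p.R) * (s.θ z * s.vx z ^ 2 / s.v z ^ 3)) ∂stm s.S T ≤
      ∫ z, (c⁻¹ * s.ux z ^ 2 + p.R / (2 * c) * (s.θx z ^ 2 / s.θ z) +
        (-(p.R / 2)) * (s.θ z * s.vx z ^ 2 / s.v z ^ 3)) ∂stm s.S T := by
    refine integral_mono_ae (integrable_comb i1 i2 i3 _ _ _) (integrable_comb iu j1 i3 _ _ _) ?_
    filter_upwards [key] with z hz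
    obtain ⟨hθ, hvl, hvu⟩ := hz
    have hvp : 0 < s.v z := hc.trans_le hvl
    have a1 : 1 * (s.ux z ^ 2 / s.v z) ≤ c⁻¹ * s.ux z ^ 2 := by rw [one_mul, div_eq_inv_mul]; gcongr
    have a2 : p.R * (s.θx z * s.vx z / s.v z ^ 2) ≤ p.R / (2 * c) * (s.θx z ^ 2 / s.θ z) +
        p.R / 2 * (s.θ z * s.vx z ^ 2 / s.v z ^ 3) := by
      have h1 : 0 ≤ p.R / (2 * s.v z * s.θ z) * (s.θx z - s.θ z * s.vx z / s.v z) ^ 2 := by positivity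
      have h2 : p.R / (2 * s.v z * s.θ z) * (s.θx z - s.θ z * s.vx z / s.v z) ^ 2 =
        p.R / (2 * s.v z) * (s.θx z ^ 2 / s.θ z) + p.R / 2 * (s.θ z * s.vx z ^ 2 / s.v z ^ 3)
          - p.R * (s.θx z * s.vx z / s.v z ^ 2) := by field_simp; ring
      have h3 : p.R / (2 * s.v z) * (s.θx z ^ 2 / s.θ z) ≤ p.R / (2 * c) * (s.θx z ^ 2 / s.θ z) := by gcongr
      linarith
    linarith
  rw [integral_comb iu j1 i3] at hup
  have lb : ∀ t ≥ 0, MemLp (fun x => s.vx (t, x) / s.v (t, x)) 2 (vol s.S) := by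
    intro t ht
    exact memLp_div (s.svx t ht) (continuous_slice s.c_v t).aestronglyMeasurable hc
      (s.ae_S fun x hx => hv' s t ht x hx)
  have iΦ : ∀ t ≥ 0, Integrable (fun x => p.μ / 2 * (s.vx (t, x) / s.v (t, x)) ^ 2 -
      s.u (t, x) * (s.vx (t, x) / s.v (t, x))) (vol s.S) := fun t ht =>
    ((lb t ht).integrable_sq.const_mul _).sub ((s.su t ht).integrable_mul (lb t ht))
  have hlow : p.μ / 4 * (∫ x in s.S, (s.vx (T, x) / s.v (T, x)) ^ 2) - 1 / p.μ *
      (∫ x in s.S, s.u (T, x) ^ 2) ≤ ∫ x in s.S, (p.μ / 2 * (s.vx (T, x) / s.v (T, x)) ^ 2 -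
      s.u (T, x) * (s.vx (T, x) / s.v (T, x))) := by
    rw [← integral_const_mul, ← integral_const_mul, ← integral_sub
      ((lb T hT).integrable_sq.const_mul _) ((s.su T hT).integrable_sq.const_mul _)]
    refine integral_mono (((lb T hT).integrable_sq.const_mul _).sub
      ((s.su T hT).integrable_sq.const_mul _)) (iΦ T hT) fun x => ?_
    simp only
    set b := s.vx (T, x) / s.v (T, x)
    have h1 : 0 ≤ 1 / p.μ * (p.μ / 2 * b - s.u (T, x)) ^ 2 := by positivity
    have h2 : 1 / p.μ * (p.μ / 2 * b - s.u (T, x)) ^ 2 = p.μ / 4 * b ^ 2 - s.u (T, x) * b +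
      1 / p.μ * s.u (T, x) ^ 2 := by field_simp; ring
    linarith
  have hst : ∫ x in s.S, (p.μ / 2 * (s.vx (0, x) / s.v (0, x)) ^ 2 -
      s.u (0, x) * (s.vx (0, x) / s.v (0, x))) ≤ p.μ / p.a ^ 2 * (∫ x in s.S, s.vx (0, x) ^ 2) +
      1 / p.μ * ∫ x in s.S, s.u (0, x) ^ 2 := by
    rw [← integral_const_mul, ← integral_const_mul, ← integral_add
      ((s.svx 0 le_rfl).integrable_sq.const_mul _) ((s.su 0 le_rfl).integrable_sq.const_mul _)]
    refine integral_mono_ae (iΦ 0 le_rfl) (((s.svx 0 le_rfl).integrable_sq.const_mul _).add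
      ((s.su 0 le_rfl).integrable_sq.const_mul _)) (s.ae_S fun x hx => ?_)
    simp only
    have h0 := s.v0_ge x hx
    have hbb : (s.vx (0, x) / s.v (0, x)) ^ 2 ≤ s.vx (0, x) ^ 2 / p.a ^ 2 := by rw [div_pow]; gcongr
    set b := s.vx (0, x) / s.v (0, x)
    have h1 : 0 ≤ 1 / p.μ * (p.μ / 2 * b + s.u (0, x)) ^ 2 := by positivity
    have h2 : 1 / p.μ * (p.μ / 2 * b + s.u (0, x)) ^ 2 = p.μ / 4 * b ^ 2 + s.u (0, x) * b +
      1 / p.μ * s.u (0, x) ^ 2 := by field_simp; ring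
    have h3 : p.μ * b ^ 2 ≤ p.μ * (s.vx (0, x) ^ 2 / p.a ^ 2) := by gcongr
    have h4 : p.μ * (s.vx (0, x) ^ 2 / p.a ^ 2) = p.μ / p.a ^ 2 * s.vx (0, x) ^ 2 := by ring
    have h5 : 0 ≤ p.μ * b ^ 2 := by positivity
    linarith
  obtain ⟨-, n2, n3, -⟩ := s.data_le
  have e1 : p.μ / p.a ^ 2 * (∫ x in s.S, s.vx (0, x) ^ 2) ≤ p.μ / p.a ^ 2 * p.N ^ 2 := by gcongr
  have e2 : 1 / p.μ * (∫ x in s.S, s.u (0, x) ^ 2) ≤ 1 / p.μ * p.N ^ 2 := by gcongr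
  have e3 : 1 / p.μ * (∫ x in s.S, s.u (T, x) ^ 2) ≤ 1 / p.μ * (2 * p.E) := by gcongr; exact (s.energy hT).1
  have e4 : c⁻¹ * ∫ z, s.ux z ^ 2 ∂stm s.S T ≤ c⁻¹ * C₂ := by gcongr; exact hux s T hT
  have e5 : p.R / (2 * c) * ∫ z, s.θx z ^ 2 / s.θ z ∂stm s.S T ≤ p.R / (2 * c) * (K * m ^ 2) := by gcongr
  have hm2 : 1 ≤ m ^ 2 := one_le_pow₀ hm
  have hBm : p.μ / p.a ^ 2 * p.N ^ 2 + 1 / p.μ * p.N ^ 2 + 1 / p.μ * (2 * p.E) + c⁻¹ * C₂ +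
      p.R / (2 * c) * (K * m ^ 2) ≤ B * m ^ 2 := by
    have : 0 ≤ (p.μ / p.a ^ 2 * p.N ^ 2 + p.N ^ 2 / p.μ + 2 * p.E / p.μ + C₂ / c) * (m ^ 2 - 1) :=
      mul_nonneg (by positivity) (by linarith)
    have e : B * m ^ 2 - (p.μ / p.a ^ 2 * p.N ^ 2 + 1 / p.μ * p.N ^ 2 + 1 / p.μ * (2 * p.E) + c⁻¹ * C₂ +
      p.R / (2 * c) * (K * m ^ 2)) =
      (p.μ / p.a ^ 2 * p.N ^ 2 + p.N ^ 2 / p.μ + 2 * p.E / p.μ + C₂ / c) * (m ^ 2 - 1) := by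
      rw [hB]; ring
    linarith
  have n4 : 0 ≤ ∫ x in s.S, (s.vx (T, x) / s.v (T, x)) ^ 2 := integral_nonneg fun x => sq_nonneg _
  have n5 : 0 ≤ ∫ z, s.θ z * s.vx z ^ 2 / s.v z ^ 3 ∂stm s.S T := by
    refine integral_nonneg_of_ae ?_
    filter_upwards [s.ae_pos T] with z hz
    obtain ⟨h1, h2⟩ := hz
    simp only [Pi.zero_apply]; positivity
  have f1 : p.μ / 4 * (∫ x in s.S, (s.vx (T, x) / s.v (T, x)) ^ 2) ≤ B * m ^ 2 := by
    have := mul_nonneg hR.le n5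
    linarith
  have f2 : p.R / 2 * (∫ z, s.θ z * s.vx z ^ 2 / s.v z ^ 3 ∂stm s.S T) ≤ B * m ^ 2 := by
    have := mul_nonneg hμ.le n4
    linarith
  have P1 : 0 ≤ 4 * V ^ 2 / p.μ * B * m ^ 2 := by positivity
  have P2 : 0 ≤ 2 * V ^ 3 / p.R * B * m ^ 2 := by positivity
  refine ⟨?_, ?_⟩
  · have g1 : ∫ x in s.S, s.vx (T, x) ^ 2 ≤ V ^ 2 * ∫ x in s.S, (s.vx (T, x) / s.v (T, x)) ^ 2 := by
      rw [← integral_const_mul]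
      refine integral_mono_ae (s.svx T hT).integrable_sq ((lb T hT).integrable_sq.const_mul _)
        (s.ae_S fun x hx => ?_)
      have h1 := s.pos_v hT hx
      have h2 := hv s T hT x hx
      simp only
      rw [div_pow, mul_div_assoc', le_div_iff₀ (by positivity), mul_comm]
      gcongr
    have g2 : ∫ x in s.S, (s.vx (T, x) / s.v (T, x)) ^ 2 ≤ 4 / p.μ * (B * m ^ 2) := by
      rw [div_mul_eq_mul_div, le_div_iff₀ hμ]; linarith
    have g3 := mul_le_left g2 (sq_nonneg V)
    have g4 : V ^ 2 * (4 / p.μ * (B * m ^ 2)) = 4 * V ^ 2 / p.μ * B * m ^ 2 := by ring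
    linarith
  · have hpt : ∀ᵐ z ∂stm s.S T, 0 ≤ s.θ z * s.vx z ^ 2 ∧ s.θ z * s.vx z ^ 2 ≤
        V ^ 3 * (s.θ z * s.vx z ^ 2 / s.v z ^ 3) := by
      filter_upwards [key] with z hz
      obtain ⟨hθ, hvl, hvu⟩ := hz
      have hvp : 0 < s.v z := hc.trans_le hvl
      refine ⟨by positivity, ?_⟩
      rw [mul_div_assoc', le_div_iff₀ (by positivity), mul_comm]
      gcongr
    have iL : Integrable (fun z => s.θ z * s.vx z ^ 2) (stm s.S T) := by
      refine (i3.const_mul (V ^ 3)).mono' aesm ?_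
      filter_upwards [hpt] with z hz
      rw [Real.norm_eq_abs, abs_of_nonneg hz.1]; exact hz.2
    refine ⟨iL, ?_⟩
    have g1 := integral_mono_ae iL (i3.const_mul (V ^ 3)) (hpt.mono fun z hz => hz.2)
    rw [integral_const_mul] at g1
    have g2 : ∫ z, s.θ z * s.vx z ^ 2 / s.v z ^ 3 ∂stm s.S T ≤ 2 / p.R * (B * m ^ 2) := by
      rw [div_mul_eq_mul_div, le_div_iff₀ hR]; linarith
    have g3 := mul_le_left g2 (by positivity : 0 ≤ V ^ 3)
    have g4 : V ^ 3 * (2 / p.R * (B * m ^ 2)) = 2 * V ^ 3 / p.R * B * m ^ 2 := by ring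
    linarith

end Sol

/-! ### The first derivatives of velocity and temperature, and the upper bound of the temperature -/

/-- The product of a function in `L²(H¹)` and a function in `L^∞(L²)`. -/
theorem integral_sq_mul_sq_le {S : Set ℝ} (hS : IsLine S) {T B : ℝ} {f fx g : ℝ × ℝ → ℝ}
    (mf : Measurable f) (mg : Measurable g)
    (lf : MemLp f 2 (stm S T)) (lfx : MemLp fx 2 (stm S T))
    (hf : ∀ᵐ t ∂vol (Ioc 0 T), IsPrim (closure S) (fun x => f (t, x)) fun x => fx (t, x))
    (hg : ∀ᵐ t ∂vol (Ioc 0 T), MemLp (fun x => g (t, x)) 2 (vol S) ∧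
      ∫ x in S, g (t, x) ^ 2 ≤ B) {l : ℝ} (hl : 0 < l) :
    Integrable (fun z => f z ^ 2 * g z ^ 2) (stm S T) ∧
    ∫ z, f z ^ 2 * g z ^ 2 ∂stm S T ≤ B * (l * (∫ z, f z ^ 2 ∂stm S T) + l⁻¹ * ∫ z, fx z ^ 2 ∂stm S T) := by
  have h1 := lf.integrable_sq
  have h2 := lfx.integrable_sq
  have hR : Integrable (fun t => B * (l * (∫ x in S, f (t, x) ^ 2) + l⁻¹ * ∫ x in S, fx (t, x) ^ 2))
      (vol (Ioc 0 T)) :=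
    ((h1.integral_prod_left.const_mul l).add (h2.integral_prod_left.const_mul l⁻¹)).const_mul B
  have key : ∀ᵐ t ∂vol (Ioc 0 T), Integrable (fun x => f (t, x) ^ 2 * g (t, x) ^ 2) (vol S) ∧
      ∫ x in S, f (t, x) ^ 2 * g (t, x) ^ 2 ≤
        B * (l * (∫ x in S, f (t, x) ^ 2) + l⁻¹ * ∫ x in S, fx (t, x) ^ 2) := by
    filter_upwards [hf, hg, MemLp.ae_slice lf, MemLp.ae_slice lfx] with t h h' l1 l2
    set X := l * (∫ x in S, f (t, x) ^ 2) + l⁻¹ * ∫ x in S, fx (t, x) ^ 2 with hX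
    have hsup : ∀ x ∈ closure S, f (t, x) ^ 2 ≤ X := fun x hx => h.sq_le hS l1 l2 hl hx
    have hX0 : 0 ≤ X := by
      have n1 : 0 ≤ ∫ x in S, f (t, x) ^ 2 := integral_nonneg fun x => sq_nonneg _
      have n2 : 0 ≤ ∫ x in S, fx (t, x) ^ 2 := integral_nonneg fun x => sq_nonneg _
      positivity
    have hle : ∀ᵐ x ∂vol S, f (t, x) ^ 2 * g (t, x) ^ 2 ≤ X * g (t, x) ^ 2 := by
      filter_upwards [ae_restrict_mem hS.measurableSet] with x hx
      exact mul_le_right (hsup x (subset_closure hx)) (sq_nonneg _)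
    have hi : Integrable (fun x => f (t, x) ^ 2 * g (t, x) ^ 2) (vol S) := by
      refine (h'.1.integrable_sq.const_mul X).mono' aesm ?_
      filter_upwards [hle] with x hx
      rw [Real.norm_eq_abs, abs_of_nonneg (by positivity)]; exact hx
    refine ⟨hi, ?_⟩
    have := integral_mono_ae hi (h'.1.integrable_sq.const_mul X) hle
    rw [integral_const_mul] at this
    refine this.trans ?_
    rw [mul_comm]
    exact mul_le_right h'.2 hX0
  have hm : Measurable fun z => f z ^ 2 * g z ^ 2 := by fun_prop
  have hi : Integrable (fun z => f z ^ 2 * g z ^ 2) (stm S T) := by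
    rw [stm, integrable_prod_iff hm.aestronglyMeasurable]
    refine ⟨key.mono fun t ht => ht.1, hR.mono' ?_ ?_⟩
    · exact hm.norm.stronglyMeasurable.integral_prod_right.aestronglyMeasurable
    · filter_upwards [key] with t ht
      rw [Real.norm_eq_abs, abs_of_nonneg (integral_nonneg fun z => norm_nonneg _)]
      have e : ∀ x, ‖f (t, x) ^ 2 * g (t, x) ^ 2‖ = f (t, x) ^ 2 * g (t, x) ^ 2 := fun x => by
        rw [Real.norm_eq_abs, abs_of_nonneg (by positivity)]
      simp only [e]
      exact ht.2
  refine ⟨hi, ?_⟩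
  rw [integral_prod _ hi, integral_prod _ h1, integral_prod _ h2]
  have := integral_mono_ae hi.integral_prod_left hR (key.mono fun t ht => ht.2)
  refine this.trans (le_of_eq ?_)
  rw [integral_const_mul, integral_add (h1.integral_prod_left.const_mul l)
    (h2.integral_prod_left.const_mul l⁻¹), integral_const_mul, integral_const_mul]

namespace Sol

variable {p : Params}

theorem neg_two_ut_uxx_le (p : Params) : ∃ δ > 0, ∃ A > 0, ∀ s : Sol p, ∀ T, ∀ᵐ z ∂stm s.S T,
    -2 * (s.ut z * s.uxx z) ≤ -δ * s.uxx z ^ 2 +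
      A * (s.ux z ^ 2 * s.vx z ^ 2 + s.θx z ^ 2 + s.θ z ^ 2 * s.vx z ^ 2) := by
  obtain ⟨V, hV, hv⟩ := v_upper p
  obtain ⟨c, hc, hv'⟩ := v_lower p
  have hμ := p.hμ; have hR := p.hR
  set A := 3 / (p.μ * c) * (p.μ ^ 2 / c ^ 2 + p.R ^ 2 + p.R ^ 2 / c ^ 2) with hA
  refine ⟨p.μ / V, by positivity, A, by positivity, fun s T => ?_⟩
  filter_upwards [ae_stm s.hS T, s.equ_stm T] with z hz he
  have hvl : c ≤ s.v z := hv' s z.1 hz.1.1.le z.2 hz.2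
  have hvu : s.v z ≤ V := hv s z.1 hz.1.1.le z.2 hz.2
  have hvp : 0 < s.v z := hc.trans_le hvl
  set Q := p.μ * (s.ux z * s.vx z / s.v z) + p.R * s.θx z - p.R * (s.θ z * s.vx z / s.v z) with hQ
  have h1 : -2 * (s.ut z * s.uxx z) = -2 * (p.μ * (s.uxx z ^ 2 / s.v z)) + 2 * (s.uxx z * Q / s.v z) := by
    rw [he, hQ]; field_simp; ring
  have h2 : 2 * (s.uxx z * Q / s.v z) ≤ p.μ * (s.uxx z ^ 2 / s.v z) + Q ^ 2 / (p.μ * s.v z) := by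
    have e1 : 0 ≤ 1 / (p.μ * s.v z) * (p.μ * s.uxx z - Q) ^ 2 := by positivity
    have e2 : 1 / (p.μ * s.v z) * (p.μ * s.uxx z - Q) ^ 2 = p.μ * (s.uxx z ^ 2 / s.v z) +
      Q ^ 2 / (p.μ * s.v z) - 2 * (s.uxx z * Q / s.v z) := by field_simp; ring
    linarith
  have h3 : Q ^ 2 ≤ 3 * ((p.μ * (s.ux z * s.vx z / s.v z)) ^ 2 + (p.R * s.θx z) ^ 2 +
      (p.R * (s.θ z * s.vx z / s.v z)) ^ 2) := by
    rw [hQ]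
    nlinarith [sq_nonneg (p.μ * (s.ux z * s.vx z / s.v z) - p.R * s.θx z),
      sq_nonneg (p.μ * (s.ux z * s.vx z / s.v z) + p.R * (s.θ z * s.vx z / s.v z)),
      sq_nonneg (p.R * s.θx z + p.R * (s.θ z * s.vx z / s.v z))]
  have h4 : 3 * ((p.μ * (s.ux z * s.vx z / s.v z)) ^ 2 + (p.R * s.θx z) ^ 2 +
      (p.R * (s.θ z * s.vx z / s.v z)) ^ 2) ≤ 3 * ((p.μ ^ 2 / c ^ 2 + p.R ^ 2 + p.R ^ 2 / c ^ 2) *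
      (s.ux z ^ 2 * s.vx z ^ 2 + s.θx z ^ 2 + s.θ z ^ 2 * s.vx z ^ 2)) := by
    have e1 : (p.μ * (s.ux z * s.vx z / s.v z)) ^ 2 ≤ p.μ ^ 2 / c ^ 2 * (s.ux z ^ 2 * s.vx z ^ 2) := by
      calc _ = p.μ ^ 2 * (s.ux z ^ 2 * s.vx z ^ 2) / s.v z ^ 2 := by ring
        _ ≤ p.μ ^ 2 * (s.ux z ^ 2 * s.vx z ^ 2) / c ^ 2 := by gcongr
        _ = _ := by ring
    have e2 : (p.R * (s.θ z * s.vx z / s.v z)) ^ 2 ≤ p.R ^ 2 / c ^ 2 * (s.θ z ^ 2 * s.vx z ^ 2) := by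
      calc _ = p.R ^ 2 * (s.θ z ^ 2 * s.vx z ^ 2) / s.v z ^ 2 := by ring
        _ ≤ p.R ^ 2 * (s.θ z ^ 2 * s.vx z ^ 2) / c ^ 2 := by gcongr
        _ = _ := by ring
    have n1 : 0 ≤ p.μ ^ 2 / c ^ 2 := by positivity
    have n2 : 0 ≤ p.R ^ 2 := by positivity
    have n3 : 0 ≤ p.R ^ 2 / c ^ 2 := by positivity
    have m1 : 0 ≤ s.ux z ^ 2 * s.vx z ^ 2 := by positivity
    have m2 : 0 ≤ s.θx z ^ 2 := by positivity
    have m3 : 0 ≤ s.θ z ^ 2 * s.vx z ^ 2 := by positivity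
    rw [mul_pow p.R (s.θx z)]
    generalize p.μ ^ 2 / c ^ 2 = a1 at *
    generalize p.R ^ 2 / c ^ 2 = a2 at *
    generalize p.R ^ 2 = a3 at *
    generalize s.ux z ^ 2 * s.vx z ^ 2 = b1 at *
    generalize s.θ z ^ 2 * s.vx z ^ 2 = b2 at *
    nlinarith [mul_nonneg n1 m2, mul_nonneg n1 m3, mul_nonneg n2 m1, mul_nonneg n2 m3,
      mul_nonneg n3 m1, mul_nonneg n3 m2]
  have h5 : Q ^ 2 / (p.μ * s.v z) ≤ A * (s.ux z ^ 2 * s.vx z ^ 2 + s.θx z ^ 2 + s.θ z ^ 2 * s.vx z ^ 2) := by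
    calc Q ^ 2 / (p.μ * s.v z) ≤ (3 * ((p.μ ^ 2 / c ^ 2 + p.R ^ 2 + p.R ^ 2 / c ^ 2) *
        (s.ux z ^ 2 * s.vx z ^ 2 + s.θx z ^ 2 + s.θ z ^ 2 * s.vx z ^ 2))) / (p.μ * c) := by
          gcongr; exact h3.trans h4
      _ = _ := by rw [hA]; ring
  have h6 : p.μ / V * s.uxx z ^ 2 ≤ p.μ * (s.uxx z ^ 2 / s.v z) := by
    calc p.μ / V * s.uxx z ^ 2 = p.μ * (s.uxx z ^ 2 / V) := by ring
      _ ≤ _ := by gcongr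
  linarith

theorem neg_two_θt_θxx_le (p : Params) : ∃ δ > 0, ∃ A > 0, ∀ s : Sol p, ∀ T, ∀ᵐ z ∂stm s.S T,
    -2 * (s.θt z * s.θxx z) ≤ -δ * s.θxx z ^ 2 +
      A * (s.θx z ^ 2 * s.vx z ^ 2 + s.ux z ^ 2 * s.ux z ^ 2 + s.θ z ^ 2 * s.ux z ^ 2) := by
  obtain ⟨V, hV, hv⟩ := v_upper p
  obtain ⟨c, hc, hv'⟩ := v_lower p
  have hμ := p.hμ; have hR := p.hR; have hκ := p.hκ; have hcv := p.hcv
  set A := 3 / (p.cv * p.κ * c) * (p.κ ^ 2 / c ^ 2 + p.μ ^ 2 + p.R ^ 2) with hA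
  refine ⟨p.κ / (p.cv * V), by positivity, A, by positivity, fun s T => ?_⟩
  filter_upwards [ae_stm s.hS T, s.eqθ_stm T] with z hz he
  have hvl : c ≤ s.v z := hv' s z.1 hz.1.1.le z.2 hz.2
  have hvu : s.v z ≤ V := hv s z.1 hz.1.1.le z.2 hz.2
  have hvp : 0 < s.v z := hc.trans_le hvl
  set Q := p.κ * (s.θx z * s.vx z / s.v z) - p.μ * s.ux z ^ 2 + p.R * (s.θ z * s.ux z) with hQ
  have h1 : -2 * (s.θt z * s.θxx z) = 1 / p.cv * (-2 * (p.κ * (s.θxx z ^ 2 / s.v z)) +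
      2 * (s.θxx z * Q / s.v z)) := by
    have : s.θt z = 1 / p.cv * (p.cv * s.θt z) := by field_simp
    rw [this, he, hQ]; field_simp; ring
  have h2 : 2 * (s.θxx z * Q / s.v z) ≤ p.κ * (s.θxx z ^ 2 / s.v z) + Q ^ 2 / (p.κ * s.v z) := by
    have e1 : 0 ≤ 1 / (p.κ * s.v z) * (p.κ * s.θxx z - Q) ^ 2 := by positivity
    have e2 : 1 / (p.κ * s.v z) * (p.κ * s.θxx z - Q) ^ 2 = p.κ * (s.θxx z ^ 2 / s.v z) +
      Q ^ 2 / (p.κ * s.v z) - 2 * (s.θxx z * Q / s.v z) := by field_simp; ring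
    linarith
  have h3 : Q ^ 2 ≤ 3 * ((p.κ * (s.θx z * s.vx z / s.v z)) ^ 2 + (p.μ * s.ux z ^ 2) ^ 2 +
      (p.R * (s.θ z * s.ux z)) ^ 2) := by
    rw [hQ]
    nlinarith [sq_nonneg (p.κ * (s.θx z * s.vx z / s.v z) + p.μ * s.ux z ^ 2),
      sq_nonneg (p.κ * (s.θx z * s.vx z / s.v z) - p.R * (s.θ z * s.ux z)),
      sq_nonneg (p.μ * s.ux z ^ 2 + p.R * (s.θ z * s.ux z))]
  have h4 : 3 * ((p.κ * (s.θx z * s.vx z / s.v z)) ^ 2 + (p.μ * s.ux z ^ 2) ^ 2 +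
      (p.R * (s.θ z * s.ux z)) ^ 2) ≤ 3 * ((p.κ ^ 2 / c ^ 2 + p.μ ^ 2 + p.R ^ 2) *
      (s.θx z ^ 2 * s.vx z ^ 2 + s.ux z ^ 2 * s.ux z ^ 2 + s.θ z ^ 2 * s.ux z ^ 2)) := by
    have e1 : (p.κ * (s.θx z * s.vx z / s.v z)) ^ 2 ≤ p.κ ^ 2 / c ^ 2 * (s.θx z ^ 2 * s.vx z ^ 2) := by
      calc _ = p.κ ^ 2 * (s.θx z ^ 2 * s.vx z ^ 2) / s.v z ^ 2 := by ring
        _ ≤ p.κ ^ 2 * (s.θx z ^ 2 * s.vx z ^ 2) / c ^ 2 := by gcongr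
        _ = _ := by ring
    have e2 : (p.μ * s.ux z ^ 2) ^ 2 = p.μ ^ 2 * (s.ux z ^ 2 * s.ux z ^ 2) := by ring
    have e3 : (p.R * (s.θ z * s.ux z)) ^ 2 = p.R ^ 2 * (s.θ z ^ 2 * s.ux z ^ 2) := by ring
    have n1 : 0 ≤ p.κ ^ 2 / c ^ 2 := by positivity
    have n2 : 0 ≤ p.R ^ 2 := by positivity
    have n3 : 0 ≤ p.μ ^ 2 := by positivity
    have m1 : 0 ≤ s.θx z ^ 2 * s.vx z ^ 2 := by positivity
    have m2 : 0 ≤ s.ux z ^ 2 * s.ux z ^ 2 := by positivity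
    have m3 : 0 ≤ s.θ z ^ 2 * s.ux z ^ 2 := by positivity
    rw [e2, e3]
    generalize p.κ ^ 2 / c ^ 2 = a1 at *
    generalize s.θx z ^ 2 * s.vx z ^ 2 = b1 at *
    generalize s.ux z ^ 2 * s.ux z ^ 2 = b2 at *
    generalize s.θ z ^ 2 * s.ux z ^ 2 = b3 at *
    generalize p.R ^ 2 = a2 at *
    generalize p.μ ^ 2 = a3 at *
    nlinarith [mul_nonneg n1 m2, mul_nonneg n1 m3, mul_nonneg n2 m1, mul_nonneg n2 m2,
      mul_nonneg n3 m1, mul_nonneg n3 m3]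
  have h5 : 1 / p.cv * (Q ^ 2 / (p.κ * s.v z)) ≤
      A * (s.θx z ^ 2 * s.vx z ^ 2 + s.ux z ^ 2 * s.ux z ^ 2 + s.θ z ^ 2 * s.ux z ^ 2) := by
    calc 1 / p.cv * (Q ^ 2 / (p.κ * s.v z)) ≤ 1 / p.cv * ((3 * ((p.κ ^ 2 / c ^ 2 + p.μ ^ 2 + p.R ^ 2) *
        (s.θx z ^ 2 * s.vx z ^ 2 + s.ux z ^ 2 * s.ux z ^ 2 + s.θ z ^ 2 * s.ux z ^ 2))) / (p.κ * c)) := by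
          gcongr; exact h3.trans h4
      _ = _ := by rw [hA]; ring
  have h6 : p.κ / (p.cv * V) * s.θxx z ^ 2 ≤ 1 / p.cv * (p.κ * (s.θxx z ^ 2 / s.v z)) := by
    calc p.κ / (p.cv * V) * s.θxx z ^ 2 = 1 / p.cv * (p.κ * (s.θxx z ^ 2 / V)) := by ring
      _ ≤ _ := by gcongr
  have h7 : 1 / p.cv * (2 * (s.θxx z * Q / s.v z)) ≤
      1 / p.cv * (p.κ * (s.θxx z ^ 2 / s.v z) + Q ^ 2 / (p.κ * s.v z)) := by gcongr
  linarith

end Sol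

theorem integral_stm_eq {S : Set ℝ} {F : ℝ × ℝ → ℝ} {T : ℝ} (hT : 0 ≤ T)
    (hF : Integrable F (stm S T)) : ∫ z, F z ∂stm S T = ∫ t in 0..T, ∫ x in S, F (t, x) := by
  rw [integral_prod _ hF, integral_of_le hT]

theorem intervalIntegrable_slice {S : Set ℝ} {F : ℝ × ℝ → ℝ} (hF : ∀ T, Integrable F (stm S T))
    {a b : ℝ} (ha : 0 ≤ a) (hab : a ≤ b) :
    IntervalIntegrable (fun t => ∫ x in S, F (t, x)) volume a b := by
  rw [intervalIntegrable_iff_Ioc hab]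
  exact IntegrableOn.mono_set (hF b).integral_prod_left (Ioc_subset_Ioc_left ha)

theorem Evol.integral_sq_add_le {S : Set ℝ} {c : ℝ} {f fx fxx ft R : ℝ × ℝ → ℝ}
    (h : Evol S c f fx fxx ft) {a : ℝ} (ha : 0 ≤ a) {g₀ : ℝ → ℝ}
    (hg : IsPrim (closure S) (fun x => f (a, x)) g₀) (lg : MemLp g₀ 2 (vol S)) {δ : ℝ}
    (hR : ∀ T, Integrable R (stm S T))
    (hle : ∀ T, ∀ᵐ z ∂stm S T, -2 * (ft z * fxx z) ≤ -δ * fxx z ^ 2 + R z) :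
    ∀ᵐ t ∂vol (Ioi a), (∫ x in S, fx (t, x) ^ 2) + δ * (∫ τ in a..t, ∫ x in S, fxx (τ, x) ^ 2) ≤
      (∫ x in S, g₀ x ^ 2) + ∫ τ in a..t, ∫ x in S, R (τ, x) := by
  filter_upwards [h.integral_sq_le ha hg lg, ae_mem_Ioi] with t ht hat
  have hat' : a ≤ t := le_of_lt hat
  have i1 := intervalIntegrable_slice h.integrable_mul ha hat'
  have i2 := intervalIntegrable_slice (fun T => (h.lfxx T).integrable_sq) ha hat'
  have i3 := intervalIntegrable_slice hR ha hat'
  have key : -2 * (∫ τ in a..t, ∫ x in S, ft (τ, x) * fxx (τ, x)) ≤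
      -δ * (∫ τ in a..t, ∫ x in S, fxx (τ, x) ^ 2) + ∫ τ in a..t, ∫ x in S, R (τ, x) := by
    rw [← interval_const_mul, ← interval_const_mul, ← interval_add (i2.const_mul _) i3]
    refine integral_mono_ae_restrict hat' (i1.const_mul _) ((i2.const_mul _).add i3) ?_
    have sub : Icc a t ⊆ Icc 0 t := Icc_subset_Icc_left ha
    have e : ∀ {P : ℝ → Prop}, (∀ᵐ τ ∂vol (Ioc 0 t), P τ) → ∀ᵐ τ ∂vol (Icc a t), P τ := by
      intro P hP
      refine ae_mono_set sub ?_
      rwa [restrict_Ioc_eq_restrict_Icc] at hP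
    filter_upwards [e (Measure.ae_ae_of_ae_prod (hle t)), e (h.integrable_mul t).prod_right_ae,
      e (h.lfxx t).integrable_sq.prod_right_ae, e (hR t).prod_right_ae] with τ h1 h2 h3 h4
    rw [← integral_const_mul, ← integral_const_mul, ← integral_add (h3.const_mul _) h4]
    exact integral_mono_ae (h2.const_mul _) ((h3.const_mul _).add h4) h1
  linarith

namespace Sol

variable {p : Params}

theorem exists_tempLe (s : Sol p) (T : ℝ) : ∃ m ≥ 1, s.TempLe T (m ^ 4) := by
  obtain ⟨c, hc, C, hb⟩ := s.bound T
  have h1 : (1:ℝ) ≤ max 1 C := le_max_left _ _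
  refine ⟨max 1 C, h1, one_le_pow₀ h1, fun t ht x hx => ?_⟩
  exact ((hb t ht x hx).2.2.2.1.trans (le_max_right 1 C)).trans (le_self_pow₀ h1 (by norm_num))

theorem integrable_θ_vx (s : Sol p) (T : ℝ) : Integrable (fun z => s.θ z ^ 2 * s.vx z ^ 2) (stm s.S T) := by
  obtain ⟨c, hc, C, hb⟩ := s.ae_bound T
  have l1 : MemLp (fun z => s.θ z * s.vx z) 2 (stm s.S T) :=
    memLp_bdd_mul (c := C) (s.lvx T) s.m_θ.aestronglyMeasurable (hb.mono fun z hz => by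
      rw [abs_of_pos (hc.trans_le hz.2.2.1)]; exact hz.2.2.2.1)
  simpa only [mul_pow] using l1.integrable_sq

theorem integrable_θ_ux (s : Sol p) (T : ℝ) : Integrable (fun z => s.θ z ^ 2 * s.ux z ^ 2) (stm s.S T) := by
  obtain ⟨c, hc, C, hb⟩ := s.ae_bound T
  have l1 : MemLp (fun z => s.θ z * s.ux z) 2 (stm s.S T) :=
    memLp_bdd_mul (c := C) (s.lux T) s.m_θ.aestronglyMeasurable (hb.mono fun z hz => by
      rw [abs_of_pos (hc.trans_le hz.2.2.1)]; exact hz.2.2.2.1)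
  simpa only [mul_pow] using l1.integrable_sq

theorem integral_ux_vx_le (s : Sol p) {T B : ℝ} (hB : ∀ t ∈ Icc 0 T, ∫ x in s.S, s.vx (t, x) ^ 2 ≤ B)
    {l : ℝ} (hl : 0 < l) : Integrable (fun z => s.ux z ^ 2 * s.vx z ^ 2) (stm s.S T) ∧
    ∫ z, s.ux z ^ 2 * s.vx z ^ 2 ∂stm s.S T ≤
      B * (l * (∫ z, s.ux z ^ 2 ∂stm s.S T) + l⁻¹ * ∫ z, s.uxx z ^ 2 ∂stm s.S T) := by
  refine integral_sq_mul_sq_le s.hS s.m_ux s.m_vx (s.lux T) (s.luxx T) (ae_Ioc s.xux T) ?_ hl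
  filter_upwards [ae_mem_Ioc] with t ht
  exact ⟨s.svx t ht.1.le, hB t ⟨ht.1.le, ht.2⟩⟩

theorem integral_θx_vx_le (s : Sol p) {T B : ℝ} (hB : ∀ t ∈ Icc 0 T, ∫ x in s.S, s.vx (t, x) ^ 2 ≤ B)
    {l : ℝ} (hl : 0 < l) : Integrable (fun z => s.θx z ^ 2 * s.vx z ^ 2) (stm s.S T) ∧
    ∫ z, s.θx z ^ 2 * s.vx z ^ 2 ∂stm s.S T ≤
      B * (l * (∫ z, s.θx z ^ 2 ∂stm s.S T) + l⁻¹ * ∫ z, s.θxx z ^ 2 ∂stm s.S T) := by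
  refine integral_sq_mul_sq_le s.hS s.m_θx s.m_vx (s.lθx T) (s.lθxx T) (ae_Ioc s.xθx T) ?_ hl
  filter_upwards [ae_mem_Ioc] with t ht
  exact ⟨s.svx t ht.1.le, hB t ⟨ht.1.le, ht.2⟩⟩

theorem integral_ux_ux_le (s : Sol p) {T B : ℝ}
    (hB : ∀ᵐ t ∂vol (Ioc 0 T), ∫ x in s.S, s.ux (t, x) ^ 2 ≤ B)
    {l : ℝ} (hl : 0 < l) : Integrable (fun z => s.ux z ^ 2 * s.ux z ^ 2) (stm s.S T) ∧
    ∫ z, s.ux z ^ 2 * s.ux z ^ 2 ∂stm s.S T ≤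
      B * (l * (∫ z, s.ux z ^ 2 ∂stm s.S T) + l⁻¹ * ∫ z, s.uxx z ^ 2 ∂stm s.S T) := by
  refine integral_sq_mul_sq_le s.hS s.m_ux s.m_ux (s.lux T) (s.luxx T) (ae_Ioc s.xux T) ?_ hl
  filter_upwards [hB, MemLp.ae_slice (s.lux T)] with t ht ht' using ⟨ht', ht⟩

/-- The lower order terms in the energy inequality for `u_x`. -/
def restU (s : Sol p) (z : ℝ × ℝ) : ℝ := s.ux z ^ 2 * s.vx z ^ 2 + s.θx z ^ 2 + s.θ z ^ 2 * s.vx z ^ 2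

/-- The lower order terms in the energy inequality for `θ_x`. -/
def restθ (s : Sol p) (z : ℝ × ℝ) : ℝ := s.θx z ^ 2 * s.vx z ^ 2 + s.ux z ^ 2 * s.ux z ^ 2 + s.θ z ^ 2 * s.ux z ^ 2

theorem vx_bounded (s : Sol p) (T : ℝ) : ∃ B, ∀ t ∈ Icc 0 T, ∫ x in s.S, s.vx (t, x) ^ 2 ≤ B := by
  obtain ⟨K, hK, h⟩ := integral_vx_sq_le p
  obtain ⟨m, hm, hM⟩ := s.exists_tempLe T
  exact ⟨K * m ^ 2, fun t ht => (h s t ht.1 m hm (hM.mono ht.2)).1⟩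

theorem integrable_restU (s : Sol p) (T : ℝ) : Integrable s.restU (stm s.S T) := by
  obtain ⟨B, hB⟩ := s.vx_bounded T
  exact ((s.integral_ux_vx_le hB one_pos).1.add (s.lθx T).integrable_sq).add (s.integrable_θ_vx T)

theorem integral_restU (s : Sol p) (T : ℝ) : ∫ z, s.restU z ∂stm s.S T =
    (∫ z, s.ux z ^ 2 * s.vx z ^ 2 ∂stm s.S T) + (∫ z, s.θx z ^ 2 ∂stm s.S T) +
      ∫ z, s.θ z ^ 2 * s.vx z ^ 2 ∂stm s.S T := by
  obtain ⟨B, hB⟩ := s.vx_bounded T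
  have h := integral_comb (s.integral_ux_vx_le hB one_pos).1 (s.lθx T).integrable_sq (s.integrable_θ_vx T) 1 1 1
  simpa only [one_mul, restU] using h

/-- The energy inequality for `u_x`, from any time at which the derivative is known. -/
theorem energy_ux (p : Params) : ∃ δ > 0, ∃ A > 0, ∀ s : Sol p, ∀ a ≥ 0, ∀ g₀ : ℝ → ℝ,
    IsPrim (closure s.S) (fun x => s.u (a, x)) g₀ → MemLp g₀ 2 (vol s.S) →
    ∀ᵐ t ∂vol (Ioi a), (∫ x in s.S, s.ux (t, x) ^ 2) + δ * (∫ τ in a..t, ∫ x in s.S, s.uxx (τ, x) ^ 2) ≤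
      (∫ x in s.S, g₀ x ^ 2) + A * ∫ τ in a..t, ∫ x in s.S, s.restU (τ, x) := by
  obtain ⟨δ, hδ, A, hA, h⟩ := neg_two_ut_uxx_le p
  refine ⟨δ, hδ, A, hA, fun s a ha g₀ hg lg => ?_⟩
  have := s.evol_u.integral_sq_add_le ha hg lg (R := fun z => A * s.restU z)
    (fun T => (s.integrable_restU T).const_mul A) (h s)
  simpa only [integral_const_mul, interval_const_mul] using this

theorem integral_ux_le (p : Params) : ∃ K > 0, ∀ s : Sol p, ∀ T, ∀ m ≥ 1, s.TempLe T (m ^ 4) →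
    ∀ᵐ t ∂vol (Ioc 0 T), ∫ x in s.S, s.ux (t, x) ^ 2 ≤ K * m ^ 6 ∧ ∫ z, s.uxx z ^ 2 ∂stm s.S t ≤ K * m ^ 6 := by
  obtain ⟨δ, hδ, A, hA, hen⟩ := energy_ux p
  obtain ⟨K₁, hK₁, hvx⟩ := integral_vx_sq_le p
  obtain ⟨K₂, hK₂, hθx⟩ := integral_θx_sq_le p
  obtain ⟨C₂, hC₂, hux⟩ := integral_ux_sq_le p
  set B := p.N ^ 2 + 2 * A ^ 2 * K₁ ^ 2 / δ * C₂ + A * K₂ + A * K₁ with hB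
  have hB0 : 0 < B := by positivity
  refine ⟨B + 2 * B / δ, by positivity, fun s T m hm hM => ?_⟩
  filter_upwards [ae_mono_set Ioc_subset_Ioi_self (hen s 0 le_rfl s.u0x s.xu0 s.lu0x), ae_mem_Ioc] with t ht htT
  have ht0 : 0 ≤ t := htT.1.le
  have hMt := hM.mono htT.2
  have hm0 : 0 < m := by linarith
  rw [← integral_stm_eq ht0 (s.luxx t).integrable_sq, ← integral_stm_eq ht0 (s.integrable_restU t),
    s.integral_restU] at ht
  set U := ∫ z, s.uxx z ^ 2 ∂stm s.S t with hU
  have hU0 : 0 ≤ U := integral_nonneg fun z => sq_nonneg _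
  have hE0 : 0 ≤ ∫ x in s.S, s.ux (t, x) ^ 2 := integral_nonneg fun z => sq_nonneg _
  set l := 2 * A * K₁ * m ^ 2 / δ with hl
  have hl0 : 0 < l := by positivity
  have I1 := (s.integral_ux_vx_le (T := t) (B := K₁ * m ^ 2)
    (fun τ hτ => (hvx s τ hτ.1 m hm (hMt.mono hτ.2)).1) hl0).2
  have I2 := (hθx s t ht0 _ hMt).2
  obtain ⟨-, j3, I3⟩ := hvx s t ht0 m hm hMt
  have I3' : ∫ z, s.θ z ^ 2 * s.vx z ^ 2 ∂stm s.S t ≤ m ^ 4 * (K₁ * m ^ 2) := by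
    refine le_trans ?_ (mul_le_left I3 (by positivity))
    rw [← integral_const_mul]
    refine integral_mono_ae (s.integrable_θ_vx t) (j3.const_mul _) ?_
    filter_upwards [hMt.ae, s.ae_pos t] with z h1 h2
    have := h2.2
    calc s.θ z ^ 2 * s.vx z ^ 2 = s.θ z * (s.θ z * s.vx z ^ 2) := by ring
      _ ≤ m ^ 4 * (s.θ z * s.vx z ^ 2) := by gcongr
  have I1' : A * ∫ z, s.ux z ^ 2 * s.vx z ^ 2 ∂stm s.S t ≤ 2 * A ^ 2 * K₁ ^ 2 / δ * C₂ * m ^ 4 + δ / 2 * U := by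
    calc _ ≤ A * (K₁ * m ^ 2 * (l * C₂ + l⁻¹ * U)) := by
          gcongr
          refine I1.trans ?_
          gcongr
          exact hux s t ht0
      _ = _ := by rw [hl]; field_simp
  have I2' : A * ∫ z, s.θx z ^ 2 ∂stm s.S t ≤ A * K₂ * m ^ 4 := by rw [mul_assoc]; gcongr
  have I3'' : A * ∫ z, s.θ z ^ 2 * s.vx z ^ 2 ∂stm s.S t ≤ A * K₁ * m ^ 6 := by
    calc _ ≤ A * (m ^ 4 * (K₁ * m ^ 2)) := by gcongr
      _ = _ := by ring
  have hN := s.data_le.2.2.2.1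
  have p1 : m ^ 4 ≤ m ^ 6 := pow_le_pow_right₀ hm (by norm_num)
  have p2 : 1 ≤ m ^ 6 := one_le_pow₀ hm
  have q1 : p.N ^ 2 ≤ p.N ^ 2 * m ^ 6 := le_mul_of_one_le_right (sq_nonneg _) p2
  have q2 : 2 * A ^ 2 * K₁ ^ 2 / δ * C₂ * m ^ 4 ≤ 2 * A ^ 2 * K₁ ^ 2 / δ * C₂ * m ^ 6 := by gcongr
  have q3 : A * K₂ * m ^ 4 ≤ A * K₂ * m ^ 6 := by gcongr
  have hfin : (∫ x in s.S, s.ux (t, x) ^ 2) + δ / 2 * U ≤ B * m ^ 6 := by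
    have e : B * m ^ 6 = p.N ^ 2 * m ^ 6 + 2 * A ^ 2 * K₁ ^ 2 / δ * C₂ * m ^ 6 + A * K₂ * m ^ 6 +
      A * K₁ * m ^ 6 := by rw [hB]; ring
    rw [e]
    linarith
  have n1 : 0 ≤ δ / 2 * U := by positivity
  have n2 : 0 ≤ 2 * B / δ * m ^ 6 := by positivity
  have n3 : 0 ≤ B * m ^ 6 := by positivity
  refine ⟨by linarith, ?_⟩
  have : U ≤ 2 / δ * (B * m ^ 6) := by rw [div_mul_eq_mul_div, le_div_iff₀ hδ]; linarith
  have e : 2 / δ * (B * m ^ 6) = 2 * B / δ * m ^ 6 := by ring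
  linarith

theorem ux_bounded (s : Sol p) (T : ℝ) : ∃ B, ∀ᵐ t ∂vol (Ioc 0 T), ∫ x in s.S, s.ux (t, x) ^ 2 ≤ B := by
  obtain ⟨K, hK, h⟩ := integral_ux_le p
  obtain ⟨m, hm, hM⟩ := s.exists_tempLe T
  exact ⟨K * m ^ 6, (h s T m hm hM).mono fun t ht => ht.1⟩

theorem integrable_restθ (s : Sol p) (T : ℝ) : Integrable s.restθ (stm s.S T) := by
  obtain ⟨B, hB⟩ := s.vx_bounded T
  obtain ⟨B', hB'⟩ := s.ux_bounded T
  exact ((s.integral_θx_vx_le hB one_pos).1.add (s.integral_ux_ux_le hB' one_pos).1).add (s.integrable_θ_ux T)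

theorem integral_restθ (s : Sol p) (T : ℝ) : ∫ z, s.restθ z ∂stm s.S T =
    (∫ z, s.θx z ^ 2 * s.vx z ^ 2 ∂stm s.S T) + (∫ z, s.ux z ^ 2 * s.ux z ^ 2 ∂stm s.S T) +
      ∫ z, s.θ z ^ 2 * s.ux z ^ 2 ∂stm s.S T := by
  obtain ⟨B, hB⟩ := s.vx_bounded T
  obtain ⟨B', hB'⟩ := s.ux_bounded T
  have h := integral_comb (s.integral_θx_vx_le hB one_pos).1 (s.integral_ux_ux_le hB' one_pos).1
    (s.integrable_θ_ux T) 1 1 1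
  simpa only [one_mul, restθ] using h

/-- The energy inequality for `θ_x`, from any time at which the derivative is known. -/
theorem energy_θx (p : Params) : ∃ δ > 0, ∃ A > 0, ∀ s : Sol p, ∀ a ≥ 0, ∀ g₀ : ℝ → ℝ,
    IsPrim (closure s.S) (fun x => s.θ (a, x)) g₀ → MemLp g₀ 2 (vol s.S) →
    ∀ᵐ t ∂vol (Ioi a), (∫ x in s.S, s.θx (t, x) ^ 2) + δ * (∫ τ in a..t, ∫ x in s.S, s.θxx (τ, x) ^ 2) ≤
      (∫ x in s.S, g₀ x ^ 2) + A * ∫ τ in a..t, ∫ x in s.S, s.restθ (τ, x) := by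
  obtain ⟨δ, hδ, A, hA, h⟩ := neg_two_θt_θxx_le p
  refine ⟨δ, hδ, A, hA, fun s a ha g₀ hg lg => ?_⟩
  have := s.evol_θ.integral_sq_add_le ha hg lg (R := fun z => A * s.restθ z)
    (fun T => (s.integrable_restθ T).const_mul A) (h s)
  simpa only [integral_const_mul, interval_const_mul] using this

theorem integral_θx_le (p : Params) : ∃ K > 0, ∀ s : Sol p, ∀ T, ∀ m ≥ 1, s.TempLe T (m ^ 4) →
    ∀ᵐ t ∂vol (Ioc 0 T), ∫ x in s.S, s.θx (t, x) ^ 2 ≤ K * m ^ 9 ∧ ∫ z, s.θxx z ^ 2 ∂stm s.S t ≤ K * m ^ 9 := by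
  obtain ⟨δ, hδ, A, hA, hen⟩ := energy_θx p
  obtain ⟨K₁, hK₁, hvx⟩ := integral_vx_sq_le p
  obtain ⟨K₂, hK₂, hθx⟩ := integral_θx_sq_le p
  obtain ⟨C₂, hC₂, hux⟩ := integral_ux_sq_le p
  obtain ⟨K₅, hK₅, huxx⟩ := integral_ux_le p
  set B := p.N ^ 2 + 2 * A ^ 2 * K₁ ^ 2 / δ * K₂ + A * K₅ * (C₂ + K₅) + A * C₂ with hB
  have hB0 : 0 < B := by positivity
  refine ⟨B + 2 * B / δ, by positivity, fun s T m hm hM => ?_⟩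
  filter_upwards [ae_mono_set Ioc_subset_Ioi_self (hen s 0 le_rfl s.θ0x s.xθ0 s.lθ0x), ae_mem_Ioc,
    huxx s T m hm hM] with t ht htT hut
  have ht0 : 0 ≤ t := htT.1.le
  have hMt := hM.mono htT.2
  have hm0 : 0 < m := by linarith
  rw [← integral_stm_eq ht0 (s.lθxx t).integrable_sq, ← integral_stm_eq ht0 (s.integrable_restθ t),
    s.integral_restθ] at ht
  set U := ∫ z, s.θxx z ^ 2 ∂stm s.S t with hU
  have hU0 : 0 ≤ U := integral_nonneg fun z => sq_nonneg _
  have hE0 : 0 ≤ ∫ x in s.S, s.θx (t, x) ^ 2 := integral_nonneg fun z => sq_nonneg _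
  set l := 2 * A * K₁ * m ^ 2 / δ with hl
  have hl0 : 0 < l := by positivity
  have I1 := (s.integral_θx_vx_le (T := t) (B := K₁ * m ^ 2)
    (fun τ hτ => (hvx s τ hτ.1 m hm (hMt.mono hτ.2)).1) hl0).2
  have I2 := (s.integral_ux_ux_le (T := t) (B := K₅ * m ^ 6) ((huxx s t m hm hMt).mono
    fun τ hτ => hτ.1) (l := m ^ 3) (by positivity)).2
  have I3 : ∫ z, s.θ z ^ 2 * s.ux z ^ 2 ∂stm s.S t ≤ m ^ 8 * C₂ := by
    refine le_trans ?_ (mul_le_left (hux s t ht0) (by positivity))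
    rw [← integral_const_mul]
    refine integral_mono_ae (s.integrable_θ_ux t) ((s.lux t).integrable_sq.const_mul _) ?_
    filter_upwards [hMt.ae, s.ae_pos t] with z h1 h2
    have := h2.2
    calc s.θ z ^ 2 * s.ux z ^ 2 ≤ (m ^ 4) ^ 2 * s.ux z ^ 2 := by gcongr
      _ = _ := by ring
  have I1' : A * ∫ z, s.θx z ^ 2 * s.vx z ^ 2 ∂stm s.S t ≤ 2 * A ^ 2 * K₁ ^ 2 / δ * K₂ * m ^ 8 + δ / 2 * U := by
    calc _ ≤ A * (K₁ * m ^ 2 * (l * (K₂ * m ^ 4) + l⁻¹ * U)) := by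
          gcongr
          refine I1.trans ?_
          gcongr
          exact (hθx s t ht0 _ hMt).2
      _ = _ := by rw [hl]; field_simp
  have I2' : A * ∫ z, s.ux z ^ 2 * s.ux z ^ 2 ∂stm s.S t ≤ A * K₅ * (C₂ + K₅) * m ^ 9 := by
    calc _ ≤ A * (K₅ * m ^ 6 * (m ^ 3 * C₂ + (m ^ 3)⁻¹ * (K₅ * m ^ 6))) := by
          gcongr
          refine I2.trans ?_
          gcongr
          · exact hux s t ht0
          · exact hut.2
      _ = _ := by field_simp
  have I3' : A * ∫ z, s.θ z ^ 2 * s.ux z ^ 2 ∂stm s.S t ≤ A * C₂ * m ^ 8 := by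
    calc _ ≤ A * (m ^ 8 * C₂) := by gcongr
      _ = _ := by ring
  have hN := s.data_le.2.2.2.2.2
  have p1 : m ^ 8 ≤ m ^ 9 := pow_le_pow_right₀ hm (by norm_num)
  have p2 : 1 ≤ m ^ 9 := one_le_pow₀ hm
  have q1 : p.N ^ 2 ≤ p.N ^ 2 * m ^ 9 := le_mul_of_one_le_right (sq_nonneg _) p2
  have q2 : 2 * A ^ 2 * K₁ ^ 2 / δ * K₂ * m ^ 8 ≤ 2 * A ^ 2 * K₁ ^ 2 / δ * K₂ * m ^ 9 := by gcongr
  have q3 : A * C₂ * m ^ 8 ≤ A * C₂ * m ^ 9 := by gcongr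
  have hfin : (∫ x in s.S, s.θx (t, x) ^ 2) + δ / 2 * U ≤ B * m ^ 9 := by
    have e : B * m ^ 9 = p.N ^ 2 * m ^ 9 + 2 * A ^ 2 * K₁ ^ 2 / δ * K₂ * m ^ 9 +
      A * K₅ * (C₂ + K₅) * m ^ 9 + A * C₂ * m ^ 9 := by rw [hB]; ring
    rw [e]
    linarith
  have n1 : 0 ≤ δ / 2 * U := by positivity
  have n2 : 0 ≤ 2 * B / δ * m ^ 9 := by positivity
  have n3 : 0 ≤ B * m ^ 9 := by positivity
  refine ⟨by linarith, ?_⟩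
  have : U ≤ 2 / δ * (B * m ^ 9) := by rw [div_mul_eq_mul_div, le_div_iff₀ hδ]; linarith
  have e : 2 / δ * (B * m ^ 9) = 2 * B / δ * m ^ 9 := by ring
  linarith

theorem excess_sq_le (s : Sol p) {t l : ℝ} (ht : 0 ≤ t) (hl : 0 < l)
    (hθ : IsPrim (closure s.S) (fun x => s.θ (t, x)) fun x => s.θx (t, x))
    (lθ : MemLp (fun x => s.θx (t, x)) 2 (vol s.S)) {x : ℝ} (hx : x ∈ closure s.S) :
    max (s.θ (t, x) - 4) 0 ^ 2 ≤ l * (8 * ∫ y in s.S, max (s.θ (t, y) - 2) 0 ^ 3 / s.θ (t, y)) +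
      l⁻¹ * ∫ y in s.S, s.θx (t, y) ^ 2 := by
  have hJ := s.hS.ordConnected_closure
  have h := hθ.comp (K := univ) (φ := fun y => max (y - 4) 0 ^ 2) (φ' := fun y => 2 * max (y - 4) 0)
    (fun y _ => (hasDerivAt_pospart_pow 4 0 y).congr_deriv (by simp)) (by fun_prop) (fun _ _ => trivial)
  have lq : MemLp (fun x => max (s.θ (t, x) - 4) 0) 2 (vol s.S) := by
    refine memLp_two_of_abs_le (C := 1) aesm (s.sθ t ht) (.of_forall fun x => ?_)
    rw [abs_of_nonneg (le_max_right _ _), one_mul]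
    exact max_le (by linarith [le_abs_self (s.θ (t, x) - 1)]) (abs_nonneg _)
  have iH' : Integrable (fun y => 2 * max (s.θ (t, y) - 4) 0 * s.θx (t, y)) (vol s.S) := by
    have := (integrable_fun_mul lq lθ).const_mul 2
    simpa only [mul_assoc] using this
  have h1 := h.abs_le_integral s.hS lq.integrable_sq iH' hx
  rw [abs_of_nonneg (by positivity)] at h1
  refine h1.trans ?_
  rw [← integral_const_mul, ← integral_const_mul, ← integral_const_mul,
    ← integral_add (((s.integrable_entropy isEntropy_quadratic ht).const_mul _).const_mul _)
      (lθ.integrable_sq.const_mul _)]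
  refine integral_mono_ae iH'.abs ((((s.integrable_entropy isEntropy_quadratic ht).const_mul _).const_mul _).add
    (lθ.integrable_sq.const_mul _)) (s.ae_S fun y hy => ?_)
  have hp := s.pos_θ ht hy
  have hq0 : 0 ≤ max (s.θ (t, y) - 4) 0 := le_max_right _ _
  have hq : max (s.θ (t, y) - 4) 0 ^ 2 ≤ 8 * (max (s.θ (t, y) - 2) 0 ^ 3 / s.θ (t, y)) := by
    by_cases h4 : s.θ (t, y) ≤ 4
    · rw [max_eq_right (by linarith)]
      have h0 : 0 ≤ max (s.θ (t, y) - 2) 0 := le_max_right _ _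
      rw [zero_pow two_ne_zero]
      positivity
    · push Not at h4
      rw [max_eq_left (by linarith), max_eq_left (by linarith), mul_div_assoc', le_div_iff₀ hp]
      nlinarith [sq_nonneg (s.θ (t, y) - 4), mul_pos hp hp]
  simp only
  set q := max (s.θ (t, y) - 4) 0
  rw [abs_mul, abs_of_nonneg (by positivity : 0 ≤ 2 * q)]
  have e1 : 0 ≤ l * (q - l⁻¹ * |s.θx (t, y)|) ^ 2 := by positivity
  have e2 : l * (q - l⁻¹ * |s.θx (t, y)|) ^ 2 = l * q ^ 2 + l⁻¹ * s.θx (t, y) ^ 2 - 2 * q * |s.θx (t, y)| := by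
    rw [← sq_abs (s.θx (t, y))]; field_simp; ring
  have e3 : l * q ^ 2 ≤ l * (8 * (max (s.θ (t, y) - 2) 0 ^ 3 / s.θ (t, y))) := by gcongr
  linarith

/-- The upper bound of the temperature. -/
theorem θ_upper (p : Params) : ∃ m ≥ 1, ∀ s : Sol p, ∀ T, s.TempLe T (m ^ 4) := by
  obtain ⟨K₁, hK₁, hG⟩ := integral_θx_sq_le p
  obtain ⟨K₂, hK₂, hθx⟩ := integral_θx_le p
  set B := 8 * K₁ + K₂ with hB
  have hB0 : 0 < B := by positivity
  refine ⟨5 + 25 * B, by linarith, fun s T => ?_⟩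
  wlog hT : 0 < T generalizing T
  · exact (this (max T 1) (by positivity)).mono (le_max_left _ _)
  obtain ⟨c, hc, C, hb⟩ := s.bound T
  set Z := Icc 0 T ×ˢ closure s.S with hZ
  set M := max 1 (sSup (s.θ '' Z)) with hM
  have hbdd : BddAbove (s.θ '' Z) := by
    refine ⟨C, ?_⟩
    rintro _ ⟨z, hz, rfl⟩
    exact (hb z.1 hz.1 z.2 hz.2).2.2.2.1
  have hM1 : 1 ≤ M := le_max_left _ _
  have hM0 : 0 ≤ M := by linarith
  set m := sqrt (sqrt M) with hm
  have hm4 : m ^ 4 = M := by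
    rw [show m ^ 4 = (m ^ 2) ^ 2 by ring, hm, Real.sq_sqrt (Real.sqrt_nonneg _), Real.sq_sqrt hM0]
  have hm1 : 1 ≤ m := by rw [hm, Real.one_le_sqrt, Real.one_le_sqrt]; exact hM1
  have hle : s.TempLe T (m ^ 4) := by
    rw [hm4]
    exact ⟨hM1, fun t ht x hx => (le_csSup hbdd ⟨(t, x), ⟨ht, hx⟩, rfl⟩).trans (le_max_right _ _)⟩
  have hm0 : 0 < m := by linarith
  have hae : ∀ᵐ t ∂vol (Ioc 0 T), ∀ x ∈ closure s.S, max (s.θ (t, x) - 4) 0 ^ 2 ≤ B * m ^ 7 := by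
    filter_upwards [hθx s T m hm1 hle, ae_mem_Ioc, ae_Ioc s.xθ T, MemLp.ae_slice (s.lθx T)] with t h1 ht h2 h3 x hx
    refine (s.excess_sq_le ht.1.le (l := m ^ 2) (by positivity) h2 h3 hx).trans ?_
    have h4 := (hG s t ht.1.le _ (hle.mono ht.2)).1
    calc _ ≤ m ^ 2 * (8 * (K₁ * m ^ 4)) + (m ^ 2)⁻¹ * (K₂ * m ^ 9) := by
          gcongr; exact h1.1
      _ = 8 * K₁ * m ^ 6 + K₂ * m ^ 7 := by field_simp
      _ ≤ 8 * K₁ * m ^ 7 + K₂ * m ^ 7 := by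
          gcongr
          norm_num
      _ = _ := by rw [hB]; ring
  have hall : ∀ t ∈ Icc 0 T, ∀ x ∈ closure s.S, max (s.θ (t, x) - 4) 0 ^ 2 ≤ B * m ^ 7 := by
    intro t ht x hx
    refine le_on_Icc_of_ae (f := fun t => max (s.θ (t, x) - 4) 0 ^ 2) (g := fun _ => B * m ^ 7)
      (by fun_prop) continuous_const hT ?_ t ht
    filter_upwards [ae_mono_set Ioo_subset_Ioc_self hae] with t ht using ht x hx
  have hmle : m ≤ 5 + 25 * B := by
    by_cases h5 : M ≤ 5
    · have : m ≤ m ^ 4 := le_self_pow₀ hm1 (by norm_num)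
      linarith
    · push Not at h5
      have hsup : sSup (s.θ '' Z) = M := by
        rw [hM]
        refine (max_eq_right ?_).symm
        by_contra h
        push Not at h
        have : M = 1 := max_eq_left h.le
        linarith
      have hne : (s.θ '' Z).Nonempty := by
        by_contra h
        rw [not_nonempty_iff_eq_empty] at h
        rw [h, Real.sSup_empty] at hsup
        linarith
      have h1 : M ≤ 4 + sqrt (B * m ^ 7) := by
        rw [← hsup]
        refine csSup_le hne ?_
        rintro _ ⟨z, hz, rfl⟩
        have h2 := Real.le_sqrt_of_sq_le (hall z.1 hz.1 z.2 hz.2)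
        have h3 : s.θ z - 4 ≤ max (s.θ z - 4) 0 := le_max_left _ _
        simp only [Prod.mk.eta] at h2
        linarith
      have h2 : (M - 4) ^ 2 ≤ B * m ^ 7 := by
        have := pow_le_pow_left₀ (by linarith : 0 ≤ M - 4) (by linarith : M - 4 ≤ sqrt (B * m ^ 7)) 2
        rwa [Real.sq_sqrt (by positivity)] at this
      have h3 : M ^ 2 ≤ 25 * (M - 4) ^ 2 := by nlinarith
      have h4 : m ^ 7 * m ≤ m ^ 7 * (25 * B) := by
        calc m ^ 7 * m = M ^ 2 := by rw [← hm4]; ring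
          _ ≤ 25 * (B * m ^ 7) := by linarith
          _ = _ := by ring
      have := le_of_mul_le_mul_left h4 (by positivity)
      linarith
  exact ⟨one_le_pow₀ (by linarith), fun t ht x hx => (hle.2 t ht x hx).trans (pow_le_pow_left₀ hm0.le hmle 4)⟩

/-- The estimates that hold at almost all times and on all time intervals. -/
theorem uniform_bounds (p : Params) : ∃ K > 0, ∀ s : Sol p, (∀ t ≥ 0, ∀ x ∈ closure s.S, s.θ (t, x) ≤ K) ∧
    (∀ t ≥ 0, ∫ x in s.S, s.vx (t, x) ^ 2 ≤ K) ∧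
    (∀ᵐ t ∂vol₊, ∫ x in s.S, s.ux (t, x) ^ 2 ≤ K) ∧
    (∀ᵐ t ∂vol₊, ∫ x in s.S, s.θx (t, x) ^ 2 ≤ K) ∧
    ∀ T ≥ 0, (∫ z, s.ux z ^ 2 ∂stm s.S T ≤ K ∧ ∫ z, s.θx z ^ 2 ∂stm s.S T ≤ K) ∧
      (∫ z, s.uxx z ^ 2 ∂stm s.S T ≤ K ∧ ∫ z, s.θxx z ^ 2 ∂stm s.S T ≤ K) ∧
      Integrable (fun z => s.θ z * s.vx z ^ 2) (stm s.S T) ∧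
      ∫ z, s.θ z * s.vx z ^ 2 ∂stm s.S T ≤ K := by
  obtain ⟨m, hm, hM⟩ := θ_upper p
  obtain ⟨K₁, hK₁, h1⟩ := integral_vx_sq_le p
  obtain ⟨K₂, hK₂, h2⟩ := integral_θx_sq_le p
  obtain ⟨K₃, hK₃, h3⟩ := integral_ux_sq_le p
  obtain ⟨K₄, hK₄, h4⟩ := integral_ux_le p
  obtain ⟨K₅, hK₅, h5⟩ := integral_θx_le p
  have hm0 : 0 < m := by linarith
  have a0 : 0 ≤ m ^ 4 := by positivity
  have a1 : 0 ≤ K₁ * m ^ 2 := by positivity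
  have a2 : 0 ≤ K₂ * m ^ 4 := by positivity
  have a4 : 0 ≤ K₄ * m ^ 6 := by positivity
  have a5 : 0 ≤ K₅ * m ^ 9 := by positivity
  refine ⟨m ^ 4 + K₁ * m ^ 2 + K₂ * m ^ 4 + K₃ + K₄ * m ^ 6 + K₅ * m ^ 9, by positivity, fun s => ?_⟩
  have hex : ∀ {F : ℝ × ℝ → ℝ} {B : ℝ}, (∀ T, MemLp F 2 (stm s.S T)) →
      (∀ᵐ t ∂vol₊, ∫ z, F z ^ 2 ∂stm s.S t ≤ B) → ∀ T,
      ∫ z, F z ^ 2 ∂stm s.S T ≤ B := by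
    intro F B hF hB T
    have h1 : ∀ᵐ t ∂vol (Ioi (max T 0)), ∫ z, F z ^ 2 ∂stm s.S t ≤ B :=
      ae_mono_set (Ioi_subset_Ioi (le_max_right _ _)) hB
    have hne : (ae (vol (Ioi (max T 0)))).NeBot := by
      rw [ae_neBot, Ne, Measure.restrict_eq_zero]
      simp
    obtain ⟨t, ht1, ht2⟩ := (h1.and ae_mem_Ioi).exists
    refine le_trans ?_ ht1
    have hTt : T ≤ t := (le_max_left T 0).trans (le_of_lt ht2)
    refine integral_mono_measure (Measure.prod_mono (Measure.restrict_mono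
      (Ioc_subset_Ioc_right hTt) le_rfl) le_rfl) (.of_forall fun z => sq_nonneg _)
      (hF t).integrable_sq
  have hu := ae_Ioi_of_Ioc fun T => h4 s T m hm (hM s T)
  have hθ := ae_Ioi_of_Ioc fun T => h5 s T m hm (hM s T)
  refine ⟨fun t ht x hx => ?_, fun t ht => ?_, ?_, ?_, fun T hT => ⟨⟨?_, ?_⟩, ⟨?_, ?_⟩, ?_, ?_⟩⟩
  · have := (hM s t).2 t ⟨ht, le_rfl⟩ x hx; linarith
  · have := (h1 s t ht m hm (hM s t)).1; linarith
  · filter_upwards [hu] with t ht; linarith [ht.1]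
  · filter_upwards [hθ] with t ht; linarith [ht.1]
  · have := h3 s T hT; linarith
  · have := (h2 s T hT _ (hM s T)).2; linarith
  · have := hex s.luxx (hu.mono fun t ht => ht.2) T; linarith
  · have := hex s.lθxx (hθ.mono fun t ht => ht.2) T; linarith
  · exact (h1 s T hT m hm (hM s T)).2.1
  · have := (h1 s T hT m hm (hM s T)).2.2; linarith

end Sol

/-! ### The lower bound of the temperature -/

theorem integral_time_eq_from {ν : Measure ℝ} [SFinite ν] {Φ Φt : ℝ × ℝ → ℝ}
    (h1 : ∀ᵐ x ∂ν, IsPrim (Ici 0) (fun t => Φ (t, x)) (fun t => Φt (t, x))) {a T : ℝ} (ha : 0 ≤ a)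
    (hT : a ≤ T) (h2 : Integrable Φt ((vol (Ioc a T)).prod ν))
    (h3 : Integrable (fun x => Φ (a, x)) ν) :
    Integrable (fun x => Φ (T, x)) ν ∧ ∫ x, Φ (T, x) ∂ν = (∫ x, Φ (a, x) ∂ν) + ∫ t in a..T, ∫ x, Φt (t, x) ∂ν := by
  have hae : (fun x => Φ (T, x)) =ᵐ[ν] fun x => Φ (a, x) + ∫ t in Ioc a T, Φt (t, x) := by
    filter_upwards [h1] with x hx
    have := hx.sub_eq (mem_Ici.2 ha) (mem_Ici.2 (ha.trans hT))
    rw [integral_of_le hT] at this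
    linarith
  have hi : Integrable (fun x => ∫ t in Ioc a T, Φt (t, x)) ν := h2.integral_prod_right
  refine ⟨(h3.add hi).congr hae.symm, ?_⟩
  rw [integral_congr_ae hae, integral_add h3 hi, integral_of_le hT,
    integral_integral_swap (f := fun t x => Φt (t, x)) h2]

theorem isPrim_of_hasDerivAt {f f' : ℝ → ℝ} (h : ∀ t, HasDerivAt f (f' t) t) (hc : Continuous f')
    (J : Set ℝ) : IsPrim J f f' := fun a _ b _ =>
  ⟨hc.intervalIntegrable a b, (intervalIntegral.integral_eq_sub_of_hasDerivAt (fun t _ => h t)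
    (hc.intervalIntegrable a b)).symm⟩

theorem hasDerivAt_pospart_sub_pow (a : ℝ) (n : ℕ) (y : ℝ) :
    HasDerivAt (fun y => max (a - y) 0 ^ (n + 2)) (-((n + 2 : ℕ) * max (a - y) 0 ^ (n + 1))) y := by
  have h1 := hasDerivAt_pospart_pow (-a) n (-y)
  have h2 := h1.comp y (hasDerivAt_neg y)
  have e : ∀ y : ℝ, -y - -a = a - y := fun y => by ring
  simp only [Function.comp_def, e] at h2
  exact h2.congr_deriv (by ring)

namespace Sol

variable {p : Params}

/-- Lower bounds of the temperature decay at most exponentially. -/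
theorem θ_propagate (s : Sol p) {k a m : ℝ} (ha : 0 ≤ a)
    (hk : ∀ t ≥ 0, ∀ x ∈ closure s.S, p.R ^ 2 * s.θ (t, x) / (4 * p.μ * s.v (t, x)) ≤ p.cv * k)
    (hk0 : 0 ≤ k)
    (hm : 0 < m) (hm1 : m ≤ 1) (h : ∀ x ∈ closure s.S, m ≤ s.θ (a, x)) {T : ℝ} (hT : a ≤ T) :
    ∀ x ∈ closure s.S, m * exp (-k * (T - a)) ≤ s.θ (T, x) := by
  have hJ := s.hS.ordConnected_closure
  have hμ := p.hμ; have hκ := p.hκ; have hcv := p.hcv; have hR := p.hR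
  set ψ : ℝ → ℝ := fun t => m * exp (-k * (t - a)) with hψ
  have cψ : Continuous ψ := by fun_prop
  have dψ : ∀ t, HasDerivAt ψ (-k * ψ t) t := by
    intro t
    have h1 : HasDerivAt (fun t => -k * (t - a)) (-k) t := by
      simpa using ((hasDerivAt_id t).sub_const a).const_mul (-k)
    exact (h1.exp.const_mul m).congr_deriv (by simp only [hψ]; ring)
  have pψ : ∀ t, 0 < ψ t := fun t => mul_pos hm (Real.exp_pos _)
  have ψ1 : ∀ t ≥ a, ψ t ≤ 1 := fun t ht => by
    have : exp (-k * (t - a)) ≤ 1 := by rw [Real.exp_le_one_iff]; nlinarith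
    calc ψ t ≤ m * 1 := mul_le_left this hm.le
      _ ≤ 1 := by linarith
  set q : ℝ × ℝ → ℝ := fun z => max (ψ z.1 - s.θ z) 0 with hq
  have cq : Continuous q := by fun_prop
  have mq := cq.measurable
  have q0 : ∀ z, 0 ≤ q z := fun z => le_max_right _ _
  have qle : ∀ z : ℝ × ℝ, a ≤ z.1 → q z ≤ |s.θ z - 1| := fun z hz =>
    max_le (by have := ψ1 z.1 hz; linarith [neg_abs_le (s.θ z - 1)]) (abs_nonneg _)
  have q1 : ∀ t ≥ a, ∀ x ∈ closure s.S, q (t, x) ≤ 1 := fun t ht x hx =>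
    max_le (by have h1 := ψ1 t ht; have h2 := s.pos_θ (ha.trans ht) hx; simp only; linarith) zero_le_one
  have hres : (vol (Ioc a T)).prod (vol s.S) ≤ stm s.S T :=
    Measure.prod_mono (Measure.restrict_mono (Ioc_subset_Ioc_left ha) le_rfl) le_rfl
  have hmem : ∀ᵐ z ∂(vol (Ioc a T)).prod (vol s.S), z.1 ∈ Ioc a T ∧ z.2 ∈ closure s.S := by
    rw [Measure.prod_restrict]
    filter_upwards [ae_restrict_mem (measurableSet_Ioc.prod s.hS.measurableSet)] with z hz
    exact ⟨hz.1, subset_closure hz.2⟩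
  have lq : MemLp q 2 ((vol (Ioc a T)).prod (vol s.S)) := by
    refine memLp_two_of_abs_le (C := 1) mq.aestronglyMeasurable ((s.lθ T).mono_measure hres) ?_
    filter_upwards [hmem] with z hz
    rw [abs_of_nonneg (q0 z), one_mul]; exact qle z hz.1.1.le
  have lqs : ∀ t ≥ a, MemLp (fun x => q (t, x)) 2 (vol s.S) := by
    intro t ht
    refine memLp_two_of_abs_le (C := 1) aesm (s.sθ t (ha.trans ht)) (.of_forall fun x => ?_)
    rw [abs_of_nonneg (q0 _), one_mul]; exact qle (t, x) ht
  have h1 : ∀ᵐ x ∂vol s.S, IsPrim (Ici 0) (fun t => q (t, x) ^ 3)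
      (fun t => 3 * q (t, x) ^ 2 * (-k * ψ t - s.θt (t, x))) := by
    filter_upwards [s.tθ] with x hx
    have hd := (isPrim_of_hasDerivAt dψ (by fun_prop) (Ici 0)).sub hx
    have := hd.comp (K := univ) (φ := fun y => max (y - 0) 0 ^ (1 + 2))
      (φ' := fun y => ((1 + 2 : ℕ) : ℝ) * max (y - 0) 0 ^ (1 + 1))
      (fun y _ => hasDerivAt_pospart_pow 0 1 y) (by fun_prop) (fun _ _ => trivial)
    simpa using this
  have hΦ : Integrable (fun z => 3 * q z ^ 2 * (-k * ψ z.1 - s.θt z)) ((vol (Ioc a T)).prod (vol s.S)) := by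
    refine integrable_of_abs_le_sq (f := fun z => q z) (g := fun z => s.θt z) (C := 3 * (k + 1))
      aesm lq ((s.lθt T).mono_measure hres) ?_
    filter_upwards [hmem] with z hz
    have e1 := q1 z.1 hz.1.1.le z.2 hz.2
    have e2 := q0 z
    have e3 := ψ1 z.1 hz.1.1.le
    have e4 := pψ z.1
    simp only [Prod.mk.eta] at e1
    rw [abs_mul, abs_of_nonneg (by positivity : 0 ≤ 3 * q z ^ 2)]
    have e5 : |-k * ψ z.1 - s.θt z| ≤ k + |s.θt z| := by
      refine (abs_sub _ _).trans ?_
      rw [abs_mul, abs_neg, abs_of_nonneg hk0, abs_of_pos e4]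
      have : k * ψ z.1 ≤ k * 1 := by gcongr
      linarith
    have e6 : q z ^ 2 ≤ q z := by nlinarith
    have e7 : q z * |s.θt z| ≤ (q z ^ 2 + s.θt z ^ 2) / 2 := by
      nlinarith [sq_nonneg (q z - |s.θt z|), sq_abs (s.θt z)]
    calc 3 * q z ^ 2 * |-k * ψ z.1 - s.θt z| ≤ 3 * q z ^ 2 * (k + |s.θt z|) := by gcongr
      _ = 3 * k * q z ^ 2 + 3 * (q z ^ 2 * |s.θt z|) := by ring
      _ ≤ 3 * k * q z ^ 2 + 3 * (q z * |s.θt z|) := by gcongr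
      _ ≤ _ := by nlinarith [sq_nonneg (q z), sq_nonneg (s.θt z), mul_nonneg hk0 (sq_nonneg (s.θt z))]
  have hst : ∀ x ∈ closure s.S, q (a, x) ^ 3 = 0 := by
    intro x hx
    have : q (a, x) = 0 := by
      simp only [hq, hψ]
      refine max_eq_right ?_
      simp only [sub_self, mul_zero, Real.exp_zero, mul_one]
      linarith [h x hx]
    rw [this]; simp
  have hint0 : Integrable (fun x => q (a, x) ^ 3) (vol s.S) := (integrable_zero ℝ ℝ _).congr (by
      filter_upwards [s.ae_S hst] with x hx
      rw [hx, Pi.zero_apply])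
  obtain ⟨iT, eT⟩ := integral_time_eq_from (Φ := fun z => q z ^ 3) h1 ha hT hΦ hint0
  have e0 : ∫ x in s.S, q (a, x) ^ 3 = 0 := by rw [integral_congr_ae (s.ae_S hst)]; simp
  have hslice : ∫ t in a..T, ∫ x in s.S, 3 * q (t, x) ^ 2 * (-k * ψ t - s.θt (t, x)) ≤ 0 := by
    rw [integral_of_le hT]
    refine integral_nonpos_of_ae ?_
    have sub1 : Ioc a T ⊆ Ioi (0:ℝ) := fun t ht => lt_of_le_of_lt ha ht.1
    have sl : ∀ {F : ℝ × ℝ → ℝ}, (∀ T, MemLp F 2 (stm s.S T)) → ∀ᵐ t ∂vol (Ioc a T),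
        MemLp (fun x => F (t, x)) 2 (vol s.S) := fun hF =>
      ae_mono_set sub1 (ae_Ioi_of_Ioc fun T => MemLp.ae_slice (hF T))
    filter_upwards [ae_mono_set sub1 s.xθ, ae_mono_set sub1 s.xθx, ae_mono_set sub1 s.eqθ,
      hΦ.prod_right_ae, ae_mem_Ioc, sl s.lθx, sl s.lux, sl s.lθt,
      ae_mono_set sub1 (by
      rcases s.bdry with h | ⟨-, h | h⟩
      · exact .of_forall fun t => Or.inl h
      · filter_upwards [ae_mem_Ioi] with t ht using Or.inr (Or.inl (h t (le_of_lt ht)))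
      · filter_upwards [h] with t ht using Or.inr (Or.inr ht) :
      ∀ᵐ t ∂vol₊, s.S = univ ∨ s.θ (t, 0) = 1 ∨ s.θx (t, 0) = 0)]
      with t hθ hθx heq hΦt ht lθx lux lθt hbd
    have ht0 : 0 ≤ t := ha.trans ht.1.le
    have hv := s.xv t ht0
    have hpos : ∀ x ∈ closure s.S, 0 < s.v (t, x) := fun x hx => s.pos_v ht0 hx
    have hqq := hθ.comp (K := univ) (φ := fun y => max (ψ t - y) 0 ^ 2)
      (φ' := fun y => -(2 * max (ψ t - y) 0))
      (fun y _ => (hasDerivAt_pospart_sub_pow (ψ t) 0 y).congr_deriv (by simp)) (by fun_prop)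
      (fun _ _ => trivial)
    have hH := ((hqq.mul hθx).div hv hpos).const_mul p.κ
    obtain ⟨c, hc, C, hb⟩ := s.ae_bound_slice ht0
    have bq : ∀ᵐ x ∂vol s.S, |q (t, x)| ≤ 1 := s.ae_S fun x hx => by
      rw [abs_of_nonneg (q0 _)]; exact q1 t ht.1.le x hx
    have mvt : AEStronglyMeasurable (fun x => s.v (t, x)) (vol s.S) :=
      (continuous_slice s.c_v t).aestronglyMeasurable
    have mqt : AEStronglyMeasurable (fun x => q (t, x)) (vol s.S) := (continuous_slice cq t).aestronglyMeasurable
    have hlow := hb.mono fun x hx => hx.1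
    have lqs' := lqs t ht.1.le
    have lqux := memLp_bdd_mul lux mqt bq
    have lqθx := memLp_bdd_mul lθx mqt bq
    have j1 := integrable_mul_div lqθx lθx mvt hc hlow
    have j2 := integrable_mul_div lqux lqux mvt hc hlow
    have lθq : MemLp (fun x => s.θ (t, x) * q (t, x)) 2 (vol s.S) :=
      memLp_bdd_mul (c := C) lqs' (continuous_slice s.c_θ t).aestronglyMeasurable (hb.mono fun x hx => by
        rw [abs_of_pos (hc.trans_le hx.2.2.1)]; exact hx.2.2.2.1)
    have j3 := integrable_mul_div lθq lqux mvt hc hlow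
    have j4 := integrable_fun_mul lqs' (memLp_bdd_mul lθt mqt bq)
    have j6 := integrable_mul_div lqs' lqθx mvt hc hlow
    let F : ℝ → ℝ := fun x => p.κ * ((-(2 * q (t, x)) * s.θx (t, x) * s.θx (t, x) +
      q (t, x) ^ 2 * s.θxx (t, x)) / s.v (t, x) - q (t, x) ^ 2 * s.θx (t, x) * s.vx (t, x) / s.v (t, x) ^ 2)
    have jj : Integrable F (vol s.S) :=
      ((integrable_comb j4 j1 j2 p.cv (-(2 * p.κ)) (-p.μ)).add (j3.const_mul p.R)).congr (by
        filter_upwards [heq] with x hx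
        simp only [Pi.add_apply, F]
        linear_combination (q (t, x) ^ 2) * hx)
    have hz : ∫ x in s.S, F x = 0 := hH.integral_eq_zero s.hS ((j6.const_mul p.κ).congr (.of_forall fun x => by
      simp only [hq]; ring)) jj (by
      rcases hbd with h0 | h0 | h0
      · exact Or.inl h0
      · right
        have : max (ψ t - s.θ (t, 0)) 0 = 0 := max_eq_right (by rw [h0]; linarith [ψ1 t ht.1.le])
        simp [this]
      · right; simp [h0])
    have hle : ∫ x in s.S, 3 * q (t, x) ^ 2 * (-k * ψ t - s.θt (t, x)) ≤
        ∫ x in s.S, -(3 / p.cv) * F x := by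
      refine integral_mono_ae hΦt (jj.const_mul _) ?_
      filter_upwards [heq, s.ae_S hpos, s.ae_S (fun x hx => s.pos_θ ht0 hx), s.ae_S (hk t ht0)]
        with x hx hvp hθp hkx
      simp only [F]
      have hqθ : q (t, x) ^ 2 * s.θ (t, x) ≤ q (t, x) ^ 2 * ψ t := by
        by_cases hlt : ψ t ≤ s.θ (t, x)
        · have : q (t, x) = 0 := max_eq_right (by simp only; linarith)
          rw [this]; simp
        · push Not at hlt
          gcongr
      have hq0 := q0 (t, x)
      generalize q (t, x) = w at *
      have e1 : -(3 / p.cv) * (p.κ * ((-(2 * w) * s.θx (t, x) * s.θx (t, x) +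
        w ^ 2 * s.θxx (t, x)) / s.v (t, x) - w ^ 2 * s.θx (t, x) * s.vx (t, x) / s.v (t, x) ^ 2)) =
        (6 * p.κ / p.cv) * (w * s.θx (t, x) ^ 2 / s.v (t, x)) - (3 / p.cv) * w ^ 2 *
          (p.cv * s.θt (t, x) - p.μ * (s.ux (t, x) ^ 2 / s.v (t, x)) +
          p.R * (s.θ (t, x) * s.ux (t, x) / s.v (t, x))) := by
        rw [hx]; field_simp; ring
      rw [e1]
      have e2 : 0 ≤ (6 * p.κ / p.cv) * (w * s.θx (t, x) ^ 2 / s.v (t, x)) := by positivity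
      have e3 : p.R * (s.θ (t, x) * s.ux (t, x) / s.v (t, x)) - p.μ * (s.ux (t, x) ^ 2 / s.v (t, x)) ≤
          p.R ^ 2 * s.θ (t, x) / (4 * p.μ * s.v (t, x)) * s.θ (t, x) := by
        have f1 : 0 ≤ 1 / (4 * p.μ * s.v (t, x)) * (p.R * s.θ (t, x) - 2 * p.μ * s.ux (t, x)) ^ 2 := by
          positivity
        have f2 : 1 / (4 * p.μ * s.v (t, x)) * (p.R * s.θ (t, x) - 2 * p.μ * s.ux (t, x)) ^ 2 =
          p.R ^ 2 * s.θ (t, x) / (4 * p.μ * s.v (t, x)) * s.θ (t, x) -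
          (p.R * (s.θ (t, x) * s.ux (t, x) / s.v (t, x)) - p.μ * (s.ux (t, x) ^ 2 / s.v (t, x))) := by
          field_simp; ring
        linarith
      have e4 : p.R ^ 2 * s.θ (t, x) / (4 * p.μ * s.v (t, x)) * s.θ (t, x) ≤ p.cv * k * s.θ (t, x) := by gcongr
      have e5 : (3 / p.cv) * w ^ 2 * (p.cv * s.θt (t, x) - p.μ * (s.ux (t, x) ^ 2 / s.v (t, x)) +
          p.R * (s.θ (t, x) * s.ux (t, x) / s.v (t, x))) ≤ (3 / p.cv) * w ^ 2 *
          (p.cv * s.θt (t, x) + p.cv * k * s.θ (t, x)) :=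
        mul_le_left (by linarith) (by positivity)
      have e6 : (3 / p.cv) * w ^ 2 * (p.cv * s.θt (t, x) + p.cv * k * s.θ (t, x)) =
        3 * w ^ 2 * s.θt (t, x) + 3 * k * (w ^ 2 * s.θ (t, x)) := by field_simp
      have e7 : k * (w ^ 2 * s.θ (t, x)) ≤ k * (w ^ 2 * ψ t) := by gcongr
      have e8 : 3 * w ^ 2 * (-k * ψ t - s.θt (t, x)) = -3 * (k * (w ^ 2 * ψ t)) - 3 * w ^ 2 * s.θt (t, x) := by
        ring
      linarith
    refine hle.trans (le_of_eq ?_)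
    rw [integral_const_mul, hz, mul_zero]
    rfl
  have hTint : ∫ x in s.S, q (T, x) ^ 3 ≤ 0 := by
    rw [e0, zero_add] at eT
    rw [eT]; exact hslice
  have hTz : ∀ᵐ x ∂vol s.S, q (T, x) ^ 3 = 0 := by
    have h2 : ∫ x in s.S, q (T, x) ^ 3 = 0 := le_antisymm hTint (integral_nonneg fun x => pow_nonneg (q0 _) 3)
    exact (integral_eq_zero_iff_of_nonneg (fun x => pow_nonneg (q0 _) 3) iT).1 h2
  intro x hx
  have hsub : Ioo x (x + 1) ⊆ s.S := fun y hy => s.hS.Ioi_subset hx hy.1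
  have := le_on_Icc_of_ae (f := fun _ => ψ T) (g := fun x => s.θ (T, x)) continuous_const
    (continuous_slice s.c_θ T) (show x < x + 1 by linarith) (by
      filter_upwards [ae_mono_set hsub hTz] with y hy
      have h0 : q (T, y) = 0 := by simpa using hy
      have h3 : ψ T - s.θ (T, y) ≤ q (T, y) := le_max_left _ _
      linarith) x ⟨le_rfl, by linarith⟩
  exact this

end Sol

theorem sq_sub_one_le_relEntropy {y : ℝ} (hy : 0 < y) : (y - 1) ^ 2 ≤ 2 * (y + 1) * (y - log y - 1) := by
  have h1 := Real.log_le_sub_one_of_pos (Real.sqrt_pos.2 hy)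
  rw [Real.log_sqrt hy.le] at h1
  have h2 := Real.sq_sqrt hy.le
  have h3 := Real.sqrt_pos.2 hy
  set r := sqrt y
  have h4 : (r - 1) ^ 2 ≤ y - log y - 1 := by nlinarith
  have h5 : (y - 1) ^ 2 ≤ 2 * (y + 1) * (r - 1) ^ 2 := by
    rw [← h2]
    have : (r ^ 2 - 1) ^ 2 = (r + 1) ^ 2 * (r - 1) ^ 2 := by ring
    rw [this]
    refine mul_le_right ?_ (sq_nonneg _)
    nlinarith [sq_nonneg (r - 1)]
  refine h5.trans (mul_le_left h4 (by positivity))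

/-- A function whose integral over an interval is small takes a small value there. -/
theorem exists_le_of_integral_le {f : ℝ → ℝ} {a b K : ℝ} (hab : a < b) (hK : 0 < K)
    (hf : IntervalIntegrable f volume a b) (h : ∫ t in a..b, f t ≤ K) {P : ℝ → Prop}
    (hP : ∀ᵐ t ∂vol (Ioc a b), P t) :
    ∃ t ∈ Ioc a b, P t ∧ f t ≤ 2 * K / (b - a) := by
  by_contra hcon
  push Not at hcon
  have hae : ∀ᵐ t ∂vol (Ioc a b), 2 * K / (b - a) ≤ f t := by
    filter_upwards [hP, ae_mem_Ioc] with t h1 h2 using (hcon t h2 h1).le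
  have h1 : ∫ t in a..b, (2 * K / (b - a)) ≤ ∫ t in a..b, f t := by
    rw [integral_of_le hab.le, integral_of_le hab.le]
    exact integral_mono_ae (by simp) ((intervalIntegrable_iff_Ioc hab.le).1 hf) hae
  rw [interval_const, smul_eq_mul, mul_div_cancel₀ _ (by linarith : b - a ≠ 0)] at h1
  linarith

namespace Sol

variable {p : Params}

theorem integral_sub_one_sq_le (p : Params) : ∃ K > 0, ∀ s : Sol p, ∀ t ≥ 0,
    ∫ x in s.S, (s.v (t, x) - 1) ^ 2 ≤ K ∧ ∫ x in s.S, (s.θ (t, x) - 1) ^ 2 ≤ K := by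
  obtain ⟨V, hV, hv⟩ := v_upper p
  obtain ⟨K, hK, hb⟩ := uniform_bounds p
  have hE := p.E_nonneg; have hR := p.hR; have hcv := p.hcv
  refine ⟨2 * (V + 1) * (p.E / p.R) + 2 * (K + 1) * (p.E / p.cv) + 1, by positivity, fun s t ht => ?_⟩
  obtain ⟨-, e1, e2, -⟩ := s.energy ht
  have n1 : 0 ≤ 2 * (V + 1) * (p.E / p.R) := by positivity
  have n2 : 0 ≤ 2 * (K + 1) * (p.E / p.cv) := by positivity
  constructor
  · have hpt : ∀ x ∈ closure s.S, (s.v (t, x) - 1) ^ 2 ≤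
        2 * (V + 1) * (s.v (t, x) - log (s.v (t, x)) - 1) := fun x hx => by
      have hp := s.pos_v ht hx
      have := hv s t ht x hx
      exact (sq_sub_one_le_relEntropy hp).trans (mul_le_right (by linarith) (relEntropy_nonneg hp))
    have h1 := integral_mono_ae (s.sv t ht).integrable_sq
      ((s.integrable_relEntropy_v ht).const_mul (2 * (V + 1))) (s.ae_S hpt)
    rw [integral_const_mul] at h1
    have h2 : ∫ x in s.S, (s.v (t, x) - log (s.v (t, x)) - 1) ≤ p.E / p.R := by rw [le_div_iff₀ hR]; linarith
    have h3 : 2 * (V + 1) * ∫ x in s.S, (s.v (t, x) - log (s.v (t, x)) - 1) ≤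
      2 * (V + 1) * (p.E / p.R) := by gcongr
    linarith
  · have hpt : ∀ x ∈ closure s.S, (s.θ (t, x) - 1) ^ 2 ≤
        2 * (K + 1) * (s.θ (t, x) - log (s.θ (t, x)) - 1) := fun x hx => by
      have hp := s.pos_θ ht hx
      have := (hb s).1 t ht x hx
      exact (sq_sub_one_le_relEntropy hp).trans (mul_le_right (by linarith) (relEntropy_nonneg hp))
    have h1 := integral_mono_ae (s.sθ t ht).integrable_sq
      ((s.integrable_relEntropy_θ ht).const_mul (2 * (K + 1))) (s.ae_S hpt)
    rw [integral_const_mul] at h1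
    have h2 : ∫ x in s.S, (s.θ (t, x) - log (s.θ (t, x)) - 1) ≤ p.E / p.cv := by rw [le_div_iff₀ hcv]; linarith
    have h3 : 2 * (K + 1) * ∫ x in s.S, (s.θ (t, x) - log (s.θ (t, x)) - 1) ≤
      2 * (K + 1) * (p.E / p.cv) := by gcongr
    linarith

/-- The lower bound of the temperature. -/
theorem θ_lower (p : Params) : ∃ c > 0, ∀ s : Sol p, ∀ t ≥ 0, ∀ x ∈ closure s.S, c ≤ s.θ (t, x) := by
  obtain ⟨c, hc, hv⟩ := v_lower p
  obtain ⟨K, hK, hb⟩ := uniform_bounds p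
  obtain ⟨C, hC, hL⟩ := integral_sub_one_sq_le p
  have hR := p.hR; have hcv := p.hcv; have hμ := p.hμ; have hpb := p.hb
  set k := p.R ^ 2 * K / (4 * p.μ * c) / p.cv with hk
  have hk0 : 0 ≤ k := by positivity
  set l := 1 / (8 * C) with hl
  have hl0 : 0 < l := by positivity
  set L := 128 * C * K with hLdef
  have hL0 : 0 < L := by positivity
  set b := min p.b (1 / 2) with hbdef
  have hb0 : 0 < b := lt_min hpb (by norm_num)
  have hb1 : b ≤ 1 / 2 := min_le_right _ _
  refine ⟨b * exp (-k * L), by positivity, fun s t ht x hx => ?_⟩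
  have hkx : ∀ t ≥ 0, ∀ x ∈ closure s.S, p.R ^ 2 * s.θ (t, x) / (4 * p.μ * s.v (t, x)) ≤ p.cv * k := by
    intro t ht x hx
    have h1 := (hb s).1 t ht x hx
    have h2 := hv s t ht x hx
    have h3 : p.cv * k = p.R ^ 2 * K / (4 * p.μ * c) := by rw [hk]; field_simp
    rw [h3]
    gcongr
  obtain ⟨a, ha0, hat, haL, hab⟩ : ∃ a ≥ 0, a ≤ t ∧ t - a ≤ L ∧ ∀ x ∈ closure s.S, b ≤ s.θ (a, x) := by
    by_cases htL : t ≤ L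
    · exact ⟨0, le_rfl, ht, by linarith, fun x hx => (min_le_left _ _).trans (s.θ0_ge x hx)⟩
    push Not at htL
    have hi : IntervalIntegrable (fun τ => ∫ x in s.S, s.θx (τ, x) ^ 2) volume (t - L) t :=
      intervalIntegrable_slice (fun T => (s.lθx T).integrable_sq) (by linarith) (by linarith)
    have hle : ∫ τ in (t - L)..t, (∫ x in s.S, s.θx (τ, x) ^ 2) ≤ K := by
      have h1 := ((hb s).2.2.2.2 t ht).1.2
      rw [integral_stm_eq ht (s.lθx t).integrable_sq] at h1
      have h2 := integral_add_adjacent_intervals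
        (intervalIntegrable_slice (fun T => (s.lθx T).integrable_sq) le_rfl (by linarith : 0 ≤ t - L)) hi
      have h3 : 0 ≤ ∫ τ in 0..(t - L), (∫ x in s.S, s.θx (τ, x) ^ 2) :=
        interval_nonneg (by linarith) fun τ _ => integral_nonneg fun x => sq_nonneg _
      linarith
    have sub1 : Ioc (t - L) t ⊆ Ioi (0:ℝ) := fun τ hτ => lt_trans (by linarith : 0 < t - L) hτ.1
    obtain ⟨a, ha, ⟨hp1, hp2⟩, hle'⟩ := exists_le_of_integral_le (by linarith) hK hi hle
      (ae_mono_set sub1 (s.xθ.and (ae_Ioi_of_Ioc fun T => MemLp.ae_slice (s.lθx T))))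
    have ha0 : 0 ≤ a := le_of_lt (sub1 ha)
    refine ⟨a, ha0, ha.2, by linarith [ha.1], fun y hy => ?_⟩
    have h1 := (hp1.sub_const 1).sq_le s.hS (s.sθ a ha0) hp2 hl0 hy
    have h2 : l * ∫ y in s.S, (s.θ (a, y) - 1) ^ 2 ≤ l * C := by gcongr; exact (hL s a ha0).2
    have h3 : l⁻¹ * ∫ y in s.S, s.θx (a, y) ^ 2 ≤ l⁻¹ * (2 * K / (t - (t - L))) := by gcongr
    have h4 : l * C = 1 / 8 := by rw [hl]; field_simp
    have h5 : l⁻¹ * (2 * K / (t - (t - L))) = 1 / 8 := by rw [sub_sub_cancel, hl, hLdef]; field_simp; norm_num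
    have h6 : (s.θ (a, y) - 1) ^ 2 ≤ (1 / 2) ^ 2 := by linarith
    have h7 := abs_le_of_sq_le_sq' h6 (by norm_num)
    linarith [h7.1]
  have h1 := s.θ_propagate ha0 hkx hk0 hb0 (by linarith) hab hat x hx
  refine le_trans ?_ h1
  have : -k * L ≤ -k * (t - a) := by nlinarith
  gcongr

/-- All estimates, at almost all times and on all time intervals. -/
theorem estimates (p : Params) : ∃ K > 0, ∀ s : Sol p,
    (∀ t ≥ 0, ∀ x ∈ closure s.S, K⁻¹ ≤ s.θ (t, x) ∧ s.θ (t, x) ≤ K) ∧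
    (∀ t ≥ 0, ∫ x in s.S, (s.v (t, x) - 1) ^ 2 ≤ K ∧ ∫ x in s.S, s.u (t, x) ^ 2 ≤ K ∧
      ∫ x in s.S, (s.θ (t, x) - 1) ^ 2 ≤ K ∧ ∫ x in s.S, s.vx (t, x) ^ 2 ≤ K) ∧
    (∀ᵐ t ∂vol₊, ∫ x in s.S, s.ux (t, x) ^ 2 ≤ K ∧ ∫ x in s.S, s.θx (t, x) ^ 2 ≤ K) ∧
    ∀ T ≥ 0, ∫ z, s.ux z ^ 2 ∂stm s.S T ≤ K ∧ ∫ z, s.θx z ^ 2 ∂stm s.S T ≤ K ∧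
      ∫ z, s.uxx z ^ 2 ∂stm s.S T ≤ K ∧ ∫ z, s.θxx z ^ 2 ∂stm s.S T ≤ K ∧
      ∫ z, s.vx z ^ 2 ∂stm s.S T ≤ K := by
  obtain ⟨c, hc, hl⟩ := θ_lower p
  obtain ⟨K, hK, hb⟩ := uniform_bounds p
  obtain ⟨C, hC, hL⟩ := integral_sub_one_sq_le p
  have hE := p.E_nonneg
  have hcK : 0 < c⁻¹ * K := by positivity
  have hc' : 0 < c⁻¹ := by positivity
  refine ⟨c⁻¹ + K + C + 2 * p.E + c⁻¹ * K, by positivity, fun s => ?_⟩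
  obtain ⟨b1, b2, b3, b4, b5⟩ := hb s
  refine ⟨fun t ht x hx => ⟨?_, ?_⟩, fun t ht => ⟨?_, ?_, ?_, ?_⟩, ?_, fun T hT => ?_⟩
  · refine le_trans ?_ (hl s t ht x hx)
    rw [inv_le_comm₀ (by positivity) hc]
    linarith
  · linarith [b1 t ht x hx]
  · linarith [(hL s t ht).1]
  · linarith [(s.energy ht).1]
  · linarith [(hL s t ht).2]
  · linarith [b2 t ht]
  · filter_upwards [b3, b4] with t h3 h4 using ⟨by linarith, by linarith⟩
  · obtain ⟨⟨d1, d2⟩, ⟨d3, d4⟩, d5, d6⟩ := b5 T hT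
    have d7 : ∫ z, s.vx z ^ 2 ∂stm s.S T ≤ c⁻¹ * K := by
      refine le_trans ?_ (mul_le_left d6 hc'.le)
      rw [← integral_const_mul]
      refine integral_mono_ae (s.lvx T).integrable_sq (d5.const_mul _) ?_
      filter_upwards [ae_stm s.hS T] with z hz
      have h1 : c ≤ s.θ z := hl s z.1 hz.1.1.le z.2 hz.2
      rw [inv_mul_eq_div, le_div_iff₀ hc, mul_comm]
      gcongr
    exact ⟨by linarith, by linarith, by linarith, by linarith, by linarith⟩

end Sol

/-! ### Decay of the derivatives -/

theorem integrableOn_Ioi_slice {S : Set ℝ} {F : ℝ × ℝ → ℝ} (hF : ∀ T, Integrable F (stm S T))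
    (h0 : ∀ z, 0 ≤ F z) {K : ℝ} (hK : ∀ T ≥ 0, ∫ z, F z ∂stm S T ≤ K) :
    IntegrableOn (fun t => ∫ x in S, F (t, x)) (Ioi 0) := by
  refine integrableOn_Ioi_of_intervalIntegral_norm_bounded (b := fun n : ℕ => (n:ℝ)) (l := atTop) K 0
    (fun n => (hF n).integral_prod_left) tendsto_natCast_atTop_atTop (.of_forall fun n => ?_)
  have hn : (0:ℝ) ≤ n := n.cast_nonneg
  refine le_trans (le_of_eq ?_) (hK n hn)
  rw [integral_stm_eq hn (hF n)]
  exact interval_congr fun t _ => Real.norm_of_nonneg (integral_nonneg fun x => h0 _)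

/-- An integrable function that grows at an integrable rate at most tends to zero. -/
theorem eventually_le_of_integrable {f r : ℝ → ℝ} (hf : IntegrableOn f (Ioi 0))
    (hr : IntegrableOn r (Ioi 0)) (hr0 : ∀ t, 0 ≤ r t)
    (h : ∀ᵐ a ∂vol₊, ∀ᵐ t ∂vol (Ioi a), f t ≤ f a + ∫ τ in a..t, r τ)
    {ε : ℝ} (hε : 0 < ε) : ∃ T ≥ 0, ∀ᵐ t ∂vol (Ioi T), f t ≤ ε := by
  have h1 := intervalIntegral_tendsto_integral_Ioi 0 hr tendsto_id
  have h2 : ∀ᶠ b in atTop, (∫ τ in Ioi 0, r τ) - ε / 2 < ∫ τ in 0..b, r τ :=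
    h1.eventually (lt_mem_nhds (by linarith))
  obtain ⟨b, hb, hb0⟩ := (h2.and (eventually_ge_atTop 0)).exists
  have hii : ∀ {c d : ℝ}, 0 ≤ c → c ≤ d → IntervalIntegrable r volume c d := fun hc hcd => by
    rw [intervalIntegrable_iff_Ioc hcd]
    exact hr.mono_set fun y hy => hc.trans_lt hy.1
  have h3 : ∀ a ≥ b, ∀ t ≥ a, ∫ τ in a..t, r τ ≤ ε / 2 := fun a ha t hat => by
    have e1 := integral_add_adjacent_intervals (hii le_rfl (hb0.trans ha)) (hii (hb0.trans ha) hat)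
    have e2 : ∫ τ in 0..b, r τ ≤ ∫ τ in 0..a, r τ := by
      rw [← integral_add_adjacent_intervals (hii le_rfl hb0) (hii hb0 ha)]
      linarith [interval_nonneg (f := r) (μ := volume) ha fun τ _ => hr0 τ]
    have e3 : ∫ τ in 0..t, r τ ≤ ∫ τ in Ioi 0, r τ := by
      rw [integral_of_le (hb0.trans (ha.trans hat))]
      exact setIntegral_mono_set hr (.of_forall hr0) Ioc_subset_Ioi_self.eventuallyLE
    linarith
  have h4 : ∃ a, b < a ∧ f a ≤ ε / 2 ∧ ∀ᵐ t ∂vol (Ioi a), f t ≤ f a + ∫ τ in a..t, r τ := by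
    by_contra hc
    push Not at hc
    have hbad : ∀ᵐ a ∂vol (Ioi b), ε / 2 ≤ f a := by
      filter_upwards [ae_mono_set (Ioi_subset_Ioi hb0) h, ae_mem_Ioi] with a ha hab
      by_contra hlt
      exact hc a hab (not_le.1 hlt).le (ha.mono fun t ht => not_lt.2 ht)
    have hi : IntegrableOn (fun _ => ε / 2) (Ioi b) := by
      refine (hf.mono_set (Ioi_subset_Ioi hb0)).mono' aestronglyMeasurable_const ?_
      filter_upwards [hbad] with a ha
      rwa [Real.norm_of_nonneg (by positivity)]
    rw [integrableOn_const_iff] at hi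
    simp [hε.ne'] at hi
  obtain ⟨a, hba, ha, hae⟩ := h4
  refine ⟨a, hb0.trans hba.le, ?_⟩
  filter_upwards [hae, ae_mem_Ioi] with t ht hat
  linarith [h3 a hba.le t (le_of_lt hat)]

namespace Sol

variable {p : Params}

/-- The derivatives decay in `L²`. -/
theorem decay (s : Sol p) {ε : ℝ} (hε : 0 < ε) : ∃ T ≥ 0, ∀ᵐ t ∂vol (Ioi T),
    ∫ x in s.S, s.vx (t, x) ^ 2 ≤ ε ∧ ∫ x in s.S, s.ux (t, x) ^ 2 ≤ ε ∧ ∫ x in s.S, s.θx (t, x) ^ 2 ≤ ε := by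
  obtain ⟨K, hK, hs⟩ := estimates p
  obtain ⟨b1, b2, b3, b4⟩ := hs s
  obtain ⟨δ, hδ, A, hA, hU⟩ := energy_ux p
  obtain ⟨δ', hδ', A', hA', hΘ⟩ := energy_θx p
  have iF : ∀ {g : ℝ × ℝ → ℝ}, (∀ T, MemLp g 2 (stm s.S T)) → (∀ T ≥ 0, ∫ z, g z ^ 2 ∂stm s.S T ≤ K) →
      IntegrableOn (fun t => ∫ x in s.S, g (t, x) ^ 2) (Ioi 0) := fun hg hgK =>
    integrableOn_Ioi_slice (fun T => (hg T).integrable_sq) (fun z => sq_nonneg _) hgK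
  have hB : ∀ T, ∀ t ∈ Icc 0 T, ∫ x in s.S, s.vx (t, x) ^ 2 ≤ K := fun T t ht => (b2 t ht.1).2.2.2
  have hθ : ∀ T, ∀ {g : ℝ × ℝ → ℝ}, MemLp g 2 (stm s.S T) → Integrable (fun z => s.θ z ^ 2 * g z ^ 2)
      (stm s.S T) → ∫ z, s.θ z ^ 2 * g z ^ 2 ∂stm s.S T ≤ K ^ 2 * ∫ z, g z ^ 2 ∂stm s.S T :=
    fun T g hg hi => by
      rw [← integral_const_mul]
      refine integral_mono_ae hi (hg.integrable_sq.const_mul _) ?_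
      filter_upwards [ae_stm s.hS T] with z hz
      have hp := s.pos_θ (x := z.2) hz.1.1.le hz.2
      have := (b1 z.1 hz.1.1.le z.2 hz.2).2
      gcongr
  have rU : IntegrableOn (fun t => ∫ x in s.S, s.restU (t, x)) (Ioi 0) := by
    refine integrableOn_Ioi_slice s.integrable_restU (fun z => by unfold restU; positivity)
      (K := K * (K + K) + K + K ^ 2 * K) fun T hT => ?_
    obtain ⟨c1, c2, c3, c4, c5⟩ := b4 T hT
    have e1 := (s.integral_ux_vx_le (hB T) one_pos).2
    have e2 := hθ T (s.lvx T) (s.integrable_θ_vx T)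
    have e3 : K ^ 2 * ∫ z, s.vx z ^ 2 ∂stm s.S T ≤ K ^ 2 * K := by gcongr
    have e4 : K * (1 * (∫ z, s.ux z ^ 2 ∂stm s.S T) + 1⁻¹ * ∫ z, s.uxx z ^ 2 ∂stm s.S T) ≤
      K * (K + K) := mul_le_left (by linarith) hK.le
    rw [s.integral_restU]
    linarith
  have rΘ : IntegrableOn (fun t => ∫ x in s.S, s.restθ (t, x)) (Ioi 0) := by
    refine integrableOn_Ioi_slice s.integrable_restθ (fun z => by unfold restθ; positivity)
      (K := K * (K + K) + K * (K + K) + K ^ 2 * K) fun T hT => ?_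
    obtain ⟨c1, c2, c3, c4, c5⟩ := b4 T hT
    have e1 := (s.integral_θx_vx_le (hB T) one_pos).2
    have e5 := (s.integral_ux_ux_le (ae_Ioc (b3.mono fun t ht => ht.1) T) one_pos).2
    have e2 := hθ T (s.lux T) (s.integrable_θ_ux T)
    have e3 : K ^ 2 * ∫ z, s.ux z ^ 2 ∂stm s.S T ≤ K ^ 2 * K := by gcongr
    have e4 : K * (1 * (∫ z, s.ux z ^ 2 ∂stm s.S T) + 1⁻¹ * ∫ z, s.uxx z ^ 2 ∂stm s.S T) ≤
      K * (K + K) := mul_le_left (by linarith) hK.le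
    have e6 : K * (1 * (∫ z, s.θx z ^ 2 ∂stm s.S T) + 1⁻¹ * ∫ z, s.θxx z ^ 2 ∂stm s.S T) ≤
      K * (K + K) := mul_le_left (by linarith) hK.le
    rw [s.integral_restθ]
    linarith
  have sl : ∀ {g : ℝ × ℝ → ℝ}, (∀ T, MemLp g 2 (stm s.S T)) → ∀ᵐ t ∂vol₊, MemLp (fun x => g (t, x)) 2 (vol s.S) :=
    fun hg => ae_Ioi_of_Ioc fun T => MemLp.ae_slice (hg T)
  have nn : ∀ {F : ℝ × ℝ → ℝ}, (∀ z, 0 ≤ F z) → ∀ t : ℝ, 0 ≤ ∫ x in s.S, F (t, x) := fun h t =>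
    integral_nonneg fun x => h _
  obtain ⟨T1, hT1, k1⟩ := eventually_le_of_integrable (iF s.lux fun T hT => (b4 T hT).1)
    (rU.const_mul A) (fun t => mul_nonneg hA.le (nn (fun z => by unfold restU; positivity) t)) (by
      filter_upwards [s.xu, sl s.lux, ae_mem_Ioi] with a ha ha' ha0
      filter_upwards [hU s a (le_of_lt ha0) _ ha ha', ae_mem_Ioi] with t ht hat
      have := mul_nonneg hδ.le (interval_nonneg (μ := volume) (le_of_lt hat)
        fun τ _ => nn (F := fun z => s.uxx z ^ 2) (fun z => sq_nonneg _) τ)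
      rw [interval_const_mul]
      linarith) hε
  obtain ⟨T2, hT2, k2⟩ := eventually_le_of_integrable (iF s.lθx fun T hT => (b4 T hT).2.1)
    (rΘ.const_mul A') (fun t => mul_nonneg hA'.le (nn (fun z => by unfold restθ; positivity) t)) (by
      filter_upwards [s.xθ, sl s.lθx, ae_mem_Ioi] with a ha ha' ha0
      filter_upwards [hΘ s a (le_of_lt ha0) _ ha ha', ae_mem_Ioi] with t ht hat
      have := mul_nonneg hδ'.le (interval_nonneg (μ := volume) (le_of_lt hat)
        fun τ _ => nn (F := fun z => s.θxx z ^ 2) (fun z => sq_nonneg _) τ)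
      rw [interval_const_mul]
      linarith) hε
  have ivx := iF s.lvx fun T hT => (b4 T hT).2.2.2.2
  have iux := iF s.luxx fun T hT => (b4 T hT).2.2.1
  obtain ⟨T3, hT3, k3⟩ := eventually_le_of_integrable ivx (ivx.add iux)
    (fun t => add_nonneg (nn (F := fun z => s.vx z ^ 2) (fun z => sq_nonneg _) t)
      (nn (F := fun z => s.uxx z ^ 2) (fun z => sq_nonneg _) t)) (by
      filter_upwards [ae_mem_Ioi] with a ha
      filter_upwards [ae_mem_Ioi] with t hat
      have ha : 0 < a := ha
      have hat : a < t := hat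
      have hsub : (vol (Ioc a t)).prod (vol s.S) ≤ stm s.S t :=
        Measure.prod_mono (Measure.restrict_mono (Ioc_subset_Ioc_left ha.le) le_rfl) le_rfl
      have i1 : ∀ T, Integrable (fun z => s.uxx z * s.vx z + s.vx z * s.uxx z) (stm s.S T) := fun T =>
        ((s.luxx T).integrable_mul (s.lvx T)).add ((s.lvx T).integrable_mul (s.luxx T))
      have h := (integral_time_eq_from (ν := vol s.S) (a := a) (T := t)
        (Φ := fun z => s.vx z * s.vx z) (Φt := fun z => s.uxx z * s.vx z + s.vx z * s.uxx z)
        (s.tvx.mono fun x hx => hx.mul hx) ha.le hat.le ((i1 t).mono_measure hsub)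
        ((s.svx a ha.le).integrable_mul (s.svx a ha.le))).2
      have h2 : ∫ τ in a..t, ∫ x in s.S, (s.uxx (τ, x) * s.vx (τ, x) + s.vx (τ, x) * s.uxx (τ, x)) ≤
          ∫ τ in a..t, ((∫ x in s.S, s.vx (τ, x) ^ 2) + ∫ x in s.S, s.uxx (τ, x) ^ 2) := by
        have j1 := intervalIntegrable_slice (fun T => (s.lvx T).integrable_sq) ha.le hat.le
        have j2 := intervalIntegrable_slice (fun T => (s.luxx T).integrable_sq) ha.le hat.le
        refine integral_mono_ae_restrict hat.le (intervalIntegrable_slice i1 ha.le hat.le) (j1.add j2) ?_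
        have hss : Icc a t ⊆ Ioi 0 := fun y hy => ha.trans_le hy.1
        filter_upwards [ae_mono_set hss (sl s.luxx), ae_mono_set hss (sl s.lvx)] with τ e1 e2
        rw [← integral_add e2.integrable_sq e1.integrable_sq]
        refine integral_mono ((e1.integrable_mul e2).add (e2.integrable_mul e1))
          (e2.integrable_sq.add e1.integrable_sq) fun x => ?_
        beta_reduce
        nlinarith [sq_nonneg (s.vx (τ, x) - s.uxx (τ, x))]
      simp only [← sq] at h
      simp only [Pi.add_apply]
      linarith) hε
  refine ⟨max T3 (max T1 T2), le_max_of_le_left hT3, ?_⟩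
  have hsub := fun {T : ℝ} (hT : T ≤ max T3 (max T1 T2)) {P : ℝ → Prop} (h : ∀ᵐ t ∂vol (Ioi T), P t) =>
    ae_mono_set (Ioi_subset_Ioi hT) h
  filter_upwards [hsub (le_max_left _ _) k3, hsub (by simp) k1, hsub (by simp) k2] with t h1 h2 h3
  exact ⟨h1, h2, h3⟩

end Sol

/-! ### Sobolev norms of primitives -/

theorem eLpNorm_two_sq {α : Type*} [MeasurableSpace α] {m : Measure α} {f : α → ℝ} (hf : MemLp f 2 m) :
    eLpNorm f 2 m ^ 2 = ENNReal.ofReal (∫ x, f x ^ 2 ∂m) := by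
  have h0 : 0 ≤ ∫ x, f x ^ 2 ∂m := integral_nonneg fun x => sq_nonneg _
  rw [hf.eLpNorm_eq_integral_rpow_norm (by simp) (by simp), ← ENNReal.ofReal_pow (by positivity)]
  congr 1
  simp only [ENNReal.toReal_ofNat, Real.rpow_two, Real.norm_eq_abs, sq_abs]
  rw [← Real.rpow_natCast, ← Real.rpow_mul h0]
  norm_num

/-- The limit of functions with derivatives bounded in `L²`. -/
theorem exists_isPrim_of_tendsto {S : Set ℝ} (hS : IsLine S) {f g : ℕ → ℝ → ℝ}
    (h : ∀ n, IsPrim (closure S) (f n) (g n)) (lg : ∀ n, MemLp (g n) 2 (vol S)) {B : ℝ}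
    (hB : ∀ n, ∫ x in S, g n x ^ 2 ≤ B) {F : ℝ → ℝ}
    (hF : ∀ x ∈ closure S, Tendsto (fun n => f n x) atTop (𝓝 (F x))) :
    ∃ G, IsPrim (closure S) F G ∧ MemLp G 2 (vol S) ∧ ∫ x in S, G x ^ 2 ≤ B := by
  have hB0 : 0 ≤ B := (integral_nonneg fun x => sq_nonneg _).trans (hB 0)
  let D := InnerProductSpace.toDual ℝ (Lp ℝ 2 (vol S))
  have hnorm : ∀ G : Lp ℝ 2 (vol S), ‖G‖ ^ 2 = ∫ x in S, G x ^ 2 := fun G => by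
    rw [Lp.norm_def, ← ENNReal.toReal_pow, eLpNorm_two_sq (Lp.memLp G),
      ENNReal.toReal_ofReal (integral_nonneg fun x => sq_nonneg _)]
  have hg : ∀ n, ‖D ((lg n).toLp _)‖ ≤ √B := fun n => by
    rw [LinearIsometryEquiv.norm_map]
    refine Real.le_sqrt_of_sq_le ?_
    rw [hnorm, integral_congr_ae ((lg n).coeFn_toLp.mono fun x hx => by rw [hx])]
    exact hB n
  obtain ⟨L, hL, hlim⟩ := (WeakDual.isCompact_closedBall (𝕜 := ℝ)
    (0 : StrongDual ℝ (Lp ℝ 2 (vol S))) √B).ultrafilter_le_nhds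
      ((hyperfilter ℕ).map fun n => StrongDual.toWeakDual (D ((lg n).toLp _))) (by
        rw [Ultrafilter.coe_map, le_principal_iff, mem_map]
        exact Eventually.of_forall fun n => mem_closedBall_zero_iff.2 (hg n))
  let G : Lp ℝ 2 (vol S) := D.symm (WeakDual.toStrongDual L)
  have hGL : ∀ w, L w = inner ℝ G w := fun w => by
    rw [← InnerProductSpace.toDual_apply_apply]
    simp [G, D]
  refine ⟨G, fun a ha b hb => ?_, Lp.memLp G, ?_⟩
  · wlog hab : a ≤ b generalizing a b
    · obtain ⟨h1, h2⟩ := this b hb a ha (le_of_not_ge hab)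
      exact ⟨h1.symm, by rw [intervalIntegral.integral_symm, ← h2]; ring⟩
    have hsub : Ioc a b ⊆ S := fun y hy => hS.Ioi_subset ha hy.1
    have hfin : (vol S) (Ioc a b) ≠ ∞ := ((Measure.restrict_apply_le _ _).trans_lt (by simp)).ne
    have hloc : IntegrableOn (G : ℝ → ℝ) (Ioc a b) := by
      have := (Lp.memLp G).restrict (Ioc a b)
      rw [Measure.restrict_restrict measurableSet_Ioc, inter_eq_left.2 hsub] at this
      exact this.integrable (by norm_num)
    refine ⟨(intervalIntegrable_iff_Ioc hab).2 hloc, ?_⟩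
    have key : ∀ w : Lp ℝ 2 (vol S),
        inner ℝ w (indicatorConstLp 2 measurableSet_Ioc hfin (1:ℝ)) = ∫ x in a..b, w x := fun w => by
      rw [real_inner_comm, L2.inner_indicatorConstLp_one measurableSet_Ioc,
        integral_of_le hab, Measure.restrict_restrict measurableSet_Ioc,
        inter_eq_left.2 hsub]
    have t1 : Tendsto (fun n => ∫ x in a..b, g n x) (hyperfilter ℕ) (𝓝 (∫ x in a..b, G x)) := by
      have := ((WeakDual.eval_continuous (𝕜 := ℝ)
        (indicatorConstLp 2 measurableSet_Ioc hfin (1:ℝ))).tendsto L).comp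
        (show Tendsto _ (hyperfilter ℕ : Filter ℕ) _ from hlim)
      rw [hGL, key] at this
      refine this.congr fun n => ?_
      change D _ _ = _
      rw [InnerProductSpace.toDual_apply_apply, key, integral_of_le hab, integral_of_le hab]
      exact integral_congr_ae (ae_mono_set hsub (lg n).coeFn_toLp)
    have t2 := ((hF b hb).sub (hF a ha)).mono_left (Nat.hyperfilter_le_atTop : (hyperfilter ℕ : Filter ℕ) ≤ atTop)
    refine tendsto_nhds_unique t2 (t1.congr fun n => ((h n).sub_eq ha hb).symm)
  · rw [← hnorm, ← Real.sq_sqrt hB0]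
    have : ‖G‖ ≤ √B := by simpa [G] using mem_closedBall_zero_iff.1 hL
    gcongr

/-- Bounds for almost every time hold at all times. -/
theorem exists_isPrim_of_ae {S : Set ℝ} (hS : IsLine S) {f g : ℝ × ℝ → ℝ} (hf : Continuous f) {a B : ℝ}
    (h : ∀ᵐ t ∂vol (Ioi a), IsPrim (closure S) (fun x => f (t, x)) (fun x => g (t, x)) ∧
      MemLp (fun x => g (t, x)) 2 (vol S) ∧ ∫ x in S, g (t, x) ^ 2 ≤ B) {t : ℝ} (ht : a ≤ t) :
    ∃ G, IsPrim (closure S) (fun x => f (t, x)) G ∧ MemLp G 2 (vol S) ∧ ∫ x in S, G x ^ 2 ≤ B := by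
  have hex : ∀ n : ℕ, ∃ τ ∈ Ioo t (t + 1 / (n + 1)), IsPrim (closure S) (fun x => f (τ, x)) (fun x => g (τ, x)) ∧
      MemLp (fun x => g (τ, x)) 2 (vol S) ∧ ∫ x in S, g (τ, x) ^ 2 ≤ B := fun n => by
    have hsub : Ioo t (t + 1 / ((n:ℝ) + 1)) ⊆ Ioi a := fun y hy => ht.trans_lt hy.1
    have hne : (ae (vol (Ioo t (t + 1 / ((n:ℝ) + 1))))).NeBot := by
      rw [ae_neBot, Ne, Measure.restrict_eq_zero]
      simp only [Real.volume_Ioo, ENNReal.ofReal_eq_zero, not_le]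
      have : (0:ℝ) < 1 / (n + 1) := by positivity
      linarith
    obtain ⟨τ, h1, h2⟩ := ((ae_restrict_mem measurableSet_Ioo).and (ae_mono_set hsub h)).exists
    exact ⟨τ, h1, h2⟩
  choose τ hτ h1 h2 h3 using hex
  have hlim : Tendsto τ atTop (𝓝 t) := by
    refine tendsto_of_tendsto_of_tendsto_of_le_of_le tendsto_const_nhds (h := fun n : ℕ => t + 1 / ((n:ℝ) + 1))
      ?_ (fun n => (hτ n).1.le) fun n => (hτ n).2.le
    simpa using (tendsto_one_div_add_atTop_nhds_zero_nat (𝕜 := ℝ)).const_add t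
  exact exists_isPrim_of_tendsto hS h1 h2 h3 fun x _ =>
    (hf.tendsto (t, x)).comp (hlim.prodMk_nhds tendsto_const_nhds)

theorem IsPrim.hasWeakDeriv {Ω : Opens ℝ} (hS : IsLine Ωˢ) {f g : ℝ → ℝ}
    (h : IsPrim (closure Ωˢ) f g) : HasWeakDeriv Ω 1 f g := by
  have hoc := hS.ordConnected_closure
  have hK : ∀ K ⊆ Ωˢ, IsCompact K → ∃ a b, a ∈ Ωˢ ∧ b ∈ Ωˢ ∧ a ≤ b ∧ K ⊆ Icc a b := by
    intro K hKS hK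
    rcases K.eq_empty_or_nonempty with rfl | hne
    · have : (1:ℝ) ∈ Ωˢ := by rcases hS with h | h <;> simp [h]
      exact ⟨1, 1, this, this, le_rfl, empty_subset _⟩
    · exact ⟨_, _, hKS (hK.sInf_mem hne), hKS (hK.sSup_mem hne), csInf_le_csSup hne hK.bddBelow hK.bddAbove,
        fun y hy => ⟨csInf_le hK.bddBelow hy, le_csSup hK.bddAbove hy⟩⟩
  have cf : ∀ {a b}, a ∈ Ωˢ → b ∈ Ωˢ → a ≤ b → ContinuousOn f (Icc a b) := fun ha hb hab => by
    simpa [uIcc_of_le hab] using h.continuousOn (subset_closure ha) (subset_closure hb)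
  have ig : ∀ {a b}, a ∈ Ωˢ → b ∈ Ωˢ → a ≤ b → IntegrableOn g (Icc a b) := fun ha hb hab => by
    have := h.intervalIntegrable (subset_closure ha) (subset_closure hb)
    rwa [intervalIntegrable_iff_integrableOn_Icc_of_le hab] at this
  refine ⟨?_, ?_, fun φ => ?_⟩
  · rw [locallyIntegrableOn_iff hS.isOpen.isLocallyClosed]
    intro K hKS hKc
    obtain ⟨a, b, ha, hb, hab, hsub⟩ := hK K hKS hKc
    exact ((cf ha hb hab).integrableOn_Icc).mono_set hsub
  · rw [locallyIntegrableOn_iff hS.isOpen.isLocallyClosed]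
    intro K hKS hKc
    obtain ⟨a, b, ha, hb, hab, hsub⟩ := hK K hKS hKc
    exact (ig ha hb hab).mono_set hsub
  obtain ⟨a, b, ha, hb, hab, hsub⟩ := hK _ φ.tsupport_subset φ.hasCompactSupport
  have hφ : ∀ x, HasDerivAt φ (fderiv ℝ φ x 1) x := fun x =>
    ((φ.contDiff.differentiable (by simp)) x).hasFDerivAt.hasDerivAt
  have cφ' : Continuous fun x => fderiv ℝ φ x 1 :=
    (φ.contDiff.continuous_fderiv (by simp)).clm_apply continuous_const
  have cφ : Continuous φ := φ.contDiff.continuous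
  have h2 := h.mul (isPrim_of_hasDerivAt hφ cφ' (closure Ωˢ))
  have z1 : ∀ x, x ∉ Icc a b → φ x = 0 := fun x hx => by
    by_contra hne
    exact hx (hsub (subset_tsupport _ hne))
  have z2 : ∀ x, x ∉ Icc a b → fderiv ℝ φ x 1 = 0 := fun x hx => by
    by_contra hne
    have : x ∈ tsupport (fderiv ℝ φ) := subset_tsupport _ fun h0 => hne (by rw [h0]; rfl)
    exact hx (hsub (tsupport_fderiv_subset ℝ this))
  have i1 : IntegrableOn (fun x => g x * φ x) Ω :=
    IntegrableOn.of_forall_sdiff_eq_zero ((ig ha hb hab).mul_continuousOn cφ.continuousOn isCompact_Icc)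
      hS.measurableSet fun x hx => by simp [z1 x hx.2]
  have i2 : IntegrableOn (fun x => f x * fderiv ℝ φ x 1) Ω :=
    IntegrableOn.of_forall_sdiff_eq_zero ((cf ha hb hab).mul cφ'.continuousOn).integrableOn_Icc
      hS.measurableSet fun x hx => by simp [z2 x hx.2]
  have i3 : IntegrableOn (fun x => f x * φ x) Ω :=
    IntegrableOn.of_forall_sdiff_eq_zero ((cf ha hb hab).mul cφ.continuousOn).integrableOn_Icc
      hS.measurableSet fun x hx => by simp [z1 x hx.2]
  have := h2.integral_eq_zero hS i3 (i1.add i2) (by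
    rcases hS with hS | hS
    · exact Or.inl hS
    · refine Or.inr ?_
      rw [z1 0 fun h0 => ?_, mul_zero]
      rw [hS] at ha
      exact absurd h0.1 (not_le.2 ha))
  rw [integral_add i1 i2] at this
  linarith

section Norms

variable {Ω : Opens ℝ} {f g g' : ℝ → ℝ}

theorem derivL2Norm_le (hS : IsLine Ωˢ) (h : IsPrim (closure Ωˢ) f g) : derivL2Norm Ω f ≤ lpNorm Ω 2 g :=
  iInf₂_le g (h.hasWeakDeriv hS)

theorem rpow_half_sq (x : ℝ≥0∞) : (x ^ (1 / 2 : ℝ)) ^ 2 = x := by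
  rw [← ENNReal.rpow_natCast, ← ENNReal.rpow_mul]
  norm_num

theorem h1Norm_sq_le (hS : IsLine Ωˢ) (h : IsPrim (closure Ωˢ) f g) :
    h1Norm Ω f ^ 2 ≤ lpNorm Ω 2 f ^ 2 + lpNorm Ω 2 g ^ 2 := by
  rw [h1Norm, rpow_half_sq]
  gcongr
  exact derivL2Norm_le hS h

theorem derivH1Norm_sq_le (hS : IsLine Ωˢ) (h : IsPrim (closure Ωˢ) f g)
    (hg : IsPrim (closure Ωˢ) g g') :
    derivH1Norm Ω f ^ 2 ≤ lpNorm Ω 2 g ^ 2 + lpNorm Ω 2 g' ^ 2 := by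
  have : derivH1Norm Ω f ≤ h1Norm Ω g := iInf₂_le g (h.hasWeakDeriv hS)
  exact (by gcongr : _ ≤ h1Norm Ω g ^ 2).trans (h1Norm_sq_le hS hg)

/-- Functions bounded in `L²` that tend to zero uniformly tend to zero in `L^q` for `q > 2`. -/
theorem tendsto_lpNorm_zero {F : ℝ → ℝ → ℝ} {K : ℝ≥0∞} (hK : K ≠ ∞)
    (h2 : ∀ᶠ t in atTop, lpNorm Ω 2 (F t) ^ 2 ≤ K)
    (hs : ∀ ε > 0, ∀ᶠ t in atTop, ∀ x ∈ Ωˢ, |F t x| ≤ ε) {q : ℝ≥0∞} (hq : 2 < q) :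
    Tendsto (fun t => lpNorm Ω q (F t)) atTop (𝓝 0) := by
  rw [ENNReal.tendsto_nhds_zero]
  intro δ hδ
  rcases eq_or_ne q ∞ with rfl | hqt
  · obtain ⟨ε, hε, hεδ⟩ := ENNReal.lt_iff_exists_nnreal_btwn.1 hδ
    filter_upwards [hs ε (by exact_mod_cast hε)] with t ht
    refine le_trans ?_ hεδ.le
    rw [lpNorm, eLpNorm_exponent_top]
    refine eLpNormEssSup_le_of_ae_nnnorm_bound ?_
    filter_upwards [ae_restrict_mem Ω.isOpen.measurableSet] with x hx
    exact ht x hx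
  have hq0 : q ≠ 0 := (lt_trans (by norm_num) hq).ne'
  have hqr : 2 < q.toReal := by
    have := (ENNReal.toReal_lt_toReal (by simp) hqt).2 hq
    simpa using this
  have hlim : Tendsto (fun e : ℝ≥0∞ => (e ^ (q.toReal - 2) * K) ^ (1 / q.toReal)) (𝓝 0) (𝓝 0) := by
    have h1 : Tendsto (fun e : ℝ≥0∞ => e ^ (q.toReal - 2)) (𝓝 0) (𝓝 0) := by
      have := (ENNReal.continuous_rpow_const (y := q.toReal - 2)).tendsto 0
      rwa [ENNReal.zero_rpow_of_pos (by linarith)] at this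
    have h3 := ENNReal.Tendsto.mul_const h1 (Or.inr hK)
    rw [zero_mul] at h3
    have h4 := (ENNReal.continuous_rpow_const (y := 1 / q.toReal)).tendsto 0
    rw [ENNReal.zero_rpow_of_pos (by positivity)] at h4
    exact h4.comp h3
  obtain ⟨η, hη, hball⟩ := ENNReal.nhds_zero_basis.eventually_iff.1 (hlim.eventually (Iic_mem_nhds hδ))
  obtain ⟨ε, hε, hεη⟩ := ENNReal.lt_iff_exists_nnreal_btwn.1 hη
  filter_upwards [h2, hs ε (by exact_mod_cast hε)] with t ht ht'
  refine le_trans ?_ (hball (mem_Iio.2 hεη))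
  rw [lpNorm, eLpNorm_eq_lintegral_rpow_enorm_toReal hq0 hqt]
  refine ENNReal.rpow_le_rpow ?_ (by positivity)
  rw [lpNorm, eLpNorm_eq_lintegral_rpow_enorm_toReal (by simp) (by simp), ENNReal.toReal_ofNat, rpow_half_sq] at ht
  refine le_trans ?_ (mul_le_mul_right ht _)
  rw [← lintegral_const_mul' _ _ (ENNReal.rpow_ne_top_of_nonneg (by linarith) (by simp))]
  refine lintegral_mono_ae ?_
  filter_upwards [ae_restrict_mem Ω.isOpen.measurableSet] with x hx
  have hx' : ‖F t x‖ₑ ≤ (ε : ℝ≥0∞) := by rw [enorm_le_coe]; exact ht' x hx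
  calc ‖F t x‖ₑ ^ q.toReal = ‖F t x‖ₑ ^ (q.toReal - 2) * ‖F t x‖ₑ ^ (2:ℝ) := by
        rw [← ENNReal.rpow_add_of_nonneg _ _ (by linarith) (by norm_num)]; congr 1; ring
    _ ≤ _ := by gcongr

end Norms

theorem lpNorm_sq_le {Ω : Opens ℝ} {f f' : ℝ → ℝ} {K : ℝ}
    (hf : MemLp f 2 (vol Ωˢ)) (hK : ∫ x in Ωˢ, f x ^ 2 ≤ K)
    (h : ∀ x ∈ closure Ωˢ, f x = f' x) : lpNorm Ω 2 f' ^ 2 ≤ ENNReal.ofReal K := by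
  have hae : f =ᵐ[vol Ωˢ] f' := by
    filter_upwards [ae_restrict_mem Ω.isOpen.measurableSet] with x hx using h x (subset_closure hx)
  rw [lpNorm, ← eLpNorm_congr_ae hae, eLpNorm_two_sq hf]
  exact ENNReal.ofReal_le_ofReal hK

theorem tendsto_norms {Ω : Opens ℝ} (hS : IsLine Ωˢ) {F f : ℝ × ℝ → ℝ} {c K : ℝ}
    (hL : ∀ t ≥ 0, MemLp (fun x => F (t, x) - c) 2 (vol Ωˢ) ∧ ∫ x in Ωˢ, (F (t, x) - c) ^ 2 ≤ K)
    (hd : ∀ ε > 0, ∃ T ≥ 0, ∀ t ≥ T, ∃ G, IsPrim (closure Ωˢ) (fun x => F (t, x)) G ∧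
      MemLp G 2 (vol Ωˢ) ∧ ∫ x in Ωˢ, G x ^ 2 ≤ ε)
    (h : ∀ t ≥ 0, ∀ x ∈ closure Ωˢ, F (t, x) = f (t, x)) {q : ℝ≥0∞} (hq : 2 < q) :
    Tendsto (fun t => lpNorm Ω q (fun x => f (t, x) - c)) atTop (𝓝 0) ∧
    Tendsto (fun t => derivL2Norm Ω (fun x => f (t, x))) atTop (𝓝 0) := by
  have hK : 0 ≤ K := (integral_nonneg fun x => sq_nonneg _).trans (hL 0 le_rfl).2
  constructor
  · refine tendsto_lpNorm_zero (K := ENNReal.ofReal K) (by simp) ?_ (fun ε hε => ?_) hq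
    · filter_upwards [eventually_ge_atTop 0] with t ht
      exact lpNorm_sq_le (hL t ht).1 (hL t ht).2 fun x hx => by rw [h t ht x hx]
    · set l := ε ^ 2 / (K + 1)
      have hl : 0 < l := by positivity
      obtain ⟨T, hT, hG⟩ := hd (l ^ 2) (by positivity)
      filter_upwards [eventually_ge_atTop T] with t ht x hx
      obtain ⟨G, h1, h2, h3⟩ := hG t ht
      have ht0 := hT.trans ht
      have hx' := subset_closure hx
      have := (h1.sub_const c).sq_le hS (hL t ht0).1 h2 hl hx'
      rw [h t ht0 x hx'] at this
      refine abs_le_of_sq_le_sq ?_ hε.le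
      have e1 : l * (∫ y in Ωˢ, (F (t, y) - c) ^ 2) ≤ l * K := mul_le_left (hL t ht0).2 hl.le
      have e2 : l⁻¹ * (∫ y in Ωˢ, G y ^ 2) ≤ l⁻¹ * l ^ 2 := mul_le_left h3 (by positivity)
      have e3 : l⁻¹ * l ^ 2 = l := by field_simp
      have e4 : l * (K + 1) = ε ^ 2 := div_mul_cancel₀ _ (by positivity)
      linarith
  · rw [ENNReal.tendsto_nhds_zero]
    intro δ hδ
    obtain ⟨ε, hε, hεδ⟩ := ENNReal.lt_iff_exists_nnreal_btwn.1 hδ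
    have hε0 : (0:ℝ) < ε := by exact_mod_cast hε
    obtain ⟨T, hT, hG⟩ := hd ((ε:ℝ) ^ 2) (by positivity)
    filter_upwards [eventually_ge_atTop T] with t ht
    obtain ⟨G, h1, h2, h3⟩ := hG t ht
    refine (derivL2Norm_le hS (h1.congr_left (h t (hT.trans ht)))).trans (le_trans ?_ hεδ.le)
    have := lpNorm_sq_le h2 h3 fun x _ => rfl
    rw [ENNReal.ofReal_pow hε0.le, ENNReal.ofReal_coe_nnreal] at this
    exact (ENNReal.pow_le_pow_left_iff two_ne_zero).1 this

theorem integral_Ioi_slice_le {S : Set ℝ} {g : ℝ × ℝ → ℝ} (hg : ∀ T, MemLp g 2 (stm S T)) {K : ℝ}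
    (hK : ∀ T ≥ 0, ∫ z, g z ^ 2 ∂stm S T ≤ K) :
    IntegrableOn (fun t => ∫ x in S, g (t, x) ^ 2) (Ioi 0) ∧ ∫ t in Ioi (0:ℝ), ∫ x in S, g (t, x) ^ 2 ≤ K := by
  have hi := integrableOn_Ioi_slice (fun T => (hg T).integrable_sq) (fun z => sq_nonneg _) hK
  refine ⟨hi, le_of_tendsto (intervalIntegral_tendsto_integral_Ioi 0 hi tendsto_id) ?_⟩
  filter_upwards [eventually_ge_atTop 0] with T hT
  have := hK T hT
  rwa [integral_stm_eq hT (hg T).integrable_sq] at this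

namespace Sol

variable {p : Params}

/-- The spatial domain of a solution. -/
def dom (s : Sol p) : Opens ℝ := ⟨s.S, s.hS.isOpen⟩

/-- The assertions of the main theorem, for functions that agree with a solution. -/
theorem conclusion (p : Params) : ∃ C > 0, ∀ (s : Sol p) (v u θ : ℝ × ℝ → ℝ),
    (∀ t ≥ 0, ∀ x ∈ closure (s.dom : Set ℝ), s.v (t, x) = v (t, x) ∧ s.u (t, x) = u (t, x) ∧
      s.θ (t, x) = θ (t, x)) →
    (∀ t ≥ 0, ∀ x ∈ closure (s.dom : Set ℝ), C⁻¹ ≤ θ (t, x) ∧ θ (t, x) ≤ C) ∧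
    ((⨆ (t : ℝ) (_ : 0 ≤ t), h1Norm3 s.dom (fun x => v (t, x) - 1) (fun x => u (t, x)) (fun x => θ (t, x) - 1)) +
        ∫⁻ t in Ioi (0 : ℝ), (derivL2Norm s.dom (fun x => v (t, x)) ^ 2 +
          (derivH1Norm s.dom (fun x => u (t, x)) ^ 2 + derivH1Norm s.dom (fun x => θ (t, x)) ^ 2))
      ≤ ENNReal.ofReal C) ∧
    ∀ q : ℝ≥0∞, 2 < q → Tendsto (fun t : ℝ =>
        (lpNorm s.dom q (fun x => v (t, x) - 1) + lpNorm s.dom q (fun x => u (t, x)) +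
          lpNorm s.dom q (fun x => θ (t, x) - 1)) +
        (derivL2Norm s.dom (fun x => v (t, x)) + derivL2Norm s.dom (fun x => u (t, x)) +
          derivL2Norm s.dom (fun x => θ (t, x)))) atTop (𝓝 0) := by
  obtain ⟨K, hK, hs⟩ := estimates p
  have hr : 0 ≤ (6 * K) ^ (1 / 2 : ℝ) := by positivity
  refine ⟨K + (6 * K) ^ (1 / 2 : ℝ) + 5 * K, by positivity, fun s v u θ he => ?_⟩
  obtain ⟨b1, b2, b3, b4⟩ := hs s
  have hS : IsLine (s.dom : Set ℝ) := s.hS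
  have hv := fun t ht x hx => (he t ht x hx).1
  have hu := fun t ht x hx => (he t ht x hx).2.1
  have hθ := fun t ht x hx => (he t ht x hx).2.2
  have sl : ∀ {g : ℝ × ℝ → ℝ}, (∀ T, MemLp g 2 (stm s.S T)) → ∀ᵐ t ∂vol₊, MemLp (fun x => g (t, x)) 2 (vol s.S) :=
    fun hg => ae_Ioi_of_Ioc fun T => MemLp.ae_slice (hg T)
  have su0 : ∀ t ≥ 0, MemLp (fun x => s.u (t, x) - 0) 2 (vol s.S) := fun t ht => by simpa using s.su t ht
  have pu := fun {t : ℝ} (ht : 0 ≤ t) => exists_isPrim_of_ae (g := s.ux) (B := K) hS s.c_u (by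
    filter_upwards [s.xu, sl s.lux, b3] with t h1 h2 h3 using ⟨h1, h2, h3.1⟩) ht
  have pθ := fun {t : ℝ} (ht : 0 ≤ t) => exists_isPrim_of_ae (g := s.θx) (B := K) hS s.c_θ (by
    filter_upwards [s.xθ, sl s.lθx, b3] with t h1 h2 h3 using ⟨h1, h2, h3.2⟩) ht
  have dec : ∀ ε > 0, ∃ T ≥ 0, ∀ t ≥ T, (∃ G, IsPrim (closure s.S) (fun x => s.v (t, x)) G ∧
      MemLp G 2 (vol s.S) ∧ ∫ x in s.S, G x ^ 2 ≤ ε) ∧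
      (∃ G, IsPrim (closure s.S) (fun x => s.u (t, x)) G ∧
      MemLp G 2 (vol s.S) ∧ ∫ x in s.S, G x ^ 2 ≤ ε) ∧
      ∃ G, IsPrim (closure s.S) (fun x => s.θ (t, x)) G ∧
      MemLp G 2 (vol s.S) ∧ ∫ x in s.S, G x ^ 2 ≤ ε := fun ε hε => by
    obtain ⟨T, hT, hd⟩ := s.decay hε
    have hT' := fun {P : ℝ → Prop} (h : ∀ᵐ t ∂vol₊, P t) => ae_mono_set (Ioi_subset_Ioi hT) h
    refine ⟨T, hT, fun t ht => ⟨exists_isPrim_of_ae (g := s.vx) hS s.c_v ?_ ht,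
      exists_isPrim_of_ae (g := s.ux) hS s.c_u ?_ ht, exists_isPrim_of_ae (g := s.θx) hS s.c_θ ?_ ht⟩⟩
    · filter_upwards [hd, ae_mem_Ioi] with t h3 h4
      have h4 : 0 ≤ t := hT.trans (le_of_lt h4)
      exact ⟨s.xv t h4, s.svx t h4, h3.1⟩
    · filter_upwards [hT' s.xu, hT' (sl s.lux), hd] with t h1 h2 h3 using ⟨h1, h2, h3.2.1⟩
    · filter_upwards [hT' s.xθ, hT' (sl s.lθx), hd] with t h1 h2 h3 using ⟨h1, h2, h3.2.2⟩
  refine ⟨fun t ht x hx => ?_, ?_, fun q hq => ?_⟩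
  · rw [← hθ t ht x hx]
    obtain ⟨h1, h2⟩ := b1 t ht x hx
    exact ⟨le_trans (by gcongr; linarith) h1, by linarith⟩
  · have e : ENNReal.ofReal (K + (6 * K) ^ (1 / 2 : ℝ) + 5 * K) =
        ENNReal.ofReal K + ENNReal.ofReal (6 * K) ^ (1 / 2 : ℝ) + ENNReal.ofReal (5 * K) := by
      rw [ENNReal.ofReal_add (by positivity) (by positivity), ENNReal.ofReal_add hK.le hr,
        ENNReal.ofReal_rpow_of_nonneg (by positivity) (by positivity)]
    rw [e]
    refine add_le_add (le_trans ?_ le_add_self) ?_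
    · refine iSup₂_le fun t ht => ?_
      obtain ⟨c1, c2, c3, c4⟩ := b2 t ht
      obtain ⟨G, g1, g2, g3⟩ := pu ht
      obtain ⟨H, k1, k2, k3⟩ := pθ ht
      have n1 := (h1Norm_sq_le hS (((s.xv t ht).sub_const 1).congr_left
        (g := fun x => v (t, x) - 1) fun x hx => by rw [hv t ht x hx])).trans
        (add_le_add (lpNorm_sq_le (s.sv t ht) c1 fun x hx => by rw [hv t ht x hx])
          (lpNorm_sq_le (s.svx t ht) c4 fun x _ => rfl))
      have n2 := (h1Norm_sq_le hS (g1.congr_left (hu t ht))).trans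
        (add_le_add (lpNorm_sq_le (s.su t ht) c2 (hu t ht)) (lpNorm_sq_le g2 g3 fun x _ => rfl))
      have n3 := (h1Norm_sq_le hS ((k1.sub_const 1).congr_left
        (g := fun x => θ (t, x) - 1) fun x hx => by rw [hθ t ht x hx])).trans
        (add_le_add (lpNorm_sq_le (s.sθ t ht) c3 fun x hx => by rw [hθ t ht x hx])
          (lpNorm_sq_le k2 k3 fun x _ => rfl))
      refine ENNReal.rpow_le_rpow ((add_le_add (add_le_add n1 n2) n3).trans (le_of_eq ?_)) (by norm_num)
      simp only [← ENNReal.ofReal_add hK.le hK.le]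
      rw [← ENNReal.ofReal_add (by positivity) (by positivity),
        ← ENNReal.ofReal_add (by positivity) (by positivity)]
      congr 1; ring
    · obtain ⟨i1, j1⟩ := integral_Ioi_slice_le s.lvx fun T hT => (b4 T hT).2.2.2.2
      obtain ⟨i2, j2⟩ := integral_Ioi_slice_le s.lux fun T hT => (b4 T hT).1
      obtain ⟨i3, j3⟩ := integral_Ioi_slice_le s.luxx fun T hT => (b4 T hT).2.2.1
      obtain ⟨i4, j4⟩ := integral_Ioi_slice_le s.lθx fun T hT => (b4 T hT).2.1
      obtain ⟨i5, j5⟩ := integral_Ioi_slice_le s.lθxx fun T hT => (b4 T hT).2.2.2.1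
      have nn : ∀ (g : ℝ × ℝ → ℝ) (t : ℝ), 0 ≤ ∫ x in s.S, g (t, x) ^ 2 := fun g t =>
        integral_nonneg fun x => sq_nonneg _
      have i6 := i1.add ((i2.add i3).add (i4.add i5))
      refine le_trans (lintegral_mono_ae ?_) (le_trans (ofReal_integral_eq_lintegral_ofReal i6
        (.of_forall fun t => ?_)).ge (ENNReal.ofReal_le_ofReal ?_))
      · filter_upwards [s.xu, s.xux, s.xθ, s.xθx, sl s.lux, sl s.luxx, sl s.lθx, sl s.lθxx,
          ae_mem_Ioi] with t h1 h2 h3 h4 l1 l2 l3 l4 ht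
        have ht : 0 ≤ t := le_of_lt ht
        simp only [Pi.add_apply]
        rw [ENNReal.ofReal_add (nn _ _) (by linarith [nn s.ux t, nn s.uxx t, nn s.θx t, nn s.θxx t]),
          ENNReal.ofReal_add (add_nonneg (nn _ _) (nn _ _)) (add_nonneg (nn _ _) (nn _ _)),
          ENNReal.ofReal_add (nn _ _) (nn _ _), ENNReal.ofReal_add (nn _ _) (nn _ _),
          ← eLpNorm_two_sq (s.svx t ht), ← eLpNorm_two_sq l1, ← eLpNorm_two_sq l2,
          ← eLpNorm_two_sq l3, ← eLpNorm_two_sq l4]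
        have := derivL2Norm_le hS ((s.xv t ht).congr_left (hv t ht))
        exact add_le_add (by gcongr; exact this) (add_le_add
          (derivH1Norm_sq_le hS (h1.congr_left (hu t ht)) h2)
          (derivH1Norm_sq_le hS (h3.congr_left (hθ t ht)) h4))
      · exact add_nonneg (nn _ _) (add_nonneg (add_nonneg (nn _ _) (nn _ _)) (add_nonneg (nn _ _) (nn _ _)))
      · have e1 := integral_add i1 ((i2.add i3).add (i4.add i5))
        have e2 := integral_add (i2.add i3) (i4.add i5)
        have e3 := integral_add i2 i3
        have e4 := integral_add i4 i5
        simp only [Pi.add_apply] at e1 e2 e3 e4 ⊢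
        linarith
  · obtain ⟨v1, v2⟩ := tendsto_norms hS (fun t ht => ⟨s.sv t ht, (b2 t ht).1⟩)
      (fun ε hε => by obtain ⟨T, hT, h⟩ := dec ε hε; exact ⟨T, hT, fun t ht => (h t ht).1⟩) hv hq
    obtain ⟨u1, u2⟩ := tendsto_norms (c := 0) (K := K) hS
      (fun t ht => ⟨su0 t ht, by simp only [sub_zero]; exact (b2 t ht).2.1⟩)
      (fun ε hε => by obtain ⟨T, hT, h⟩ := dec ε hε; exact ⟨T, hT, fun t ht => (h t ht).2.1⟩) hu hq
    obtain ⟨θ1, θ2⟩ := tendsto_norms hS (fun t ht => ⟨s.sθ t ht, (b2 t ht).2.2.1⟩)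
      (fun ε hε => by obtain ⟨T, hT, h⟩ := dec ε hε; exact ⟨T, hT, fun t ht => (h t ht).2.2⟩) hθ hq
    simpa using ((v1.add u1).add θ1).add ((v2.add u2).add θ2)

end Sol

/-! ### Weak derivatives on lines -/

theorem ae_eq_zero_of_test {Ω : Opens ℝ} {H : ℝ → ℝ}
    (hH : LocallyIntegrableOn H Ωˢ) (h : ∀ η : 𝓓(Ω, ℝ), ∫ x in Ωˢ, H x * η x = 0) :
    ∀ᵐ x ∂vol Ωˢ, H x = 0 := by
  rw [ae_restrict_iff' Ω.isOpen.measurableSet]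
  refine Ω.isOpen.ae_eq_zero_of_integral_contDiff_smul_eq_zero hH fun η h1 h2 h3 => ?_
  rw [← h ⟨η, h1, h2, h3⟩, ← setIntegral_eq_integral_of_forall_compl_eq_zero (s := Ωˢ)
    fun x hx => by rw [image_eq_zero_of_notMem_tsupport fun hx' => hx (h3 hx'), zero_smul]]
  exact integral_congr_ae (.of_forall fun x => mul_comm _ _)

theorem tsupport_fderiv_one_subset (φ : ℝ → ℝ) : tsupport (fun x => fderiv ℝ φ x 1) ⊆ tsupport φ :=
  (closure_mono fun x hx => by
    rw [Function.mem_support] at hx ⊢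
    exact fun h0 => hx (by rw [h0]; rfl)).trans (tsupport_fderiv_subset ℝ)

theorem integrableOn_mul_test {Ω : Opens ℝ} {f φ : ℝ → ℝ}
    (hf : LocallyIntegrableOn f Ωˢ) (hc : Continuous φ) (hs : HasCompactSupport φ)
    (hφ : tsupport φ ⊆ Ω) : IntegrableOn (fun x => f x * φ x) Ωˢ :=
  IntegrableOn.of_forall_sdiff_eq_zero
    ((hf.integrableOn_compact_subset hφ hs).mul_continuousOn hc.continuousOn hs)
    Ω.isOpen.measurableSet fun x hx => by rw [image_eq_zero_of_notMem_tsupport hx.2, mul_zero]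

theorem TestFunction.integrableOn_mul {Ω : Opens ℝ} {f : ℝ → ℝ}
    (hf : LocallyIntegrableOn f Ωˢ) (φ : 𝓓(Ω, ℝ)) :
    IntegrableOn (fun x => f x * φ x) Ωˢ ∧
    IntegrableOn (fun x => f x * fderiv ℝ φ x 1) Ωˢ :=
  ⟨integrableOn_mul_test hf φ.contDiff.continuous φ.hasCompactSupport φ.tsupport_subset,
    integrableOn_mul_test hf ((φ.contDiff.continuous_fderiv (by simp)).clm_apply continuous_const)
      (φ.hasCompactSupport.of_isClosed_subset (isClosed_tsupport _) (tsupport_fderiv_one_subset _))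
      ((tsupport_fderiv_one_subset _).trans φ.tsupport_subset)⟩

/-- Uniqueness of the weak derivative. -/
theorem HasWeakDeriv.ae_eq {Ω : Opens ℝ} {f f' g g' : ℝ → ℝ} (h : HasWeakDeriv Ω 1 f g)
    (h' : HasWeakDeriv Ω 1 f' g') (hf : ∀ᵐ x ∂vol Ωˢ, f x = f' x) :
    ∀ᵐ x ∂vol Ωˢ, g x = g' x := by
  have := ae_eq_zero_of_test (h.2.1.sub h'.2.1) fun η => by
    simp only [Pi.sub_apply, sub_mul]
    rw [integral_sub (TestFunction.integrableOn_mul h.2.1 η).1 (TestFunction.integrableOn_mul h'.2.1 η).1]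
    have e := integral_congr_ae (hf.mono fun x hx => (by rw [hx] : f x * fderiv ℝ η x 1 = f' x * fderiv ℝ η x 1))
    rw [h.2.2 η, h'.2.2 η] at e
    linarith
  filter_upwards [this] with x hx
  exact sub_eq_zero.1 hx

theorem IsLine.one_mem {S : Set ℝ} (hS : IsLine S) : (1:ℝ) ∈ S := by rcases hS with h | h <;> simp [h]

theorem IsLine.exists_Icc {S : Set ℝ} (hS : IsLine S) {K : Set ℝ} (hK : IsCompact K) (hKS : K ⊆ S) :
    ∃ a ∈ S, ∃ b ∈ S, a ≤ 1 ∧ 1 ≤ b ∧ K ⊆ Icc a b := by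
  have h1 : IsCompact (insert 1 K) := hK.insert 1
  have h2 : insert 1 K ⊆ S := insert_subset hS.one_mem hKS
  have hne : (insert 1 K).Nonempty := insert_nonempty _ _
  exact ⟨_, h2 (h1.sInf_mem hne), _, h2 (h1.sSup_mem hne), csInf_le h1.bddBelow (mem_insert _ _),
    le_csSup h1.bddAbove (mem_insert _ _), fun y hy => ⟨csInf_le h1.bddBelow (mem_insert_of_mem _ hy),
      le_csSup h1.bddAbove (mem_insert_of_mem _ hy)⟩⟩

/-- A function without weak derivative is constant. -/
theorem ae_eq_const_of_test {Ω : Opens ℝ} (hS : IsLine Ωˢ) {H : ℝ → ℝ}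
    (hH : LocallyIntegrableOn H Ωˢ)
    (h : ∀ φ : 𝓓(Ω, ℝ), ∫ x in Ωˢ, H x * fderiv ℝ φ x 1 = 0) :
    ∃ C, ∀ᵐ x ∂vol Ωˢ, H x = C := by
  let χ₀ : ContDiffBump (1:ℝ) := ⟨1 / 4, 1 / 2, by norm_num, by norm_num⟩
  let χ := χ₀.normed volume
  have hχΩ : tsupport χ ⊆ Ωˢ := by
    rw [χ₀.tsupport_normed_eq]
    rcases hS with hS | hS
    · rw [hS]; exact subset_univ _
    · rw [hS]
      intro y hy
      rw [Real.closedBall_eq_Icc] at hy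
      have : (1:ℝ) - 1 / 2 ≤ y := hy.1
      exact mem_Ioi.2 (by linarith)
  have cχ : Continuous χ := χ₀.continuous_normed
  have sχ : HasCompactSupport χ := χ₀.hasCompactSupport_normed
  refine ⟨∫ x in Ωˢ, H x * χ x, ?_⟩
  set C := ∫ x in Ωˢ, H x * χ x
  have cC : LocallyIntegrableOn (fun _ : ℝ => C) Ωˢ :=
    continuousOn_const.locallyIntegrableOn Ω.isOpen.measurableSet
  have := ae_eq_zero_of_test (hH.sub cC) fun η => ?_
  · filter_upwards [this] with x hx using sub_eq_zero.1 hx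
  obtain ⟨a, ha, b, hb, ha1, hb1, hK⟩ := hS.exists_Icc (η.hasCompactSupport.isCompact.union sχ.isCompact)
    (union_subset η.tsupport_subset hχΩ)
  have cη : Continuous η := η.contDiff.continuous
  set m := ∫ x, η x
  let w : ℝ → ℝ := fun x => η x - m * χ x
  have cw : Continuous w := cη.sub (cχ.const_mul m)
  have hw0 : ∀ x, x ∉ Icc a b → w x = 0 := fun x hx => by
    have h1 : x ∉ tsupport η := fun h => hx (hK (Or.inl h))
    have h2 : x ∉ tsupport χ := fun h => hx (hK (Or.inr h))
    simp only [w, image_eq_zero_of_notMem_tsupport h1, image_eq_zero_of_notMem_tsupport h2, mul_zero, sub_zero]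
  have hw : ∫ x, w x = 0 := by
    rw [integral_sub (cη.integrable_of_hasCompactSupport η.hasCompactSupport)
      ((cχ.integrable_of_hasCompactSupport sχ).const_mul m), integral_const_mul, χ₀.integral_normed]
    ring
  let ψ : ℝ → ℝ := fun x => ∫ y in (a - 1)..x, w y
  have hψ : ∀ x, HasDerivAt ψ (w x) x := fun x => cw.integral_hasStrictDerivAt (a - 1) x |>.hasDerivAt
  have dψ : deriv ψ = w := funext fun x => (hψ x).deriv
  have sψ : Function.support ψ ⊆ Icc a b := fun x hx => by
    by_contra hx'
    refine hx ?_
    rcases lt_or_ge x a with hxa | hxa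
    · refine (interval_congr (g := fun _ => 0) fun y hy => hw0 y fun hy' => ?_).trans (by simp)
      have := hy.2
      have h3 : max (a - 1) x < a := max_lt (by linarith) hxa
      linarith [hy'.1]
    · have hxb : b < x := by
        by_contra h
        exact hx' ⟨hxa, not_lt.1 h⟩
      rw [← hw]
      refine intervalIntegral.integral_eq_integral_of_support_subset fun y hy => ?_
      have : y ∈ Icc a b := by
        by_contra h
        exact hy (hw0 y h)
      exact ⟨by linarith [this.1], by linarith [this.2]⟩
  have tψ : tsupport ψ ⊆ Icc a b := closure_minimal sψ isClosed_Icc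
  have := h ⟨ψ, contDiff_infty_iff_deriv.2 ⟨fun x => (hψ x).differentiableAt, by
      rw [dψ]; exact η.contDiff.sub (contDiff_const.mul χ₀.contDiff_normed)⟩,
    isCompact_Icc.of_isClosed_subset (isClosed_tsupport _) tψ,
    tψ.trans (hS.ordConnected.out ha hb)⟩
  have e : ∀ x, fderiv ℝ ψ x 1 = w x := fun x => by rw [fderiv_apply_one_eq_deriv, dψ]
  have e2 : ∫ x in Ωˢ, H x * w x = 0 := by
    rw [← this]; exact integral_congr_ae (.of_forall fun x => by simp only [← e]; rfl)
  have i1 := (TestFunction.integrableOn_mul hH η).1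
  have i2 := integrableOn_mul_test hH cχ sχ hχΩ
  have i3 := (TestFunction.integrableOn_mul cC η).1
  have e3 : ∫ x in Ωˢ, H x * w x = (∫ x in Ωˢ, H x * η x) - m * C := by
    rw [← integral_const_mul, ← integral_sub i1 (i2.const_mul m)]
    exact integral_congr_ae (.of_forall fun x => by simp only [w]; ring)
  have e4 : ∫ x in Ωˢ, η x = m := setIntegral_eq_integral_of_forall_compl_eq_zero fun x hx =>
    image_eq_zero_of_notMem_tsupport fun hx' => hx (η.tsupport_subset hx')
  simp only [Pi.sub_apply, sub_mul]
  rw [integral_sub i1 i3, integral_const_mul, e4]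
  linarith [mul_comm m C]

/-- A weak derivative, integrable up to the boundary, is a derivative. -/
theorem HasWeakDeriv.exists_ae_eq {Ω : Opens ℝ} (hS : IsLine Ωˢ) {f g : ℝ → ℝ}
    (h : HasWeakDeriv Ω 1 f g) (hg : ∀ a ∈ closure Ωˢ, ∀ b ∈ closure Ωˢ, IntervalIntegrable g volume a b) :
    ∃ F, IsPrim (closure Ωˢ) F g ∧ ∀ᵐ x ∂vol Ωˢ, f x = F x := by
  have hG := isPrim_integral (subset_closure hS.one_mem) hg
  have hG' := hG.hasWeakDeriv hS
  obtain ⟨C, hC⟩ := ae_eq_const_of_test hS (h.1.sub hG'.1) fun φ => by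
    simp only [Pi.sub_apply, sub_mul]
    rw [integral_sub (TestFunction.integrableOn_mul h.1 φ).2 (TestFunction.integrableOn_mul hG'.1 φ).2,
      h.2.2 φ, hG'.2.2 φ, sub_self]
  refine ⟨_, hG.add_const C, ?_⟩
  filter_upwards [hC] with x hx
  simp only [Pi.sub_apply] at hx
  linarith

theorem IsPrim.continuousOn_closure {S : Set ℝ} (hS : IsLine S) {f g : ℝ → ℝ}
    (h : IsPrim (closure S) f g) : ContinuousOn f (closure S) := by
  have := hS.ordConnected_closure
  intro x hx
  have h1 : x + 1 ∈ closure S := hS.mem_of_le hx (by linarith)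
  rcases hS.closure_eq with ⟨-, h2⟩ | ⟨-, h2⟩
  · refine ((h.continuousOn (a := x - 1) (b := x + 1) (by simp [h2]) h1).continuousAt ?_).continuousWithinAt
    rw [uIcc_of_le (by linarith)]
    exact Icc_mem_nhds (by linarith) (by linarith)
  · rw [h2] at hx ⊢
    have h0 : (0:ℝ) ∈ closure S := by simp [h2]
    have h3 := h.continuousOn (a := 0) h0 h1
    have hx0 : (0:ℝ) ≤ x := hx
    rw [uIcc_of_le (by linarith)] at h3
    refine (h3 x ⟨hx, by linarith⟩).mono_of_mem_nhdsWithin ?_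
    rw [mem_nhdsWithin]
    exact ⟨Iio (x + 1), isOpen_Iio, by simp, fun y hy => ⟨hy.2, le_of_lt hy.1⟩⟩

theorem eqOn_closure_of_ae {S : Set ℝ} (hS : IsLine S) {f F : ℝ → ℝ} (hf : ContinuousOn f (closure S))
    (hF : ContinuousOn F (closure S)) (h : ∀ᵐ x ∂vol S, f x = F x) :
    EqOn f F (closure S) :=
  (Measure.eqOn_open_of_ae_eq h hS.isOpen (hf.mono subset_closure) (hF.mono subset_closure)).of_subset_closure
    hf hF subset_closure le_rfl

theorem HasWeakDeriv.isPrim {Ω : Opens ℝ} (hS : IsLine Ωˢ) {f g : ℝ → ℝ}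
    (h : HasWeakDeriv Ω 1 f g) (hf : ContinuousOn f (closure Ωˢ))
    (hg : ∀ a ∈ closure Ωˢ, ∀ b ∈ closure Ωˢ, IntervalIntegrable g volume a b) :
    IsPrim (closure Ωˢ) f g := by
  obtain ⟨F, hF, hae⟩ := h.exists_ae_eq hS hg
  exact hF.congr_left (eqOn_closure_of_ae hS hf (hF.continuousOn_closure hS) hae).symm

/-! ### Weak derivatives of slices -/

/-- The bounded part of a set. -/
def bdPart (A : Set ℝ) (n : ℕ) : Set ℝ := A ∩ Icc (-n : ℝ) n

theorem bdPart_mono (A : Set ℝ) {m n : ℕ} (h : m ≤ n) : bdPart A m ⊆ bdPart A n :=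
  inter_subset_inter_right _ (Icc_subset_Icc (by simpa using h) (by simpa using h))

theorem exists_subset_Icc {K : Set ℝ} (hK : IsCompact K) : ∃ n : ℕ, K ⊆ Icc (-n : ℝ) n := by
  obtain ⟨r, hr⟩ := hK.isBounded.subset_closedBall 0
  obtain ⟨n, hn⟩ := exists_nat_ge r
  refine ⟨n, hr.trans ?_⟩
  rw [Real.closedBall_eq_Icc]
  exact Icc_subset_Icc (by linarith) (by linarith)

theorem locallyIntegrableOn_of_bdPart {A : Set ℝ} (hA : IsOpen A) {f : ℝ → ℝ}
    (h : ∀ n, IntegrableOn f (bdPart A n)) : LocallyIntegrableOn f A := by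
  rw [locallyIntegrableOn_iff hA.isLocallyClosed]
  intro K hKA hK
  obtain ⟨n, hn⟩ := exists_subset_Icc hK
  exact (h n).mono_set (subset_inter hKA hn)

theorem integrableOn_mul_of_compact {α : Type*} [MeasurableSpace α] {m : Measure α} {f c : α → ℝ} {s t : Set α}
    (hf : IntegrableOn f s m) (hc : Measurable c) {C : ℝ} (hC : ∀ z, |c z| ≤ C) (ht : MeasurableSet t)
    (h0 : ∀ z ∈ t \ s, c z = 0) : IntegrableOn (fun z => f z * c z) t m :=
  IntegrableOn.of_forall_sdiff_eq_zero
    (Integrable.mul_bdd (c := C) hf hc.aestronglyMeasurable (.of_forall hC)) ht fun z hz => by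
      rw [h0 z hz, mul_zero]

section Slice

variable {A B : Opens ℝ} {f g : ℝ × ℝ → ℝ}

theorem measurableSet_bdPart (A : Opens ℝ) (n : ℕ) : MeasurableSet (bdPart Aˢ n) :=
  A.isOpen.measurableSet.inter measurableSet_Icc

theorem ae_slice_bdPart (hf : ∀ n, IntegrableOn f (bdPart Aˢ n ×ˢ bdPart Bˢ n)) :
    ∀ᵐ s ∂vol Aˢ, ∀ n, IntegrableOn (fun x => f (s, x)) (bdPart Bˢ n) := by
  have h : ∀ n, ∀ᵐ s, s ∈ bdPart Aˢ n → IntegrableOn (fun x => f (s, x)) (bdPart Bˢ n) := fun n => by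
      rw [← ae_restrict_iff' (measurableSet_bdPart A n)]
      have := hf n
      rw [IntegrableOn, Measure.volume_eq_prod, ← Measure.prod_restrict] at this
      exact this.prod_right_ae
  rw [ae_restrict_iff' A.isOpen.measurableSet]
  filter_upwards [ae_all_iff.2 h] with s hs hsA n
  obtain ⟨m, hm⟩ := exists_subset_Icc (isCompact_singleton (x := s))
  have h1 := hs (max m n) (bdPart_mono _ (le_max_left _ _) ⟨hsA, hm rfl⟩)
  exact h1.mono_set (bdPart_mono _ (le_max_right _ _))

/-- The weak equation on almost all slices, for one test function. -/
theorem ae_integral_slice_eq_zero (hf : ∀ n, IntegrableOn f (bdPart Aˢ n ×ˢ bdPart Bˢ n))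
    (hg : ∀ n, IntegrableOn g (bdPart Aˢ n ×ˢ bdPart Bˢ n)) (η : 𝓓(B, ℝ))
    (h : ∀ α : 𝓓(A, ℝ), ∫ z in Aˢ ×ˢ Bˢ, f z * (α z.1 * fderiv ℝ η z.2 1) =
      - ∫ z in Aˢ ×ˢ Bˢ, g z * (α z.1 * η z.2)) :
    ∀ᵐ s ∂vol Aˢ, ∫ x in Bˢ, (f (s, x) * fderiv ℝ η x 1 + g (s, x) * η x) = 0 := by
  have cη : Continuous η := η.contDiff.continuous
  have cη' : Continuous fun x => fderiv ℝ η x 1 :=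
    (η.contDiff.continuous_fderiv (by simp)).clm_apply continuous_const
  obtain ⟨n, hn⟩ := exists_subset_Icc η.hasCompactSupport
  have sη' : HasCompactSupport fun x => fderiv ℝ η x 1 :=
    η.hasCompactSupport.of_isClosed_subset (isClosed_tsupport _) (tsupport_fderiv_one_subset _)
  obtain ⟨C, hC⟩ := η.hasCompactSupport.exists_bound_of_continuous cη
  obtain ⟨C', hC'⟩ := sη'.exists_bound_of_continuous cη'
  have z1 : ∀ x, x ∉ Icc (-n : ℝ) n → η x = 0 := fun x hx => image_eq_zero_of_notMem_tsupport fun h => hx (hn h)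
  have z2 : ∀ x, x ∉ Icc (-n : ℝ) n → fderiv ℝ η x 1 = 0 := fun x hx =>
    image_eq_zero_of_notMem_tsupport (f := fun x => fderiv ℝ η x 1)
      fun h => hx (hn (tsupport_fderiv_one_subset _ h))
  have mB := B.isOpen.measurableSet
  have mA := A.isOpen.measurableSet
  have key : ∀ {k : ℝ × ℝ → ℝ} {c : ℝ → ℝ} {C : ℝ},
      (∀ m, IntegrableOn k (bdPart Aˢ m ×ˢ bdPart Bˢ m)) → Continuous c →
      (∀ x, ‖c x‖ ≤ C) → (∀ x, x ∉ Icc (-n : ℝ) n → c x = 0) → ∀ m,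
      IntegrableOn (fun z => k z * c z.2) (bdPart Aˢ m ×ˢ Bˢ) :=
    fun {k c C} hk cc hC hz m => by
      refine (integrableOn_mul_of_compact (hk (max m n)) (by fun_prop) (fun z => hC z.2)
        ((measurableSet_bdPart A (max m n)).prod mB) fun z hz' => hz _ fun hzI => hz'.2
          ⟨hz'.1.1, hz'.1.2, ?_⟩).mono_set (prod_mono (bdPart_mono _ (le_max_left _ _)) le_rfl)
      exact Icc_subset_Icc (by simp) (by simp) hzI
  have i1 := key hf cη' hC' z2
  have i2 := key hg cη hC z1
  have i3 : ∀ m, IntegrableOn (fun s => ∫ x in Bˢ, (f (s, x) * fderiv ℝ η x 1 + g (s, x) * η x))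
      (bdPart Aˢ m) := fun m => by
    have := (i1 m).add (i2 m)
    rw [IntegrableOn, Measure.volume_eq_prod, ← Measure.prod_restrict] at this
    exact this.integral_prod_left
  refine ae_eq_zero_of_test (locallyIntegrableOn_of_bdPart A.isOpen i3) fun α => ?_
  have cα : Continuous α := α.contDiff.continuous
  obtain ⟨m, hm⟩ := exists_subset_Icc α.hasCompactSupport
  obtain ⟨M, hM⟩ := α.hasCompactSupport.exists_bound_of_continuous cα
  have zα : ∀ z ∈ (Aˢ ×ˢ Bˢ) \ (bdPart Aˢ m ×ˢ Bˢ), α z.1 = 0 :=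
    fun z hz => image_eq_zero_of_notMem_tsupport fun h => hz.2 ⟨⟨hz.1.1, hm h⟩, hz.1.2⟩
  have j1 := integrableOn_mul_of_compact (c := fun z => α z.1) (i1 m) (by fun_prop) (fun z => hM z.1)
    (mA.prod mB) zα
  have j2 := integrableOn_mul_of_compact (c := fun z => α z.1) (i2 m) (by fun_prop) (fun z => hM z.1)
    (mA.prod mB) zα
  have e : ∫ z in Aˢ ×ˢ Bˢ, (f z * fderiv ℝ η z.2 1 * α z.1 + g z * η z.2 * α z.1) = 0 := by
    rw [integral_add j1 j2]
    have e1 := h α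
    have c1 : ∀ z : ℝ × ℝ, f z * (α z.1 * fderiv ℝ η z.2 1) = f z * fderiv ℝ η z.2 1 * α z.1 := fun z => by ring
    have c2 : ∀ z : ℝ × ℝ, g z * (α z.1 * η z.2) = g z * η z.2 * α z.1 := fun z => by ring
    simp only [c1, c2] at e1
    linarith
  have j3 := j1.add j2
  rw [IntegrableOn, Measure.volume_eq_prod, ← Measure.prod_restrict] at j3
  rw [Measure.volume_eq_prod, ← Measure.prod_restrict] at e
  have e5 := integral_prod _ j3
  simp only [Pi.add_apply] at e5
  rw [e] at e5
  rw [e5]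
  refine integral_congr_ae (.of_forall fun s => ?_)
  simp only [← add_mul]
  rw [integral_mul_const]

/-- The weak equation on almost all slices. -/
theorem ae_hasWeakDeriv_slice (hf : ∀ n, IntegrableOn f (bdPart Aˢ n ×ˢ bdPart Bˢ n))
    (hg : ∀ n, IntegrableOn g (bdPart Aˢ n ×ˢ bdPart Bˢ n))
    (h : ∀ (α : 𝓓(A, ℝ)) (η : 𝓓(B, ℝ)), ∫ z in Aˢ ×ˢ Bˢ, f z * (α z.1 * fderiv ℝ η z.2 1) =
      - ∫ z in Aˢ ×ˢ Bˢ, g z * (α z.1 * η z.2)) :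
    ∀ᵐ s ∂vol Aˢ, HasWeakDeriv B 1 (fun x => f (s, x)) (fun x => g (s, x)) := by
  let D : (n : ℕ) → Set C(Icc (-n : ℝ) n, ℝ × ℝ) := fun n =>
    {F | ∃ η : 𝓓(B, ℝ), tsupport η ⊆ Icc (-n : ℝ) n ∧ ∀ x, F x = (η x, fderiv ℝ η x 1)}
  have hD : ∀ n, ∃ c ⊆ D n, c.Countable ∧ D n ⊆ closure c := fun n =>
    (TopologicalSpace.IsSeparable.of_separableSpace (D n)).exists_countable_dense_subset
  choose c hcD hcc hcd using hD
  choose η hη1 hη2 using fun n (F : c n) => hcD n F.2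
  have hae : ∀ᵐ s ∂vol Aˢ, ∀ n, ∀ F : c n,
      ∫ x in Bˢ, (f (s, x) * fderiv ℝ (η n F) x 1 + g (s, x) * η n F x) = 0 := by
    refine ae_all_iff.2 fun n => ?_
    have : Countable (c n) := (hcc n).to_subtype
    exact ae_all_iff.2 fun F => ae_integral_slice_eq_zero hf hg (η n F) fun α => h α (η n F)
  filter_upwards [hae, ae_slice_bdPart hf, ae_slice_bdPart hg] with s hs hfs hgs
  have lf := locallyIntegrableOn_of_bdPart B.isOpen hfs
  have lg := locallyIntegrableOn_of_bdPart B.isOpen hgs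
  refine ⟨lf, lg, fun φ => ?_⟩
  have hin : ∀ ψ : 𝓓(B, ℝ), IntegrableOn (fun x => f (s, x) * fderiv ℝ ψ x 1 + g (s, x) * ψ x) B := fun ψ =>
    (TestFunction.integrableOn_mul lf ψ).2.add (TestFunction.integrableOn_mul lg ψ).1
  have hsplit : ∀ ψ : 𝓓(B, ℝ), ∫ x in Bˢ, (f (s, x) * fderiv ℝ ψ x 1 + g (s, x) * ψ x) =
      (∫ x in Bˢ, f (s, x) * fderiv ℝ ψ x 1) + ∫ x in Bˢ, g (s, x) * ψ x := fun ψ =>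
    integral_add (TestFunction.integrableOn_mul lf ψ).2 (TestFunction.integrableOn_mul lg ψ).1
  rw [eq_neg_iff_add_eq_zero, ← hsplit]
  obtain ⟨n, hn⟩ := exists_subset_Icc φ.hasCompactSupport
  have hloc : ∀ ψ : 𝓓(B, ℝ), tsupport ψ ⊆ Icc (-n : ℝ) n → ∀ x, x ∉ Icc (-n : ℝ) n →
      ψ x = 0 ∧ fderiv ℝ ψ x 1 = 0 := fun ψ hψ x hx =>
    ⟨image_eq_zero_of_notMem_tsupport fun h => hx (hψ h),
      image_eq_zero_of_notMem_tsupport (f := fun x => fderiv ℝ ψ x 1)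
        fun h => hx (hψ (tsupport_fderiv_one_subset _ h))⟩
  have iM : IntegrableOn (fun x => |f (s, x)| + |g (s, x)|) (bdPart Bˢ n) := (hfs n).abs.add (hgs n).abs
  set M := ∫ x in bdPart Bˢ n, (|f (s, x)| + |g (s, x)|)
  have hM : 0 ≤ M := integral_nonneg fun x => by positivity
  have hε : ∀ ε > 0, |∫ x in Bˢ, (f (s, x) * fderiv ℝ φ x 1 + g (s, x) * φ x)| ≤ M * ε := by
    intro ε hε
    let Φ : C(Icc (-n : ℝ) n, ℝ × ℝ) := ⟨fun x => (φ x, fderiv ℝ φ x 1), by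
      have h1 : Continuous φ := φ.contDiff.continuous
      have h2 : Continuous fun x => fderiv ℝ φ x 1 :=
        (φ.contDiff.continuous_fderiv (by simp)).clm_apply continuous_const
      exact (h1.prodMk h2).comp continuous_subtype_val⟩
    obtain ⟨F, hF, hd⟩ := Metric.mem_closure_iff.1 (hcd n ⟨φ, hn, fun x => rfl⟩ : Φ ∈ closure (c n)) ε hε
    have h0 := hs n ⟨F, hF⟩
    have hb : ∀ x ∈ Icc (-n : ℝ) n, |φ x - η n ⟨F, hF⟩ x| ≤ ε ∧
        |fderiv ℝ φ x 1 - fderiv ℝ (η n ⟨F, hF⟩) x 1| ≤ ε := fun x hx => by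
      have h3 := (ContinuousMap.dist_apply_le_dist (f := Φ) (g := F) ⟨x, hx⟩).trans hd.le
      rw [show F ⟨x, hx⟩ = _ from hη2 n ⟨F, hF⟩ ⟨x, hx⟩, Prod.dist_eq] at h3
      exact ⟨(le_max_left _ _).trans h3, (le_max_right _ _).trans h3⟩
    rw [← sub_zero (∫ x in Bˢ, _), ← h0, ← integral_sub (hin φ) (hin _),
      setIntegral_eq_of_subset_of_forall_sdiff_eq_zero (s := bdPart Bˢ n) B.isOpen.measurableSet
        inter_subset_left fun x hx => ?_]
    · rw [← integral_mul_const, ← Real.norm_eq_abs]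
      refine norm_integral_le_of_norm_le (iM.mul_const ε) ?_
      filter_upwards [ae_restrict_mem (measurableSet_bdPart B n)] with x hx
      obtain ⟨b1, b2⟩ := hb x hx.2
      have e : f (s, x) * fderiv ℝ φ x 1 + g (s, x) * φ x - (f (s, x) * fderiv ℝ (η n ⟨F, hF⟩) x 1 +
          g (s, x) * η n ⟨F, hF⟩ x) = f (s, x) * (fderiv ℝ φ x 1 - fderiv ℝ (η n ⟨F, hF⟩) x 1) +
          g (s, x) * (φ x - η n ⟨F, hF⟩ x) := by ring
      rw [e, Real.norm_eq_abs, add_mul]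
      refine (abs_add_le _ _).trans (add_le_add ?_ ?_) <;> rw [abs_mul] <;> gcongr
    · have hx' : x ∉ Icc (-n : ℝ) n := fun h => hx.2 ⟨hx.1, h⟩
      obtain ⟨a1, a2⟩ := hloc φ hn x hx'
      obtain ⟨a3, a4⟩ := hloc (η n ⟨F, hF⟩) (hη1 n ⟨F, hF⟩) x hx'
      simp only [a1, a2, a3, a4, mul_zero, add_zero, sub_zero]
  refine abs_eq_zero.1 (le_antisymm (le_of_forall_pos_le_add fun ε hε' => ?_) (abs_nonneg _))
  refine (hε (ε / (M + 1)) (by positivity)).trans ?_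
  rw [zero_add, mul_div_assoc', div_le_iff₀ (by positivity)]
  nlinarith

end Slice

/-! ### Slices of functions of time and space -/

/-- The time axis. -/
abbrev timeAxis : Opens ℝ := ⟨Ioi 0, isOpen_Ioi⟩

theorem isLine_timeAxis : IsLine (timeAxis : Set ℝ) := Or.inr rfl

theorem closure_timeAxis : closure (timeAxis : Set ℝ) = Ici 0 := closure_Ioi 0

/-- Integrability on bounded parts of space-time. -/
def BoxInt (S : Set ℝ) (f : ℝ × ℝ → ℝ) : Prop := ∀ n : ℕ, IntegrableOn f (bdPart (Ioi 0) n ×ˢ bdPart S n)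

section

variable {Ω : Opens ℝ} {S : Set ℝ} {f g c : ℝ × ℝ → ℝ}

theorem BoxInt.of_continuous (S : Set ℝ) (hf : Continuous f) : BoxInt S f := fun n =>
  (hf.continuousOn.integrableOn_compact (isCompact_Icc.prod isCompact_Icc)).mono_set
    (prod_mono inter_subset_right inter_subset_right : _ ⊆ Icc (-n : ℝ) n ×ˢ Icc (-n : ℝ) n)

theorem BoxInt.mul_continuous (hf : BoxInt S f) (hc : Continuous c) (hS : MeasurableSet S) :
    BoxInt S (fun z => f z * c z) := fun n => by
  obtain ⟨C, hC⟩ := (isCompact_Icc.prod isCompact_Icc :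
    IsCompact (Icc (-n : ℝ) n ×ˢ Icc (-n : ℝ) n)).exists_bound_of_continuousOn hc.continuousOn
  refine Integrable.mul_bdd (c := C) (hf n) hc.measurable.aestronglyMeasurable ?_
  filter_upwards [ae_restrict_mem ((measurableSet_Ioi.inter measurableSet_Icc).prod
    (hS.inter measurableSet_Icc))] with z hz using hC z ⟨hz.1.2, hz.2.2⟩

theorem BoxInt.of_memLp (hf : ∀ T, MemLp f 2 (stm S T)) : BoxInt S f := fun n => by
  have h1 : bdPart (Ioi 0) n ×ˢ bdPart S n ⊆ (Ioc 0 (n:ℝ)) ×ˢ S :=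
    prod_mono (fun t ht => ⟨ht.1, ht.2.2⟩) inter_subset_left
  have h2 := hf n
  rw [stm, Measure.prod_restrict, ← Measure.volume_eq_prod] at h2
  have h3 : (volume : Measure (ℝ × ℝ)) (bdPart (Ioi 0) n ×ˢ bdPart S n) ≠ ∞ :=
    ((measure_mono (prod_mono inter_subset_right inter_subset_right)).trans_lt
      ((isCompact_Icc.prod isCompact_Icc).measure_lt_top)).ne
  have : IsFiniteMeasure (vol (bdPart (Ioi 0) n ×ˢ bdPart S n)) := ⟨by simpa using h3.lt_top⟩
  exact (h2.mono_measure (Measure.restrict_mono h1 le_rfl)).integrable (by norm_num)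

theorem BoxInt.add (hf : BoxInt S f) (hg : BoxInt S g) : BoxInt S (fun z => f z + g z) := fun n =>
  Integrable.add (hf n) (hg n)

theorem BoxInt.const_mul (hf : BoxInt S f) (k : ℝ) : BoxInt S (fun z => k * f z) := fun n =>
  Integrable.const_mul (hf n) k

/-- The product of two test functions. -/
def prodTest (α : 𝓓(timeAxis, ℝ)) (η : 𝓓(Ω, ℝ)) : 𝓓(spaceTime Ω, ℝ) :=
  have hsub : tsupport (fun z : ℝ × ℝ => α z.1 * η z.2) ⊆ tsupport α ×ˢ tsupport η :=
    closure_minimal (fun _ hz => ⟨subset_tsupport _ (left_ne_zero_of_mul hz),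
      subset_tsupport _ (right_ne_zero_of_mul hz)⟩) ((isClosed_tsupport _).prod (isClosed_tsupport _))
  { toFun := fun z => α z.1 * η z.2
    contDiff' := (α.contDiff.comp contDiff_fst).mul (η.contDiff.comp contDiff_snd)
    hasCompactSupport' := (α.hasCompactSupport.isCompact.prod η.hasCompactSupport.isCompact).of_isClosed_subset
      (isClosed_tsupport _) hsub
    tsupport_subset' := hsub.trans (prod_mono α.tsupport_subset η.tsupport_subset) }

theorem prodTest_apply (α : 𝓓(timeAxis, ℝ)) (η : 𝓓(Ω, ℝ)) (z : ℝ × ℝ) : prodTest α η z = α z.1 * η z.2 := rfl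

theorem fderiv_prodTest (α : 𝓓(timeAxis, ℝ)) (η : 𝓓(Ω, ℝ)) (z : ℝ × ℝ) :
    fderiv ℝ (prodTest α η) z (1, 0) = fderiv ℝ α z.1 1 * η z.2 ∧
    fderiv ℝ (prodTest α η) z (0, 1) = α z.1 * fderiv ℝ η z.2 1 := by
  have h1 := ((α.contDiff.differentiable (by simp)) z.1).hasFDerivAt.comp z hasFDerivAt_fst
  have h2 := ((η.contDiff.differentiable (by simp)) z.2).hasFDerivAt.comp z hasFDerivAt_snd
  have h3 : HasFDerivAt (prodTest α η) _ z := h1.mul h2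
  rw [h3.fderiv]
  constructor <;> simp [mul_comm]

/-- A weak equation `f_x = g` holds on almost all lines `t = const`. -/
theorem ae_hasWeakDeriv_x (hf : BoxInt Ω f) (hg : BoxInt Ω g) (h : ∀ (α : 𝓓(timeAxis, ℝ)) (η : 𝓓(Ω, ℝ)),
    ∫ z in (spaceTime Ω)ˢ, f z * fderiv ℝ (prodTest α η) z (0, 1) =
      - ∫ z in (spaceTime Ω)ˢ, g z * prodTest α η z) :
    ∀ᵐ t ∂vol₊, HasWeakDeriv Ω 1 (fun x => f (t, x)) (fun x => g (t, x)) :=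
  ae_hasWeakDeriv_slice (A := timeAxis) hf hg fun α η => by
    have := h α η
    simp only [fderiv_prodTest, prodTest_apply] at this
    exact this

theorem setIntegral_swap (f : ℝ × ℝ → ℝ) (A B : Set ℝ) : ∫ z in B ×ˢ A, f z.swap = ∫ z in A ×ˢ B, f z := by
  have := (Measure.measurePreserving_swap (μ := (volume : Measure ℝ)) (ν := (volume : Measure ℝ)))
    |>.setIntegral_preimage_emb MeasurableEquiv.prodComm.measurableEmbedding f (A ×ˢ B)
  rwa [preimage_swap_prod] at this

theorem integrableOn_swap {A B : Set ℝ} (h : IntegrableOn f (A ×ˢ B)) :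
    IntegrableOn (fun z => f z.swap) (B ×ˢ A) := by
  have := (Measure.measurePreserving_swap (μ := (volume : Measure ℝ)) (ν := (volume : Measure ℝ)))
    |>.integrableOn_comp_preimage MeasurableEquiv.prodComm.measurableEmbedding (f := f) (s := A ×ˢ B)
  rw [preimage_swap_prod] at this
  exact this.2 h

/-- A weak equation `f_t = g` holds on almost all lines `x = const`. -/
theorem ae_hasWeakDeriv_t (hf : BoxInt Ω f) (hg : BoxInt Ω g) (h : ∀ (α : 𝓓(timeAxis, ℝ)) (η : 𝓓(Ω, ℝ)),
    ∫ z in (spaceTime Ω)ˢ, f z * fderiv ℝ (prodTest α η) z (1, 0) =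
      - ∫ z in (spaceTime Ω)ˢ, g z * prodTest α η z) :
    ∀ᵐ x ∂vol Ωˢ, HasWeakDeriv timeAxis 1 (fun t => f (t, x)) (fun t => g (t, x)) :=
  ae_hasWeakDeriv_slice (A := Ω) (B := timeAxis) (f := fun z => f z.swap) (g := fun z => g z.swap)
    (fun n => integrableOn_swap (hf n)) (fun n => integrableOn_swap (hg n)) fun η α => by
      have := h α η
      simp only [fderiv_prodTest, prodTest_apply] at this
      rw [show ((spaceTime Ω : Opens (ℝ × ℝ)) : Set (ℝ × ℝ)) = Ioi 0 ×ˢ Ωˢ from rfl,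
        ← setIntegral_swap, ← setIntegral_swap (fun z => g z * _)] at this
      simp only [Prod.fst_swap, Prod.snd_swap, mul_comm] at this ⊢
      exact this

theorem ae_spaceTime_iff {P : ℝ × ℝ → Prop} :
    (∀ᵐ z ∂vol (spaceTime Ω)ˢ, P z) ↔ ∀ᵐ z ∂vol₊.prod (vol Ωˢ), P z := by
  rw [Measure.prod_restrict]; rfl

/-- If `f` is weakly differentiable in time on almost all lines, then it is so in the weak sense. -/
theorem integral_prodTest_t (hf : BoxInt Ω f) (hg : BoxInt Ω g)
    (h : ∀ᵐ x ∂vol Ωˢ, IsPrim (Ici 0) (fun t => f (t, x)) (fun t => g (t, x)))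
    (α : 𝓓(timeAxis, ℝ)) (η : 𝓓(Ω, ℝ)) :
    ∫ z in (spaceTime Ω)ˢ, f z * fderiv ℝ (prodTest α η) z (1, 0) =
      - ∫ z in (spaceTime Ω)ˢ, g z * prodTest α η z := by
  obtain ⟨n, hn⟩ := exists_subset_Icc (α.hasCompactSupport.isCompact.union η.hasCompactSupport.isCompact)
  have cα : Continuous α := α.contDiff.continuous
  have cη : Continuous η := η.contDiff.continuous
  have cα' : Continuous fun x => fderiv ℝ α x 1 :=
    (α.contDiff.continuous_fderiv (by simp)).clm_apply continuous_const
  have int : ∀ {k : ℝ × ℝ → ℝ} {β : ℝ → ℝ}, BoxInt Ω k → Continuous β → tsupport β ⊆ tsupport α →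
      Integrable (fun z => k z * (β z.1 * η z.2)) (vol₊.prod (vol Ωˢ)) :=
    fun {k β} hk cβ hβ => by
    have z0 : ∀ z ∈ ((timeAxis : Set ℝ) ×ˢ Ωˢ) \ (bdPart (Ioi 0) n ×ˢ bdPart Ωˢ n),
        k z * (β z.1 * η z.2) = 0 := fun z hz => by
      by_contra h0
      have h1 := right_ne_zero_of_mul h0
      exact hz.2 ⟨⟨hz.1.1, hn (Or.inl (hβ (subset_tsupport _ (left_ne_zero_of_mul h1))))⟩,
        hz.1.2, hn (Or.inr (subset_tsupport _ (right_ne_zero_of_mul h1)))⟩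
    rw [Measure.prod_restrict]
    exact IntegrableOn.of_forall_sdiff_eq_zero (hk.mul_continuous
      (by fun_prop : Continuous fun z : ℝ × ℝ => β z.1 * η z.2) Ω.isOpen.measurableSet n)
      (timeAxis.isOpen.measurableSet.prod Ω.isOpen.measurableSet) z0
  have e : ∀ k : ℝ × ℝ → ℝ, ∫ z in (spaceTime Ω)ˢ, k z = ∫ z, k z ∂vol₊.prod (vol Ωˢ) := fun k => by
    rw [Measure.prod_restrict]; rfl
  simp only [fderiv_prodTest, prodTest_apply]
  rw [e, e, integral_prod_symm _ (int hf cα' (tsupport_fderiv_one_subset _)),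
    integral_prod_symm _ (int hg cα le_rfl), ← integral_neg]
  refine integral_congr_ae (h.mono fun x hx => ?_)
  rw [← closure_timeAxis] at hx
  have := (hx.hasWeakDeriv isLine_timeAxis).2.2 α
  simp only [← mul_assoc, integral_mul_const]
  rw [show ∫ t in Ioi (0:ℝ), f (t, x) * fderiv ℝ α t 1 = _ from this, neg_mul]
  rfl

end

/-! ### Pointwise derivatives of generalized solutions -/

theorem intervalIntegrable_of_bdPart {S : Set ℝ} (hS : IsLine S) {g : ℝ → ℝ}
    (h : ∀ n, IntegrableOn g (bdPart S n)) :
    ∀ a ∈ closure S, ∀ b ∈ closure S, IntervalIntegrable g volume a b := fun a ha b hb => by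
  wlog hab : a ≤ b generalizing a b
  · exact (this b hb a ha (le_of_not_ge hab)).symm
  obtain ⟨n, hn⟩ := exists_subset_Icc (isCompact_Icc (a := a) (b := b))
  rw [intervalIntegrable_iff_Ioc hab]
  exact (h n).mono_set (subset_inter (fun y hy => hS.Ioi_subset ha hy.1) (Ioc_subset_Icc_self.trans hn))

/-- The derivative of `f` in `x` in terms of `f` and `g = f_xx`. -/
def derivOfSecond (f g : ℝ × ℝ → ℝ) (z : ℝ × ℝ) : ℝ :=
  f (z.1, z.2 + 1) - f z - ∫ r in Ioc (0:ℝ) 1, (1 - r) * g (z.1, z.2 + r)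

theorem measurable_derivOfSecond {f g : ℝ × ℝ → ℝ} (hf : Measurable f) (hg : Measurable g) :
    Measurable (derivOfSecond f g) := by
  have : StronglyMeasurable fun z : ℝ × ℝ => ∫ r in Ioc (0:ℝ) 1, (1 - r) * g (z.1, z.2 + r) :=
    StronglyMeasurable.integral_prod_right (f := fun (z : ℝ × ℝ) (r : ℝ) => (1 - r) * g (z.1, z.2 + r))
      (Measurable.stronglyMeasurable (by fun_prop))
  exact ((by fun_prop : Measurable fun z : ℝ × ℝ => f (z.1, z.2 + 1)).sub hf).sub this.measurable

theorem IsPrim.eq_of_second {S : Set ℝ} (hS : IsLine S) {F W G : ℝ → ℝ} (h : IsPrim (closure S) F W)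
    (h' : IsPrim (closure S) W G) {x : ℝ} (hx : x ∈ closure S) :
    W x = F (x + 1) - F x - ∫ r in Ioc (0:ℝ) 1, (1 - r) * G (x + r) := by
  have := hS.ordConnected_closure
  have hx1 : x + 1 ∈ closure S := hS.mem_of_le hx (by linarith)
  have hl : IsPrim (closure S) (fun y => x + 1 - y) (fun _ => -1) :=
    isPrim_of_hasDerivAt (fun y => by simpa using (hasDerivAt_id y).const_sub (x + 1)) continuous_const _
  have hm := hl.mul h'
  have e1 := hm.sub_eq hx hx1
  have i1 := h.intervalIntegrable hx hx1
  have i2 : IntervalIntegrable (fun y => (x + 1 - y) * G y) volume x (x + 1) := by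
    have := (hm.intervalIntegrable hx hx1).add i1
    refine IntervalIntegrable.congr ?_ this
    exact fun y _ => by ring
  rw [interval_add (i1.const_mul (-1)) i2, interval_const_mul, ← h.sub_eq hx hx1] at e1
  have e2 : ∫ y in x..x + 1, (x + 1 - y) * G y = ∫ r in Ioc (0:ℝ) 1, (1 - r) * G (x + r) := by
    rw [← integral_of_le zero_le_one]
    have := intervalIntegral.integral_comp_add_left (a := 0) (b := 1) (fun y => (x + 1 - y) * G y) x
    rw [add_zero] at this
    rw [← this]
    exact interval_congr fun r _ => by ring_nf
  rw [e2] at e1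
  linarith

section

variable {Ω : Opens ℝ} {f g : ℝ × ℝ → ℝ}

theorem exists_measurable_ae_eq (hf : LocallyIntegrableOn f (spaceTime Ω)ˢ) :
    ∃ F, Measurable F ∧ ∀ᵐ z ∂vol (spaceTime Ω)ˢ, f z = F z :=
  ⟨_, hf.aestronglyMeasurable.stronglyMeasurable_mk.measurable, hf.aestronglyMeasurable.ae_eq_mk⟩

theorem stm_le (Ω : Opens ℝ) (T : ℝ) : stm Ωˢ T ≤ vol (spaceTime Ω)ˢ := by
  rw [stm, Measure.prod_restrict]
  exact Measure.restrict_mono (Set.prod_mono Ioc_subset_Ioi_self le_rfl) le_rfl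

theorem stm_eq (Ω : Opens ℝ) (T : ℝ) : stm Ωˢ T = vol (Ioo 0 T ×ˢ Ωˢ) := by
  rw [stm, ← Measure.restrict_congr_set Ioo_ae_eq_Ioc, Measure.prod_restrict]; rfl

theorem stm_mono (S : Set ℝ) {T T' : ℝ} (h : T ≤ T') : stm S T ≤ stm S T' :=
  Measure.prod_mono (Measure.restrict_mono (Ioc_subset_Ioc_right h) le_rfl) le_rfl

theorem memLp_stm_of_memL2L2 (h : ∀ T > 0, MemL2L2 Ω T f)
    (hfg : ∀ᵐ z ∂vol (spaceTime Ω)ˢ, f z = g z) (T : ℝ) :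
    MemLp g 2 (stm Ωˢ T) := by
  have h1 := h (max T 1) (by positivity)
  rw [MemL2L2, ← stm_eq] at h1
  exact (h1.mono_measure (stm_mono _ (le_max_left _ _))).ae_eq (ae_mono (stm_le Ω T) hfg)

theorem memLinftyL2_stm (h : ∀ T > 0, MemLinftyL2 Ω T f) (hg : Measurable g)
    (hfg : ∀ᵐ z ∂vol (spaceTime Ω)ˢ, f z = g z) (T : ℝ) :
    MemLp g 2 (stm Ωˢ T) ∧ ∃ B, ∀ᵐ t ∂vol (Ioc 0 T),
      MemLp (fun x => g (t, x)) 2 (vol Ωˢ) ∧ ∫ x in Ωˢ, g (t, x) ^ 2 ≤ B := by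
  obtain ⟨-, C, hC⟩ := h (max T 1) (by positivity)
  rw [Measure.restrict_congr_set Ioo_ae_eq_Ioc] at hC
  have hC' := ae_mono (Measure.restrict_mono (Ioc_subset_Ioc_right (le_max_left T 1)) le_rfl) hC
  have hb : ∀ᵐ t ∂vol (Ioc 0 T), lpNorm Ω 2 (fun x => g (t, x)) ≤ C := by
    filter_upwards [hC', Measure.ae_ae_of_ae_prod (ae_mono (stm_le Ω T) hfg)] with t h1 h2
    rwa [lpNorm, eLpNorm_congr_ae h2] at h1
  constructor
  · refine ⟨hg.aestronglyMeasurable, ?_⟩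
    rw [eLpNorm_lt_top_iff_lintegral_rpow_enorm_lt_top (by simp) (by simp), lintegral_prod _ (by fun_prop)]
    refine lt_of_le_of_lt (lintegral_mono_ae (g := fun _ => (C : ℝ≥0∞) ^ 2) ?_) ?_
    · filter_upwards [hb] with t ht
      rw [lpNorm, eLpNorm_eq_lintegral_rpow_enorm_toReal (by simp) (by simp)] at ht
      have := pow_le_pow_left₀ zero_le ht 2
      rw [ENNReal.toReal_ofNat, rpow_half_sq] at this
      simpa using this
    · rw [lintegral_const]
      exact ENNReal.mul_lt_top (by simp) (by simp)
  · refine ⟨C ^ 2, hb.mono fun t ht => ?_⟩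
    have hm : MemLp (fun x => g (t, x)) 2 (vol Ωˢ) := ⟨aesm, ht.trans_lt (by simp)⟩
    refine ⟨hm, ?_⟩
    have := pow_le_pow_left₀ zero_le ht 2
    rw [lpNorm, eLpNorm_two_sq hm] at this
    rw [← ENNReal.ofReal_le_ofReal_iff (by positivity)]
    refine this.trans (le_of_eq ?_)
    rw [ENNReal.ofReal_pow (by positivity), ENNReal.ofReal_coe_nnreal]

theorem ae_isPrim_x (hS : IsLine Ωˢ) (hf : Continuous f) (hg : BoxInt Ω g)
    (h : ∀ φ : 𝓓(spaceTime Ω, ℝ), ∫ z in (spaceTime Ω)ˢ, f z * fderiv ℝ φ z (0, 1) =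
      - ∫ z in (spaceTime Ω)ˢ, g z * φ z) :
    ∀ᵐ t ∂vol₊, IsPrim (closure Ωˢ) (fun x => f (t, x)) (fun x => g (t, x)) := by
  filter_upwards [ae_hasWeakDeriv_x (.of_continuous _ hf) hg fun α η => h _,
    ae_slice_bdPart (A := timeAxis) hg] with t h1 h2
  exact h1.isPrim hS (by fun_prop) (intervalIntegrable_of_bdPart hS h2)

theorem ae_isPrim_t (hf : Continuous f) (hg : BoxInt Ω g)
    (h : ∀ φ : 𝓓(spaceTime Ω, ℝ), ∫ z in (spaceTime Ω)ˢ, f z * fderiv ℝ φ z (1, 0) =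
      - ∫ z in (spaceTime Ω)ˢ, g z * φ z) :
    ∀ᵐ x ∂vol Ωˢ, IsPrim (Ici 0) (fun t => f (t, x)) (fun t => g (t, x)) := by
  filter_upwards [ae_hasWeakDeriv_t (.of_continuous _ hf) hg fun α η => h _,
    ae_slice_bdPart (B := timeAxis) (f := fun z => g z.swap) fun n => integrableOn_swap (hg n)] with x h1 h2
  have := h1.isPrim isLine_timeAxis (by fun_prop) (intervalIntegrable_of_bdPart isLine_timeAxis h2)
  rwa [closure_timeAxis] at this

theorem ae_isPrim_xx (hS : IsLine Ωˢ) (hf : Continuous f) {k : ℝ × ℝ → ℝ} (mg : Measurable g)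
    (mk : Measurable k) (hg : BoxInt Ω g) (hk : BoxInt Ω k)
    (h : ∀ φ : 𝓓(spaceTime Ω, ℝ), ∫ z in (spaceTime Ω)ˢ, f z * fderiv ℝ φ z (0, 1) =
      - ∫ z in (spaceTime Ω)ˢ, g z * φ z)
    (h' : ∀ φ : 𝓓(spaceTime Ω, ℝ), ∫ z in (spaceTime Ω)ˢ, g z * fderiv ℝ φ z (0, 1) =
      - ∫ z in (spaceTime Ω)ˢ, k z * φ z) :
    (∀ᵐ t ∂vol₊, IsPrim (closure Ωˢ) (fun x => f (t, x)) (fun x => derivOfSecond f k (t, x)) ∧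
      IsPrim (closure Ωˢ) (fun x => derivOfSecond f k (t, x)) (fun x => k (t, x))) ∧
    ∀ᵐ z ∂vol (spaceTime Ω)ˢ, g z = derivOfSecond f k z := by
  have hoc := hS.ordConnected_closure
  have key : ∀ᵐ t ∂vol₊, (IsPrim (closure Ωˢ) (fun x => f (t, x)) (fun x => derivOfSecond f k (t, x)) ∧
      IsPrim (closure Ωˢ) (fun x => derivOfSecond f k (t, x)) (fun x => k (t, x))) ∧
      ∀ᵐ x ∂vol Ωˢ, g (t, x) = derivOfSecond f k (t, x) := by
    filter_upwards [ae_isPrim_x hS hf hg h, ae_hasWeakDeriv_x hg hk fun α η => h' _,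
      ae_slice_bdPart (A := timeAxis) hk] with t h1 h2 h3
    obtain ⟨W, hW, hae⟩ := h2.exists_ae_eq hS (intervalIntegrable_of_bdPart hS h3)
    have h4 : IsPrim (closure Ωˢ) (fun x => f (t, x)) W := h1.congr_right (by rwa [hS.restrict_closure])
    have e : ∀ x ∈ closure Ωˢ, W x = derivOfSecond f k (t, x) := fun x hx => h4.eq_of_second hS hW hx
    have hae' : ∀ᵐ x ∂vol Ωˢ, W x = derivOfSecond f k (t, x) := by
      filter_upwards [ae_restrict_mem hS.measurableSet] with x hx using e x (subset_closure hx)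
    refine ⟨⟨h4.congr_right (by rwa [hS.restrict_closure]), hW.congr_left e⟩, ?_⟩
    filter_upwards [hae, hae'] with x h5 h6 using h5.trans h6
  refine ⟨key.mono fun t ht => ht.1, ?_⟩
  rw [ae_spaceTime_iff, Measure.ae_prod_iff_ae_ae
    (measurableSet_eq_fun mg (measurable_derivOfSecond hf.measurable mk))]
  exact key.mono fun t ht => ht.2

/-- The derivatives of a component of a solution, realized pointwise. -/
theorem exists_component (hS : IsLine Ωˢ) (hf : Continuous f) {fx fxx ft : ℝ × ℝ → ℝ}
    (wx : HasWeakDerivX Ω f fx) (wxx : HasWeakDerivX Ω fx fxx) (wt : HasWeakDerivT Ω f ft)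
    (rx : ∀ T > 0, MemLinftyL2 Ω T fx) (rxx : ∀ T > 0, MemL2L2 Ω T fxx) (rt : ∀ T > 0, MemL2L2 Ω T ft) :
    ∃ Fx Fxx Ft : ℝ × ℝ → ℝ, Measurable Fx ∧ Measurable Fxx ∧ Measurable Ft ∧
      (∀ᵐ z ∂vol (spaceTime Ω)ˢ, fx z = Fx z ∧ ft z = Ft z) ∧
      (∀ T, MemLp Fx 2 (stm Ωˢ T) ∧ ∃ B, ∀ᵐ t ∂vol (Ioc 0 T), MemLp (fun x => Fx (t, x)) 2 (vol Ωˢ) ∧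
          ∫ x in Ωˢ, Fx (t, x) ^ 2 ≤ B) ∧
      (∀ T, MemLp Fxx 2 (stm Ωˢ T)) ∧ (∀ T, MemLp Ft 2 (stm Ωˢ T)) ∧
      (∀ᵐ t ∂vol₊, IsPrim (closure Ωˢ) (fun x => f (t, x))
        (fun x => Fx (t, x)) ∧ IsPrim (closure Ωˢ) (fun x => Fx (t, x)) (fun x => Fxx (t, x))) ∧
      ∀ᵐ x ∂vol Ωˢ, IsPrim (Ici 0) (fun t => f (t, x)) (fun t => Ft (t, x)) := by
  obtain ⟨gx, mgx, hgx⟩ := exists_measurable_ae_eq wx.2.1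
  obtain ⟨Fxx, mFxx, hFxx⟩ := exists_measurable_ae_eq wxx.2.1
  obtain ⟨Ft, mFt, hFt⟩ := exists_measurable_ae_eq wt.2.1
  have lFxx := memLp_stm_of_memL2L2 rxx hFxx
  have lFt := memLp_stm_of_memL2L2 rt hFt
  have congr : ∀ {p q : ℝ × ℝ → ℝ} (w : ℝ × ℝ → ℝ), (∀ᵐ z ∂vol (spaceTime Ω)ˢ, p z = q z) →
      ∫ z in (spaceTime Ω)ˢ, p z * w z = ∫ z in (spaceTime Ω)ˢ, q z * w z :=
    fun w h => integral_congr_ae (h.mono fun z hz => by simp only [hz])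
  obtain ⟨h1, h2⟩ := ae_isPrim_xx hS hf mgx mFxx (.of_memLp fun T => (memLinftyL2_stm rx mgx hgx T).1)
    (.of_memLp lFxx) (fun φ => by rw [wx.2.2 φ, congr φ hgx])
    (fun φ => by rw [← congr _ hgx, wxx.2.2 φ, congr φ hFxx])
  have mFx := measurable_derivOfSecond hf.measurable mFxx
  have hFx : ∀ᵐ z ∂vol (spaceTime Ω)ˢ, fx z = derivOfSecond f Fxx z := by
    filter_upwards [hgx, h2] with z e1 e2 using e1.trans e2
  refine ⟨derivOfSecond f Fxx, Fxx, Ft, mFx, mFxx, mFt, ?_, memLinftyL2_stm rx mFx hFx, lFxx, lFt, h1,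
    ae_isPrim_t hf (.of_memLp lFt) fun φ => by rw [wt.2.2 φ, congr φ hFt]⟩
  filter_upwards [hFx, hFt] with z e1 e2 using ⟨e1, e2⟩

end

/-! ### Bounds on finite time intervals -/

theorem sq_integral_abs_le {ρ : Measure ℝ} [IsFiniteMeasure ρ] {g : ℝ → ℝ} (hg : MemLp g 2 ρ) :
    (∫ x, |g x| ∂ρ) ^ 2 ≤ ρ.real univ * ∫ x, g x ^ 2 ∂ρ := by
  have h1 : Integrable (fun x => |g x|) ρ := (hg.integrable (by norm_num)).abs
  have hl : ∀ l : ℝ, 2 * l * (∫ x, |g x| ∂ρ) ≤ (∫ x, g x ^ 2 ∂ρ) + l ^ 2 * ρ.real univ := fun l => by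
    have e : l ^ 2 * ρ.real univ = ∫ _, l ^ 2 ∂ρ := by simp [mul_comm]
    rw [← integral_const_mul, e, ← integral_add hg.integrable_sq (integrable_const _)]
    refine integral_mono (h1.const_mul _) (hg.integrable_sq.add (integrable_const _)) fun x => ?_
    beta_reduce
    nlinarith [sq_nonneg (|g x| - l), sq_abs (g x)]
  rcases eq_or_lt_of_le (measureReal_nonneg (μ := ρ) (s := univ)) with hm | hm
  · have : ρ = 0 := by
      rw [← Measure.measure_univ_eq_zero]
      exact (measureReal_eq_zero_iff (by simp)).1 hm.symm
    simp [this]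
  · have := hl ((∫ x, |g x| ∂ρ) / ρ.real univ)
    have e : ((∫ x, |g x| ∂ρ) / ρ.real univ) ^ 2 * ρ.real univ = (∫ x, |g x| ∂ρ) ^ 2 / ρ.real univ := by field_simp
    rw [e] at this
    have h2 : (∫ x, |g x| ∂ρ) ^ 2 / ρ.real univ ≤ ∫ x, g x ^ 2 ∂ρ := by
      have e2 : 2 * ((∫ x, |g x| ∂ρ) / ρ.real univ) * (∫ x, |g x| ∂ρ) =
        2 * ((∫ x, |g x| ∂ρ) ^ 2 / ρ.real univ) := by ring
      linarith
    rwa [div_le_iff₀ hm, mul_comm] at h2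

section Majorant

variable {S : Set ℝ} {f ft : ℝ × ℝ → ℝ} {c : ℝ}

/-- A majorant of `f(t) - c`, uniform in `t ≤ T`. -/
theorem exists_majorant (mft : Measurable ft)
    (tf : ∀ᵐ x ∂vol S, IsPrim (Ici 0) (fun t => f (t, x)) (fun t => ft (t, x)))
    (lft : ∀ T, MemLp ft 2 (stm S T)) (h0 : MemLp (fun x => f (0, x) - c) 2 (vol S)) (T : ℝ) :
    ∃ k, MemLp k 2 (vol S) ∧ ∀ᵐ x ∂vol S, ∀ t ∈ Icc 0 T, |f (t, x) - c| ≤ k x := by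
  have hsw := (lft T).integrable_sq.swap
  have hL : MemLp (fun x => ∫ t in Ioc 0 T, |ft (t, x)|) 2 (vol S) := by
    have hm : AEStronglyMeasurable (fun x => ∫ t in Ioc 0 T, |ft (t, x)|) (vol S) :=
      (StronglyMeasurable.integral_prod_right (f := fun x t => |ft (t, x)|)
        (Measurable.stronglyMeasurable (by fun_prop))).aestronglyMeasurable
    rw [memLp_two_iff_integrable_sq hm]
    refine Integrable.mono' (hsw.integral_prod_left.const_mul ((vol (Ioc 0 T)).real univ)) (hm.pow 2) ?_
    filter_upwards [hsw.prod_right_ae] with x hx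
    rw [Real.norm_of_nonneg (sq_nonneg _)]
    exact sq_integral_abs_le ((memLp_two_iff_integrable_sq aesm).2 hx)
  refine ⟨_, h0.abs.add hL, ?_⟩
  filter_upwards [tf] with x hx t ht
  have hT := ht.1.trans ht.2
  have h1 := hx.sub_eq (mem_Ici.2 le_rfl) (mem_Ici.2 ht.1)
  have h2 : |∫ τ in 0..t, ft (τ, x)| ≤ ∫ τ in Ioc 0 T, |ft (τ, x)| := by
    rw [integral_of_le ht.1]
    refine abs_integral_le_integral_abs.trans ?_
    have hi := (intervalIntegrable_iff_Ioc hT).1 (hx.intervalIntegrable (mem_Ici.2 le_rfl) (mem_Ici.2 hT))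
    exact setIntegral_mono_set hi.abs (.of_forall fun y => abs_nonneg _) (Ioc_subset_Ioc_right ht.2).eventuallyLE
  have e : f (t, x) - c = (f (0, x) - c) + ∫ τ in 0..t, ft (τ, x) := by linarith
  rw [e]
  exact (abs_add_le _ _).trans (add_le_add le_rfl h2)

theorem memLp_of_majorant (mf : Measurable f) (hk : ∀ T, ∃ k, MemLp k 2 (vol S) ∧
      ∀ᵐ x ∂vol S, ∀ t ∈ Icc 0 T, |f (t, x) - c| ≤ k x) :
    (∀ t ≥ 0, MemLp (fun x => f (t, x) - c) 2 (vol S)) ∧ ∀ T, MemLp (fun z => f z - c) 2 (stm S T) := by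
  constructor
  · intro t ht
    obtain ⟨k, lk, h⟩ := hk t
    refine lk.of_le aesm ?_
    filter_upwards [h] with x hx
    exact (hx t ⟨ht, le_rfl⟩).trans (le_abs_self _)
  · intro T
    obtain ⟨k, lk, h⟩ := hk T
    refine (memLp_snd lk T).of_le aesm ?_
    have h1 : ∀ᵐ z ∂stm S T, ∀ t ∈ Icc 0 T, |f (t, z.2) - c| ≤ k z.2 := Measure.quasiMeasurePreserving_snd.ae h
    have h2 : ∀ᵐ z ∂stm S T, z.1 ∈ Ioc 0 T := Measure.quasiMeasurePreserving_fst.ae ae_mem_Ioc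
    filter_upwards [h1, h2] with z hz hz'
    exact (hz z.1 ⟨hz'.1.le, hz'.2⟩).trans (le_abs_self _)

end Majorant

theorem IsPrim.sq_le_local {S : Set ℝ} (hS : IsLine S) {f f' k : ℝ → ℝ} (h : IsPrim (closure S) f f')
    (hf' : MemLp f' 2 (vol S)) {B : ℝ} (hB : ∫ x in S, f' x ^ 2 ≤ B)
    (hk : MemLp k 2 (vol S)) (hfk : ∀ᵐ x ∂vol S, |f x| ≤ k x) {x δ : ℝ}
    (hx : x ∈ closure S) (hδ : 0 < δ) :
    f x ^ 2 ≤ 2 / δ * (∫ y in Ioc x (x + δ), k y ^ 2) + 2 * δ * B := by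
  have hoc := hS.ordConnected_closure
  have hxδ : x ≤ x + δ := by linarith
  have hsub : Ioc x (x + δ) ⊆ S := fun y hy => hS.Ioi_subset hx hy.1
  have hx' : x + δ ∈ closure S := hS.mem_of_le hx hxδ
  have hi : IntegrableOn (fun y => k y ^ 2) (Ioc x (x + δ)) := hk.integrable_sq.mono_measure
    (Measure.restrict_mono hsub le_rfl)
  have hv : volume.real (Ioc x (x + δ)) = δ := by rw [Real.volume_real_Ioc_of_le hxδ]; ring
  have hcs : (∫ y in x..x + δ, |f' y|) ^ 2 ≤ δ * B := by
    rw [integral_of_le hxδ]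
    refine (sq_integral_abs_le (hf'.mono_measure (Measure.restrict_mono hsub le_rfl))).trans ?_
    rw [measureReal_restrict_apply_univ, hv]
    refine mul_le_left (le_trans ?_ hB) hδ.le
    exact setIntegral_mono_set hf'.integrable_sq (.of_forall fun y => sq_nonneg _) hsub.eventuallyLE
  have hpt : ∀ᵐ y ∂vol (Ioc x (x + δ)), f x ^ 2 ≤ 2 * k y ^ 2 + 2 * (δ * B) := by
    filter_upwards [ae_mono_set hsub hfk, ae_mem_Ioc] with y h1 h2
    have h3 := h.abs_sub_le hx hx' (a := x) (b := y) ⟨le_rfl, hxδ⟩ ⟨h2.1.le, h2.2⟩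
    have h4 : (f y - f x) ^ 2 ≤ δ * B := by rw [← sq_abs]; exact (pow_le_pow_left₀ (abs_nonneg _) h3 2).trans hcs
    have h5 : f y ^ 2 ≤ k y ^ 2 := by rw [← sq_abs]; exact pow_le_pow_left₀ (abs_nonneg _) h1 2
    nlinarith [sq_nonneg (2 * f y - f x)]
  have h6 := integral_mono_ae (integrable_const _) ((hi.const_mul 2).add (integrable_const (2 * (δ * B)))) hpt
  rw [integral_const, measureReal_restrict_apply_univ, hv, smul_eq_mul] at h6
  have h7 := integral_add (hi.const_mul 2) (integrable_const (2 * (δ * B)) (μ := vol (Ioc x (x + δ))))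
  rw [integral_const_mul, integral_const, measureReal_restrict_apply_univ, hv, smul_eq_mul] at h7
  simp only [Pi.add_apply] at h6
  rw [h7] at h6
  have h8 : δ * f x ^ 2 ≤ δ * (2 / δ * (∫ y in Ioc x (x + δ), k y ^ 2) + 2 * δ * B) := by
    refine h6.trans (le_of_eq ?_); field_simp
  exact le_of_mul_le_mul_left h8 hδ

theorem exists_tail_le {S : Set ℝ} {k : ℝ → ℝ} (hk : MemLp k 2 (vol S))
    {ε : ℝ} (hε : 0 < ε) : ∃ n : ℕ, ∫ y in S, {y : ℝ | (n:ℝ) ≤ |y|}.indicator (fun y => k y ^ 2) y ≤ ε := by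
  have hm : ∀ n : ℕ, MeasurableSet {y : ℝ | (n:ℝ) ≤ |y|} := fun n =>
    measurableSet_le measurable_const (by fun_prop)
  have := tendsto_integral_of_dominated_convergence (μ := vol S)
    (F := fun (n : ℕ) y => {y : ℝ | (n:ℝ) ≤ |y|}.indicator (fun y => k y ^ 2) y) (f := fun _ => 0)
    (fun y => k y ^ 2) (fun n => hk.integrable_sq.aestronglyMeasurable.indicator (hm n)) hk.integrable_sq
    (fun n => .of_forall fun y => by
      rw [Real.norm_of_nonneg (indicator_nonneg (fun y _ => sq_nonneg _) y)]
      exact indicator_le_self' (fun y _ => sq_nonneg _) y)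
    (.of_forall fun y => by
      obtain ⟨m, hm⟩ := exists_nat_gt |y|
      refine tendsto_const_nhds.congr' ?_
      filter_upwards [eventually_ge_atTop m] with n hn
      rw [indicator_of_notMem]
      have : (m:ℝ) ≤ n := by exact_mod_cast hn
      simpa using hm.trans_le this)
  rw [integral_zero] at this
  exact (this.eventually (Iic_mem_nhds hε)).exists

theorem exists_bound {S : Set ℝ} (hS : IsLine S) {f fx : ℝ × ℝ → ℝ} {c T B : ℝ} (hT : 0 < T)
    (cf : Continuous f) (hk : ∃ k, MemLp k 2 (vol S) ∧ ∀ᵐ x ∂vol S, ∀ t ∈ Icc 0 T, |f (t, x) - c| ≤ k x)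
    (h : ∀ᵐ t ∂vol (Ioc 0 T), IsPrim (closure S) (fun x => f (t, x)) (fun x => fx (t, x)) ∧
      MemLp (fun x => fx (t, x)) 2 (vol S) ∧ ∫ x in S, fx (t, x) ^ 2 ≤ B) :
    ∃ C X, ∀ t ∈ Icc 0 T, ∀ x ∈ closure S, |f (t, x) - c| ≤ C ∧ (X ≤ |x| → |f (t, x) - c| ≤ 1 / 2) := by
  obtain ⟨k, lk, hk⟩ := hk
  have hloc : ∀ δ > 0, ∀ t ∈ Icc 0 T, ∀ x ∈ closure S,
      (f (t, x) - c) ^ 2 ≤ 2 / δ * (∫ y in Ioc x (x + δ), k y ^ 2) + 2 * δ * B := fun δ hδ t ht x hx => by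
    refine le_on_Icc_of_ae (f := fun t => (f (t, x) - c) ^ 2) (by fun_prop) continuous_const hT ?_ t ht
    filter_upwards [ae_mono_set Ioo_subset_Ioc_self h, ae_restrict_mem measurableSet_Ioo] with τ h1 h2
    exact (h1.1.sub_const c).sq_le_local hS h1.2.1 h1.2.2 lk
      (hk.mono fun x hx => hx τ (Ioo_subset_Icc_self h2)) hx hδ
  have hsub : ∀ {x δ : ℝ}, x ∈ closure S → Ioc x (x + δ) ⊆ S := fun hx y hy => hS.Ioi_subset hx hy.1
  set δ := 1 / (16 * (|B| + 1))
  have hδ : 0 < δ := by positivity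
  have hδ1 : δ ≤ 1 := by rw [div_le_one (by positivity)]; linarith [abs_nonneg B]
  have hδB : 2 * δ * B ≤ 1 / 8 := by
    have : δ * B ≤ δ * (|B| + 1) := by have := le_abs_self B; gcongr; linarith
    have e : δ * (|B| + 1) = 1 / 16 := by simp only [δ]; field_simp
    linarith
  obtain ⟨n, hn⟩ := exists_tail_le lk (ε := δ / 16) (by positivity)
  refine ⟨√(2 / δ * (∫ y in S, k y ^ 2) + 2 * δ * B), n + 1, fun t ht x hx => ⟨Real.abs_le_sqrt
    ((hloc δ hδ t ht x hx).trans ?_), fun hX => abs_le_of_sq_le_sq ((hloc δ hδ t ht x hx).trans ?_) (by norm_num)⟩⟩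
  · have := setIntegral_mono_set lk.integrable_sq (.of_forall fun y => sq_nonneg _) (hsub (δ := δ) hx).eventuallyLE
    gcongr
  · have : ∫ y in Ioc x (x + δ), k y ^ 2 ≤ δ / 16 := by
      refine le_trans (le_trans (le_of_eq ?_) (setIntegral_mono_set
        (lk.integrable_sq.indicator (measurableSet_le measurable_const (by fun_prop)))
        (.of_forall fun y => indicator_nonneg (fun y _ => sq_nonneg _) y)
        (hsub (δ := δ) hx).eventuallyLE)) hn
      refine setIntegral_congr_fun measurableSet_Ioc fun y hy => ?_
      rw [indicator_of_mem]
      have h1 : |x| ≤ |y| + |y - x| := by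
        have := abs_sub_abs_le_abs_sub x y
        rw [abs_sub_comm] at this; linarith
      have h2 : |y - x| ≤ 1 := by rw [abs_of_nonneg (by linarith [hy.1])]; linarith [hy.2]
      simp only [mem_ofPred_eq]
      linarith
    have h2 : 2 / δ * (∫ y in Ioc x (x + δ), k y ^ 2) ≤ 2 / δ * (δ / 16) := by gcongr
    have e : 2 / δ * (δ / 16) = 1 / 8 := by field_simp; norm_num
    linarith

theorem exists_pos_le {S : Set ℝ} {f : ℝ × ℝ → ℝ} {T C X : ℝ} (hT : 0 ≤ T) (cf : Continuous f)
    (hpos : ∀ z, 0 < f z) (h : ∀ t ∈ Icc 0 T, ∀ x ∈ closure S,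
      |f (t, x) - 1| ≤ C ∧ (X ≤ |x| → |f (t, x) - 1| ≤ 1 / 2)) :
    ∃ c > 0, ∀ t ∈ Icc 0 T, ∀ x ∈ closure S, c ≤ f (t, x) := by
  obtain ⟨z, -, hz⟩ := (isCompact_Icc.prod isCompact_Icc : IsCompact (Icc (0:ℝ) T ×ˢ
    Icc (-|X|) |X|)).exists_isMinOn ⟨(0, 0), ⟨le_rfl, hT⟩, by simp⟩ cf.continuousOn
  refine ⟨min (f z) (1 / 2), lt_min (hpos z) (by norm_num), fun t ht x hx => ?_⟩
  rcases le_or_gt X |x| with h1 | h1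
  · have := (abs_le.1 ((h t ht x hx).2 h1)).1
    exact (min_le_right _ _).trans (by linarith)
  · exact (min_le_left _ _).trans (hz ⟨ht, abs_le.1 (h1.le.trans (le_abs_self X))⟩)

/-! ### From generalized solutions to pointwise derivatives -/

section

variable {Ω : Opens ℝ}

theorem intervalIntegrable_of_memLp {S : Set ℝ} (hS : IsLine S) {g : ℝ → ℝ}
    (lg : MemLp g 2 (vol S)) :
    ∀ a ∈ closure S, ∀ b ∈ closure S, IntervalIntegrable g volume a b :=
  intervalIntegrable_of_bdPart hS fun n => by
    have : IsFiniteMeasure (vol (bdPart S n)) := ⟨by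
      rw [Measure.restrict_apply_univ]
      exact (measure_mono inter_subset_right).trans_lt isCompact_Icc.measure_lt_top⟩
    have h1 : bdPart S n ⊆ S := inter_subset_left
    exact (lg.mono_measure (Measure.restrict_mono h1 le_rfl)).integrable (by norm_num)

theorem exists_init (hS : IsLine Ωˢ) {f : ℝ → ℝ} (cf : ContinuousOn f (closure Ωˢ))
    (h : MemH1 Ω f) : ∃ g, Measurable g ∧ IsPrim (closure Ωˢ) f g ∧ MemLp g 2 (vol Ωˢ) ∧ h1Norm Ω f ^ 2 =
        ENNReal.ofReal ((∫ x in Ωˢ, f x ^ 2) + ∫ x in Ωˢ, g x ^ 2) := by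
  obtain ⟨lf, g₀, w, lg₀⟩ := h
  have hoc := hS.ordConnected_closure
  have hae := lg₀.1.ae_eq_mk
  have hp : IsPrim (closure Ωˢ) f (lg₀.1.mk g₀) :=
    (w.isPrim hS cf (intervalIntegrable_of_memLp hS lg₀)).congr_right (by rw [hS.restrict_closure]; exact hae)
  have lg : MemLp (lg₀.1.mk g₀) 2 (vol Ωˢ) := lg₀.ae_eq hae
  refine ⟨_, lg₀.1.stronglyMeasurable_mk.measurable, hp, lg, ?_⟩
  have hd : derivL2Norm Ω f = lpNorm Ω 2 (lg₀.1.mk g₀) := le_antisymm (derivL2Norm_le hS hp)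
    (le_iInf₂ fun g' h' => (eLpNorm_congr_ae ((hp.hasWeakDeriv hS).ae_eq h' (.of_forall fun _ => rfl))).le)
  rw [h1Norm, rpow_half_sq, hd, lpNorm, lpNorm, eLpNorm_two_sq lf, eLpNorm_two_sq lg,
    ENNReal.ofReal_add (integral_nonneg fun x => sq_nonneg _) (integral_nonneg fun x => sq_nonneg _)]

theorem HasWeakDeriv.congr {e : ℝ × ℝ} {f f' g : ℝ × ℝ → ℝ} (h : HasWeakDeriv (spaceTime Ω) e f g)
    (hf : ∀ z ∈ (spaceTime Ω)ˢ, f z = f' z) : HasWeakDeriv (spaceTime Ω) e f' g := by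
  have hm := (spaceTime Ω).isOpen.measurableSet
  refine ⟨h.1.congr ?_, h.2.1, fun φ => ?_⟩
  · filter_upwards [ae_restrict_mem hm] with z hz using hf z hz
  · rw [← h.2.2 φ]
    exact setIntegral_congr_fun hm fun z hz => by simp only [hf z hz]

/-- The derivative of the specific volume. -/
theorem exists_vx (hS : IsLine Ωˢ) {v ux uxx : ℝ × ℝ → ℝ} {v0x : ℝ → ℝ} (cv : Continuous v)
    (muxx : Measurable uxx) (mv0x : Measurable v0x)
    (luxx : ∀ T, MemLp uxx 2 (stm Ωˢ T)) (lv0x : MemLp v0x 2 (vol Ωˢ))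
    (xux : ∀ᵐ t ∂vol₊, IsPrim (closure Ωˢ) (fun x => ux (t, x)) (fun x => uxx (t, x)))
    (tv : ∀ᵐ x ∂vol Ωˢ, IsPrim (Ici 0) (fun t => v (t, x)) (fun t => ux (t, x)))
    (xv0 : IsPrim (closure Ωˢ) (fun x => v (0, x)) v0x) :
    ∃ vx : ℝ × ℝ → ℝ, Measurable vx ∧ (∀ x, vx (0, x) = v0x x) ∧ (∀ t ≥ 0, MemLp (fun x => vx (t, x)) 2 (vol Ωˢ)) ∧
      (∀ T, MemLp vx 2 (stm Ωˢ T)) ∧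
      (∀ T, ∃ B, ∀ t ∈ Icc 0 T, ∫ x in Ωˢ, vx (t, x) ^ 2 ≤ B) ∧
      (∀ᵐ x ∂vol Ωˢ, IsPrim (Ici 0) (fun t => vx (t, x)) (fun t => uxx (t, x))) ∧
      ∀ t ≥ 0, IsPrim (closure Ωˢ) (fun x => v (t, x)) (fun x => vx (t, x)) := by
  let vx : ℝ × ℝ → ℝ := fun z => v0x z.2 + ∫ τ, (Ioc 0 z.1).indicator (fun τ => uxx (τ, z.2)) τ
  have hvx : ∀ {t : ℝ}, 0 ≤ t → ∀ x, vx (t, x) = v0x x + ∫ τ in 0..t, uxx (τ, x) := fun ht x => by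
    simp only [vx]
    rw [integral_indicator measurableSet_Ioc, integral_of_le ht]
  have mvx : Measurable vx := by
    refine (mv0x.comp measurable_snd).add (StronglyMeasurable.integral_prod_right
      (f := fun (z : ℝ × ℝ) τ => (Ioc 0 z.1).indicator (fun τ => uxx (τ, z.2)) τ)
      (Measurable.stronglyMeasurable ?_)).measurable
    have : MeasurableSet {w : (ℝ × ℝ) × ℝ | w.2 ∈ Ioc 0 w.1.1} :=
      (measurableSet_lt measurable_const measurable_snd).inter (measurableSet_le measurable_snd (by fun_prop))
    exact (by fun_prop : Measurable fun w : (ℝ × ℝ) × ℝ => uxx (w.2, w.1.2)).indicator this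
  have hv0 : ∀ x, vx (0, x) = v0x x := fun x => by simp [hvx le_rfl]
  have tvx : ∀ᵐ x ∂vol Ωˢ, IsPrim (Ici 0) (fun t => vx (t, x)) (fun t => uxx (t, x)) := by
    filter_upwards [ae_slice_bdPart (B := timeAxis) (f := fun z => uxx z.swap)
      fun n => integrableOn_swap (BoxInt.of_memLp luxx n)] with x hx
    have := intervalIntegrable_of_bdPart isLine_timeAxis hx
    rw [closure_timeAxis] at this
    refine ((isPrim_integral (mem_Ici.2 le_rfl) this).add_const (v0x x)).congr_left fun t ht => ?_
    rw [hvx ht, add_comm]; rfl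
  have hk : ∀ T, ∃ k, MemLp k 2 (vol Ωˢ) ∧ ∀ᵐ x ∂vol Ωˢ, ∀ t ∈ Icc 0 T, |vx (t, x) - 0| ≤ k x :=
    exists_majorant muxx tvx luxx (by simpa only [hv0, sub_zero])
  obtain ⟨svx, lvx⟩ := memLp_of_majorant mvx hk
  simp only [sub_zero] at svx lvx hk
  refine ⟨vx, mvx, hv0, svx, lvx, fun T => ?_, tvx, fun t ht => ?_⟩
  · obtain ⟨k, lk, hk⟩ := hk T
    refine ⟨_, fun t ht => integral_mono_ae (svx t ht.1).integrable_sq lk.integrable_sq (hk.mono fun x hx => ?_)⟩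
    simp only
    rw [← sq_abs]
    exact pow_le_pow_left₀ (abs_nonneg _) (hx t ht) 2
  · have key : ∀ {a b}, a ∈ Ωˢ → a ≤ b → b ∈ Ωˢ → IsPrim (Ici 0) (fun t => v (t, a)) (fun t => ux (t, a)) →
        IsPrim (Ici 0) (fun t => v (t, b)) (fun t => ux (t, b)) →
        v (t, b) - v (t, a) = ∫ x in a..b, vx (t, x) := fun {a b} ha hab hb h1 h2 => by
      have ha' := subset_closure ha
      have hb' := subset_closure hb
      have hsub : Ioc a b ⊆ Ωˢ := fun y hy => hS.Ioi_subset ha' hy.1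
      have hfub := integral_time_eq (ν := vol (Ioc a b)) (T := t)
        (ae_mono_set hsub tvx) ht
        (((luxx t).mono_measure (Measure.prod_mono le_rfl (Measure.restrict_mono hsub le_rfl))).integrable
          (by norm_num)) (by
          simp only [hv0]
          exact (lv0x.mono_measure (Measure.restrict_mono hsub le_rfl)).integrable (by norm_num))
      have e1 := h1.sub_eq (mem_Ici.2 le_rfl) (mem_Ici.2 ht)
      have e2 := h2.sub_eq (mem_Ici.2 le_rfl) (mem_Ici.2 ht)
      have e3 := xv0.sub_eq ha' hb'
      have e4 : ∫ τ in 0..t, ∫ x in Ioc a b, uxx (τ, x) = (∫ τ in 0..t, ux (τ, b)) - ∫ τ in 0..t, ux (τ, a) := by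
        rw [← interval_sub (h2.intervalIntegrable (mem_Ici.2 le_rfl) (mem_Ici.2 ht))
          (h1.intervalIntegrable (mem_Ici.2 le_rfl) (mem_Ici.2 ht)), integral_of_le ht,
          integral_of_le ht]
        refine integral_congr_ae ((Sol.ae_Ioc xux t).mono fun τ hτ => ?_)
        simp only
        rw [hτ.sub_eq ha' hb', integral_of_le hab]
      rw [integral_of_le hab, hfub.2, e4]
      simp only [hv0]
      rw [integral_of_le hab] at e3
      linarith
    have hne : (ae (vol Ωˢ)).NeBot := by
      rw [ae_neBot, Ne, Measure.restrict_eq_zero]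
      exact (hS.isOpen.measure_pos volume ⟨1, hS.one_mem⟩).ne'
    obtain ⟨a, ha, ha'⟩ := (tv.and (ae_restrict_mem hS.measurableSet)).exists
    have hF := (isPrim_integral (subset_closure ha') (intervalIntegrable_of_memLp hS (svx t ht))).add_const (v (t, a))
    refine hF.congr_left (eqOn_closure_of_ae hS (hF.continuousOn_closure hS) (by fun_prop) ?_)
    filter_upwards [tv, ae_restrict_mem hS.measurableSet] with b hb hb'
    rcases le_total a b with hab | hab
    · rw [← key ha' hab hb' ha hb]; ring
    · rw [intervalIntegral.integral_symm, ← key hb' hab ha' hb ha]; ring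

end

/-- The trace of a weak derivative. -/
theorem eq_zero_of_trace {f g g' : ℝ → ℝ} (h : IsPrim (Ici 0) f g) (cg : ContinuousOn g (Ici 0))
    {F : ℝ → ℝ} (hF : ∀ x > 0, F x = f x) (h' : HasWeakDeriv timeAxis 1 F g')
    (hg' : Tendsto g' (𝓝[>] 0) (𝓝 0)) : g 0 = 0 := by
  rw [← closure_timeAxis] at h
  have hae := h'.ae_eq (h.hasWeakDeriv isLine_timeAxis) (by filter_upwards [ae_mem_Ioi] with x hx using hF x hx)
  have hne : (𝓝[>] (0:ℝ) ⊓ ae vol₊).NeBot := by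
    rw [inf_neBot_iff]
    intro s hs s' hs'
    obtain ⟨δ, hδ, hsub⟩ := mem_nhdsGT_iff_exists_Ioo_subset.1 hs
    have hδ : (0:ℝ) < δ := hδ
    have h1 : ∀ᵐ x ∂vol (Ioo 0 δ), x ∈ s' := ae_mono_set Ioo_subset_Ioi_self hs'
    have : (ae (vol (Ioo 0 δ))).NeBot := by
      rw [ae_neBot, Ne, Measure.restrict_eq_zero]
      simp [hδ]
    obtain ⟨x, hx, hx'⟩ := (h1.and (ae_restrict_mem measurableSet_Ioo)).exists
    exact ⟨x, hsub hx', hx⟩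
  have t1 : Tendsto g (𝓝[>] (0:ℝ) ⊓ ae vol₊) (𝓝 (g 0)) :=
    ((cg 0 (mem_Ici.2 le_rfl)).mono_left (nhdsWithin_mono _ Ioi_subset_Ici_self)).mono_left inf_le_left
  have t2 := hg'.mono_left (inf_le_left (b := ae vol₊))
  exact tendsto_nhds_unique t1 (t2.congr' (hae.filter_mono inf_le_right))

theorem Problem.isLine : ∀ P : Problem, IsLine (P.dom : Set ℝ)
  | .cauchy => Or.inl rfl
  | .insulated => Or.inr rfl
  | .isothermal => Or.inr rfl

theorem IsLine.exists_retract {S : Set ℝ} (hS : IsLine S) :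
    ∃ r : ℝ → ℝ, Continuous r ∧ (∀ x, r x ∈ closure S) ∧ ∀ x ∈ closure S, r x = x := by
  rcases hS.closure_eq with ⟨-, h⟩ | ⟨-, h⟩ <;> rw [h]
  · exact ⟨id, continuous_id, fun x => mem_univ _, fun x _ => rfl⟩
  · exact ⟨fun x => max x 0, by fun_prop, fun x => mem_Ici.2 (le_max_right _ _), fun x hx => max_eq_left hx⟩

theorem Problem.boundary (P : Problem) {u θ : ℝ × ℝ → ℝ} (h : P.BoundaryCondition u θ) :
    (P.dom : Set ℝ) = univ ∨ (P.dom : Set ℝ) = Ioi 0 ∧ (∀ t > 0, u (t, 0) = 0) ∧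
      ((∀ t > 0, θ (t, 0) = 1) ∨ ∀ᵐ t ∂vol₊, ∃ g : ℝ → ℝ,
        HasWeakDeriv timeAxis 1 (fun x => θ (t, x)) g ∧ Tendsto g (𝓝[>] 0) (𝓝 0)) := by
  cases P with
  | cauchy => exact Or.inl rfl
  | insulated => exact Or.inr ⟨rfl, h.1, Or.inr h.2⟩
  | isothermal => exact Or.inr ⟨rfl, h.1, Or.inl h.2⟩

theorem sInf_le_closure {S : Set ℝ} {w w₀ : ℝ → ℝ} (hw : Continuous w) (hpos : ∀ x, 0 < w x)
    (h : ∀ x ∈ S, w x = w₀ x) : ∀ x ∈ closure S, sInf (w₀ '' S) ≤ w x := fun x hx => by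
  refine closure_minimal (t := {x | sInf (w₀ '' S) ≤ w x}) (fun y hy => ?_) (isClosed_le continuous_const hw) hx
  have : BddBelow (w₀ '' S) := ⟨0, by rintro _ ⟨z, hz, rfl⟩; rw [← h z hz]; exact (hpos z).le⟩
  simp only [mem_ofPred_eq]
  rw [h y hy]
  exact csInf_le this ⟨y, hy, rfl⟩

theorem eq_const_of_pos {w : ℝ → ℝ} (hw : Continuous w) {c : ℝ} (h : ∀ t > 0, w t = c) :
    ∀ t ≥ 0, w t = c := fun t ht => by
  have : closure (Ioi (0:ℝ)) ⊆ {t | w t = c} :=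
    closure_minimal (fun t ht => h t ht) (isClosed_eq hw continuous_const)
  rw [closure_Ioi] at this
  exact this ht

set_option maxHeartbeats 1000000 in
/-- A generalized solution has pointwise derivatives. -/
theorem exists_sol {μ κ R cv : ℝ} (hμ : 0 < μ) (hκ : 0 < κ) (hR : 0 < R) (hcv : 0 < cv) (P : Problem) {e₀ : ℝ}
    {v₀ u₀ θ₀ : ℝ → ℝ} {v u θ : ℝ × ℝ → ℝ} (hA : AdmissibleData P v₀ u₀ θ₀)
    (hsol : IsGeneralizedSolution P μ κ R cv e₀ v₀ u₀ θ₀ v u θ) :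
    ∃ s : Sol ⟨μ, κ, R, cv, (h1Norm3 P.dom (fun x => v₀ x - 1) u₀ (fun x => θ₀ x - 1)).toReal,
        sInf (v₀ '' (P.dom : Set ℝ)), sInf (θ₀ '' (P.dom : Set ℝ)), hμ, hκ, hR, hcv, hA.inf_v, hA.inf_θ⟩,
      s.S = P.dom ∧ ∀ t ≥ 0, ∀ x ∈ closure (P.dom : Set ℝ),
        s.v (t, x) = v (t, x) ∧ s.u (t, x) = u (t, x) ∧ s.θ (t, x) = θ (t, x) := by
  obtain ⟨D, h⟩ := hsol
  have hS := P.isLine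
  have hoc := hS.ordConnected_closure
  set Ω := P.dom
  obtain ⟨r, cr, hr, hr'⟩ := hS.exists_retract
  let ρ : ℝ × ℝ → ℝ × ℝ := fun z => (max z.1 0, r z.2)
  have cρ : Continuous ρ := by fun_prop
  have mρ : ∀ z, ρ z ∈ Ici (0:ℝ) ×ˢ closure Ωˢ := fun z => ⟨mem_Ici.2 (le_max_right _ _), hr _⟩
  have eρ : ∀ t ≥ 0, ∀ x ∈ closure Ωˢ, ρ (t, x) = (t, x) := fun t ht x hx => by
    simp only [ρ, max_eq_left ht, hr' x hx]
  have eρ' : ∀ z ∈ (spaceTime Ω)ˢ, ρ z = z := fun z hz => eρ z.1 (le_of_lt hz.1) z.2 (subset_closure hz.2)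
  have cV : Continuous (v ∘ ρ) := h.cont_v.comp_continuous cρ mρ
  have cU : Continuous (u ∘ ρ) := h.cont_u.comp_continuous cρ mρ
  have cΘ : Continuous (θ ∘ ρ) := h.cont_θ.comp_continuous cρ mρ
  have eV := fun z hz => (congrArg v (eρ' z hz)).symm
  have eU := fun z hz => (congrArg u (eρ' z hz)).symm
  have eΘ := fun z hz => (congrArg θ (eρ' z hz)).symm
  have pV : ∀ z, 0 < (v ∘ ρ) z := fun z => h.pos_v _ (mρ z).1 _ (mρ z).2
  have pΘ : ∀ z, 0 < (θ ∘ ρ) z := fun z => h.pos_θ _ (mρ z).1 _ (mρ z).2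
  have i0 : ∀ {f : ℝ × ℝ → ℝ} {f₀ : ℝ → ℝ}, (∀ x ∈ Ωˢ, f (0, x) = f₀ x) →
      ∀ x ∈ Ωˢ, (f ∘ ρ) (0, x) = f₀ x := fun hf x hx => by
    rw [← hf x hx, Function.comp_apply, eρ 0 le_rfl x (subset_closure hx)]
  have i1 : ∀ {f : ℝ × ℝ → ℝ} {f₀ : ℝ → ℝ}, Continuous (f ∘ ρ) → ContinuousOn f₀ (closure Ωˢ) →
      (∀ x ∈ Ωˢ, f (0, x) = f₀ x) → ∀ ⦃x⦄, x ∈ closure Ωˢ → (f ∘ ρ) (0, x) = f₀ x :=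
    fun hf hf₀ h0 => eqOn_closure_of_ae hS (hf.comp (.prodMk_right 0)).continuousOn hf₀
      (by filter_upwards [ae_restrict_mem hS.measurableSet] with x hx using i0 h0 x hx)
  have jv := i1 cV hA.cont_v h.init_v
  have ju := i1 cU hA.cont_u h.init_u
  have jθ := i1 cΘ hA.cont_θ h.init_θ
  have hV0 := i0 h.init_v
  have hΘ0 := i0 h.init_θ
  obtain ⟨Ux, Uxx, Ut, mUx, mUxx, mUt, aeU, lUx, lUxx, lUt, xU, tU⟩ := exists_component hS cU
    (h.weak_ux.congr eU) h.weak_uxx (h.weak_ut.congr eU) h.reg_ux h.reg_uxx h.reg_ut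
  obtain ⟨Θx, Θxx, Θt, mΘx, mΘxx, mΘt, aeΘ, lΘx, lΘxx, lΘt, xΘ, tΘ⟩ := exists_component hS cΘ
    (h.weak_θx.congr eΘ) h.weak_θxx (h.weak_θt.congr eΘ) h.reg_θx h.reg_θxx h.reg_θt
  obtain ⟨v0x, mv0x, xv0, lv0x, nv⟩ := exists_init (f := fun x => v₀ x - 1) hS (hA.cont_v.sub continuousOn_const) hA.h1_v
  obtain ⟨u0x, -, xu0, lu0x, nu⟩ := exists_init hS hA.cont_u hA.h1_u
  obtain ⟨θ0x, -, xθ0, lθ0x, nθ⟩ := exists_init (f := fun x => θ₀ x - 1) hS (hA.cont_θ.sub continuousOn_const) hA.h1_θ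
  replace xv0 : IsPrim (closure Ωˢ) (fun x => (v ∘ ρ) (0, x)) v0x :=
    (xv0.add_const 1).congr_left fun x hx => by rw [jv hx]; ring
  replace xu0 : IsPrim (closure Ωˢ) (fun x => (u ∘ ρ) (0, x)) u0x := xu0.congr_left fun x hx => (ju hx).symm
  replace xθ0 : IsPrim (closure Ωˢ) (fun x => (θ ∘ ρ) (0, x)) θ0x :=
    (xθ0.add_const 1).congr_left fun x hx => by rw [jθ hx]; ring
  set V := v ∘ ρ
  set U := u ∘ ρ
  set Θ := θ ∘ ρ
  have mST := (spaceTime Ω).isOpen.measurableSet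
  have aeST : ∀ᵐ z ∂vol (spaceTime Ω)ˢ, v z = V z ∧ u z = U z ∧ θ z = Θ z ∧
      D.ux z = Ux z ∧ D.ut z = Ut z ∧ D.θx z = Θx z := by
    filter_upwards [aeU, aeΘ, ae_restrict_mem mST] with z h1 h2 hz
    exact ⟨eV z hz, eU z hz, eΘ z hz, h1.1, h1.2, h2.1⟩
  have tV : ∀ᵐ x ∂vol Ωˢ, IsPrim (Ici 0) (fun t => V (t, x)) (fun t => Ux (t, x)) :=
    ae_isPrim_t cV (.of_memLp fun T => (lUx T).1) fun φ => by
      rw [integral_congr_ae (g := fun z => v z * fderiv ℝ φ z (1, 0))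
        (aeST.mono fun z hz => by simp only [hz.1]), h.mass φ, h.weak_ux.2.2 φ]
      exact congrArg _ (integral_congr_ae (aeST.mono fun z hz => by simp only [hz.2.2.2.1]))
  obtain ⟨vx, mvx, hv0, svx, lvx, bvx, tvx, xv⟩ := exists_vx hS cV mUxx mv0x lUxx lv0x
    (xU.mono fun t ht => ht.2) tV xv0
  have lv0 : MemLp (fun x => V (0, x) - 1) 2 (vol Ωˢ) := hA.h1_v.1.ae_eq
    (by filter_upwards [ae_restrict_mem hS.measurableSet] with x hx; rw [jv (subset_closure hx)])
  have lu0 : MemLp (fun x => U (0, x) - 0) 2 (vol Ωˢ) := hA.h1_u.1.ae_eq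
    (by filter_upwards [ae_restrict_mem hS.measurableSet] with x hx; rw [sub_zero, ju (subset_closure hx)])
  have lθ0 : MemLp (fun x => Θ (0, x) - 1) 2 (vol Ωˢ) := hA.h1_θ.1.ae_eq
    (by filter_upwards [ae_restrict_mem hS.measurableSet] with x hx; rw [jθ (subset_closure hx)])
  have kV := exists_majorant mUx tV (fun T => (lUx T).1) lv0
  have kU := exists_majorant mUt tU lUt lu0
  have kΘ := exists_majorant mΘt tΘ lΘt lθ0
  obtain ⟨sV, lV⟩ := memLp_of_majorant cV.measurable kV
  obtain ⟨sU, lU⟩ := memLp_of_majorant cU.measurable kU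
  obtain ⟨sΘ, lΘ⟩ := memLp_of_majorant cΘ.measurable kΘ
  simp only [sub_zero] at sU lU
  have hbound : ∀ T, ∃ c > 0, ∃ C, ∀ t ∈ Icc 0 T, ∀ x ∈ closure Ωˢ, c ≤ V (t, x) ∧ V (t, x) ≤ C ∧
      c ≤ Θ (t, x) ∧ Θ (t, x) ≤ C ∧ |U (t, x)| ≤ C := fun T => by
    set T' := max T 1
    have hT' : 0 < T' := by positivity
    obtain ⟨B1, hB1⟩ := bvx T'
    obtain ⟨-, B2, hB2⟩ := lUx T'
    obtain ⟨-, B3, hB3⟩ := lΘx T'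
    obtain ⟨C1, X1, h1⟩ := exists_bound (B := B1) hS hT' cV (kV T') (by
      filter_upwards [ae_mem_Ioc] with t ht
      exact ⟨xv t ht.1.le, svx t ht.1.le, hB1 t ⟨ht.1.le, ht.2⟩⟩)
    obtain ⟨C2, X2, h2⟩ := exists_bound (B := B2) hS hT' cU (kU T') (by
      filter_upwards [Sol.ae_Ioc xU T', hB2] with t a1 a2 using ⟨a1.1, a2⟩)
    obtain ⟨C3, X3, h3⟩ := exists_bound (B := B3) hS hT' cΘ (kΘ T') (by
      filter_upwards [Sol.ae_Ioc xΘ T', hB3] with t a1 a2 using ⟨a1.1, a2⟩)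
    obtain ⟨c1, hc1, k1⟩ := exists_pos_le hT'.le cV pV h1
    obtain ⟨c3, hc3, k3⟩ := exists_pos_le hT'.le cΘ pΘ h3
    refine ⟨min c1 c3, lt_min hc1 hc3, max (1 + C1) (max (1 + C3) C2), fun t ht x hx => ?_⟩
    have ht' : t ∈ Icc 0 T' := ⟨ht.1, ht.2.trans (le_max_left _ _)⟩
    have a1 := (abs_le.1 (h1 t ht' x hx).1).2
    have a2 := (h2 t ht' x hx).1
    have a3 := (abs_le.1 (h3 t ht' x hx).1).2
    rw [sub_zero] at a2
    exact ⟨(min_le_left _ _).trans (k1 t ht' x hx), le_max_of_le_left (by linarith),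
      (min_le_right _ _).trans (k3 t ht' x hx),
      le_max_of_le_right (le_max_of_le_left (by linarith)), le_max_of_le_right (le_max_of_le_right a2)⟩
  have cVi : Continuous fun z => (V z)⁻¹ := cV.inv₀ fun z => (pV z).ne'
  have mS := hS.measurableSet
  have bUx : BoxInt Ω Ux := .of_memLp fun T => (lUx T).1
  have bΘx : BoxInt Ω Θx := .of_memLp fun T => (lΘx T).1
  have bUt : BoxInt Ω Ut := .of_memLp lUt
  have pv : ∀ t, ∀ x ∈ closure Ωˢ, 0 < V (t, x) := fun t x _ => pV _
  have equ : ∀ᵐ t ∂vol₊, ∀ᵐ x ∂vol Ωˢ,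
      Ut (t, x) = μ * (Uxx (t, x) / V (t, x) - Ux (t, x) * vx (t, x) / V (t, x) ^ 2)
        - R * (Θx (t, x) / V (t, x) - Θ (t, x) * vx (t, x) / V (t, x) ^ 2) := by
    have hw := ae_hasWeakDeriv_x (f := fun z => μ * (Ux z / V z) + -R * (Θ z / V z)) (g := Ut) (by
        simp only [div_eq_mul_inv]
        exact ((bUx.mul_continuous cVi mS).const_mul μ).add
          ((BoxInt.of_continuous _ (cΘ.mul cVi)).const_mul (-R))) bUt fun α η => by
        refine (integral_congr_ae (aeST.mono fun z hz => ?_)).trans ((h.momentum (prodTest α η)).symm.trans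
          ((h.weak_ut.2.2 (prodTest α η)).trans (congrArg _ (integral_congr_ae (aeST.mono fun z hz => ?_)))))
        · simp only [hz.1, hz.2.2.1, hz.2.2.2.1]
          ring
        · simp only [hz.2.2.2.2.1]
    filter_upwards [hw, xU, xΘ, ae_mem_Ioi] with t h1 h2 h3 ht
    have hx := xv t (le_of_lt ht)
    have hp := ((h2.2.div hx (pv t)).const_mul μ).add ((h3.1.div hx (pv t)).const_mul (-R))
    filter_upwards [h1.ae_eq (hp.hasWeakDeriv hS) (.of_forall fun _ => rfl)] with x hx
    rw [hx]; ring
  have eqθ : ∀ᵐ t ∂vol₊, ∀ᵐ x ∂vol Ωˢ,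
      cv * Θt (t, x) = κ * (Θxx (t, x) / V (t, x) - Θx (t, x) * vx (t, x) / V (t, x) ^ 2)
        + μ * (Ux (t, x) ^ 2 / V (t, x)) - R * (Θ (t, x) * Ux (t, x) / V (t, x)) := by
    have tF : ∀ᵐ x ∂vol Ωˢ, IsPrim (Ici 0)
        (fun t => cv * Θ (t, x) + e₀ + 1 / 2 * (U (t, x) * U (t, x)))
        (fun t => cv * Θt (t, x) + 1 / 2 * (Ut (t, x) * U (t, x) + U (t, x) * Ut (t, x))) := by
      filter_upwards [tΘ, tU] with x h1 h2
      exact ((h1.const_mul cv).add_const e₀).add ((h2.mul h2).const_mul (1 / 2))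
    have bF : BoxInt Ω fun z => cv * Θ z + e₀ + 1 / 2 * (U z * U z) := .of_continuous _ (by fun_prop)
    have bUU : BoxInt Ω fun z => Ut z * U z := bUt.mul_continuous cU mS
    have bG : BoxInt Ω fun z => cv * Θt z + 1 / 2 * (Ut z * U z + U z * Ut z) :=
      ((BoxInt.of_memLp lΘt).const_mul cv).add ((bUU.add (by simpa only [mul_comm] using bUU)).const_mul (1 / 2))
    have hw := ae_hasWeakDeriv_x
      (f := fun z => κ * (Θx z / V z) + μ * (U z * Ux z / V z) + -R * (Θ z * U z / V z))
      (by
        simp only [div_eq_mul_inv, mul_comm (U _) (Ux _)]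
        exact (((bΘx.mul_continuous cVi mS).const_mul κ).add
          (((bUx.mul_continuous cU mS).mul_continuous cVi mS).const_mul μ)).add
          ((BoxInt.of_continuous _ ((cΘ.mul cU).mul cVi)).const_mul (-R))) bG fun α η => by
        rw [← integral_prodTest_t bF bG tF]
        refine (integral_congr_ae (aeST.mono fun z hz => ?_)).trans ((h.energy (prodTest α η)).symm.trans
          (integral_congr_ae (aeST.mono fun z hz => ?_)))
        · simp only [hz.1, hz.2.1, hz.2.2.1, hz.2.2.2.1, hz.2.2.2.2.2]
          ring
        · simp only [hz.2.1, hz.2.2.1]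
          ring
    filter_upwards [hw, xU, xΘ, equ, ae_mem_Ioi] with t h1 h2 h3 h4 ht
    have hx := xv t (le_of_lt ht)
    have hp := (((h3.2.div hx (pv t)).const_mul κ).add (((h2.1.mul h2.2).div hx (pv t)).const_mul μ)).add
      (((h3.1.mul h2.1).div hx (pv t)).const_mul (-R))
    filter_upwards [h1.ae_eq (hp.hasWeakDeriv hS) (.of_forall fun _ => rfl), h4] with x h5 h6
    simp only [h6] at h5
    have e : cv * Θt (t, x) = (cv * Θt (t, x) + 1 / 2 * (Ut (t, x) * U (t, x) + U (t, x) * Ut (t, x))) -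
      U (t, x) * Ut (t, x) := by ring
    rw [e, h6, h5]
    ring
  have hbdry : Ωˢ = univ ∨ (∀ t ≥ 0, U (t, 0) = 0) ∧ ((∀ t ≥ 0, Θ (t, 0) = 1) ∨ ∀ᵐ t ∂vol₊, Θx (t, 0) = 0) := by
    refine (P.boundary h.boundary).imp_right fun ⟨hΩ, b1, b2⟩ => ?_
    have hcl : closure Ωˢ = Ici 0 := by rw [hΩ, closure_Ioi]
    have h0 : ∀ t > 0, ρ (t, 0) = (t, 0) := fun t ht => eρ t (le_of_lt ht) 0 (by simp [hcl])
    refine ⟨eq_const_of_pos (w := fun t => U (t, 0)) (by fun_prop) fun t ht => ?_, b2.imp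
      (fun b3 => eq_const_of_pos (w := fun t => Θ (t, 0)) (by fun_prop) fun t ht => ?_) fun b3 => ?_⟩
    · exact (congrArg u (h0 t ht)).trans (b1 t ht)
    · exact (congrArg θ (h0 t ht)).trans (b3 t ht)
    · filter_upwards [b3, xΘ, ae_mem_Ioi] with t ⟨g, g1, g2⟩ h2 ht
      have c := h2.2.continuousOn_closure hS
      have h3 := h2.1
      rw [hcl] at c h3
      exact eq_zero_of_trace h3 c (fun x hx => (congrArg θ (eρ t (le_of_lt ht) x (by
        rw [hcl]; exact le_of_lt hx))).symm) g1 g2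
  have hdata : (∫ x in Ωˢ, (V (0, x) - 1) ^ 2) + (∫ x in Ωˢ, vx (0, x) ^ 2) +
      (∫ x in Ωˢ, U (0, x) ^ 2) + (∫ x in Ωˢ, u0x x ^ 2) +
      (∫ x in Ωˢ, (Θ (0, x) - 1) ^ 2) + (∫ x in Ωˢ, θ0x x ^ 2) ≤
      (h1Norm3 Ω (fun x => v₀ x - 1) u₀ (fun x => θ₀ x - 1)).toReal ^ 2 := by
    have nn : ∀ w : ℝ → ℝ, 0 ≤ ∫ x in Ωˢ, w x ^ 2 := fun w => integral_nonneg fun x => sq_nonneg _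
    have e : ∀ {w w' : ℝ → ℝ}, (∀ x ∈ closure Ωˢ, w x = w' x) →
        ∫ x in Ωˢ, w x ^ 2 = ∫ x in Ωˢ, w' x ^ 2 := fun hw =>
      setIntegral_congr_fun mS fun x hx => by simp only [hw x (subset_closure hx)]
    have n1 := add_nonneg (nn fun x => v₀ x - 1) (nn v0x)
    have n2 := add_nonneg (nn u₀) (nn u0x)
    have n3 := add_nonneg (nn fun x => θ₀ x - 1) (nn θ0x)
    rw [← ENNReal.toReal_pow, h1Norm3, rpow_half_sq, nv, nu, nθ,
      ← ENNReal.ofReal_add n1 n2, ← ENNReal.ofReal_add (add_nonneg n1 n2) n3,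
      ENNReal.toReal_ofReal (add_nonneg (add_nonneg n1 n2) n3),
      e (w := fun x => V (0, x) - 1) (w' := fun x => v₀ x - 1) (fun x hx => by simp only [← jv hx]),
      e (w := fun x => U (0, x)) ju, e (w := fun x => Θ (0, x) - 1) (w' := fun x => θ₀ x - 1)
        (fun x hx => by simp only [← jθ hx]), e (fun x _ => hv0 x)]
    linarith
  exact ⟨{
    S := Ω, hS := hS, v := V, u := U, θ := Θ, vx := vx, ux := Ux, uxx := Uxx, ut := Ut, θx := Θx
    θxx := Θxx, θt := Θt, u0x := u0x, θ0x := θ0x, c_v := cV, c_u := cU, c_θ := cΘ, m_vx := mvx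
    m_ux := mUx, m_uxx := mUxx, m_ut := mUt, m_θx := mΘx, m_θxx := mΘxx, m_θt := mΘt, bound := hbound
    sv := sV, su := sU, sθ := sΘ, svx := svx, lv := lV, lu := lU, lθ := lΘ, lvx := lvx
    lux := fun T => (lUx T).1, luxx := lUxx, lut := lUt, lθx := fun T => (lΘx T).1, lθxx := lΘxx
    lθt := lΘt, xv := xv, xu := xU.mono fun t ht => ht.1, xux := xU.mono fun t ht => ht.2
    xθ := xΘ.mono fun t ht => ht.1, xθx := xΘ.mono fun t ht => ht.2, tv := tV, tu := tU, tθ := tΘ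
    tvx := tvx, equ := equ, eqθ := eqθ, bdry := hbdry, xu0 := xu0, xθ0 := xθ0, lu0x := lu0x
    lθ0x := lθ0x, data := hdata
    v0_ge := sInf_le_closure (w := fun x => V (0, x)) (by fun_prop) (fun x => pV _) hV0
    θ0_ge := sInf_le_closure (w := fun x => Θ (0, x)) (by fun_prop) (fun x => pΘ _) hΘ0 },
    rfl, fun t ht x hx => ⟨congrArg v (eρ t ht x hx), congrArg u (eρ t ht x hx), congrArg θ (eρ t ht x hx)⟩⟩

end NavierStokes1D

end

open NavierStokes1D in
theorem theorem1p1 (μ κ R cv : ℝ) (hμ : 0 < μ) (hκ : 0 < κ) (hR : 0 < R) (hcv : 0 < cv) :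
    -- `C₀` depends only on `μ, κ, R, c_v`, the `H¹` norm of the data, `inf v₀` and `inf θ₀`.
    ∃ C₀ : ℝ → ℝ → ℝ → ℝ, (∀ N a b : ℝ, 0 < C₀ N a b) ∧
      ∀ (P : Problem) (e₀ : ℝ) (v₀ u₀ θ₀ : ℝ → ℝ) (v u θ : ℝ × ℝ → ℝ),
        AdmissibleData P v₀ u₀ θ₀ →
        IsGeneralizedSolution P μ κ R cv e₀ v₀ u₀ θ₀ v u θ →
        ∀ C : ℝ, C = C₀ (h1Norm3 P.dom (fun x => v₀ x - 1) u₀ (fun x => θ₀ x - 1)).toReal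
            (sInf (v₀ '' (P.dom : Set ℝ))) (sInf (θ₀ '' (P.dom : Set ℝ))) →
          (∀ t ≥ 0, ∀ x ∈ closure (P.dom : Set ℝ), C⁻¹ ≤ θ (t, x) ∧ θ (t, x) ≤ C) ∧
          ((⨆ (t : ℝ) (_ : 0 ≤ t), h1Norm3 P.dom (fun x => v (t, x) - 1) (fun x => u (t, x))
                (fun x => θ (t, x) - 1)) +
              ∫⁻ t in Ioi (0 : ℝ), (derivL2Norm P.dom (fun x => v (t, x)) ^ 2 +
                (derivH1Norm P.dom (fun x => u (t, x)) ^ 2 +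
                  derivH1Norm P.dom (fun x => θ (t, x)) ^ 2))
            ≤ ENNReal.ofReal C) ∧
          ∀ p : ℝ≥0∞, 2 < p →
            Tendsto (fun t : ℝ =>
              (lpNorm P.dom p (fun x => v (t, x) - 1) + lpNorm P.dom p (fun x => u (t, x)) +
                lpNorm P.dom p (fun x => θ (t, x) - 1)) +
              (derivL2Norm P.dom (fun x => v (t, x)) + derivL2Norm P.dom (fun x => u (t, x)) +
                derivL2Norm P.dom (fun x => θ (t, x)))) atTop (𝓝 0) := by
  refine ⟨fun N a b => if h : 0 < a ∧ 0 < b then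
    (Sol.conclusion ⟨μ, κ, R, cv, N, a, b, hμ, hκ, hR, hcv, h.1, h.2⟩).choose else 1, fun N a b => ?_,
    fun P e₀ v₀ u₀ θ₀ v u θ hA hsol C hC => ?_⟩
  · dsimp only
    split_ifs with h
    · exact (Sol.conclusion ⟨μ, κ, R, cv, N, a, b, hμ, hκ, hR, hcv, h.1, h.2⟩).choose_spec.1
    · exact one_pos
  · obtain ⟨s, hs, h⟩ := exists_sol hμ hκ hR hcv P hA hsol
    have hd : s.dom = P.dom := TopologicalSpace.Opens.ext hs
    dsimp only at hC
    rw [dif_pos ⟨hA.inf_v, hA.inf_θ⟩] at hC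
    rw [hC]
    have := (Sol.conclusion _).choose_spec.2 s v u θ (by rwa [hd])
    rw [hd] at this
    exact this
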